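/- Let $V$ be a vertex operator algebra of CFT type over $\mathbb{C}$ with conformal vector $\omega$, let $r\ge 2$, and let $M_0,M_1,\dots,M_r$ be $V$-modules on which $L(0)$ is locally finite with finite-dimensional generalized eigenspaces and nilpotent part of bounded order, such that $M_0=\bigoplus_{k\ge 0}(M_0)_{\Delta'+k}$ and $M_i=\bigoplus_{k\ge 0}(M_i)_{\Delta_i+k}$ (generalized $L(0)$-eigenspaces). Assume that $M_1,\dots,M_r$ are $C_1$-cofinite, that the contragredient module $M_0^\vee$ is generated by $(M_0)_{\Delta'}^*$ and that $M_r$ is generated by $(M_r)_{\Delta_r}$. Let $\mathrm{std}_r=1(2(\cdots(r-1\;r)))$ be the standard tree and $x_p=z_p-z_r$ ($p<r$). A parenthesized intertwining operator of type $(\mathrm{std}_r,M_0,M_1,\dots,M_r)$ is a linear map $F$ from $M_{[r]}=M_1\otimes\cdots\otimes M_r$ to the formal series in complex powers and logarithms of $x_1,\dots,x_{r-1}$ with coefficients in $M_0$ such that (PI0) for all $u\in M_0^\vee$ and $m\in M_{[r]}$ the series $\langle u,F(m)\rangle$ lies, for every admissible tuple of radii, in the span of the $\prod_p x_p^{s_p}(\log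 x_p)^{k_p}\,f$ with $f$ a power series in the $x_{p+1}/x_p$ converging absolutely on the polydisc of these radii (a tuple of positive radii is admissible if $z_1,\dots,z_r$ are distinct whenever $x_1\neq 0$ and each $|x_{p+1}/x_p|$ is positive and smaller than the respective radius); (PI1) $F(L(-1)_pm)=\partial_{x_p}F(m)$ for $p<r$; (PI2) for all $a\in V$, $n\in\mathbb{Z}$ and $p\in\{1,\dots,r\}$, $$F(a(n)_pm)=\sum_{k\ge0}\binom nk (z_r-z_p)^k\,a(n-k)F(m)-\sum_{s\ne p}\sum_{k\ge0}\binom nk (z_s-z_p)^{n-k}F(a(k)_sm),$$ with $(z_s-z_p)^{j}$ expanded in $|x_1|>\cdots>|x_{r-1}|$. Put $\tilde F=\exp(L(-1)z_r)F$, with $x_p=z_p-z_r$ expanded in $|z_p|>|z_r|$, and $$\bar F(m_1\otimes\cdots\otimes m_r)=\mathrm{pr}_{\Delta'}\,z_1^{-L(0)}\tilde F(z_1^{L(0)}m_1\otimes\cdots\otimes z_r^{L(0)}m_r),\qquad \zeta_i=z_{i+1}/z_i,$$ where $\mathrm{pr}_{\Delta'}$ is the projection of $M_0$ onto $(M_0)_{\Delta'}$.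 For $\lambda\in(\mathbb{C}/\mathbb{Z})^{r-2}$ let $p_\lambda\bar F$ be the part of $\bar F$ whose exponents of $\zeta_1,\dots,\zeta_{r-2}$ lie in $\lambda_1,\dots,\lambda_{r-2}$, let $S_\lambda(F)\subset\mathbb{C}^{r-2}$ be the set of $k$ such that $\zeta_1^{k_1}\cdots\zeta_{r-2}^{k_{r-2}}\zeta_{r-1}^{\Delta_r}$ has a non-zero coefficient (a polynomial in the $\log\zeta_i$) in $p_\lambda\bar F(m)$ for some $m\in M_{[r]}$, and let $\Delta_\lambda(F)$ be the set of the $h\in S_\lambda(F)$ that are minimal, i.e. $k\in S_\lambda(F)$ and $h-k\in\mathbb{Z}_{\ge0}^{r-2}$ imply $k=h$. Let $A(V)=V/O(V)$ be the Zhu algebra and $A(M)=M/O(M)$ the Frenkel–Zhu bimodules, and for $1\le p\le r$ put $$T_p=A(M_p)\otimes_{A(V)}\cdots\otimes_{A(V)}A(M_{r-1})\otimes_{A(V)}(M_r)_{\Delta_r},\qquad T_r=(M_r)_{\Delta_r},$$ where $a$ acts on $(M_r)_{\Delta_r}$ and $(M_0)_{\Delta'}$ by $o(a)=a(\Delta_a-1)$.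 Then for every such $F$: 1. $\bar F$ is a series in $\zeta_1,\dots,\zeta_{r-1}$ and their logarithms with coefficients in $(M_0)_{\Delta'}$, and its poles are bounded below: for every $\lambda$ there are $\mu_i\in-\lambda_i+\mathbb{Z}$ ($1\le i\le r-2$), independent of $m$, such that $$\zeta_1^{\mu_1}\cdots\zeta_{r-2}^{\mu_{r-2}}\zeta_{r-1}^{-\Delta_r}\,p_\lambda\bar F(m)\in (M_0)_{\Delta'}[[\zeta_1,\dots,\zeta_{r-1}]][\log\zeta_1,\dots,\log\zeta_{r-1}]\quad\text{for all }m\in M_{[r]}.$$ 2. If $F\ne0$, then $p_\lambda\bar F\neq0$ for some $\lambda$; if $p_\lambda\bar F\ne0$, then $\Delta_\lambda(F)\neq\emptyset$. 3. For every $h\in\Delta_\lambda(F)$, taking the coefficient of $\zeta_1^{h_1}\cdots\zeta_{r-2}^{h_{r-2}}\zeta_{r-1}^{\Delta_r}$ in $\bar F$ (with $m_r$ projected to $(M_r)_{\Delta_r}$) induces a unique linear map $$A(F):A(M_1)\otimes_{A(V)}\cdots\otimes_{A(V)}A(M_{r-1})\otimes_{A(V)}(M_r)_{\Delta_r}\to(M_0)_{\Delta'}[\log\zeta_1,\dots,\log\zeta_{r-1}],$$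 and $A(F)$ is a non-zero homomorphism of left $A(V)$-modules. 4. For every $h\in\Delta_\lambda(F)$ and $1\le i\le r-2$, $h_i$ is an eigenvalue of $\omega$ on $T_{i+1}$, and $\lambda_i=h_i+\mathbb{Z}$. Only finitely many pairs $(\lambda,h)$ with $h\in\Delta_\lambda(F)$ occur when $F$ runs over all parenthesized intertwining operators of the given type. 5. If $\omega$ acts semisimply on all of $T_1,\dots,T_r$, then for every $h\in\Delta_\lambda(F)$ the map $A(F)$ contains no logarithm, i.e. it takes values in $(M_0)_{\Delta'}$ and is an $A(V)$-module homomorphism $T_1\to(M_0)_{\Delta'}$. -/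

import Mathlib

open scoped TensorProduct

/-! ## Vertex operator algebras and their modules -/

/-- A vertex operator algebra of CFT type over `ℂ`; `mode a n` is the `n`-th product `a(n)`. The sums
over `k` are finite on every vector because of `trunc`. -/
class VertexOperatorAlgebra (V : Type*) [AddCommGroup V] [Module ℂ V] where
  mode : V →ₗ[ℂ] (ℤ → Module.End ℂ V)
  vac : V
  vac_ne_zero : vac ≠ 0
  trunc : ∀ a b : V, ∃ N : ℤ, ∀ n ≥ N, mode a n b = 0
  creation_nonneg : ∀ (a : V) (n : ℤ), 0 ≤ n → mode a n vac = 0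
  creation : ∀ a : V, mode a (-1) vac = a
  vacuum : ∀ n : ℤ, mode vac n = if n = -1 then LinearMap.id else 0
  commutator : ∀ (a b : V) (m n : ℤ) (c : V),
    mode a m (mode b n c) - mode b n (mode a m c) =
      ∑ᶠ k : ℕ, ((Ring.choose m k : ℤ) : ℂ) • mode (mode a k b) (m + n - k) c
  iterate : ∀ (a b : V) (n m : ℤ) (c : V),
    mode (mode a n b) m c =
      ∑ᶠ k : ℕ, ((Ring.choose n k : ℤ) : ℂ) •
        ((-1 : ℂ) ^ k • mode a (n - k) (mode b (m + k) c)
          - (-1 : ℂ) ^ (n - (k : ℤ)) • mode b (m + n - k) (mode a k c))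
  /-- the conformal vector; `L(n) = ω(n+1)` -/
  conf : V
  charge : ℂ
  virasoro : ∀ (m n : ℤ) (c : V),
    mode conf (m + 1) (mode conf (n + 1) c) - mode conf (n + 1) (mode conf (m + 1) c) =
      ((m : ℂ) - n) • mode conf (m + n + 1) c
        + (if m + n = 0 then ((m : ℂ) ^ 3 - m) / 12 * charge else 0) • c
  translation : ∀ (a : V) (n : ℤ) (c : V),
    mode conf 0 (mode a n c) - mode a n (mode conf 0 c) = (-(n : ℂ)) • mode a (n - 1) c
  semisimple : ⨆ d : ℕ, Module.End.eigenspace (mode conf 1) (d : ℂ) = ⊤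
  finite : ∀ d : ℕ, FiniteDimensional ℂ (Module.End.eigenspace (mode conf 1) (d : ℂ))
  cft_type : Module.End.eigenspace (mode conf 1) 0 = Submodule.span ℂ {vac}

/-- A (weak) module over a vertex operator algebra: `mode a n` is the operator `a(n)` on `M`. -/
class VOAModule (V : Type*) [AddCommGroup V] [Module ℂ V] [VertexOperatorAlgebra V]
    (M : Type*) [AddCommGroup M] [Module ℂ M] where
  mode : V →ₗ[ℂ] (ℤ → Module.End ℂ M)
  trunc : ∀ (a : V) (c : M), ∃ N : ℤ, ∀ n ≥ N, mode a n c = 0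
  vacuum : ∀ n : ℤ, mode VertexOperatorAlgebra.vac n = if n = -1 then LinearMap.id else 0
  commutator : ∀ (a b : V) (m n : ℤ) (c : M),
    mode a m (mode b n c) - mode b n (mode a m c) =
      ∑ᶠ k : ℕ, ((Ring.choose m k : ℤ) : ℂ) •
        mode (VertexOperatorAlgebra.mode a k b) (m + n - k) c
  iterate : ∀ (a b : V) (n m : ℤ) (c : M),
    mode (VertexOperatorAlgebra.mode a n b) m c =
      ∑ᶠ k : ℕ, ((Ring.choose n k : ℤ) : ℂ) •
        ((-1 : ℂ) ^ k • mode a (n - k) (mode b (m + k) c)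
          - (-1 : ℂ) ^ (n - (k : ℤ)) • mode b (m + n - k) (mode a k c))

namespace VOA

noncomputable section

/-- A vertex operator algebra is a module over itself. -/
instance selfModule (V : Type*) [AddCommGroup V] [Module ℂ V] [VertexOperatorAlgebra V] :
    VOAModule V V where
  mode := VertexOperatorAlgebra.mode
  trunc := VertexOperatorAlgebra.trunc
  vacuum := VertexOperatorAlgebra.vacuum
  commutator := VertexOperatorAlgebra.commutator
  iterate := VertexOperatorAlgebra.iterate

/-- The operator `a(n)` on the module `M`. -/
abbrev md {V : Type*} [AddCommGroup V] [Module ℂ V] [VertexOperatorAlgebra V]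
    (M : Type*) [AddCommGroup M] [Module ℂ M] [VOAModule V M] (a : V) (n : ℤ) : Module.End ℂ M :=
  VOAModule.mode a n

/-- The Virasoro operator `L(n) = ω(n+1)` on `M`. -/
def vir (V : Type*) [AddCommGroup V] [Module ℂ V] [VertexOperatorAlgebra V]
    (M : Type*) [AddCommGroup M] [Module ℂ M] [VOAModule V M] (n : ℤ) : Module.End ℂ M :=
  md M (VertexOperatorAlgebra.conf : V) (n + 1)

/-- The homogeneous subspace `V_d`. -/
def grade (V : Type*) [AddCommGroup V] [Module ℂ V] [VertexOperatorAlgebra V] (d : ℕ) :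
    Submodule ℂ V :=
  Module.End.eigenspace (vir V V 0) (d : ℂ)

/-- The generalized eigenspace `M_h` of `L(0)`. -/
def wt (V : Type*) [AddCommGroup V] [Module ℂ V] [VertexOperatorAlgebra V]
    (M : Type*) [AddCommGroup M] [Module ℂ M] [VOAModule V M] (h : ℂ) : Submodule ℂ M :=
  Module.End.maxGenEigenspace (vir V M 0) h

section basic

variable {V : Type*} [AddCommGroup V] [Module ℂ V] [VertexOperatorAlgebra V]
  {M : Type*} [AddCommGroup M] [Module ℂ M] [VOAModule V M]

theorem md_smul (r : ℂ) (a : V) (n : ℤ) : md M (r • a) n = r • md M a n := by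
  simp [md]

theorem conf_zero_apply (a : V) :
    md V (VertexOperatorAlgebra.conf : V) 0 a = md V a (-2) VertexOperatorAlgebra.vac := by
  have h := VertexOperatorAlgebra.translation a (-1) (VertexOperatorAlgebra.vac : V)
  rw [VertexOperatorAlgebra.creation, VertexOperatorAlgebra.creation_nonneg _ 0 le_rfl] at h
  have h2 : ((-1 : ℤ) - 1) = -2 := by norm_num
  rw [h2] at h
  simp only [map_zero, sub_zero, Int.cast_neg, Int.cast_one, neg_neg, one_smul] at h
  exact h

theorem choose_neg_two (k : ℕ) : ((Ring.choose (-2 : ℤ) k : ℤ) : ℂ) = (-1) ^ k * (k + 1) := by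
  have : Ring.choose (-2 : ℤ) k = (-1) ^ k * (k + 1) := by
    rw [Ring.choose_neg]
    have h2 : (2 : ℤ) + k - 1 = ((k + 1 : ℕ) : ℤ) := by push_cast; ring
    rw [h2, Ring.choose_natCast, Nat.choose_succ_self_right]
    simp [Int.negOnePow, Units.smul_def]
    ring
  rw [this]; push_cast; ring

/-- The operator `(L(-1)a)(n)` is `-n a(n-1)`. -/
theorem mode_translate (a : V) (n : ℤ) (c : M) :
    md M (md V (VertexOperatorAlgebra.conf : V) 0 a) n c = (-(n : ℂ)) • md M a (n - 1) c := by
  rw [conf_zero_apply]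
  have h := VOAModule.iterate a (VertexOperatorAlgebra.vac : V) (-2) n c
  change md M (md V a (-2) VertexOperatorAlgebra.vac) n c = _ at h
  rw [h]
  simp only [choose_neg_two, VOAModule.vacuum]
  rcases lt_trichotomy n 0 with hn | hn | hn
  · obtain ⟨k, rfl⟩ : ∃ k : ℕ, n = -1 - k := ⟨(-1 - n).toNat, by omega⟩
    rw [finsum_eq_single _ k]
    · rw [if_pos (by omega), if_neg (by omega)]
      simp only [LinearMap.id_apply, LinearMap.zero_apply, smul_zero, sub_zero, smul_smul]
      have : (-2 : ℤ) - k = -1 - k - 1 := by ring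
      rw [this]
      congr 1
      push_cast
      rw [mul_right_comm, ← mul_pow]; norm_num
    · intro j hj
      rw [if_neg (by omega), if_neg (by omega)]; simp
  · subst hn
    rw [finsum_eq_zero_of_forall_eq_zero]
    · simp
    · intro j
      rw [if_neg (by omega), if_neg (by omega)]; simp
  · obtain ⟨k, rfl⟩ : ∃ k : ℕ, n = k + 1 := ⟨(n - 1).toNat, by omega⟩
    rw [finsum_eq_single _ k]
    · rw [if_neg (by omega), if_pos (by omega)]
      simp only [LinearMap.id_apply, LinearMap.zero_apply, map_zero, smul_zero, zero_sub, smul_neg,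
        smul_smul]
      have : (k : ℤ) + 1 - 1 = k := by ring
      rw [this, ← neg_smul]
      congr 1
      have h3 : (-1 : ℂ) ^ (-2 - (k : ℤ)) = (-1) ^ k := by
        rw [zpow_sub₀ (by norm_num)]
        rcases neg_one_pow_eq_or ℂ k with h | h <;> simp [h]
      rw [h3]
      push_cast
      rw [mul_right_comm, ← mul_pow]; norm_num
    · intro j hj
      rw [if_neg (by omega), if_neg (by omega)]; simp

theorem conf_one_of_mem {d : ℕ} {a : V} (ha : a ∈ grade V d) :
    md V (VertexOperatorAlgebra.conf : V) 1 a = (d : ℂ) • a := by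
  have := Module.End.mem_eigenspace_iff.mp ha
  simpa [vir] using this

theorem conf_mem : (VertexOperatorAlgebra.conf : V) ∈ grade V 2 := by
  refine Module.End.mem_eigenspace_iff.mpr ?_
  have h := VertexOperatorAlgebra.virasoro (V := V) 0 (-2) VertexOperatorAlgebra.vac
  have h1 := VertexOperatorAlgebra.creation (VertexOperatorAlgebra.conf : V)
  have h2 := VertexOperatorAlgebra.creation_nonneg (VertexOperatorAlgebra.conf : V) 1 (by norm_num)
  have e1 : (-2 : ℤ) + 1 = -1 := by norm_num
  have e2 : (0 : ℤ) + 1 = 1 := by norm_num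
  have e3 : (0 : ℤ) + -2 + 1 = -1 := by norm_num
  have e4 : ¬ ((0 : ℤ) + -2 = 0) := by norm_num
  rw [e1, e2, e3, h1, h2, if_neg e4] at h
  simp only [map_zero, sub_zero, zero_smul, add_zero, Int.cast_zero, Int.cast_neg, Int.cast_ofNat,
    sub_neg_eq_add, zero_add] at h
  have hv : vir V V 0 = VertexOperatorAlgebra.mode (VertexOperatorAlgebra.conf : V) 1 := by
    simp [vir, md, VOAModule.mode]
  rw [hv, h]
  norm_num

/-- `[L(0), a(n)] = (Δ_a - n - 1) a(n)` on every module. -/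
theorem vir_zero_comm {d : ℕ} {a : V} (ha : a ∈ grade V d) (n : ℤ) (c : M) :
    vir V M 0 (md M a n c) - md M a n (vir V M 0 c) = ((d : ℂ) - n - 1) • md M a n c := by
  have h := VOAModule.commutator (VertexOperatorAlgebra.conf : V) a 1 n c
  have hv : vir V M 0 = md M (VertexOperatorAlgebra.conf : V) 1 := by simp [vir]
  rw [hv]
  change md M _ 1 _ - _ = _ at h
  rw [h, finsum_eq_sum_of_support_subset (s := Finset.range 2)]
  · rw [Finset.sum_range_succ, Finset.sum_range_one]
    have h0 := mode_translate (M := M) a (1 + n) c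
    have h1 := conf_one_of_mem ha
    simp only [Nat.cast_zero, sub_zero, Nat.cast_one, Ring.choose_zero_right, Ring.choose_one_right,
      Int.cast_one, one_smul]
    change md M (md V _ 0 a) (1 + n) c + md M (md V _ 1 a) (1 + n - 1) c = _
    rw [h0, h1]
    have h2 : (1 + n - 1) = n := by ring
    rw [h2, md_smul, LinearMap.smul_apply, ← add_smul]
    congr 1
    push_cast; ring
  · intro k hk
    by_contra hk2
    apply hk
    have : ¬ k < 2 := by simpa using hk2
    have h3 : Ring.choose (1 : ℤ) k = 0 := by
      have := Ring.choose_natCast (R := ℤ) 1 k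
      rw [Nat.cast_one] at this
      rw [this, Nat.choose_eq_zero_of_lt (by omega)]; rfl
    simp [h3]

theorem grade_mode {d e : ℕ} {a b : V} (ha : a ∈ grade V d) (hb : b ∈ grade V e) (n : ℤ)
    (f : ℕ) (hf : (f : ℤ) = d + e - n - 1) : md V a n b ∈ grade V f := by
  have h := vir_zero_comm (M := V) ha n b
  have hb' := Module.End.mem_eigenspace_iff.mp hb
  refine Module.End.mem_eigenspace_iff.mpr ?_
  rw [hb', map_smul, sub_eq_iff_eq_add] at h
  rw [h, ← add_smul]
  congr 1
  have : (f : ℂ) = d + e - n - 1 := by exact_mod_cast hf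
  rw [this]; ring

theorem mode_eq_zero {d e : ℕ} {a b : V} (ha : a ∈ grade V d) (hb : b ∈ grade V e) (n : ℤ)
    (hn : (d : ℤ) + e - n - 1 < 0) : md V a n b = 0 := by
  have h := vir_zero_comm (M := V) ha n b
  have hb' := Module.End.mem_eigenspace_iff.mp hb
  rw [hb', map_smul, sub_eq_iff_eq_add, ← add_smul] at h
  have hm : md V a n b ∈ Module.End.eigenspace (vir V V 0) ((d : ℂ) - n - 1 + e) :=
    Module.End.mem_eigenspace_iff.mpr h
  have hd := (Module.End.eigenspaces_iSupIndep (vir V V 0)) ((d : ℂ) - n - 1 + e)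
  have htop : (⨆ j, ⨆ (_ : j ≠ (d : ℂ) - n - 1 + e), Module.End.eigenspace (vir V V 0) j) = ⊤ := by
    rw [eq_top_iff, ← VertexOperatorAlgebra.semisimple (V := V)]
    refine iSup_le fun f => ?_
    have hne : (f : ℂ) ≠ (d : ℂ) - n - 1 + e := by
      intro h2
      have : ((f : ℤ) : ℂ) = (((d : ℤ) - n - 1 + e : ℤ) : ℂ) := by push_cast; exact h2
      have := Int.cast_injective this
      omega
    have hv : vir V V 0 = VertexOperatorAlgebra.mode (VertexOperatorAlgebra.conf : V) 1 := by
      simp [vir, md, VOAModule.mode]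
    rw [← hv]
    exact le_iSup₂_of_le (f : ℂ) hne le_rfl
  rw [htop, disjoint_top] at hd
  rw [hd] at hm
  simpa using hm

theorem translate_mem {d : ℕ} {a : V} (ha : a ∈ grade V d) :
    md V (VertexOperatorAlgebra.conf : V) 0 a ∈ grade V (d + 1) := by
  have hω : (VertexOperatorAlgebra.conf : V) ∈ grade V 2 := conf_mem
  exact grade_mode hω ha 0 (d + 1) (by push_cast; ring)

/-! ### The Frenkel-Zhu products -/

/-- `Res_z Y(a,z) (1+z)^A z^{-q} = ∑ₖ (A choose k) a(k-q)`. -/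
def zop (M : Type*) [AddCommGroup M] [Module ℂ M] [VOAModule V M] (A : ℕ) (q : ℤ) (a : V) :
    Module.End ℂ M :=
  ∑ k ∈ Finset.range (A + 1), (A.choose k : ℂ) • md M a (k - q)

theorem zop_apply (A : ℕ) (q : ℤ) (a : V) (m : M) :
    zop M A q a m = ∑ k ∈ Finset.range (A + 1), (A.choose k : ℂ) • md M a (k - q) m := by
  simp [zop]

theorem zop_zero (A : ℕ) (q : ℤ) : zop M A q (0 : V) = 0 := by
  simp [zop, md]

theorem zop_translate (D : ℕ) (Q : ℤ) (c : V) (m : M) :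
    zop M (D + 1) Q (md V (VertexOperatorAlgebra.conf : V) 0 c) m =
      (Q : ℂ) • zop M (D + 1) (Q + 1) c m - ((D : ℂ) + 1) • zop M D Q c m := by
  have h1 : ((D : ℂ) + 1) • zop M D Q c m = ∑ k ∈ Finset.range (D + 2),
      (((D + 1).choose k : ℂ) * k) • md M c (k - Q - 1) m := by
    rw [Finset.sum_range_succ', zop_apply, Finset.smul_sum]
    simp only [Nat.cast_zero, mul_zero, zero_smul, add_zero]
    refine Finset.sum_congr rfl fun k _ => ?_
    rw [smul_smul]
    have e : ((k + 1 : ℕ) : ℤ) - Q - 1 = k - Q := by push_cast; ring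
    rw [e]
    congr 1
    exact_mod_cast Nat.add_one_mul_choose_eq D k
  rw [h1, zop_apply, zop_apply, Finset.smul_sum, ← Finset.sum_sub_distrib]
  refine Finset.sum_congr rfl fun k _ => ?_
  rw [mode_translate]
  have e : (k : ℤ) - (Q + 1) = k - Q - 1 := by ring
  rw [e, smul_smul, smul_smul, ← sub_smul]
  congr 1
  push_cast; ring

/-- `O(M)`, spanned by the elements `a ∘ m`. -/
def zhuO (V : Type*) [AddCommGroup V] [Module ℂ V] [VertexOperatorAlgebra V]
    (M : Type*) [AddCommGroup M] [Module ℂ M] [VOAModule V M] : Submodule ℂ M :=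
  Submodule.span ℂ {x | ∃ d : ℕ, ∃ a ∈ grade V d, ∃ m : M, x = zop M d 2 a m}

theorem zop_mem_zhuO (N : ℕ) : ∀ {d : ℕ} {c : V}, c ∈ grade V d → ∀ m : M,
    zop M (d + N) (2 + N) c m ∈ zhuO V M := by
  induction N with
  | zero =>
    intro d c hc m
    refine Submodule.subset_span ⟨d, c, hc, m, ?_⟩
    simp
  | succ N ih =>
    intro d c hc m
    have h1 := ih (translate_mem hc) m
    have h2 := ih hc m
    have e : d + 1 + N = d + N + 1 := by ring
    rw [e, zop_translate] at h1
    have h3 := Submodule.add_mem _ h1 (Submodule.smul_mem _ (((d + N : ℕ) : ℂ) + 1) h2)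
    rw [sub_add_cancel] at h3
    have hne : (((2 : ℤ) + N : ℤ) : ℂ) ≠ 0 := by
      have : ((2 : ℤ) + N) ≠ 0 := by omega
      exact_mod_cast this
    have h4 := (Submodule.smul_mem_iff _ hne).mp h3
    have e1 : d + (N + 1) = d + N + 1 := by ring
    have e2 : (2 : ℤ) + ((N + 1 : ℕ) : ℤ) = 2 + N + 1 := by push_cast; ring
    rw [e1, e2]
    exact h4

theorem choose_alternating (k J : ℕ) :
    (∑ i ∈ Finset.range (J + 1), (-1 : ℂ) ^ (J - i) * (k.choose i : ℂ)) =
      ((Ring.choose ((k : ℤ) - 1) J : ℤ) : ℂ) := by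
  have hs : ∀ i ∈ Finset.range (J + 1), (-1 : ℤ) ^ (J - i) * (k.choose i : ℤ)
      = (-1) ^ J * ((-1) ^ i * (k.choose i : ℤ)) := by
    intro i hi
    have hi' : i ≤ J := by simpa [Nat.lt_succ_iff] using hi
    obtain ⟨t, rfl⟩ := Nat.exists_eq_add_of_le hi'
    rw [Nat.add_sub_cancel_left, pow_add, ← mul_assoc]
    congr 1
    rcases neg_one_pow_eq_or ℤ i with h | h <;> simp [h]
  have h : (∑ i ∈ Finset.range (J + 1), (-1 : ℤ) ^ (J - i) * (k.choose i : ℤ)) =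
      Ring.choose ((k : ℤ) - 1) J := by
    rw [Finset.sum_congr rfl hs, ← Finset.mul_sum]
    rcases k with _ | k
    · rw [Finset.sum_range_succ']
      have e : ((0 : ℕ) : ℤ) - 1 = -1 := by norm_num
      rw [e, Ring.choose_neg]
      have e2 : (1 : ℤ) + J - 1 = (J : ℤ) := by ring
      rw [e2, Ring.choose_natCast]
      simp [Int.negOnePow, Units.smul_def]
    · rw [Int.alternating_sum_range_choose_eq_choose]
      have e : ((k + 1 : ℕ) : ℤ) - 1 = (k : ℤ) := by push_cast; ring
      rw [e, Ring.choose_natCast, ← mul_assoc, ← mul_pow]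
      norm_num
  rw [← h]
  push_cast
  rfl

theorem choose_shift_sum {X : Type*} [AddCommGroup X] [Module ℂ X] (A i : ℕ) (g : ℤ → X) :
    (A.choose i : ℂ) • ∑ k ∈ Finset.range (A - i + 1), ((A - i).choose k : ℂ) • g (k + i) =
      ∑ k ∈ Finset.range (A + 1), ((A.choose k : ℂ) * (k.choose i : ℂ)) • g k := by
  rcases lt_or_ge A i with h | h
  · rw [Nat.choose_eq_zero_of_lt h, Nat.cast_zero, zero_smul]
    symm
    refine Finset.sum_eq_zero fun k hk => ?_
    have : k < i := by have := Finset.mem_range.mp hk; omega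
    rw [Nat.choose_eq_zero_of_lt this]; simp
  · obtain ⟨t, rfl⟩ := Nat.exists_eq_add_of_le h
    rw [Nat.add_sub_cancel_left]
    have e : i + t + 1 = i + (t + 1) := by ring
    rw [e, Finset.sum_range_add _ i (t + 1)]
    have h0 : ∑ x ∈ Finset.range i, (((i + t).choose x : ℂ) * (x.choose i : ℂ)) • g x = 0 := by
      refine Finset.sum_eq_zero fun k hk => ?_
      rw [Nat.choose_eq_zero_of_lt (Finset.mem_range.mp hk)]; simp
    rw [h0, zero_add, Finset.smul_sum]
    refine Finset.sum_congr rfl fun k hk => ?_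
    rw [smul_smul]
    have e2 : ((i + k : ℕ) : ℤ) = k + i := by push_cast; ring
    rw [e2]
    congr 1
    have hk' : i + k ≤ i + t := by have := Finset.mem_range.mp hk; omega
    have := Nat.choose_mul (n := i + t) (k := i + k) (s := i) (Nat.le_add_right i k)
    rw [Nat.add_sub_cancel_left, Nat.add_sub_cancel_left] at this
    exact_mod_cast this.symm

theorem shift_identity {X : Type*} [AddCommGroup X] [Module ℂ X] (A J : ℕ) (s : ℤ) (g : ℤ → X) :
    ∑ k ∈ Finset.range (A + 1),
        ((A.choose k : ℂ) * ((Ring.choose ((k : ℤ) - 1) J : ℤ) : ℂ)) • g (k + s) =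
      ∑ i ∈ Finset.range (J + 1), ((-1 : ℂ) ^ (J - i) * (A.choose i : ℂ)) •
        ∑ k ∈ Finset.range (A - i + 1), ((A - i).choose k : ℂ) • g (k + (i + s)) := by
  have h : ∀ i ∈ Finset.range (J + 1), ((-1 : ℂ) ^ (J - i) * (A.choose i : ℂ)) •
        ∑ k ∈ Finset.range (A - i + 1), ((A - i).choose k : ℂ) • g (k + (i + s)) =
      ∑ k ∈ Finset.range (A + 1),
        ((A.choose k : ℂ) * ((-1 : ℂ) ^ (J - i) * (k.choose i : ℂ))) • g (k + s) := by
    intro i _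
    have := choose_shift_sum A i (fun n => g (n + s))
    rw [mul_smul]
    simp only [add_assoc] at this
    rw [this, Finset.smul_sum]
    refine Finset.sum_congr rfl fun k _ => ?_
    rw [smul_smul]
    congr 1
    ring
  rw [Finset.sum_congr rfl h, Finset.sum_comm]
  refine Finset.sum_congr rfl fun k _ => ?_
  rw [← Finset.sum_smul, ← Finset.mul_sum, choose_alternating]

theorem zop_add (A B : ℕ) (q : ℤ) (c : V) (m : M) :
    zop M (A + B) q c m = ∑ k ∈ Finset.range (A + 1), (A.choose k : ℂ) •
      ∑ l ∈ Finset.range (B + 1), (B.choose l : ℂ) • md M c (l + (k - q)) m := by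
  have key : ∀ (B : ℕ) (g : ℤ → M) (s : ℤ), ∑ k ∈ Finset.range (B + 1 + 1),
      ((B + 1).choose k : ℂ) • g (k + s) =
      (∑ k ∈ Finset.range (B + 1), (B.choose k : ℂ) • g (k + s)) +
      ∑ k ∈ Finset.range (B + 1), (B.choose k : ℂ) • g (k + (s + 1)) := by
    intro B g s
    rw [Finset.sum_range_succ']
    have h2 : ∑ k ∈ Finset.range (B + 1), (B.choose k : ℂ) • g (k + s) =
        ∑ k ∈ Finset.range (B + 1), (B.choose (k + 1) : ℂ) • g (((k + 1 : ℕ) : ℤ) + s)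
          + g s := by
      have := Finset.sum_range_succ' (fun k : ℕ => (B.choose k : ℂ) • g (k + s)) (B + 1)
      rw [Finset.sum_range_succ] at this
      simpa using this
    rw [h2, add_right_comm, ← Finset.sum_add_distrib]
    congr 1
    · refine Finset.sum_congr rfl fun k _ => ?_
      rw [Nat.choose_succ_succ, Nat.cast_add, add_smul, add_comm]
      have e : ((k + 1 : ℕ) : ℤ) + s = k + (s + 1) := by push_cast; ring
      rw [e]
    · simp
  induction A generalizing q with
  | zero =>
    simp only [zero_add, Finset.sum_range_one, Nat.choose_self, Nat.cast_one, one_smul,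
      Nat.cast_zero, zop_apply, sub_eq_add_neg]
  | succ A ih =>
    have e : A + 1 + B = A + B + 1 := by ring
    have k1 := key (A + B) (fun n => md M c n m) (-q)
    have k2 := key A (fun n => ∑ l ∈ Finset.range (B + 1), (B.choose l : ℂ) •
      md M c (l + n) m) (-q)
    have i1 := ih q
    have i2 := ih (q - 1)
    rw [zop_apply] at i1 i2 ⊢
    rw [e]
    have e2 : ∀ k : ℤ, k - (q - 1) = k + (-q + 1) := by intro k; ring
    simp only [e2] at i2
    simp only [sub_eq_add_neg] at i1 ⊢
    rw [k1, i1, i2, k2]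

theorem zop_comm (A B : ℕ) (q : ℤ) (a b : V) (m : M) :
    ∃ N : ℕ, zop M A 1 a (zop M B q b m) - zop M B q b (zop M A 1 a m) =
      ∑ J ∈ Finset.range N, ∑ i ∈ Finset.range (J + 1), ((-1 : ℂ) ^ (J - i) * (A.choose i : ℂ)) •
        zop M (A - i + B) (q + J - i + 1) (md V a J b) m := by
  obtain ⟨N0, hN0⟩ := VertexOperatorAlgebra.trunc a b
  refine ⟨N0.toNat, ?_⟩
  have hcomm : ∀ p n : ℤ, md M a p (md M b n m) - md M b n (md M a p m) =
      ∑ J ∈ Finset.range N0.toNat, ((Ring.choose p J : ℤ) : ℂ) •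
        md M (md V a J b) (p + n - J) m := by
    intro p n
    have h := VOAModule.commutator a b p n m
    change md M a p (md M b n m) - md M b n (md M a p m) = _ at h
    rw [h, finsum_eq_sum_of_support_subset]
    · rfl
    · intro k hk
      by_contra hk2
      apply hk
      have : N0.toNat ≤ k := by simpa using hk2
      have h3 := hN0 k (by omega)
      simp [h3]
  have hL : zop M A 1 a (zop M B q b m) - zop M B q b (zop M A 1 a m) =
      ∑ k ∈ Finset.range (A + 1), ∑ l ∈ Finset.range (B + 1),
        ((A.choose k : ℂ) * (B.choose l : ℂ)) •
          (md M a (k - 1) (md M b (l - q) m) - md M b (l - q) (md M a (k - 1) m)) := by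
    simp only [zop_apply, map_sum, map_smul, Finset.smul_sum, smul_smul, smul_sub,
      Finset.sum_sub_distrib]
    congr 1
    rw [Finset.sum_comm]
    refine Finset.sum_congr rfl fun k _ => Finset.sum_congr rfl fun l _ => ?_
    rw [mul_comm]
  rw [hL]
  simp only [hcomm, Finset.smul_sum, smul_smul]
  have hJ : ∀ J ∈ Finset.range N0.toNat,
      ∑ i ∈ Finset.range (J + 1), ((-1 : ℂ) ^ (J - i) * (A.choose i : ℂ)) •
        zop M (A - i + B) (q + J - i + 1) (md V a J b) m =
      ∑ k ∈ Finset.range (A + 1), ∑ l ∈ Finset.range (B + 1),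
        ((A.choose k : ℂ) * (B.choose l : ℂ) * ((Ring.choose ((k : ℤ) - 1) J : ℤ) : ℂ)) •
          md M (md V a J b) ((k : ℤ) - 1 + (l - q) - J) m := by
    intro J _
    have := shift_identity A J (-1 - q - J) (fun n => ∑ l ∈ Finset.range (B + 1),
      (B.choose l : ℂ) • md M (md V a J b) (l + n) m)
    have h2 : ∀ i ∈ Finset.range (J + 1), ((-1 : ℂ) ^ (J - i) * (A.choose i : ℂ)) •
        zop M (A - i + B) (q + J - i + 1) (md V a J b) m =
        ((-1 : ℂ) ^ (J - i) * (A.choose i : ℂ)) • ∑ k ∈ Finset.range (A - i + 1),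
          ((A - i).choose k : ℂ) • ∑ l ∈ Finset.range (B + 1),
            (B.choose l : ℂ) • md M (md V a J b) (l + (k + (i + (-1 - q - J)))) m := by
      intro i _
      rw [zop_add]
      have e : ∀ k : ℕ, (k : ℤ) - (q + J - i + 1) = k + (i + (-1 - q - J)) := by
        intro k; ring
      simp only [e]
    rw [Finset.sum_congr rfl h2, ← this]
    refine Finset.sum_congr rfl fun k _ => ?_
    rw [Finset.smul_sum]
    refine Finset.sum_congr rfl fun l _ => ?_
    rw [smul_smul]
    have e : (l : ℤ) + (k + (-1 - q - J)) = k - 1 + (l - q) - J := by ring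
    rw [e]
    congr 1
    ring
  rw [Finset.sum_congr rfl hJ]
  rw [Finset.sum_comm (s := Finset.range N0.toNat)]
  refine Finset.sum_congr rfl fun k _ => ?_
  exact Finset.sum_comm

/-- The commutator of `Res Y(a,z)(1+z)^A/z` and `Res Y(b,w)(1+w)^B/w^q` maps into `O(M)`. -/
theorem zop_comm_mem {d e : ℕ} {a b : V} (ha : a ∈ grade V d) (hb : b ∈ grade V e) (A B N : ℕ)
    (hAB : A + B + 1 = d + e + N) (m : M) :
    zop M A 1 a (zop M B (N + 1) b m) - zop M B (N + 1) b (zop M A 1 a m) ∈ zhuO V M := by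
  obtain ⟨K, hK⟩ := zop_comm A B (N + 1) a b m
  rw [hK]
  refine Submodule.sum_mem _ fun J _ => Submodule.sum_mem _ fun i hi => ?_
  have hi' : i ≤ J := by have := Finset.mem_range.mp hi; omega
  rcases lt_or_ge A i with hA | hA
  · rw [Nat.choose_eq_zero_of_lt hA]; simp
  refine Submodule.smul_mem _ _ ?_
  rcases lt_or_ge (d + e) (J + 1) with hJ | hJ
  · rw [mode_eq_zero ha hb J (by omega)]
    rw [zop_zero, LinearMap.zero_apply]
    exact Submodule.zero_mem _
  · have hm := grade_mode ha hb (J : ℤ) (d + e - J - 1) (by omega)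
    have h := zop_mem_zhuO (M := M) (J - i + N) hm m
    have e1 : d + e - J - 1 + (J - i + N) = A - i + B := by omega
    have e2 : (2 : ℤ) + ((J - i + N : ℕ) : ℤ) = (N : ℤ) + 1 + J - i + 1 := by
      rw [Nat.cast_add, Nat.cast_sub hi']; ring
    rw [e1, e2] at h
    exact h

/-- The left product `a * m`, for `a ∈ V_d`. -/
def zhuLeft (M : Type*) [AddCommGroup M] [Module ℂ M] [VOAModule V M] (d : ℕ) (a : V) :
    Module.End ℂ M :=
  zop M d 1 a

/-- The right product `m * a = ∑ₖ (Δ_a-1 choose k) a(k-1)m`, for `a ∈ V_d`. -/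
def zhuRight (M : Type*) [AddCommGroup M] [Module ℂ M] [VOAModule V M] (d : ℕ) (a : V) (m : M) : M :=
  ∑ᶠ k : ℕ, ((Ring.choose ((d : ℤ) - 1) k : ℤ) : ℂ) • md M a ((k : ℤ) - 1) m

theorem zhuRight_succ (d : ℕ) (a : V) (m : M) : zhuRight M (d + 1) a m = zop M d 1 a m := by
  rw [zop_apply, zhuRight, finsum_eq_sum_of_support_subset (s := Finset.range (d + 1))]
  · refine Finset.sum_congr rfl fun k _ => ?_
    have e : ((d + 1 : ℕ) : ℤ) - 1 = d := by push_cast; ring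
    rw [e, Ring.choose_natCast]; simp
  · intro k hk
    by_contra hk2
    apply hk
    have hk3 : d < k := by
      have : ¬ k < d + 1 := by simpa using hk2
      omega
    have e : ((d + 1 : ℕ) : ℤ) - 1 = d := by push_cast; ring
    simp only [e, Ring.choose_natCast, Nat.choose_eq_zero_of_lt hk3]
    simp

theorem zhuRight_zero {a : V} (ha : a ∈ grade V 0) :
    ∃ r : ℂ, ∀ m : M, zhuRight M 0 a m = r • m := by
  have h0 : grade V 0 = Submodule.span ℂ {VertexOperatorAlgebra.vac} := by
    rw [← VertexOperatorAlgebra.cft_type]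
    simp [grade, vir, md, VOAModule.mode]
  rw [h0, Submodule.mem_span_singleton] at ha
  obtain ⟨r, rfl⟩ := ha
  refine ⟨r, fun m => ?_⟩
  rw [zhuRight, finsum_eq_single _ 0]
  · simp only [md_smul]
    rw [md, VOAModule.vacuum, if_pos (by norm_num)]
    simp
  · intro k hk
    simp only [md_smul]
    rw [md, VOAModule.vacuum, if_neg (by omega)]
    simp

theorem zhuLeft_mem_zhuO {d : ℕ} {a : V} (ha : a ∈ grade V d) {m : M} (hm : m ∈ zhuO V M) :
    zhuLeft M d a m ∈ zhuO V M := by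
  induction hm using Submodule.span_induction with
  | mem x hx =>
    obtain ⟨e, b, hb, y, rfl⟩ := hx
    have h := zop_comm_mem (M := M) ha hb d e 1 rfl y
    have h2 : zop M e 2 b (zop M d 1 a y) ∈ zhuO V M :=
      Submodule.subset_span ⟨e, b, hb, _, rfl⟩
    have e1 : ((1 : ℕ) : ℤ) + 1 = 2 := by norm_num
    rw [e1] at h
    have h3 := Submodule.add_mem _ h h2
    rwa [sub_add_cancel] at h3
  | zero => rw [map_zero]; exact Submodule.zero_mem _
  | add x y _ _ hx hy => rw [map_add]; exact Submodule.add_mem _ hx hy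
  | smul r x _ hx => rw [map_smul]; exact Submodule.smul_mem _ _ hx

/-- The left and the right products commute modulo `O(M)`. -/
theorem zhuLeft_zhuRight {d e : ℕ} {a b : V} (ha : a ∈ grade V d) (hb : b ∈ grade V e) (m : M) :
    zhuLeft M d a (zhuRight M e b m) - zhuRight M e b (zhuLeft M d a m) ∈ zhuO V M := by
  rcases e with _ | e
  · obtain ⟨r, hr⟩ := zhuRight_zero (M := M) hb
    rw [hr, hr, map_smul, sub_self]
    exact Submodule.zero_mem _
  · rw [zhuRight_succ, zhuRight_succ, ← Submodule.neg_mem_iff, neg_sub]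
    have h := zop_comm_mem (M := M) hb ha e d 0 (by omega) m
    have e1 : ((0 : ℕ) : ℤ) + 1 = 1 := by norm_num
    rw [e1] at h
    exact h

end basic

/-! ## Conditions on modules -/

/-- A module in the category considered here: `L(0)` is locally finite, the generalized eigenspaces
are finite-dimensional, the nilpotent part of `L(0)` has bounded order, and the weights lie in
finitely many sets `Δ + ℕ`. -/
structure IsVModule (V : Type*) [AddCommGroup V] [Module ℂ V] [VertexOperatorAlgebra V]
    (M : Type*) [AddCommGroup M] [Module ℂ M] [VOAModule V M] : Prop where
  locally_finite : ∀ m : M, ∃ W : Submodule ℂ M, m ∈ W ∧ FiniteDimensional ℂ W ∧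
    ∀ w ∈ W, vir V M 0 w ∈ W
  finite : ∀ h : ℂ, FiniteDimensional ℂ (wt V M h)
  nilpotent : ∃ N : ℕ, ∀ h : ℂ, ∀ m ∈ wt V M h,
    ((vir V M 0 - algebraMap ℂ (Module.End ℂ M) h) ^ N) m = 0
  bounded : ∃ s : Finset ℂ, s.Nonempty ∧ ⨆ Δ ∈ s, ⨆ k : ℕ, wt V M (Δ + k) = ⊤

/-- `M = ⨁_{k ≥ 0} M_{Δ+k}`. -/
def IsGradedFrom (V : Type*) [AddCommGroup V] [Module ℂ V] [VertexOperatorAlgebra V]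
    (M : Type*) [AddCommGroup M] [Module ℂ M] [VOAModule V M] (Δ : ℂ) : Prop :=
  ⨆ k : ℕ, wt V M (Δ + k) = ⊤

/-- `C₁(M)`, spanned by `a(-1)m` with `a` homogeneous of positive weight. -/
def cOne (V : Type*) [AddCommGroup V] [Module ℂ V] [VertexOperatorAlgebra V]
    (M : Type*) [AddCommGroup M] [Module ℂ M] [VOAModule V M] : Submodule ℂ M :=
  Submodule.span ℂ {x | ∃ d : ℕ, 1 ≤ d ∧ ∃ a ∈ grade V d, ∃ m : M, x = md M a (-1) m}

/-- `M` is `C₁`-cofinite. -/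
def IsCOneCofinite (V : Type*) [AddCommGroup V] [Module ℂ V] [VertexOperatorAlgebra V]
    (M : Type*) [AddCommGroup M] [Module ℂ M] [VOAModule V M] : Prop :=
  FiniteDimensional ℂ (M ⧸ cOne V M)

/-- `M` is generated by `M_Δ` as a module. -/
def IsGeneratedBy (V : Type*) [AddCommGroup V] [Module ℂ V] [VertexOperatorAlgebra V]
    (M : Type*) [AddCommGroup M] [Module ℂ M] [VOAModule V M] (Δ : ℂ) : Prop :=
  ∀ W : Submodule ℂ M, wt V M Δ ≤ W → (∀ (a : V) (n : ℤ), ∀ w ∈ W, md M a n w ∈ W) → W = ⊤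

/-- `(M_h)^*`, as the space of the functionals on `M` that vanish on `M_{h'}` for all `h' ≠ h`. -/
def wtDual (V : Type*) [AddCommGroup V] [Module ℂ V] [VertexOperatorAlgebra V]
    (M : Type*) [AddCommGroup M] [Module ℂ M] [VOAModule V M] (h : ℂ) :
    Submodule ℂ (Module.Dual ℂ M) :=
  (⨆ h' : ℂ, ⨆ _ : h' ≠ h, wt V M h').dualAnnihilator

/-- The restricted dual space `M^∨ = ⨁_h (M_h)^*`. -/
def resDual (V : Type*) [AddCommGroup V] [Module ℂ V] [VertexOperatorAlgebra V]
    (M : Type*) [AddCommGroup M] [Module ℂ M] [VOAModule V M] : Submodule ℂ (Module.Dual ℂ M) :=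
  ⨆ h : ℂ, wtDual V M h

/-- The operator `a(j)`, `a ∈ V_d`, of the dual module: the coefficient of `z^{-j-1}` in
`u ↦ u ∘ Y(e^{L(1)z}(-z⁻²)^{L(0)}a, z⁻¹)`. -/
def dualMode {V : Type*} [AddCommGroup V] [Module ℂ V] [VertexOperatorAlgebra V]
    {M : Type*} [AddCommGroup M] [Module ℂ M] [VOAModule V M] (d : ℕ) (a : V) (j : ℤ)
    (u : Module.Dual ℂ M) : Module.Dual ℂ M :=
  ∑ k ∈ Finset.range (d + 1), ((-1 : ℂ) ^ d / (k.factorial : ℂ)) •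
    u.comp (md M ((vir V V 1 ^ k) a) (2 * d - 2 - k - j))

/-- `M^∨` is generated by `(M_Δ)^*` as a module. -/
def IsDualGeneratedBy (V : Type*) [AddCommGroup V] [Module ℂ V] [VertexOperatorAlgebra V]
    (M : Type*) [AddCommGroup M] [Module ℂ M] [VOAModule V M] (Δ : ℂ) : Prop :=
  ∀ W : Submodule ℂ (Module.Dual ℂ M), wtDual V M Δ ≤ W →
    (∀ (d : ℕ), ∀ a ∈ grade V d, ∀ (j : ℤ), ∀ u ∈ W, dualMode d a j u ∈ W) → resDual V M ≤ W

open Classical in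
/-- The projection of `M` onto `M_h` along the other generalized eigenspaces. -/
def genProj (V : Type*) [AddCommGroup V] [Module ℂ V] [VertexOperatorAlgebra V]
    (M : Type*) [AddCommGroup M] [Module ℂ M] [VOAModule V M] (h : ℂ) : M →ₗ[ℂ] ↥(wt V M h) :=
  if H : IsCompl (wt V M h) (⨆ h' : ℂ, ⨆ _ : h' ≠ h, wt V M h') then
    Submodule.projectionOnto _ _ H
  else 0

/-- The coefficient of `z^h (log z)^k` in `z^{L(0)} = ∑ₕ z^h exp((L(0) - h) log z) pr_h`. -/
def powL0 (V : Type*) [AddCommGroup V] [Module ℂ V] [VertexOperatorAlgebra V]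
    (M : Type*) [AddCommGroup M] [Module ℂ M] [VOAModule V M] (h : ℂ) (k : ℕ) : Module.End ℂ M :=
  ((k.factorial : ℂ)⁻¹) • (((vir V M 0 - algebraMap ℂ (Module.End ℂ M) h) ^ k : Module.End ℂ M) ∘ₗ
    (wt V M h).subtype ∘ₗ genProj V M h)

/-! ## Tensor products over the Zhu algebra

The Zhu algebra `A(V) = V/O(V)` is spanned by the classes of the homogeneous `a ∈ V`, so that an
`A(V)`-module is described by the operators of these elements; balancing over `A(V)` and
`A(V)`-linearity are expressed through them. -/

theorem md_mem_wt {V : Type*} [AddCommGroup V] [Module ℂ V] [VertexOperatorAlgebra V]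
    {M : Type*} [AddCommGroup M] [Module ℂ M] [VOAModule V M] (Δ : ℂ) {d : ℕ} {a : V}
    (ha : a ∈ grade V d) : ∀ m ∈ wt V M Δ, md M a ((d : ℤ) - 1) m ∈ wt V M Δ := by
  have hc : Commute (vir V M 0) (md M a ((d : ℤ) - 1)) := by
    refine LinearMap.ext fun m => ?_
    have h := vir_zero_comm (M := M) ha ((d : ℤ) - 1) m
    have e : (d : ℂ) - (((d : ℤ) - 1 : ℤ) : ℂ) - 1 = 0 := by push_cast; ring
    rw [e, zero_smul, sub_eq_zero] at h
    exact h
  exact Module.End.mapsTo_maxGenEigenspace_of_comm hc Δ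

/-- The operator `o(a) = a(Δ_a-1)` on `M_Δ`; it is the left action of `a` on this `A(V)`-module when
`Δ` is the lowest weight. -/
def zeroMode {V : Type*} [AddCommGroup V] [Module ℂ V] [VertexOperatorAlgebra V]
    (M : Type*) [AddCommGroup M] [Module ℂ M] [VOAModule V M] (Δ : ℂ) (d : ℕ) (a : ↥(grade V d)) :
    Module.End ℂ ↥(wt V M Δ) :=
  (md M (a : V) ((d : ℤ) - 1)).restrict (md_mem_wt Δ a.2)

/-- `A(M) = M/O(M)`. -/
abbrev ZhuMod (V : Type*) [AddCommGroup V] [Module ℂ V] [VertexOperatorAlgebra V]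
    (M : Type*) [AddCommGroup M] [Module ℂ M] [VOAModule V M] : Type _ :=
  M ⧸ zhuO V M

/-- The left action of `A(V)` on `A(M)`. -/
def zhuAct {V : Type*} [AddCommGroup V] [Module ℂ V] [VertexOperatorAlgebra V]
    (M : Type*) [AddCommGroup M] [Module ℂ M] [VOAModule V M] (d : ℕ) (a : ↥(grade V d)) :
    Module.End ℂ (ZhuMod V M) :=
  (zhuO V M).mapQ (zhuO V M) (zhuLeft M d (a : V)) (fun _ hm => zhuLeft_mem_zhuO a.2 hm)

/-- The relations `(m * a) ⊗ t = m ⊗ (a · t)` that define `A(M) ⊗_{A(V)} W`. -/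
def balance {V : Type*} [AddCommGroup V] [Module ℂ V] [VertexOperatorAlgebra V]
    (M : Type*) [AddCommGroup M] [Module ℂ M] [VOAModule V M] {W : Type*} [AddCommGroup W]
    [Module ℂ W] (act : (d : ℕ) → ↥(grade V d) → Module.End ℂ W) :
    Submodule ℂ (ZhuMod V M ⊗[ℂ] W) :=
  Submodule.span ℂ {x | ∃ (d : ℕ) (a : ↥(grade V d)) (m : M) (t : W),
    x = (zhuO V M).mkQ (zhuRight M d (a : V) m) ⊗ₜ[ℂ] t - (zhuO V M).mkQ m ⊗ₜ[ℂ] act d a t}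

theorem balance_le {V : Type*} [AddCommGroup V] [Module ℂ V] [VertexOperatorAlgebra V]
    (M : Type*) [AddCommGroup M] [Module ℂ M] [VOAModule V M] {W : Type*} [AddCommGroup W]
    [Module ℂ W] (act : (d : ℕ) → ↥(grade V d) → Module.End ℂ W) (d : ℕ) (a : ↥(grade V d)) :
    balance M act ≤ (balance M act).comap ((zhuAct M d a).rTensor W) := by
  refine Submodule.span_le.mpr ?_
  rintro x ⟨e, b, m, t, rfl⟩
  refine Submodule.subset_span ⟨e, b, zhuLeft M d (a : V) m, t, ?_⟩
  have h := zhuLeft_zhuRight (M := M) a.2 b.2 m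
  have h2 : (zhuO V M).mkQ (zhuLeft M d (a : V) (zhuRight M e (b : V) m)) =
      (zhuO V M).mkQ (zhuRight M e (b : V) (zhuLeft M d (a : V) m)) := by
    rw [← sub_eq_zero, ← map_sub]
    exact (Submodule.Quotient.mk_eq_zero _).mpr h
  rw [← h2, map_sub, LinearMap.rTensor_tmul, LinearMap.rTensor_tmul]
  rfl

/-- A left `A(V)`-module with a map from tuples of vectors, which is used for the iterated tensor
products and their elements `m_p ⊗ ⋯ ⊗ m_r`. -/
structure ZhuTail (V : Type*) [AddCommGroup V] [Module ℂ V] [VertexOperatorAlgebra V]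
    (P : Type*) where
  carrier : Type*
  [addCommGroup : AddCommGroup carrier]
  [module : Module ℂ carrier]
  act : (d : ℕ) → ↥(grade V d) → Module.End ℂ carrier
  tens : P → carrier

attribute [instance] ZhuTail.addCommGroup ZhuTail.module

universe v

/-- The `A(V)`-module `A(M_p) ⊗_{A(V)} ⋯ ⊗_{A(V)} A(M_{r-1}) ⊗_{A(V)} (M_r)_Δ`; the modules are indexed
by `0, …, n+1`, so that the index of the last one `M_r` is `n+1`. The left action is the one on the
first factor. -/
def zhuTail (V : Type*) [AddCommGroup V] [Module ℂ V] [VertexOperatorAlgebra V] {n : ℕ}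
    (M : Fin (n + 2) → Type v) [∀ i, AddCommGroup (M i)] [∀ i, Module ℂ (M i)]
    [∀ i, VOAModule V (M i)] (Δ : ℂ) (p : Fin (n + 2)) : ZhuTail.{_, _, v} V (∀ i, M i) :=
  Fin.reverseInduction (motive := fun _ => ZhuTail.{_, _, v} V (∀ i, M i))
    { carrier := ↥(wt V (M (Fin.last (n + 1))) Δ)
      act := zeroMode (M (Fin.last (n + 1))) Δ
      tens := fun m => genProj V (M (Fin.last (n + 1))) Δ (m (Fin.last (n + 1))) }
    (fun i T =>
      { carrier := (ZhuMod V (M i.castSucc) ⊗[ℂ] T.carrier) ⧸ balance (M i.castSucc) T.act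
        act := fun d a => (balance (M i.castSucc) T.act).mapQ (balance (M i.castSucc) T.act)
          ((zhuAct (M i.castSucc) d a).rTensor T.carrier) (balance_le (M i.castSucc) T.act d a)
        tens := fun m => (balance (M i.castSucc) T.act).mkQ
          ((zhuO V (M i.castSucc)).mkQ (m i.castSucc) ⊗ₜ[ℂ] T.tens m) })
    p

/-- The operator of the class of the conformal vector `ω`. -/
def ZhuTail.omega {V : Type*} [AddCommGroup V] [Module ℂ V] [VertexOperatorAlgebra V]
    {P : Type*} (T : ZhuTail V P) : Module.End ℂ T.carrier :=
  T.act 2 ⟨VertexOperatorAlgebra.conf, conf_mem⟩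

/-! ## Series with complex powers and logarithms -/

/-- Formal series `∑ w_{t,k} x^t (log x)^k` in `N` variables, given by their coefficients `w_{t,k}`. -/
abbrev LogSeries (N : ℕ) (W : Type*) : Type _ := (Fin N → ℂ) → (Fin N →₀ ℕ) → W

/-- The exponent of `ζ^ν` in the variables `x`, where `ζ_i = x_{i+1}/x_i`. -/
def zetaShift {n : ℕ} (ν : Fin n → ℂ) : Fin (n + 1) → ℂ := fun j =>
  ∑ i : Fin n, ν i * ((if j = i.succ then 1 else 0) - (if j = i.castSucc then 1 else 0))

/-- The formal derivative `∂/∂x_p`. -/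
def derivX {N : ℕ} {W : Type*} [AddCommGroup W] [Module ℂ W] (p : Fin N) (G : LogSeries N W) :
    LogSeries N W := fun t k =>
  (t p + 1) • G (t + Pi.single p 1) k + ((k p : ℂ) + 1) • G (t + Pi.single p 1) (k + Finsupp.single p 1)

/-- The product of a series without logarithms and a series. -/
def mulX {N : ℕ} {W : Type*} [AddCommGroup W] [Module ℂ W] (f : (Fin N → ℂ) → ℂ)
    (G : LogSeries N W) : LogSeries N W := fun t k =>
  ∑ᶠ s : Fin N → ℂ, f s • G (t - s) k

/-! ## Parenthesized intertwining operators for the standard tree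

The leaves of the standard tree `1(2(⋯(r-1 r)))`, `r = n+2`, are indexed by `0, …, n+1`. Its
coordinates are `x_p = z_p - z_r` for the leaves `p ≠ r` and `ζ_i = x_{i+1}/x_i`. -/

/-- The exponent of `x_p^c`. -/
def leafExp {n : ℕ} (p : Fin (n + 2)) (c : ℂ) : Fin (n + 1) → ℂ := fun i =>
  if i.castSucc = p then c else 0

open Classical in
/-- The expansion of `(z_s - z_p)^j = (x_s - x_p)^j`, where `x_r = 0`, in `|x_s| > |x_p|` for
`s < p`. -/
def expPowLT {n : ℕ} (s p : Fin (n + 2)) (j : ℤ) (t : Fin (n + 1) → ℂ) : ℂ :=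
  ∑ᶠ l : ℕ, if t = leafExp s ((j : ℂ) - l) + leafExp p l ∧ (p = Fin.last (n + 1) → l = 0) then
    (-1 : ℂ) ^ l * ((Ring.choose j l : ℤ) : ℂ) else 0

open Classical in
/-- The expansion of `(z_s - z_p)^j` in the region `|x_1| > |x_2| > ⋯ > |x_{r-1}|` of the standard
tree. For `s = p` it is only used for `j ≥ 0`. -/
def expPow {n : ℕ} (s p : Fin (n + 2)) (j : ℤ) (t : Fin (n + 1) → ℂ) : ℂ :=
  if s < p then expPowLT s p j t
  else if p < s then (-1 : ℂ) ^ j * expPowLT p s j t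
  else if j = 0 ∧ t = 0 then 1 else 0

/-- The radii `𝔭` for which the points `z_1, …, z_r` are distinct whenever `0 < |ζ_i| < 𝔭_i`. -/
def Admissible {n : ℕ} (ρ : Fin n → ℝ) : Prop :=
  (∀ e, 0 < ρ e) ∧ ∀ ζ : Fin n → ℂ, (∀ e, 0 < ‖ζ e‖ ∧ ‖ζ e‖ < ρ e) → ∀ z x : ℂ, x ≠ 0 →
    Function.Injective (fun i : Fin (n + 2) =>
      if i = Fin.last (n + 1) then z else z + x * ∏ e : Fin n, if (e : ℕ) < i then ζ e else 1)

/-- Absolute convergence in the polydisc of radii `ρ`. -/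
def ConvergesOn {n : ℕ} (ρ : Fin n → ℝ) (f : MvPowerSeries (Fin n) ℂ) : Prop :=
  ∀ ζ : Fin n → ℂ, (∀ e, ‖ζ e‖ < ρ e) →
    Summable fun ν : Fin n →₀ ℕ => ‖MvPowerSeries.coeff ν f‖ * ∏ e, ‖ζ e‖ ^ ν e

open Classical in
/-- The series `x^s (log x)^κ f(ζ)`. -/
def monoSeries {n : ℕ} (s : Fin (n + 1) → ℂ) (κ : Fin (n + 1) →₀ ℕ) (f : MvPowerSeries (Fin n) ℂ) :
    LogSeries (n + 1) ℂ := fun t k =>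
  if k = κ then ∑ᶠ ν : Fin n →₀ ℕ,
    if t = s + zetaShift (fun e => (ν e : ℂ)) then MvPowerSeries.coeff ν f else 0
  else 0

/-- The series in `x^ℂ`, `log x` and `ζ` that converge in the polydiscs of all admissible radii. -/
def convSeries (n : ℕ) : Submodule ℂ (LogSeries (n + 1) ℂ) :=
  ⨅ ρ : Fin n → ℝ, ⨅ _ : Admissible ρ,
    Submodule.span ℂ {G | ∃ s κ f, ConvergesOn ρ f ∧ G = monoSeries s κ f}

/-- An operator acting on the `p`-th factor of `M_1 ⊗ ⋯ ⊗ M_r`. -/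
def slot {n : ℕ} {M : Fin (n + 2) → Type*} [∀ i, AddCommGroup (M i)] [∀ i, Module ℂ (M i)]
    (p : Fin (n + 2)) (f : Module.End ℂ (M p)) : Module.End ℂ (⨂[ℂ] i, M i) :=
  PiTensorProduct.map (Function.update (fun i => (LinearMap.id : M i →ₗ[ℂ] M i)) p f)

/-- `F` is a parenthesized intertwining operator of type `(std_r, M₀, M_1, …, M_r)`. -/
structure IsPIO (V : Type*) [AddCommGroup V] [Module ℂ V] [VertexOperatorAlgebra V] {n : ℕ}
    (M₀ : Type*) [AddCommGroup M₀] [Module ℂ M₀] [VOAModule V M₀]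
    (M : Fin (n + 2) → Type*) [∀ i, AddCommGroup (M i)] [∀ i, Module ℂ (M i)]
    [∀ i, VOAModule V (M i)] (F : (⨂[ℂ] i, M i) →ₗ[ℂ] LogSeries (n + 1) M₀) : Prop where
  convergent : ∀ u ∈ resDual V M₀, ∀ m, (fun t k => u (F m t k)) ∈ convSeries n
  translation : ∀ (p : Fin (n + 1)) (m : ⨂[ℂ] i, M i),
    F (slot p.castSucc (vir V (M p.castSucc) (-1)) m) = derivX p (F m)
  borcherds : ∀ (a : V) (j : ℤ) (p : Fin (n + 2)) (m : ⨂[ℂ] i, M i) (t : Fin (n + 1) → ℂ)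
      (l : Fin (n + 1) →₀ ℕ),
    F (slot p (md (M p) a j) m) t l =
      (∑ᶠ k : ℕ, ((Ring.choose j k : ℤ) : ℂ) •
        mulX (expPow (Fin.last (n + 1)) p k) (fun t' l' => md M₀ a (j - k) (F m t' l')) t l)
      - ∑ s ∈ Finset.univ.erase p, ∑ᶠ k : ℕ, ((Ring.choose j k : ℤ) : ℂ) •
        mulX (expPow s p (j - k)) (F (slot s (md (M s) a k) m)) t l

/-! ## The modified series -/

/-- The coefficient of `y^j` in `(1-y)^s (log(1-y))^q`. -/
def shiftCoeff (s : ℂ) (q j : ℕ) : ℂ :=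
  PowerSeries.coeff j
    ((PowerSeries.mk fun i => (-1 : ℂ) ^ i * Ring.choose s i) *
      (PowerSeries.mk fun i => if i = 0 then 0 else -(1 / (i : ℂ))) ^ q)

open Classical in
/-- The substitution of `x_p = z_p - z_r`, expanded in `|z_p| > |z_r|`. -/
def toZ {n : ℕ} {W : Type*} [AddCommGroup W] [Module ℂ W] (G : LogSeries (n + 1) W) :
    LogSeries (n + 2) W := fun t l =>
  ∑ᶠ j : Fin (n + 1) → ℕ,
    if l (Fin.last (n + 1)) = 0 ∧ t (Fin.last (n + 1)) = ∑ i, (j i : ℂ) then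
      ∑ᶠ k : Fin (n + 1) →₀ ℕ,
        (∏ i, ((k i).choose (l i.castSucc) : ℂ) *
          (if l i.castSucc ≤ k i then
            shiftCoeff (t i.castSucc + j i) (k i - l i.castSucc) (j i) else 0)) •
        G (fun i => t i.castSucc + j i) k
    else 0

/-- `F̃ = exp(L(-1)z_r) F`, as a series in `z_1, …, z_r`. -/
def tildeF (V : Type*) [AddCommGroup V] [Module ℂ V] [VertexOperatorAlgebra V] {n : ℕ}
    {M₀ : Type*} [AddCommGroup M₀] [Module ℂ M₀] [VOAModule V M₀] (G : LogSeries (n + 1) M₀) :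
    LogSeries (n + 2) M₀ := fun t l =>
  ∑ᶠ k : ℕ, ((k.factorial : ℂ)⁻¹) •
    (vir V M₀ (-1) ^ k) (toZ G (t - Pi.single (Fin.last (n + 1)) (k : ℂ)) l)

/-- `F̃(z_1^{L(0)}m_1 ⊗ ⋯ ⊗ z_r^{L(0)}m_r)`. -/
def tildeFL0 (V : Type*) [AddCommGroup V] [Module ℂ V] [VertexOperatorAlgebra V] {n : ℕ}
    {M₀ : Type*} [AddCommGroup M₀] [Module ℂ M₀] [VOAModule V M₀]
    {M : Fin (n + 2) → Type*} [∀ i, AddCommGroup (M i)] [∀ i, Module ℂ (M i)]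
    [∀ i, VOAModule V (M i)] (F : (⨂[ℂ] i, M i) →ₗ[ℂ] LogSeries (n + 1) M₀) (m : ⨂[ℂ] i, M i) :
    LogSeries (n + 2) M₀ := fun t l =>
  ∑ᶠ h : Fin (n + 2) → ℂ, ∑ k ∈ Finset.HasAntidiagonal.antidiagonal l,
    tildeF V (F (PiTensorProduct.map (fun i => powL0 V (M i) (h i) (k.1 i)) m)) (t - h) k.2

/-- `F̄(m) = pr_{Δ'} z_1^{-L(0)} F̃(z_1^{L(0)}m_1 ⊗ ⋯ ⊗ z_r^{L(0)}m_r)`, where `pr_{Δ'}` is the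
projection onto `(M₀)_{Δ'}`, as a series in `z_1, …, z_r`. -/
def barFz (V : Type*) [AddCommGroup V] [Module ℂ V] [VertexOperatorAlgebra V] {n : ℕ}
    {M₀ : Type*} [AddCommGroup M₀] [Module ℂ M₀] [VOAModule V M₀]
    {M : Fin (n + 2) → Type*} [∀ i, AddCommGroup (M i)] [∀ i, Module ℂ (M i)]
    [∀ i, VOAModule V (M i)] (Δ' : ℂ) (F : (⨂[ℂ] i, M i) →ₗ[ℂ] LogSeries (n + 1) M₀)
    (m : ⨂[ℂ] i, M i) : LogSeries (n + 2) M₀ := fun t l =>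
  ∑ k ∈ Finset.range (l 0 + 1), (-1 : ℂ) ^ k • powL0 V M₀ Δ' k
    (tildeFL0 V F m (t + Pi.single 0 Δ') (l - Finsupp.single 0 k))

/-- The series in `z` obtained from a series in `ζ` by `ζ_i = z_{i+1}/z_i`. -/
def zetaToZ {n : ℕ} {W : Type*} [AddCommGroup W] [Module ℂ W] (G : LogSeries (n + 1) W) :
    LogSeries (n + 2) W := fun t l =>
  open Classical in
  if ∑ i, t i = 0 then
    ∑ᶠ q : Fin (n + 1) →₀ ℕ,
      (MvPolynomial.coeff l (∏ i : Fin (n + 1),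
        (MvPolynomial.X i.succ - MvPolynomial.X i.castSucc : MvPolynomial (Fin (n + 2)) ℂ) ^ q i)) •
      G (fun i => -∑ j : Fin (n + 1), if j ≤ i then t j.castSucc else 0) q
  else 0

/-- `F̄(m)` as a series in `ζ_i = z_{i+1}/z_i`, `1 ≤ i ≤ r-1`, obtained by setting `z_1 = 1`, so that
`z_{i+1} = ζ_1 ⋯ ζ_i` and `log z_{i+1} = log ζ_1 + ⋯ + log ζ_i`. -/
def barF (V : Type*) [AddCommGroup V] [Module ℂ V] [VertexOperatorAlgebra V] {n : ℕ}
    {M₀ : Type*} [AddCommGroup M₀] [Module ℂ M₀] [VOAModule V M₀]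
    {M : Fin (n + 2) → Type*} [∀ i, AddCommGroup (M i)] [∀ i, Module ℂ (M i)]
    [∀ i, VOAModule V (M i)] (Δ' : ℂ) (F : (⨂[ℂ] i, M i) →ₗ[ℂ] LogSeries (n + 1) M₀)
    (m : ⨂[ℂ] i, M i) : LogSeries (n + 1) M₀ := fun ν q =>
  ∑ᶠ l : Fin (n + 2) →₀ ℕ, if l 0 = 0 then
    (MvPolynomial.coeff q (∏ i : Fin (n + 1),
      (∑ j : Fin (n + 1), if j ≤ i then MvPolynomial.X j else 0 :
        MvPolynomial (Fin (n + 1)) ℂ) ^ l i.succ)) •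
      barFz V Δ' F m (zetaShift ν) l
  else 0

/-- The class of a complex number in `ℂ/ℤ`. -/
abbrev ModInt : Type := ℂ ⧸ AddSubgroup.zmultiples (1 : ℂ)

open Classical in
/-- The projection `p_λ`: the part of a series with exponents of `ζ_i` in `λ_i` for `i ≤ r-2`. -/
def pLam {n : ℕ} {W : Type*} [AddCommGroup W] (lam : Fin n → ModInt) (G : LogSeries (n + 1) W) :
    LogSeries (n + 1) W := fun ν q =>
  if ∀ i : Fin n, (ν i.castSucc : ModInt) = lam i then G ν q else 0

/-- The set `S_λ(F)` of the exponents `k` such that the coefficient of `ζ_1^{k_1} ⋯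
ζ_{r-2}^{k_{r-2}} ζ_{r-1}^{Δ_r}` in `p_λ F̄` does not vanish. -/
def expSet (V : Type*) [AddCommGroup V] [Module ℂ V] [VertexOperatorAlgebra V] {n : ℕ}
    {M₀ : Type*} [AddCommGroup M₀] [Module ℂ M₀] [VOAModule V M₀]
    {M : Fin (n + 2) → Type*} [∀ i, AddCommGroup (M i)] [∀ i, Module ℂ (M i)]
    [∀ i, VOAModule V (M i)] (Δ' Δr : ℂ) (F : (⨂[ℂ] i, M i) →ₗ[ℂ] LogSeries (n + 1) M₀)
    (lam : Fin n → ModInt) : Set (Fin n → ℂ) :=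
  {k | ∃ m q, pLam lam (barF V Δ' F m) (Fin.snoc (α := fun _ => ℂ) k Δr) q ≠ 0}

/-- The set of the minimal elements of `S_λ(F)`. -/
def leadSet (V : Type*) [AddCommGroup V] [Module ℂ V] [VertexOperatorAlgebra V] {n : ℕ}
    {M₀ : Type*} [AddCommGroup M₀] [Module ℂ M₀] [VOAModule V M₀]
    {M : Fin (n + 2) → Type*} [∀ i, AddCommGroup (M i)] [∀ i, Module ℂ (M i)]
    [∀ i, VOAModule V (M i)] (Δ' Δr : ℂ) (F : (⨂[ℂ] i, M i) →ₗ[ℂ] LogSeries (n + 1) M₀)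
    (lam : Fin n → ModInt) : Set (Fin n → ℂ) :=
  {h | h ∈ expSet V Δ' Δr F lam ∧ ∀ k ∈ expSet V Δ' Δr F lam,
    (∀ i, ∃ j : ℕ, h i - k i = j) → k = h}

end

end VOA

/-!
A parenthesized intertwining operator `F` is studied through its coefficients in the coordinates
`x_p = z_p - z_r`. On vectors `m_i` of weights `w_i`, the coefficient of `x^T` has weight
`∑ w_i + ∑ T_p` (`IsPIO.mem_wt`): the Borcherds identity for `L(0)` at the last point, together with the
translation property, is an Euler equation, by which `L(0)` acts on this coefficient as a scalar plus
commuting nilpotent operators. The exponents of `ζ_i = x_{i+1}/x_i`, after the rescaling of the vectors by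
`z_i^{L(0)}`, are the weights of the intermediate states between the `i`-th and the following points
(`interExp`).

Everything else about `F` follows from one residue identity, that of
`z^A x_p^c (z - x_p)^{-q} a(z)` with `a` of weight `D + 1`, `A ∈ {D, D + 1}`, `c ∈ {0, 1}` and
`q = c + A - D`, a combination of Borcherds identities at `p` (`IsPIO.lead`, `IsPIO.lead_homog`).
Modulo terms in which an intermediate state has a smaller weight, it expresses the action on `m_p` of
the operator `∑ (A choose i) a(i-q)` by `o(a)` on `M₀` and the contributions of the other points to `o(a)`:
of those to the left of `p` if `c = 0`, and of those to the right if `A = D`. It is used twice.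

* By `C₁`-cofiniteness, vectors of large weight are combinations of vectors `a(-1)m`. The identity for
  `A = D`, `c = 1` reduces these to vectors of smaller total weight without lowering the weights of the
  intermediate states, so these weights are bounded below (`IsPIO.exists_bound`,
  `IsPIO.exists_pole_bound`). Hence minimal exponents exist (`IsPIO.leadSet_nonempty`).
* At a minimal exponent the terms with smaller intermediate weights vanish (`IsPIO.lead_vanishing`), and
  the four choices of `(A, c)` say that the leading coefficient kills `O(M_p)`, that the right product
  with `a` at `p` is the sum of the contributions of the points to the right of `p`, that the left product
  is `o(a)` minus the contributions from the left, and that `o(a)` is the sum of all contributions. So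
  the right product at `p` is the left product at `p + 1`, and the left product at the first point is
  `o(a)`: the leading coefficient is balanced over `A(V)` and `A(V)`-linear
  (`IsPIO.isZhuBalanced_leadMap`, `IsPIO.leadMap_leftOp_zero`), and induces a map on the iterated tensor
  product by the universal property of the latter (`IsZhuBalanced.exists_lift`).

In weight `Δ'` the factor `exp(L(-1)z_r)` does not contribute, since `L(-1)` raises the weight. The Euler
equation shows that `F̄` is invariant under rescaling all the `z_i` (`IsPIO.barFz_scale`), so it is a series
in the `ζ_i` and their logarithms (`IsPIO.barFz_eq_zetaToZ`). That `M₀^∨` is generated by its lowest weight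
space implies that `F` has a non-zero coefficient of weight `Δ'` (`IsPIO.exists_ne_zero`); that `M_r` is
generated by its lowest weight space implies that one occurs on this space
(`IsPIO.exists_lowest_ne_zero`).

For `a = ω` the contribution of a point to `o(ω)` is the Euler operator in its coordinate, by the
translation property, so `ω` acts on the leading coefficient, as a map on `T_{i+1}`, as
`h_i + ∂/∂(log ζ_i)` (`IsPIO.omega_relation`, `IsPIO.leadMap_omega`). The `T_p` are finite-dimensional
by `C₁`-cofiniteness (`zhuTail_finite`), and the derivative is locally nilpotent. So `h_i` is an
eigenvalue of `ω` on `T_{i+1}`, there are finitely many possibilities for it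
(`hasEigenvalue_of_intertwines`), and if `ω` is semisimple the derivatives of the leading coefficient with
respect to all `log ζ_i` vanish (`comp_eq_zero_of_isSemisimple`).
-/

namespace VOA

noncomputable section

section weights

variable {V : Type*} [AddCommGroup V] [Module ℂ V] [VertexOperatorAlgebra V]
  {M : Type*} [AddCommGroup M] [Module ℂ M] [VOAModule V M]

/-! ### Weight spaces -/

theorem IsGradedFrom.iSup_wt {Δ : ℂ} (h : IsGradedFrom V M Δ) : ⨆ h, wt V M h = ⊤ := by
  rw [eq_top_iff, ← h]
  exact iSup_le fun k => le_iSup (wt V M) _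

theorem IsGradedFrom.isCompl {Δ : ℂ} (hM : IsGradedFrom V M Δ) (h : ℂ) :
    IsCompl (wt V M h) (⨆ h' : ℂ, ⨆ _ : h' ≠ h, wt V M h') := by
  refine ⟨(vir V M 0).independent_maxGenEigenspace h, ?_⟩
  rw [codisjoint_iff, eq_top_iff, ← hM.iSup_wt]
  refine iSup_le fun h' => ?_
  by_cases e : h' = h
  · subst e; exact le_sup_left
  · exact le_sup_of_le_right (le_iSup₂_of_le h' e le_rfl)

theorem IsGradedFrom.genProj_of_mem {Δ : ℂ} (hM : IsGradedFrom V M Δ) {h : ℂ} {m : M}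
    (hm : m ∈ wt V M h) : (genProj V M h m : M) = m := by
  rw [genProj, dif_pos (hM.isCompl h)]
  exact congrArg Subtype.val (Submodule.projectionOnto_apply_left (hM.isCompl h) ⟨m, hm⟩)

theorem IsGradedFrom.genProj_of_mem_ne {Δ : ℂ} (hM : IsGradedFrom V M Δ) {h h' : ℂ} {m : M}
    (hm : m ∈ wt V M h') (hne : h' ≠ h) : genProj V M h m = 0 := by
  rw [genProj, dif_pos (hM.isCompl h)]
  exact (Submodule.projectionOnto_apply_eq_zero_iff (hM.isCompl h)).mpr
    ((le_iSup₂_of_le (f := fun h' (_ : h' ≠ h) => wt V M h') h' hne le_rfl) hm)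

theorem IsGradedFrom.eq_zero_of_ne {Δ : ℂ} (hM : IsGradedFrom V M Δ) {h : ℂ}
    (hne : ∀ k : ℕ, h ≠ Δ + k) {m : M} (hm : m ∈ wt V M h) : m = 0 := by
  have hd := (vir V M 0).independent_maxGenEigenspace h
  have : (⨆ h' : ℂ, ⨆ _ : h' ≠ h, wt V M h') = ⊤ := by
    rw [eq_top_iff, ← hM]
    exact iSup_le fun k => le_iSup₂_of_le _ (hne k).symm le_rfl
  change Disjoint (wt V M h) (⨆ h' : ℂ, ⨆ _ : h' ≠ h, wt V M h') at hd
  rw [this, disjoint_top] at hd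
  rw [hd] at hm
  simpa using hm

theorem IsGradedFrom.eq_zero_of_lt {Δ : ℂ} (hM : IsGradedFrom V M Δ) {h : ℂ} {j : ℤ} (hj : j < 0)
    (hh : h = Δ + j) {m : M} (hm : m ∈ wt V M h) : m = 0 := by
  refine hM.eq_zero_of_ne (fun k hk => ?_) hm
  rw [hh] at hk
  have : ((j : ℤ) : ℂ) = ((k : ℤ) : ℂ) := by simpa using hk
  have := Int.cast_injective this
  omega

theorem IsGradedFrom.hom_ext {Δ : ℂ} (hM : IsGradedFrom V M Δ) {W : Type*} [AddCommGroup W]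
    [Module ℂ W] {f g : M →ₗ[ℂ] W} (h : ∀ k : ℕ, ∀ m ∈ wt V M (Δ + k), f m = g m) : f = g := by
  have : (⊤ : Submodule ℂ M) ≤ LinearMap.eqLocus f g := by
    rw [← hM]
    exact iSup_le fun k m hm => h k m hm
  exact LinearMap.ext fun m => this (Submodule.mem_top (x := m))

/-- The operator `L(0) - h`; it is locally nilpotent on the weight space of weight `h`. -/
def nil (V : Type*) [AddCommGroup V] [Module ℂ V] [VertexOperatorAlgebra V]
    (M : Type*) [AddCommGroup M] [Module ℂ M] [VOAModule V M] (h : ℂ) : Module.End ℂ M :=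
  vir V M 0 - algebraMap ℂ (Module.End ℂ M) h

theorem nil_apply (h : ℂ) (m : M) : nil V M h m = vir V M 0 m - h • m := by
  simp [nil]

theorem mem_wt_iff {h : ℂ} {m : M} : m ∈ wt V M h ↔ ∃ k, (nil V M h ^ k) m = 0 := by
  rw [wt, Module.End.mem_maxGenEigenspace]
  rfl

theorem nil_mem {h : ℂ} {m : M} (hm : m ∈ wt V M h) : nil V M h m ∈ wt V M h := by
  obtain ⟨k, hk⟩ := mem_wt_iff.mp hm
  refine mem_wt_iff.mpr ⟨k, ?_⟩
  rw [← Module.End.mul_apply, ← pow_succ, pow_succ', Module.End.mul_apply, hk, map_zero]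

theorem nil_pow_mem {h : ℂ} {m : M} (hm : m ∈ wt V M h) (k : ℕ) :
    (nil V M h ^ k) m ∈ wt V M h := by
  induction k with
  | zero => simpa using hm
  | succ k ih => rw [pow_succ', Module.End.mul_apply]; exact nil_mem ih

theorem vir_zero_mem {h : ℂ} {m : M} (hm : m ∈ wt V M h) : vir V M 0 m ∈ wt V M h := by
  have := Submodule.add_mem _ (nil_mem hm) (Submodule.smul_mem _ h hm)
  rwa [nil_apply, sub_add_cancel] at this

/-- Modes of homogeneous vectors commute with the nilpotent part of `L(0)`. -/
theorem nil_md {d : ℕ} {a : V} (ha : a ∈ grade V d) (j : ℤ) (h : ℂ) (m : M) :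
    nil V M (h + (d - j - 1)) (md M a j m) = md M a j (nil V M h m) := by
  have := vir_zero_comm (M := M) ha j m
  rw [nil_apply, nil_apply, map_sub, map_smul, add_smul, ← this]
  abel

theorem nil_pow_md {d : ℕ} {a : V} (ha : a ∈ grade V d) (j : ℤ) (h : ℂ) (k : ℕ) (m : M) :
    (nil V M (h + (d - j - 1)) ^ k) (md M a j m) = md M a j ((nil V M h ^ k) m) := by
  induction k generalizing m with
  | zero => simp
  | succ k ih =>
    rw [pow_succ, Module.End.mul_apply, nil_md ha, ih, pow_succ, Module.End.mul_apply]

theorem md_mem {d : ℕ} {a : V} (ha : a ∈ grade V d) (j : ℤ) {h : ℂ} {m : M} (hm : m ∈ wt V M h) :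
    md M a j m ∈ wt V M (h + (d - j - 1)) := by
  obtain ⟨k, hk⟩ := mem_wt_iff.mp hm
  exact mem_wt_iff.mpr ⟨k, by rw [nil_pow_md ha, hk, map_zero]⟩

theorem md_mem' {d : ℕ} {a : V} (ha : a ∈ grade V d) (j : ℤ) {h h' : ℂ} {m : M}
    (hm : m ∈ wt V M h) (e : h' = h + (d - j - 1)) : md M a j m ∈ wt V M h' :=
  e ▸ md_mem ha j hm

theorem vir_neg_one (V : Type*) [AddCommGroup V] [Module ℂ V] [VertexOperatorAlgebra V]
    (M : Type*) [AddCommGroup M] [Module ℂ M] [VOAModule V M] :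
    vir V M (-1) = md M (VertexOperatorAlgebra.conf : V) 0 := by
  simp [vir]

theorem vir_zero (V : Type*) [AddCommGroup V] [Module ℂ V] [VertexOperatorAlgebra V]
    (M : Type*) [AddCommGroup M] [Module ℂ M] [VOAModule V M] :
    vir V M 0 = md M (VertexOperatorAlgebra.conf : V) 1 := by
  simp [vir]

theorem vir_neg_one_pow_mem {h : ℂ} {m : M} (hm : m ∈ wt V M h) (k : ℕ) :
    (vir V M (-1) ^ k) m ∈ wt V M (h + k) := by
  induction k with
  | zero => simpa using hm
  | succ k ih =>
    rw [pow_succ', Module.End.mul_apply, vir_neg_one V M]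
    rw [vir_neg_one V M] at ih
    exact md_mem' conf_mem 0 ih (by push_cast; ring)

theorem iSup_grade (V : Type*) [AddCommGroup V] [Module ℂ V] [VertexOperatorAlgebra V] :
    ⨆ d, grade V d = ⊤ := by
  have := VertexOperatorAlgebra.semisimple (V := V)
  rw [← this]
  simp [grade, vir, md, VOAModule.mode]

theorem grade_zero (V : Type*) [AddCommGroup V] [Module ℂ V] [VertexOperatorAlgebra V] :
    grade V 0 = Submodule.span ℂ {VertexOperatorAlgebra.vac} := by
  rw [← VertexOperatorAlgebra.cft_type]
  simp [grade, vir, md, VOAModule.mode]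

/-! ### The restricted dual -/

theorem apply_eq_zero_of_mem_wtDual {h h' : ℂ} {u : Module.Dual ℂ M} (hu : u ∈ wtDual V M h)
    {m : M} (hm : m ∈ wt V M h') (hne : h' ≠ h) : u m = 0 :=
  (Submodule.mem_dualAnnihilator u).mp hu m
    ((le_iSup₂_of_le (f := fun h' (_ : h' ≠ h) => wt V M h') h' hne le_rfl) hm)

theorem wtDual_le_resDual (h : ℂ) : wtDual V M h ≤ resDual V M := le_iSup (wtDual V M) h

theorem IsGradedFrom.comp_genProj_mem {Δ : ℂ} (hM : IsGradedFrom V M Δ) (h : ℂ)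
    (f : Module.Dual ℂ ↥(wt V M h)) : f ∘ₗ genProj V M h ∈ wtDual V M h := by
  refine (Submodule.mem_dualAnnihilator _).mpr fun m hm => ?_
  have : (⨆ h' : ℂ, ⨆ _ : h' ≠ h, wt V M h') ≤ LinearMap.ker (genProj V M h) :=
    iSup₂_le fun h' hne m hm => hM.genProj_of_mem_ne hm hne
  rw [LinearMap.comp_apply, this hm, map_zero]

/-- A weight space is finite-dimensional, so finitely many functionals separate its points. -/
theorem IsGradedFrom.exists_functionals {Δ : ℂ} (hM : IsGradedFrom V M Δ) (hV : IsVModule V M)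
    (h : ℂ) : ∃ S : Finset (Module.Dual ℂ M), (∀ u ∈ S, u ∈ wtDual V M h) ∧
      ∀ m, genProj V M h m ≠ 0 → ∃ u ∈ S, u m ≠ 0 := by
  classical
  have := hV.finite h
  let b := Module.finBasis ℂ ↥(wt V M h)
  refine ⟨Finset.univ.image fun i => b.coord i ∘ₗ genProj V M h, ?_, fun m hm => ?_⟩
  · intro u hu
    obtain ⟨i, -, rfl⟩ := Finset.mem_image.mp hu
    exact hM.comp_genProj_mem h _
  · by_contra hc
    push Not at hc
    apply hm
    refine b.ext_elem_iff.mpr fun i => ?_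
    have := hc _ (Finset.mem_image_of_mem _ (Finset.mem_univ i))
    simpa using this

theorem IsGradedFrom.eq_zero_of_genProj {Δ : ℂ} (hM : IsGradedFrom V M Δ) {m : M}
    (h : ∀ h, genProj V M h m = 0) : m = 0 := by
  have hm : m ∈ ⨆ h, wt V M h := by rw [hM.iSup_wt]; trivial
  rw [Submodule.mem_iSup_iff_exists_finsupp] at hm
  obtain ⟨f, hf, rfl⟩ := hm
  refine Finset.sum_eq_zero fun i hi => ?_
  have := h i
  rw [Finsupp.sum, map_sum, Finset.sum_eq_single i] at this
  · rw [← hM.genProj_of_mem (hf i), this]; rfl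
  · intro j _ hj; exact hM.genProj_of_mem_ne (hf j) hj
  · intro h2; simp [Finsupp.notMem_support_iff.mp h2]

theorem IsGradedFrom.eq_zero_of_resDual {Δ : ℂ} (hM : IsGradedFrom V M Δ) (hV : IsVModule V M)
    {m : M} (h : ∀ u ∈ resDual V M, u m = 0) : m = 0 := by
  refine hM.eq_zero_of_genProj fun h' => ?_
  by_contra hc
  obtain ⟨S, hS, hS2⟩ := hM.exists_functionals hV h'
  obtain ⟨u, hu, hum⟩ := hS2 m hc
  exact hum (h u (wtDual_le_resDual h' (hS u hu)))

/-- A functional of lowest weight kills the images of the operators that raise the weight. -/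
theorem IsGradedFrom.wtDual_md {Δ : ℂ} (hM : IsGradedFrom V M Δ) {u : Module.Dual ℂ M}
    (hu : u ∈ wtDual V M Δ) {d : ℕ} {a : V} (ha : a ∈ grade V d) {j : ℤ} (hj : j < (d : ℤ) - 1)
    (m : M) : u (md M a j m) = 0 := by
  have : u ∘ₗ md M a j = 0 := by
    refine hM.hom_ext fun k m hm => ?_
    refine apply_eq_zero_of_mem_wtDual hu (md_mem ha j hm) fun h => ?_
    have h2 : (((k : ℤ) + d - j - 1 : ℤ) : ℂ) = ((0 : ℤ) : ℂ) := by
      push_cast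
      linear_combination h
    have := Int.cast_injective h2
    omega
  exact LinearMap.congr_fun this m

/-! ### `C₁`-cofiniteness -/

/-- The part of `C₁(M)` of weight `Δ + k`. -/
def cOneWt (V : Type*) [AddCommGroup V] [Module ℂ V] [VertexOperatorAlgebra V]
    (M : Type*) [AddCommGroup M] [Module ℂ M] [VOAModule V M] (Δ : ℂ) (k : ℕ) : Submodule ℂ M :=
  Submodule.span ℂ {x | ∃ d : ℕ, 1 ≤ d ∧ ∃ a ∈ grade V d, ∃ j : ℕ, j + d = k ∧
    ∃ m ∈ wt V M (Δ + j), x = md M a (-1) m}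

theorem IsGradedFrom.genProj_cOne {Δ : ℂ} (hM : IsGradedFrom V M Δ) (k : ℕ) {x : M}
    (hx : x ∈ cOne V M) : (genProj V M (Δ + k) x : M) ∈ cOneWt V M Δ k := by
  have : cOne V M ≤ (cOneWt V M Δ k).comap
      ((wt V M (Δ + k)).subtype ∘ₗ genProj V M (Δ + k)) := by
    refine Submodule.span_le.mpr ?_
    rintro x ⟨d, hd, a, ha, m, rfl⟩
    have hm : m ∈ ⨆ k : ℕ, wt V M (Δ + k) := by rw [hM]; trivial
    suffices key : (⨆ k : ℕ, wt V M (Δ + k)) ≤ Submodule.comap (md M a (-1))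
        ((cOneWt V M Δ k).comap ((wt V M (Δ + k)).subtype ∘ₗ genProj V M (Δ + k))) from key hm
    refine iSup_le fun j m hm => ?_
    change ((genProj V M (Δ + k) (md M a (-1) m) : ↥(wt V M (Δ + k))) : M) ∈ cOneWt V M Δ k
    have hmem : md M a (-1) m ∈ wt V M (Δ + ((j + d : ℕ) : ℂ)) :=
      md_mem' ha (-1) hm (by push_cast; ring)
    by_cases e : j + d = k
    · subst e
      rw [hM.genProj_of_mem hmem]
      exact Submodule.subset_span ⟨d, hd, a, ha, j, rfl, m, hm, rfl⟩
    · rw [hM.genProj_of_mem_ne hmem]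
      · exact Submodule.zero_mem _
      · intro h
        apply e
        exact_mod_cast add_left_cancel h
  exact this hx

/-- In a `C₁`-cofinite module, vectors of large weight lie in `C₁(M)`, in a homogeneous way. -/
theorem IsGradedFrom.exists_cOne {Δ : ℂ} (hM : IsGradedFrom V M Δ) (hC : IsCOneCofinite V M) :
    ∃ K : ℕ, ∀ k, K < k → wt V M (Δ + k) ≤ cOneWt V M Δ k := by
  have : FiniteDimensional ℂ (M ⧸ cOne V M) := hC
  -- the images of the sums of the first weight spaces stabilize in the finite-dimensional quotient
  let f : ℕ →o Submodule ℂ (M ⧸ cOne V M) :=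
    ⟨fun K => (⨆ k ∈ Finset.range (K + 1), wt V M (Δ + k)).map (cOne V M).mkQ, fun K L h =>
      Submodule.map_mono (iSup₂_le fun k hk => le_iSup₂_of_le k
        (by simp only [Finset.mem_range] at hk ⊢; omega) le_rfl)⟩
  obtain ⟨K, hK⟩ := monotone_stabilizes_iff_noetherian.mpr
    (inferInstance : IsNoetherian ℂ (M ⧸ cOne V M)) f
  refine ⟨K, fun k hk m hm => ?_⟩
  have h1 : (cOne V M).mkQ m ∈ f k := Submodule.mem_map_of_mem
    ((le_iSup₂_of_le (f := fun (k : ℕ) (_ : k ∈ Finset.range _) => wt V M (Δ + k)) k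
      (Finset.self_mem_range_succ k) le_rfl) hm)
  rw [← hK k hk.le] at h1
  obtain ⟨y, hy, hym⟩ := Submodule.mem_map.mp h1
  -- `m - y ∈ C₁(M)`, and the component of weight `Δ + k` of `m - y` is `m`
  have hy0 : genProj V M (Δ + k) y = 0 := by
    have : (⨆ k ∈ Finset.range (K + 1), wt V M (Δ + k)) ≤
        LinearMap.ker (genProj V M (Δ + k)) := by
      refine iSup₂_le fun j hj m hm => hM.genProj_of_mem_ne hm fun h => ?_
      have : j = k := by exact_mod_cast add_left_cancel h
      simp only [Finset.mem_range] at hj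
      omega
    exact this hy
  have hx : m - y ∈ cOne V M := by
    rw [← Submodule.ker_mkQ (cOne V M), LinearMap.mem_ker, map_sub, hym, sub_self]
  have := hM.genProj_cOne k hx
  rwa [map_sub, hy0, sub_zero, hM.genProj_of_mem hm] at this

/-! ### Generation by raising operators -/

/-- A module generated by its lowest weight space is spanned by the images of this space under
products of operators that raise the weight. -/
theorem IsGradedFrom.eq_top_of_raising {Δ : ℂ} (hM : IsGradedFrom V M Δ)
    (hgen : IsGeneratedBy V M Δ) (W : Submodule ℂ M) (hW : wt V M Δ ≤ W)
    (hr : ∀ (d : ℕ), ∀ a ∈ grade V d, ∀ j : ℤ, j < (d : ℤ) - 1 → ∀ m ∈ W, md M a j m ∈ W) :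
    W = ⊤ := by
  -- `X` is the smallest subspace with these closure properties
  let X : Submodule ℂ M := sInf {Y | wt V M Δ ≤ Y ∧
    ∀ (d : ℕ), ∀ a ∈ grade V d, ∀ j : ℤ, j < (d : ℤ) - 1 → ∀ m ∈ Y, md M a j m ∈ Y}
  have hX1 : wt V M Δ ≤ X := le_sInf fun Y hY => hY.1
  have hX2 : ∀ (d : ℕ), ∀ a ∈ grade V d, ∀ j : ℤ, j < (d : ℤ) - 1 → ∀ m ∈ X, md M a j m ∈ X :=
    fun d a ha j hj m hm => Submodule.mem_sInf.mpr fun Y hY =>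
      hY.2 d a ha j hj m (Submodule.mem_sInf.mp hm Y hY)
  -- `Z` is the part of `X` that all modes map into `X`; by the commutator formula it has the
  -- closure properties of `X`, whence `Z = X` and `X` is a submodule
  let Z : Submodule ℂ M :=
    { carrier := {m | m ∈ X ∧ ∀ (d : ℕ), ∀ a ∈ grade V d, ∀ j : ℤ, md M a j m ∈ X}
      add_mem' := fun {x y} hx hy => ⟨X.add_mem hx.1 hy.1, fun d a ha j => by
        rw [map_add]; exact X.add_mem (hx.2 d a ha j) (hy.2 d a ha j)⟩
      zero_mem' := ⟨X.zero_mem, fun d a ha j => by rw [map_zero]; exact X.zero_mem⟩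
      smul_mem' := fun c x hx => ⟨X.smul_mem c hx.1, fun d a ha j => by
        rw [map_smul]; exact X.smul_mem c (hx.2 d a ha j)⟩ }
  have hZ : X ≤ Z := by
    refine sInf_le ⟨fun m hm => ⟨hX1 hm, fun d a ha j => ?_⟩, fun d b hb j' hj' m hm =>
      ⟨hX2 d b hb j' hj' m hm.1, fun e a ha j => ?_⟩⟩
    · rcases lt_or_ge j (d : ℤ) with hj | hj
      · rcases lt_or_ge j ((d : ℤ) - 1) with hj2 | hj2
        · exact hX2 d a ha j hj2 m (hX1 hm)
        · have : j = (d : ℤ) - 1 := by omega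
          subst this
          exact hX1 (md_mem_wt Δ ha m hm)
      · have := hM.eq_zero_of_lt (j := (d : ℤ) - j - 1) (by omega) (by push_cast; ring)
          (md_mem ha j hm)
        rw [this]; exact X.zero_mem
    · have h := VOAModule.commutator a b j j' m
      rw [sub_eq_iff_eq_add] at h
      change md M a j (md M b j' m) = _ at h
      rw [h]
      refine X.add_mem ?_ (hX2 d b hb j' hj' _ (hm.2 e a ha j))
      refine finsum_induction (· ∈ X) X.zero_mem (fun _ _ => X.add_mem) fun k => X.smul_mem _ ?_
      rcases lt_or_ge ((e : ℤ) + d - k - 1) 0 with hk | hk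
      · have h0 := mode_eq_zero ha hb k hk
        change md M (md V a k b) _ m ∈ X
        rw [h0]
        simp [md]
      · exact hm.2 _ _ (grade_mode ha hb k ((e : ℤ) + d - k - 1).toNat (by omega)) _
  have hXt : X = ⊤ := by
    refine hgen X hX1 fun a n m hm => ?_
    have ha : a ∈ ⨆ d, grade V d := by rw [iSup_grade]; trivial
    refine Submodule.iSup_induction (grade V) (motive := fun a => md M a n m ∈ X) ha
      (fun d a ha => (hZ hm).2 d a ha n) ?_ ?_
    · simp [md]
    · intro a b h1 h2
      have : md M (a + b) n = md M a n + md M b n := by simp [md]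
      rw [this]; exact X.add_mem h1 h2
  rw [eq_top_iff, ← hXt]
  exact sInf_le ⟨hW, hr⟩

end weights

/-! ### Binomial identities -/

theorem choose_trinomial (j : ℤ) (k l : ℕ) :
    Ring.choose j k * Ring.choose (j - k) l = ((k + l).choose k : ℤ) * Ring.choose j (k + l) := by
  have h := Ring.choose_add_smul_choose (j - k) l k
  rw [sub_add_cancel, add_comm l k] at h
  rw [← h, nsmul_eq_mul, mul_comm, Nat.choose_symm_add]

/-- The `A`-th difference of `j ↦ (j choose J)` for `J ≤ A`. -/
theorem alternating_choose_sum (A J : ℕ) (hJ : J ≤ A) (c : ℤ) :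
    ∑ i ∈ Finset.range (A + 1), (-1 : ℤ) ^ i * (A.choose i : ℤ) * Ring.choose ((i : ℤ) + c) J =
      if J = A then (-1) ^ A else 0 := by
  -- an alternating sum of order `A + 1` of `g` is one of order `A` of the difference of `g`
  have key : ∀ (A : ℕ) (g : ℕ → ℤ), ∑ i ∈ Finset.range (A + 1 + 1),
      (-1 : ℤ) ^ i * ((A + 1).choose i : ℤ) * g i =
      -∑ i ∈ Finset.range (A + 1), (-1 : ℤ) ^ i * (A.choose i : ℤ) * (g (i + 1) - g i) := by
    intro A g
    rw [Finset.sum_range_succ']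
    have h2 : ∑ i ∈ Finset.range (A + 1), (-1 : ℤ) ^ i * (A.choose i : ℤ) * g i =
        -∑ i ∈ Finset.range (A + 1), (-1 : ℤ) ^ i * (A.choose (i + 1) : ℤ) * g (i + 1) + g 0 := by
      have := Finset.sum_range_succ' (fun i => (-1 : ℤ) ^ i * (A.choose i : ℤ) * g i) (A + 1)
      rw [Finset.sum_range_succ] at this
      simp only [Nat.choose_succ_self, Nat.cast_zero, mul_zero, zero_mul, add_zero, pow_zero,
        Nat.choose_zero_right, Nat.cast_one, one_mul] at this
      rw [this, ← Finset.sum_neg_distrib]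
      congr 1
      refine Finset.sum_congr rfl fun i _ => ?_
      ring
    simp only [mul_sub, Finset.sum_sub_distrib]
    rw [h2, neg_sub, sub_eq_add_neg, add_right_comm, ← Finset.sum_neg_distrib,
      ← Finset.sum_neg_distrib, ← Finset.sum_add_distrib]
    simp only [pow_zero, Nat.choose_zero_right, Nat.cast_one, one_mul]
    congr 1
    refine Finset.sum_congr rfl fun i _ => ?_
    rw [Nat.choose_succ_succ]; push_cast; ring
  induction A generalizing J c with
  | zero =>
    have : J = 0 := by omega
    subst this
    simp
  | succ A ih =>
    rw [key A (fun i => Ring.choose ((i : ℤ) + c) J)]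
    rcases J with _ | J
    · simp
    · have h2 : ∀ i ∈ Finset.range (A + 1), (-1 : ℤ) ^ i * (A.choose i : ℤ) *
          (Ring.choose (((i + 1 : ℕ) : ℤ) + c) (J + 1) - Ring.choose ((i : ℤ) + c) (J + 1)) =
          (-1 : ℤ) ^ i * (A.choose i : ℤ) * Ring.choose ((i : ℤ) + c) J := by
        intro i _
        have e : ((i + 1 : ℕ) : ℤ) + c = (i : ℤ) + c + 1 := by push_cast; ring
        rw [e, Ring.choose_succ_succ]
        ring
      rw [Finset.sum_congr rfl h2, ih J (by omega) c]
      by_cases e : J = A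
      · subst e; simp [pow_succ]
      · simp [e]

theorem neg_one_zpow_eq_of_even {i j : ℤ} (h : Even (i - j)) : (-1 : ℂ) ^ i = (-1) ^ j := by
  have : i = j + (i - j) := by ring
  rw [this, zpow_add₀ (by norm_num), h.neg_one_zpow, mul_one]

/-- The coefficients of `(z - y)^k` in `z^A (z - x)^{-q}`, expanded in `|x| > |y|`, up to the order
`A`. -/
theorem kernel_coeff (A k l : ℕ) (q : ℤ) (hJ : k + l ≤ A) :
    ∑ i ∈ Finset.range (A + 1), (A.choose i : ℂ) * (((Ring.choose ((i : ℤ) - q) k : ℤ) : ℂ) *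
      ((-1 : ℂ) ^ ((i : ℤ) - q - k) * ((-1 : ℂ) ^ l *
        ((Ring.choose ((i : ℤ) - q - k) l : ℤ) : ℂ)))) =
      if k + l = A then (-1 : ℂ) ^ q * (A.choose k : ℂ) else 0 := by
  -- up to a factor that does not depend on `i`, the product of the two binomial coefficients is
  -- the coefficient `i - q choose k + l`
  have h1 : ∀ i ∈ Finset.range (A + 1),
      (A.choose i : ℂ) * (((Ring.choose ((i : ℤ) - q) k : ℤ) : ℂ) *
      ((-1 : ℂ) ^ ((i : ℤ) - q - k) * ((-1 : ℂ) ^ l *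
        ((Ring.choose ((i : ℤ) - q - k) l : ℤ) : ℂ)))) =
      (-1 : ℂ) ^ (q + k + l) * ((k + l).choose k : ℂ) *
        (((-1 : ℤ) ^ i * (A.choose i : ℤ) * Ring.choose ((i : ℤ) + -q) (k + l) : ℤ) : ℂ) := by
    intro i _
    have h := congrArg (Int.cast (R := ℂ)) (choose_trinomial ((i : ℤ) - q) k l)
    push_cast at h
    have e : (-1 : ℂ) ^ ((i : ℤ) - q - k) = (-1) ^ (q + k) * (-1) ^ i := by
      rw [← zpow_natCast (-1 : ℂ) i, ← zpow_add₀ (by norm_num)]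
      exact neg_one_zpow_eq_of_even ⟨-q - k, by ring⟩
    rw [e, zpow_add₀ (by norm_num : (-1 : ℂ) ≠ 0) (q + k) l, zpow_natCast]
    push_cast
    rw [← sub_eq_add_neg]
    linear_combination (A.choose i : ℂ) * (-1) ^ (q + k) * (-1) ^ i * (-1) ^ l * h
  rw [Finset.sum_congr rfl h1, ← Finset.mul_sum, ← Int.cast_sum, alternating_choose_sum A _ hJ]
  split_ifs with h
  · subst h
    push_cast
    rw [zpow_add₀ (by norm_num), zpow_add₀ (by norm_num), zpow_natCast, zpow_natCast, pow_add]
    have : ∀ i : ℕ, (-1 : ℂ) ^ i * (-1) ^ i = 1 := fun i => by rw [← mul_pow]; norm_num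
    linear_combination (-1 : ℂ) ^ q * ((k + l).choose k : ℂ) * ((-1) ^ l * (-1) ^ l * this k + this l)
  · simp

/-! ### Tensors of homogeneous vectors -/

section tensors

variable {V : Type*} [AddCommGroup V] [Module ℂ V] [VertexOperatorAlgebra V] {n : ℕ}
  {M : Fin (n + 2) → Type*} [∀ i, AddCommGroup (M i)] [∀ i, Module ℂ (M i)]
  [∀ i, VOAModule V (M i)]

/-- All entries of the tuple `m` are homogeneous, with weights `w`. -/
def Homog (V : Type*) [AddCommGroup V] [Module ℂ V] [VertexOperatorAlgebra V] {n : ℕ}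
    {M : Fin (n + 2) → Type*} [∀ i, AddCommGroup (M i)] [∀ i, Module ℂ (M i)]
    [∀ i, VOAModule V (M i)] (w : Fin (n + 2) → ℂ) (m : ∀ i, M i) : Prop :=
  ∀ i, m i ∈ wt V (M i) (w i)

theorem Homog.update {w : Fin (n + 2) → ℂ} {m : ∀ i, M i} (hm : Homog V w m) (p : Fin (n + 2))
    {h : ℂ} {x : M p} (hx : x ∈ wt V (M p) h) :
    Homog V (Function.update w p h) (Function.update m p x) := by
  intro i
  by_cases e : i = p
  · subst e; simpa using hx
  · simpa [e] using hm i

theorem slot_tprod (p : Fin (n + 2)) (f : Module.End ℂ (M p)) (m : ∀ i, M i) :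
    slot p f (PiTensorProduct.tprod ℂ m) =
      PiTensorProduct.tprod ℂ (Function.update m p (f (m p))) := by
  rw [slot, PiTensorProduct.map_tprod]
  congr 1
  funext i
  by_cases e : i = p
  · subst e; simp
  · simp [e]

/-- Linear maps on a tensor product of graded modules are equal if they agree on the tensors of
homogeneous vectors. -/
theorem tensor_hom_ext {Δ : Fin (n + 2) → ℂ} (hΔ : ∀ i, IsGradedFrom V (M i) (Δ i)) {W : Type*}
    [AddCommGroup W] [Module ℂ W] {f g : (⨂[ℂ] i, M i) →ₗ[ℂ] W}
    (h : ∀ (k : Fin (n + 2) → ℕ) (m : ∀ i, M i), Homog V (fun i => Δ i + k i) m →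
      f (PiTensorProduct.tprod ℂ m) = g (PiTensorProduct.tprod ℂ m)) : f = g := by
  -- the entries with index in `s` are arbitrary, the others are homogeneous
  suffices H : ∀ s : Finset (Fin (n + 2)), ∀ m : ∀ i, M i,
      (∀ i, i ∉ s → ∃ k : ℕ, m i ∈ wt V (M i) (Δ i + k)) →
      f (PiTensorProduct.tprod ℂ m) = g (PiTensorProduct.tprod ℂ m) by
    refine PiTensorProduct.ext (MultilinearMap.ext fun m => ?_)
    exact H Finset.univ m fun i hi => absurd (Finset.mem_univ i) hi
  intro s
  induction s using Finset.induction_on with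
  | empty =>
    intro m hm
    choose k hk using fun i => hm i (Finset.notMem_empty i)
    exact h k m hk
  | insert p s hp ih =>
    intro m hm
    have : f ∘ₗ (PiTensorProduct.tprod ℂ).toLinearMap m p =
        g ∘ₗ (PiTensorProduct.tprod ℂ).toLinearMap m p := by
      refine (hΔ p).hom_ext fun k x hx => ?_
      refine ih _ fun i hi => ?_
      by_cases e : i = p
      · subst e; exact ⟨k, by simpa using hx⟩
      · rw [Function.update_of_ne e]
        exact hm i (by simp [e, hi])
    have := LinearMap.congr_fun this (m p)
    simpa using this

theorem tensor_induction {Δ : Fin (n + 2) → ℂ} (hΔ : ∀ i, IsGradedFrom V (M i) (Δ i))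
    (W : Submodule ℂ (⨂[ℂ] i, M i)) (h : ∀ (k : Fin (n + 2) → ℕ) (m : ∀ i, M i),
      Homog V (fun i => Δ i + k i) m → PiTensorProduct.tprod ℂ m ∈ W) (x : ⨂[ℂ] i, M i) :
    x ∈ W := by
  have : W.mkQ = 0 := tensor_hom_ext hΔ fun k m hm => by
    simpa using h k m hm
  rw [← Submodule.ker_mkQ W, LinearMap.mem_ker, this, LinearMap.zero_apply]

end tensors

/-! ### Exponents -/

/-- The exponents of `ζ_1, …, ζ_n` in the monomial `x^T`. -/
def zetaExp {n : ℕ} (T : Fin (n + 1) → ℂ) (i : Fin n) : ℂ :=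
  ∑ l : Fin (n + 1), if i.castSucc < l then T l else 0

theorem sum_zetaShift {n : ℕ} (ν : Fin n → ℂ) : ∑ j, zetaShift ν j = 0 := by
  simp only [zetaShift]
  rw [Finset.sum_comm]
  simp [← Finset.mul_sum]

theorem zetaExp_zetaShift {n : ℕ} (ν : Fin n → ℂ) : zetaExp (zetaShift ν) = ν := by
  funext i
  have h : ∀ l : Fin (n + 1), (if i.castSucc < l then zetaShift ν l else 0) =
      ∑ j : Fin n, ν j * ((if l = j.succ then (if i.castSucc < l then 1 else 0) else 0) -
        (if l = j.castSucc then (if i.castSucc < l then 1 else 0) else 0)) := by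
    intro l
    split_ifs <;> simp [zetaShift]
  rw [zetaExp, Finset.sum_congr rfl fun l _ => h l, Finset.sum_comm]
  simp only [← Finset.mul_sum, Finset.sum_sub_distrib, Finset.sum_ite_eq', Finset.mem_univ, if_true]
  rw [Finset.sum_eq_single i]
  · simp
  · intro j _ hj
    have : (i.castSucc < j.succ) ↔ i.castSucc < j.castSucc := by
      simp only [Fin.lt_def, Fin.val_castSucc, Fin.val_succ]
      have : (i : ℕ) ≠ j := fun h => hj (Fin.ext h.symm)
      omega
    simp [this]
  · simp

theorem zetaExp_add {n : ℕ} (T T' : Fin (n + 1) → ℂ) : zetaExp (T + T') = zetaExp T + zetaExp T' := by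
  funext i
  simp only [zetaExp, Pi.add_apply, ← Finset.sum_add_distrib]
  refine Finset.sum_congr rfl fun l _ => ?_
  split_ifs <;> simp

theorem zetaExp_sub {n : ℕ} (T T' : Fin (n + 1) → ℂ) : zetaExp (T - T') = zetaExp T - zetaExp T' := by
  rw [eq_sub_iff_add_eq, ← zetaExp_add, sub_add_cancel]

theorem leafExp_castSucc {n : ℕ} (p : Fin (n + 1)) (c : ℂ) :
    leafExp p.castSucc c = Pi.single p c := by
  funext i
  by_cases e : i = p
  · subst e; simp [leafExp]
  · simp [leafExp, e]

theorem leafExp_zero {n : ℕ} (p : Fin (n + 2)) : leafExp p 0 = 0 := by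
  funext i; simp [leafExp]

theorem leafExp_add {n : ℕ} (p : Fin (n + 2)) (c d : ℂ) :
    leafExp p (c + d) = leafExp p c + leafExp p d := by
  funext i; simp only [leafExp, Pi.add_apply]; split_ifs <;> simp

theorem sum_leafExp {n : ℕ} {p : Fin (n + 2)} (hp : p ≠ Fin.last (n + 1)) (c : ℂ) :
    ∑ i, leafExp p c i = c := by
  obtain ⟨p, rfl⟩ := Fin.exists_castSucc_eq.mpr hp
  rw [leafExp_castSucc]; simp

theorem zetaExp_leafExp {n : ℕ} {p : Fin (n + 2)} (hp : p ≠ Fin.last (n + 1)) (c : ℂ) (i : Fin n) :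
    zetaExp (leafExp p c) i = if i.castSucc.castSucc < p then c else 0 := by
  obtain ⟨p, rfl⟩ := Fin.exists_castSucc_eq.mpr hp
  rw [leafExp_castSucc, zetaExp, Finset.sum_eq_single p]
  · simp
  · intro j _ hj; simp [hj]
  · simp

/-! ### The expansions of the powers of `z_s - z_p` -/

section expansions

variable {N : ℕ} {W : Type*} [AddCommGroup W] [Module ℂ W]

theorem mulX_smul (c : ℂ) (f : (Fin N → ℂ) → ℂ) (G : LogSeries N W) (t k) :
    mulX (fun s => c * f s) G t k = c • mulX f G t k := by
  simp only [mulX, mul_smul]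
  exact (smul_finsum c _).symm

/-- The product with a series `∑ c_l x^{e_l}` given by an injective family of exponents. -/
theorem mulX_finsum {e : ℕ → Fin N → ℂ} (he : Function.Injective e) (c : ℕ → ℂ) (P : ℕ → Prop)
    [DecidablePred P] (f : (Fin N → ℂ) → ℂ)
    (hf : ∀ s, f s = ∑ᶠ l : ℕ, if s = e l ∧ P l then c l else 0)
    (G : LogSeries N W) (t k) :
    mulX f G t k = ∑ᶠ l : ℕ, (if P l then c l else 0) • G (t - e l) k := by
  have h1 : ∀ l, f (e l) = if P l then c l else 0 := by
    intro l
    rw [hf, finsum_eq_single _ l]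
    · simp
    · intro l' hl'
      rw [if_neg]
      rintro ⟨h, -⟩
      exact hl' (he h).symm
  have h2 : ∀ s, s ∉ Set.range e → f s = 0 := by
    intro s hs
    rw [hf]
    refine finsum_eq_zero_of_forall_eq_zero fun l => if_neg ?_
    rintro ⟨h, -⟩
    exact hs ⟨l, h.symm⟩
  classical
  simp only [← h1]
  rw [← finsum_mem_range (f := fun s => f s • G (t - s) k) he, mulX]
  refine finsum_congr fun s => ?_
  by_cases hs : s ∈ Set.range e
  · rw [finsum_eq_if, if_pos hs]
  · rw [finsum_eq_if, if_neg hs, h2 s hs, zero_smul]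

variable {n : ℕ}

theorem mulX_expPowLT {s p : Fin (n + 2)} (hsp : s < p) (j : ℤ) (G : LogSeries (n + 1) W) (t k) :
    mulX (expPowLT s p j) G t k = ∑ᶠ l : ℕ, (if p = Fin.last (n + 1) → l = 0 then
      (-1 : ℂ) ^ l * ((Ring.choose j l : ℤ) : ℂ) else 0) •
        G (t - (leafExp s ((j : ℂ) - l) + leafExp p l)) k := by
  classical
  refine mulX_finsum (e := fun l : ℕ => leafExp s ((j : ℂ) - l) + leafExp p l) ?_ _ _ _
    (fun s => ?_) G t k
  · obtain ⟨s, rfl⟩ := Fin.exists_castSucc_eq.mpr (ne_of_lt (lt_of_lt_of_le hsp (Fin.le_last p)))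
    intro l l' h
    have := congrFun h s
    have h2 : s.castSucc ≠ p := ne_of_lt hsp
    simpa [leafExp, h2] using this
  · rw [expPowLT]

theorem expPow_of_lt {s p : Fin (n + 2)} (hsp : s < p) (j : ℤ) : expPow s p j = expPowLT s p j := by
  funext t; simp [expPow, hsp]

theorem expPow_of_gt {s p : Fin (n + 2)} (hsp : p < s) (j : ℤ) :
    expPow s p j = fun t => (-1 : ℂ) ^ j * expPowLT p s j t := by
  funext t; simp [expPow, hsp, not_lt_of_gt hsp]

theorem mulX_expPow_self (p : Fin (n + 2)) (j : ℤ) (G : LogSeries (n + 1) W) (t k) :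
    mulX (expPow p p j) G t k = if j = 0 then G t k else 0 := by
  rw [mulX, finsum_eq_single _ 0]
  · by_cases hj : j = 0 <;> simp [expPow, hj]
  · intro s hs
    simp [expPow, hs]

theorem mulX_expPow_gt {s p : Fin (n + 2)} (hsp : p < s) (j : ℤ) (G : LogSeries (n + 1) W) (t k) :
    mulX (expPow s p j) G t k = ∑ᶠ l : ℕ, (if s = Fin.last (n + 1) → l = 0 then
      (-1 : ℂ) ^ j * ((-1 : ℂ) ^ l * ((Ring.choose j l : ℤ) : ℂ)) else 0) •
        G (t - (leafExp p ((j : ℂ) - l) + leafExp s l)) k := by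
  rw [expPow_of_gt hsp, mulX_smul, mulX_expPowLT hsp, smul_finsum]
  refine finsum_congr fun l => ?_
  rw [smul_smul]
  split_ifs <;> simp

theorem mulX_expPow_last {s : Fin (n + 2)} (hs : s < Fin.last (n + 1)) (j : ℤ)
    (G : LogSeries (n + 1) W) (t k) :
    mulX (expPow s (Fin.last (n + 1)) j) G t k = G (t - leafExp s j) k := by
  rw [expPow_of_lt hs, mulX_expPowLT hs, finsum_eq_single _ 0]
  · simp [leafExp_zero]
  · intro l hl
    simp [hl]

theorem mulX_expPow_last' {p : Fin (n + 2)} (hp : p < Fin.last (n + 1)) (j : ℤ)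
    (G : LogSeries (n + 1) W) (t k) :
    mulX (expPow (Fin.last (n + 1)) p j) G t k = (-1 : ℂ) ^ j • G (t - leafExp p j) k := by
  rw [mulX_expPow_gt hp, finsum_eq_single _ 0]
  · simp [leafExp_zero]
  · intro l hl
    simp [hl]

end expansions

/-! ### Convergence and the supports of the series -/

/-- The radii `1` are admissible: if `|ζ_i| < 1` for all `i`, then `|x_1| > |x_2| > ⋯ > 0`. -/
theorem admissible_one (n : ℕ) : Admissible (fun _ : Fin n => (1 : ℝ)) := by
  refine ⟨fun _ => one_pos, fun ζ hζ z x hx => ?_⟩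
  have hne : ∀ i : Fin (n + 2), ∏ e : Fin n, (if (e : ℕ) < i then ζ e else 1) ≠ 0 := by
    refine fun i => Finset.prod_ne_zero_iff.mpr fun e _ => ?_
    split_ifs
    · exact norm_pos_iff.mp (hζ e).1
    · exact one_ne_zero
  have hlt : ∀ i j : Fin (n + 2), i < j → j ≠ Fin.last (n + 1) →
      ‖∏ e : Fin n, (if (e : ℕ) < j then ζ e else 1)‖ <
        ‖∏ e : Fin n, (if (e : ℕ) < i then ζ e else 1)‖ := by
    intro i j hij hj
    have hj' : (j : ℕ) < n + 1 := by
      have := j.2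
      have : (j : ℕ) ≠ n + 1 := fun h => hj (Fin.ext h)
      omega
    have hij' : (i : ℕ) < j := hij
    rw [norm_prod, norm_prod]
    refine Finset.prod_lt_prod (fun e _ => ?_) (fun e _ => ?_) ⟨⟨i, by omega⟩, Finset.mem_univ _, ?_⟩
    · split_ifs
      · exact (hζ e).1
      · simp
    · split_ifs with h1 h2 h2
      · exact le_rfl
      · simpa using (hζ e).2.le
      · omega
      · exact le_rfl
    · simp [hij', (hζ _).2]
  have hne2 : ∀ i j : Fin (n + 2), i < j →
      (if i = Fin.last (n + 1) then z else z + x * ∏ e : Fin n, if (e : ℕ) < i then ζ e else 1) ≠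
      (if j = Fin.last (n + 1) then z else z + x * ∏ e : Fin n, if (e : ℕ) < j then ζ e else 1) := by
    intro i j hij h
    rw [if_neg (ne_of_lt (lt_of_lt_of_le hij (Fin.le_last j)))] at h
    by_cases hj : j = Fin.last (n + 1)
    · rw [if_pos hj] at h
      exact mul_ne_zero hx (hne i) (by simpa using h)
    · rw [if_neg hj] at h
      have h2 := mul_left_cancel₀ hx (add_left_cancel h)
      exact (hlt i j hij hj).ne (by rw [h2])
  intro i j h
  rcases lt_trichotomy i j with hij | hij | hij
  · exact absurd h (hne2 i j hij)
  · exact hij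
  · exact absurd h.symm (hne2 j i hij)

/-- The logarithms of a convergent series are bounded and its exponents lie in finitely many
translates of the exponents of `ℂ[[ζ]]`. -/
theorem convSeries_support {n : ℕ} {G : LogSeries (n + 1) ℂ} (hG : G ∈ convSeries n) :
    ∃ (S : Finset (Fin (n + 1) → ℂ)) (D : ℕ), ∀ t k, G t k ≠ 0 →
      (∃ s ∈ S, ∃ ν : Fin n → ℕ, t = s + zetaShift (fun e => (ν e : ℂ))) ∧ ∀ i, k i ≤ D := by
  classical
  have h := (Submodule.mem_iInf _).mp ((Submodule.mem_iInf _).mp hG fun _ => 1) (admissible_one n)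
  clear hG
  induction h using Submodule.span_induction with
  | mem x hx =>
    obtain ⟨s, κ, f, -, rfl⟩ := hx
    refine ⟨{s}, ∑ i, κ i, fun t k h => ?_⟩
    rw [monoSeries] at h
    split_ifs at h with hk
    · subst hk
      obtain ⟨ν, hν⟩ := not_forall.mp fun h0 => h (finsum_eq_zero_of_forall_eq_zero h0)
      split_ifs at hν with ht
      · exact ⟨⟨s, by simp, ν, ht⟩, fun i => Finset.single_le_sum (f := fun i => k i)
          (fun _ _ => Nat.zero_le _) (Finset.mem_univ i)⟩
      · exact absurd rfl hν
    · exact absurd rfl h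
  | zero => exact ⟨∅, 0, fun t k h => absurd rfl h⟩
  | add x y _ _ hx hy =>
    obtain ⟨S, D, hS⟩ := hx
    obtain ⟨S', D', hS'⟩ := hy
    refine ⟨S ∪ S', max D D', fun t k h => ?_⟩
    by_cases h0 : x t k = 0
    · have : y t k ≠ 0 := fun h1 => h (by simp [h0, h1])
      obtain ⟨⟨s, hs, ν, hν⟩, hk⟩ := hS' t k this
      exact ⟨⟨s, Finset.mem_union_right _ hs, ν, hν⟩, fun i => le_max_of_le_right (hk i)⟩
    · obtain ⟨⟨s, hs, ν, hν⟩, hk⟩ := hS t k h0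
      exact ⟨⟨s, Finset.mem_union_left _ hs, ν, hν⟩, fun i => le_max_of_le_left (hk i)⟩
  | smul c x _ hx =>
    obtain ⟨S, D, hS⟩ := hx
    exact ⟨S, D, fun t k h => hS t k fun h0 => h (by simp [h0])⟩

section pio

variable {V : Type*} [AddCommGroup V] [Module ℂ V] [VertexOperatorAlgebra V] {n : ℕ}
  {M₀ : Type*} [AddCommGroup M₀] [Module ℂ M₀] [VOAModule V M₀]
  {M : Fin (n + 2) → Type*} [∀ i, AddCommGroup (M i)] [∀ i, Module ℂ (M i)]
  [∀ i, VOAModule V (M i)] {F : (⨂[ℂ] i, M i) →ₗ[ℂ] LogSeries (n + 1) M₀}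

/-- The components of `F(x)` in a weight space of `M₀` have bounded logarithms, and exponents in
finitely many translates of the exponents of `ℂ[[ζ]]`, since finitely many functionals detect this
weight space. -/
theorem IsPIO.support (hF : IsPIO V M₀ M F) {Δ' : ℂ} (hΔ' : IsGradedFrom V M₀ Δ')
    (hM₀ : IsVModule V M₀) (h : ℂ) (x : ⨂[ℂ] i, M i) :
    ∃ (S : Finset (Fin (n + 1) → ℂ)) (D : ℕ), ∀ t k, genProj V M₀ h (F x t k) ≠ 0 →
      (∃ s ∈ S, ∃ ν : Fin n → ℕ, t = s + zetaShift (fun e => (ν e : ℂ))) ∧ ∀ i, k i ≤ D := by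
  classical
  obtain ⟨U, hU, hU2⟩ := hΔ'.exists_functionals hM₀ h
  have hc := fun u : U => convSeries_support
    (hF.convergent u.1 (wtDual_le_resDual h (hU u.1 u.2)) x)
  choose S D hSD using hc
  refine ⟨Finset.univ.biUnion S, ∑ u, D u, fun t k hk => ?_⟩
  obtain ⟨u, hu, hne⟩ := hU2 _ hk
  obtain ⟨⟨s, hs, ν, hν⟩, hk⟩ := hSD ⟨u, hu⟩ t k hne
  exact ⟨⟨s, Finset.mem_biUnion.mpr ⟨_, Finset.mem_univ _, hs⟩, ν, hν⟩, fun i => (hk i).trans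
    (Finset.single_le_sum (f := D) (fun _ _ => Nat.zero_le _) (Finset.mem_univ (⟨u, hu⟩ : U)))⟩

/-! ### The Borcherds identity in coordinates -/

theorem IsPIO.borcherds_last (hF : IsPIO V M₀ M F) (a : V) (j : ℤ) (x : ⨂[ℂ] i, M i)
    (t : Fin (n + 1) → ℂ) (l : Fin (n + 1) →₀ ℕ) :
    F (slot (Fin.last (n + 1)) (md _ a j) x) t l = md M₀ a j (F x t l) -
      ∑ s ∈ Finset.univ.erase (Fin.last (n + 1)), ∑ᶠ k : ℕ, ((Ring.choose j k : ℤ) : ℂ) •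
        F (slot s (md (M s) a k) x) (t - leafExp s ((j : ℂ) - k)) l := by
  rw [hF.borcherds]
  congr 1
  · rw [finsum_eq_single _ 0]
    · rw [mulX_expPow_self]; simp
    · intro k hk
      rw [mulX_expPow_self]; simp [hk]
  · refine Finset.sum_congr rfl fun s hs => finsum_congr fun k => ?_
    rw [mulX_expPow_last (lt_of_le_of_ne (Fin.le_last s) (Finset.ne_of_mem_erase hs))]
    push_cast
    rfl

theorem IsPIO.borcherds_lt (hF : IsPIO V M₀ M F) (a : V) (j : ℤ) {p : Fin (n + 2)}
    (hp : p < Fin.last (n + 1)) (x : ⨂[ℂ] i, M i) (t : Fin (n + 1) → ℂ) (l : Fin (n + 1) →₀ ℕ) :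
    F (slot p (md _ a j) x) t l =
      (∑ᶠ k : ℕ, ((Ring.choose j k : ℤ) : ℂ) • (-1 : ℂ) ^ k •
        md M₀ a (j - k) (F x (t - leafExp p k) l)) -
      ((∑ s ∈ Finset.univ.filter (· < p), ∑ᶠ k : ℕ, ((Ring.choose j k : ℤ) : ℂ) • ∑ᶠ i : ℕ,
        ((-1 : ℂ) ^ i * ((Ring.choose (j - k) i : ℤ) : ℂ)) • F (slot s (md (M s) a k) x)
          (t - (leafExp s ((j : ℂ) - k - i) + leafExp p i)) l) +
      ∑ s ∈ Finset.univ.filter (p < ·), ∑ᶠ k : ℕ, ((Ring.choose j k : ℤ) : ℂ) • ∑ᶠ i : ℕ,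
        (if s = Fin.last (n + 1) → i = 0 then
          (-1 : ℂ) ^ (j - k) * ((-1 : ℂ) ^ i * ((Ring.choose (j - k) i : ℤ) : ℂ)) else 0) •
          F (slot s (md (M s) a k) x) (t - (leafExp p ((j : ℂ) - k - i) + leafExp s i)) l) := by
  rw [hF.borcherds]
  congr 1
  · refine finsum_congr fun k => ?_
    rw [mulX_expPow_last' hp]
    simp
  · have e : (Finset.univ.erase p : Finset (Fin (n + 2))) =
        (Finset.univ.filter (· < p)).disjUnion (Finset.univ.filter (p < ·))
          (Finset.disjoint_filter.mpr fun i _ h1 h2 => lt_asymm h1 h2) := by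
      ext i
      simp [lt_or_lt_iff_ne]
    rw [e, Finset.sum_disjUnion]
    congr 1
    · refine Finset.sum_congr rfl fun s hs => finsum_congr fun k => ?_
      have hs' : s < p := by simpa using hs
      rw [expPow_of_lt hs', mulX_expPowLT hs']
      congr 1
      refine finsum_congr fun i => ?_
      rw [if_pos fun h => absurd h hp.ne]
      push_cast
      rfl
    · refine Finset.sum_congr rfl fun s hs => finsum_congr fun k => ?_
      have hs' : p < s := by simpa using hs
      rw [mulX_expPow_gt hs']
      push_cast
      rfl

/-- The Borcherds identity for `L(0) = ω(1)` at the last leaf, in which only `ω(0) = L(-1)` and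
`ω(1) = L(0)` occur, and where `L(-1)` acts as a derivation by `IsPIO.translation`. This is the Euler
equation for the series `F(x)`. -/
theorem IsPIO.euler (hF : IsPIO V M₀ M F) (x : ⨂[ℂ] i, M i) (t : Fin (n + 1) → ℂ)
    (l : Fin (n + 1) →₀ ℕ) :
    vir V M₀ 0 (F x t l) = ∑ p, F (slot p (vir V (M p) 0) x) t l + (∑ i, t i) • F x t l +
      ∑ i, ((l i : ℂ) + 1) • F x t (l + Finsupp.single i 1) := by
  have h := hF.borcherds_last VertexOperatorAlgebra.conf 1 x t l
  have hs : ∀ s ∈ Finset.univ.erase (Fin.last (n + 1)),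
      (∑ᶠ k : ℕ, ((Ring.choose (1 : ℤ) k : ℤ) : ℂ) •
        F (slot s (md (M s) (VertexOperatorAlgebra.conf : V) k) x)
          (t - leafExp s (((1 : ℤ) : ℂ) - k)) l) =
      F (slot s (vir V (M s) 0) x) t l +
        F (slot s (vir V (M s) (-1)) x) (t - leafExp s 1) l := by
    intro s _
    rw [finsum_eq_sum_of_support_subset (s := Finset.range 2)]
    · rw [Finset.sum_range_succ, Finset.sum_range_one, vir_zero, vir_neg_one]
      simp [leafExp_zero, add_comm]
    · intro k hk
      by_contra hk2
      apply hk
      have : ¬ k < 2 := by simpa using hk2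
      have h3 : Ring.choose (1 : ℤ) k = 0 := by
        have := Ring.choose_natCast (R := ℤ) 1 k
        rw [Nat.cast_one] at this
        rw [this, Nat.choose_eq_zero_of_lt (by omega)]; rfl
      simp [h3]
  rw [Finset.sum_congr rfl hs, Finset.sum_add_distrib, ← vir_zero, ← vir_zero] at h
  rw [← Finset.add_sum_erase _ _ (Finset.mem_univ (Fin.last (n + 1))), h]
  have h2 : ∑ s ∈ Finset.univ.erase (Fin.last (n + 1)),
      F (slot s (vir V (M s) (-1)) x) (t - leafExp s 1) l =
      (∑ i, t i) • F x t l + ∑ i, ((l i : ℂ) + 1) • F x t (l + Finsupp.single i 1) := by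
    have h3 := Fin.sum_univ_castSucc (fun s => F (slot s (vir V (M s) (-1)) x) (t - leafExp s 1) l)
    rw [← Finset.add_sum_erase _ _ (Finset.mem_univ (Fin.last (n + 1))), add_comm,
      add_right_cancel_iff] at h3
    rw [h3, Finset.sum_smul, ← Finset.sum_add_distrib]
    refine Finset.sum_congr rfl fun i _ => ?_
    rw [hF.translation, derivX, leafExp_castSucc, sub_add_cancel]
    simp
  rw [h2]
  abel

end pio

section projections

variable {V : Type*} [AddCommGroup V] [Module ℂ V] [VertexOperatorAlgebra V]
  {M : Type*} [AddCommGroup M] [Module ℂ M] [VOAModule V M]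

theorem IsGradedFrom.genProj_vir {Δ : ℂ} (hM : IsGradedFrom V M Δ) (h : ℂ) (m : M) :
    (genProj V M h (vir V M 0 m) : M) = vir V M 0 (genProj V M h m) := by
  have : (wt V M h).subtype ∘ₗ genProj V M h ∘ₗ vir V M 0 =
      vir V M 0 ∘ₗ (wt V M h).subtype ∘ₗ genProj V M h := by
    refine hM.hom_ext fun k m hm => ?_
    by_cases e : Δ + k = h
    · subst e
      simp [hM.genProj_of_mem hm, hM.genProj_of_mem (vir_zero_mem hm)]
    · simp [hM.genProj_of_mem_ne hm e, hM.genProj_of_mem_ne (vir_zero_mem hm) e]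
  exact LinearMap.congr_fun this m

theorem IsGradedFrom.mem_wt_of_genProj {Δ : ℂ} (hM : IsGradedFrom V M Δ) {h : ℂ} {m : M}
    (hm : ∀ h', h' ≠ h → genProj V M h' m = 0) : m ∈ wt V M h := by
  have : m - genProj V M h m = 0 := by
    refine hM.eq_zero_of_genProj fun h' => ?_
    by_cases e : h' = h
    · subst e
      rw [map_sub, sub_eq_zero]
      exact Subtype.ext (hM.genProj_of_mem (genProj V M h' m).2).symm
    · rw [map_sub, hm h' e, hM.genProj_of_mem_ne (genProj V M h m).2 (Ne.symm e), sub_zero]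
  rw [sub_eq_zero.mp this]
  exact (genProj V M h m).2

theorem mem_wt_of_vir {h : ℂ} {m : M} (hm : vir V M 0 m = h • m) : m ∈ wt V M h :=
  mem_wt_iff.mpr ⟨1, by rw [pow_one, nil_apply, hm, sub_self]⟩

end projections

section pio

variable {V : Type*} [AddCommGroup V] [Module ℂ V] [VertexOperatorAlgebra V] {n : ℕ}
  {M₀ : Type*} [AddCommGroup M₀] [Module ℂ M₀] [VOAModule V M₀]
  {M : Fin (n + 2) → Type*} [∀ i, AddCommGroup (M i)] [∀ i, Module ℂ (M i)]
  [∀ i, VOAModule V (M i)] {F : (⨂[ℂ] i, M i) →ₗ[ℂ] LogSeries (n + 1) M₀}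

/-! ### Homogeneity -/

theorem tprod_eq_zero {m : ∀ i, M i} {p : Fin (n + 2)} (h : m p = 0) :
    PiTensorProduct.tprod ℂ m = 0 :=
  MultilinearMap.map_coord_zero _ p h

theorem slot_vir_tprod (w : Fin (n + 2) → ℂ) (p : Fin (n + 2)) (m : ∀ i, M i) :
    slot p (vir V (M p) 0) (PiTensorProduct.tprod ℂ m) =
      PiTensorProduct.tprod ℂ (Function.update m p (nil V (M p) (w p) (m p))) +
        w p • PiTensorProduct.tprod ℂ m := by
  rw [slot_tprod]
  have e : vir V (M p) 0 (m p) = nil V (M p) (w p) (m p) + w p • m p := by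
    rw [nil_apply, sub_add_cancel]
  rw [e, MultilinearMap.map_update_add, MultilinearMap.map_update_smul, Function.update_eq_self]

/-- The Euler equation on tensors of homogeneous vectors. -/
theorem IsPIO.euler_tprod (hF : IsPIO V M₀ M F) (w : Fin (n + 2) → ℂ) (m : ∀ i, M i)
    (t : Fin (n + 1) → ℂ) (l : Fin (n + 1) →₀ ℕ) :
    vir V M₀ 0 (F (PiTensorProduct.tprod ℂ m) t l) =
      ∑ p, F (PiTensorProduct.tprod ℂ (Function.update m p (nil V (M p) (w p) (m p)))) t l +
      (∑ i, w i + ∑ i, t i) • F (PiTensorProduct.tprod ℂ m) t l +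
      ∑ i, ((l i : ℂ) + 1) • F (PiTensorProduct.tprod ℂ m) t (l + Finsupp.single i 1) := by
  rw [hF.euler]
  have : ∀ p, F (slot p (vir V (M p) 0) (PiTensorProduct.tprod ℂ m)) t l =
      F (PiTensorProduct.tprod ℂ (Function.update m p (nil V (M p) (w p) (m p)))) t l +
        w p • F (PiTensorProduct.tprod ℂ m) t l := by
    intro p
    rw [slot_vir_tprod w, map_add, map_smul]
    rfl
  rw [Finset.sum_congr rfl fun p _ => this p, Finset.sum_add_distrib, ← Finset.sum_smul, add_smul]
  abel

/-- The coefficients of `F` on homogeneous vectors are homogeneous. The Euler equation says that `L(0)`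
acts on them by a scalar, up to commuting nilpotent operators. -/
theorem IsPIO.mem_wt (hF : IsPIO V M₀ M F) {Δ' : ℂ} (hΔ' : IsGradedFrom V M₀ Δ')
    (hM₀ : IsVModule V M₀) {w : Fin (n + 2) → ℂ} {m : ∀ i, M i} (hm : Homog V w m)
    (T : Fin (n + 1) → ℂ) (k : Fin (n + 1) →₀ ℕ) :
    F (PiTensorProduct.tprod ℂ m) T k ∈ wt V M₀ (∑ i, w i + ∑ i, T i) := by
  -- `N` is the sum of the nilpotency orders of the entries; in the induction step the terms of the
  -- Euler equation with a nilpotent part of `L(0)` on an entry vanish in weight `h'`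
  suffices H : ∀ (N : ℕ) (e : Fin (n + 2) → ℕ) (m : ∀ i, M i), ∑ i, e i = N →
      (∀ i, (nil V (M i) (w i) ^ e i) (m i) = 0) → ∀ h', h' ≠ ∑ i, w i + ∑ i, T i → ∀ k,
      genProj V M₀ h' (F (PiTensorProduct.tprod ℂ m) T k) = 0 by
    choose e he using fun i => mem_wt_iff.mp (hm i)
    exact hΔ'.mem_wt_of_genProj fun h' hne => H _ e m rfl he h' hne k
  intro N
  induction N with
  | zero =>
    intro e m he hm h' _ k
    have h0 : e 0 = 0 := by
      have := Finset.single_le_sum (f := e) (fun _ _ => Nat.zero_le _) (Finset.mem_univ 0)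
      omega
    have := hm 0
    rw [h0, pow_zero, Module.End.one_apply] at this
    rw [tprod_eq_zero this, map_zero]
    exact map_zero _
  | succ N ih =>
    intro e m he hm h' hne k
    by_cases h0 : ∃ p, e p = 0
    · obtain ⟨p, hp⟩ := h0
      have := hm p
      rw [hp, pow_zero, Module.End.one_apply] at this
      rw [tprod_eq_zero this, map_zero]
      exact map_zero _
    push Not at h0
    have hnil : ∀ p k, genProj V M₀ h' (F (PiTensorProduct.tprod ℂ
        (Function.update m p (nil V (M p) (w p) (m p)))) T k) = 0 := by
      intro p k
      refine ih (Function.update e p (e p - 1)) _ ?_ ?_ h' hne k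
      · have h1 := Finset.add_sum_erase Finset.univ e (Finset.mem_univ p)
        have h2 : ∑ i ∈ Finset.univ.erase p, Function.update e p (e p - 1) i =
            ∑ i ∈ Finset.univ.erase p, e i :=
          Finset.sum_congr rfl fun i hi => Function.update_of_ne (Finset.ne_of_mem_erase hi) _ _
        rw [← Finset.add_sum_erase _ _ (Finset.mem_univ p), Function.update_self, h2]
        have := h0 p
        omega
      · intro i
        by_cases hi : i = p
        · subst hi
          rw [Function.update_self, Function.update_self, ← Module.End.mul_apply, ← pow_succ,
            Nat.sub_add_cancel (Nat.one_le_iff_ne_zero.mpr (h0 i)), hm i]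
        · rw [Function.update_of_ne hi, Function.update_of_ne hi, hm i]
    obtain ⟨S, D, hD⟩ := hF.support hΔ' hM₀ h' (PiTensorProduct.tprod ℂ m)
    -- the powers of the logarithms are bounded, so one may descend on them
    have hdesc : ∀ (b : ℕ) (k : Fin (n + 1) →₀ ℕ), (n + 1) * D < ∑ i, k i + b →
        genProj V M₀ h' (F (PiTensorProduct.tprod ℂ m) T k) = 0 := by
      intro b
      induction b with
      | zero =>
        intro k hk
        by_contra hc
        have := Finset.sum_le_card_nsmul Finset.univ (fun i => k i) D
          fun i _ => (hD T k hc).2 i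
        simp at this
        omega
      | succ b ihb =>
        intro k hk
        have h1 := hF.euler_tprod w m T k
        have h2 := congrArg (fun y => (genProj V M₀ h' y : M₀)) h1
        simp only [hΔ'.genProj_vir, map_add, map_sum, map_smul] at h2
        rw [Finset.sum_eq_zero fun p _ => hnil p k, zero_add] at h2
        have h5 : ∑ i, ((k i : ℂ) + 1) • genProj V M₀ h' (F (PiTensorProduct.tprod ℂ m) T
            (k + Finsupp.single i 1)) = 0 := by
          refine Finset.sum_eq_zero fun i _ => ?_
          rw [ihb, smul_zero]
          simp only [Finsupp.add_apply, Finset.sum_add_distrib, Finsupp.single_apply]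
          simp
          omega
        rw [h5, add_zero] at h2
        -- the component of weight `h'` is an eigenvector with an eigenvalue other than `h'`
        have h3 := mem_wt_of_vir h2
        have h4 := hΔ'.genProj_of_mem_ne h3 (Ne.symm hne)
        rw [← Subtype.val_inj, hΔ'.genProj_of_mem (Subtype.mem _)] at h4
        exact Subtype.ext h4
    exact hdesc ((n + 1) * D + 1) k (by omega)

theorem IsPIO.eq_zero_of_lt (hF : IsPIO V M₀ M F) {Δ' : ℂ} (hΔ' : IsGradedFrom V M₀ Δ')
    (hM₀ : IsVModule V M₀) {w : Fin (n + 2) → ℂ} {m : ∀ i, M i} (hm : Homog V w m)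
    {T : Fin (n + 1) → ℂ} {j : ℤ} (hj : j < 0) (h : ∑ i, w i + ∑ i, T i = Δ' + j)
    (k : Fin (n + 1) →₀ ℕ) : F (PiTensorProduct.tprod ℂ m) T k = 0 :=
  hΔ'.eq_zero_of_lt hj h (hF.mem_wt hΔ' hM₀ hm T k)

theorem finite_bounded {N : ℕ} (D : ℕ) : {k : Fin N →₀ ℕ | ∀ i, k i ≤ D}.Finite :=
  (Set.finite_Icc 0 (Finsupp.equivFunOnFinite.symm fun _ => D)).subset fun _ hk =>
    ⟨fun _ => Nat.zero_le _, fun i => hk i⟩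

theorem IsPIO.finite_support (hF : IsPIO V M₀ M F) {Δ' : ℂ} (hΔ' : IsGradedFrom V M₀ Δ')
    (hM₀ : IsVModule V M₀) {Δ : Fin (n + 2) → ℂ} (hΔ : ∀ i, IsGradedFrom V (M i) (Δ i))
    (x : ⨂[ℂ] i, M i) (T : Fin (n + 1) → ℂ) : {k | F x T k ≠ 0}.Finite := by
  let W : Submodule ℂ (⨂[ℂ] i, M i) :=
    { carrier := {x | {k | F x T k ≠ 0}.Finite}
      add_mem' := fun {x y} hx hy => (hx.union hy).subset fun k hk => by
        by_contra hc
        simp only [Set.mem_union, Set.mem_ofPred_eq, not_or, not_not] at hc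
        exact hk (by rw [map_add]; simp [hc.1, hc.2])
      zero_mem' := by simp
      smul_mem' := fun c x hx => Set.Finite.subset hx fun k hk h0 => hk (by
        rw [map_smul]; simp [h0]) }
  refine tensor_induction hΔ W (fun j m hm => ?_) x
  obtain ⟨S, D, hD⟩ := hF.support hΔ' hM₀ (∑ i, (Δ i + j i) + ∑ i, T i) (PiTensorProduct.tprod ℂ m)
  refine (finite_bounded D).subset fun k hk => (hD T k fun h0 => hk ?_).2
  rw [← hΔ'.genProj_of_mem (hF.mem_wt hΔ' hM₀ hm T k), h0]
  rfl

/-! ### The leading part of the Borcherds identity -/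

/-- The contribution of the `s`-th tensor factor to the action of the zero mode `a(D)`. -/
def zeroTerm (F : (⨂[ℂ] i, M i) →ₗ[ℂ] LogSeries (n + 1) M₀) (a : V) (D : ℕ) (s : Fin (n + 2))
    (x : ⨂[ℂ] i, M i) (T : Fin (n + 1) → ℂ) (l : Fin (n + 1) →₀ ℕ) : M₀ :=
  ∑ k ∈ Finset.range (D + 1), if s = Fin.last (n + 1) → k = D then
    (D.choose k : ℂ) • F (slot s (md (M s) a k) x) (T - leafExp s ((D : ℂ) - k)) l else 0

/-- The residue identity for `z^A x_p^c (z - x_p)^{-q} a(z)`, `q = c + A - D`, when all the terms that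
are not leading vanish. It is the sum over `i` of the Borcherds identities for the modes `a(i - q)` at
`p`, with the coefficients of `z^A = ((z - x_p) + x_p)^A`. What survives of the other points is
their contribution to `a(D)`: on the left of `p` if `c = 0`, on the right of `p` if `A = D`. -/
theorem IsPIO.lead (hF : IsPIO V M₀ M F) (a : V) (D A c : ℕ) (hDA : D ≤ A) {p : Fin (n + 2)}
    (hp : p < Fin.last (n + 1)) (x : ⨂[ℂ] i, M i) (T : Fin (n + 1) → ℂ) (l : Fin (n + 1) →₀ ℕ)
    (H0 : ∀ γ : ℕ, 1 ≤ γ → F x (T - leafExp p γ) l = 0)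
    (H1 : ∀ s < p, ∀ k γ : ℕ, 1 ≤ γ → F (slot s (md (M s) a k) x)
      (T - leafExp p γ - leafExp s ((D : ℂ) - k - γ)) l = 0)
    (H2 : ∀ s, p < s → ∀ k i : ℕ, D < k + i → (s = Fin.last (n + 1) → i = 0) →
      F (slot s (md (M s) a k) x) (T - leafExp p ((D : ℂ) - k - i) - leafExp s i) l = 0) :
    ∑ i ∈ Finset.range (A + 1), (A.choose i : ℂ) •
      F (slot p (md (M p) a ((i : ℤ) - (c + A - D))) x) (T - leafExp p ((c : ℂ) + A - i)) l =
    (if c = 0 then md M₀ a D (F x T l) -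
      ∑ s ∈ Finset.univ.filter (· < p), zeroTerm F a D s x T l else 0) -
    (if A = D then (-1 : ℂ) ^ c • ∑ s ∈ Finset.univ.filter (p < ·), zeroTerm F a D s x T l
      else 0) := by
  set q : ℤ := c + A - D with hq
  have hqc : (q : ℂ) = c + A - D := by rw [hq]; push_cast; ring
  have hle : ∀ i ∈ Finset.range (A + 1), i ≤ A := fun i hi => by
    have := Finset.mem_range.mp hi; omega
  -- the terms with `a` acting on `M₀`
  have e1 : ∀ i ∈ Finset.range (A + 1), (A.choose i : ℂ) • (∑ᶠ k : ℕ,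
      ((Ring.choose ((i : ℤ) - q) k : ℤ) : ℂ) • (-1 : ℂ) ^ k •
        md M₀ a ((i : ℤ) - q - k) (F x (T - leafExp p ((c : ℂ) + A - i) - leafExp p k) l)) =
      if i = A then (if c = 0 then md M₀ a D (F x T l) else 0) else 0 := by
    intro i hi
    have hi := hle i hi
    have hT : ∀ k : ℕ, T - leafExp p ((c : ℂ) + A - i) - leafExp p k =
        T - leafExp p ((c + (A - i) + k : ℕ) : ℂ) := by
      intro k
      rw [sub_sub, ← leafExp_add]
      congr 2
      push_cast [hi]; ring
    simp only [hT]
    by_cases h : i = A ∧ c = 0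
    · obtain ⟨rfl, rfl⟩ := h
      rw [finsum_eq_single _ 0]
      · simp [leafExp_zero, hq]
      · intro k hk
        rw [H0 _ (by omega)]; simp
    · rw [finsum_eq_zero_of_forall_eq_zero]
      · split_ifs with h1 h2
        · exact absurd ⟨h1, h2⟩ h
        · simp
        · simp
      · intro k
        rw [H0 _ (by omega)]; simp
  -- the factors to the left of `p`
  have e2 : ∀ s ∈ Finset.univ.filter (· < p), ∀ i ∈ Finset.range (A + 1), (A.choose i : ℂ) •
      (∑ᶠ k : ℕ, ((Ring.choose ((i : ℤ) - q) k : ℤ) : ℂ) • ∑ᶠ l' : ℕ,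
        ((-1 : ℂ) ^ l' * ((Ring.choose ((i : ℤ) - q - k) l' : ℤ) : ℂ)) •
        F (slot s (md (M s) a k) x) (T - leafExp p ((c : ℂ) + A - i) -
          (leafExp s ((((i : ℤ) - q : ℤ) : ℂ) - k - l') + leafExp p l')) l) =
      if i = A then (if c = 0 then zeroTerm F a D s x T l else 0) else 0 := by
    intro s hs i hi
    have hi := hle i hi
    have hs : s < p := by simpa using hs
    have hT : ∀ k l' : ℕ, T - leafExp p ((c : ℂ) + A - i) -
        (leafExp s ((((i : ℤ) - q : ℤ) : ℂ) - k - l') + leafExp p l') =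
        T - leafExp p ((c + (A - i) + l' : ℕ) : ℂ) -
          leafExp s ((D : ℂ) - k - ((c + (A - i) + l' : ℕ) : ℂ)) := by
      intro k l'
      have e : leafExp p ((c + (A - i) + l' : ℕ) : ℂ) =
          leafExp p ((c : ℂ) + A - i) + leafExp p (l' : ℂ) := by
        rw [← leafExp_add]; congr 1; push_cast [hi]; ring
      rw [e]
      have e2 : (((i : ℤ) - q : ℤ) : ℂ) - k - l' =
          (D : ℂ) - k - ((c + (A - i) + l' : ℕ) : ℂ) := by
        push_cast [hi]; rw [hqc]; ring
      rw [e2]; abel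
    simp only [hT]
    by_cases h : i = A ∧ c = 0
    · obtain ⟨rfl, rfl⟩ := h
      have h1 : ∀ k : ℕ, ((Ring.choose ((i : ℤ) - q) k : ℤ) : ℂ) • (∑ᶠ l' : ℕ,
          ((-1 : ℂ) ^ l' * ((Ring.choose ((i : ℤ) - q - k) l' : ℤ) : ℂ)) •
          F (slot s (md (M s) a k) x) (T - leafExp p ((0 + (i - i) + l' : ℕ) : ℂ) -
            leafExp s ((D : ℂ) - k - ((0 + (i - i) + l' : ℕ) : ℂ))) l) =
          (D.choose k : ℂ) • F (slot s (md (M s) a k) x) (T - leafExp s ((D : ℂ) - k)) l := by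
        intro k
        rw [finsum_eq_single _ 0]
        · have : (i : ℤ) - q = (D : ℤ) := by rw [hq]; push_cast; ring
          rw [this, Ring.choose_natCast]
          simp [leafExp_zero]
        · intro l' hl'
          rw [H1 s hs k _ (by omega), smul_zero]
      rw [finsum_congr h1, finsum_eq_sum_of_support_subset (s := Finset.range (D + 1))]
      · rw [if_pos rfl, if_pos rfl, zeroTerm, Nat.choose_self, Nat.cast_one, one_smul]
        refine Finset.sum_congr rfl fun k _ => ?_
        rw [if_pos fun h => absurd h (lt_trans hs hp).ne]
      · intro k hk
        by_contra hk2
        apply hk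
        change (D.choose k : ℂ) • _ = (0 : M₀)
        rw [Nat.choose_eq_zero_of_lt (by simp at hk2; omega), Nat.cast_zero, zero_smul]
    · rw [finsum_eq_zero_of_forall_eq_zero]
      · split_ifs with h1 h2
        · exact absurd ⟨h1, h2⟩ h
        · simp
        · simp
      · intro k
        rw [finsum_eq_zero_of_forall_eq_zero, smul_zero]
        intro l'
        rw [H1 s hs k _ (by omega), smul_zero]
  -- the factors to the right of `p`
  -- (by `kernel_coeff` the terms with `k + l'` smaller than `D` cancel in the sum over `i`)
  have e3 : ∀ s ∈ Finset.univ.filter (p < ·), ∑ i ∈ Finset.range (A + 1), (A.choose i : ℂ) •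
      (∑ᶠ k : ℕ, ((Ring.choose ((i : ℤ) - q) k : ℤ) : ℂ) • ∑ᶠ l' : ℕ,
        (if s = Fin.last (n + 1) → l' = 0 then (-1 : ℂ) ^ ((i : ℤ) - q - k) *
          ((-1 : ℂ) ^ l' * ((Ring.choose ((i : ℤ) - q - k) l' : ℤ) : ℂ)) else 0) •
        F (slot s (md (M s) a k) x) (T - leafExp p ((c : ℂ) + A - i) -
          (leafExp p ((((i : ℤ) - q : ℤ) : ℂ) - k - l') + leafExp s l')) l) =
      if A = D then (-1 : ℂ) ^ c • zeroTerm F a D s x T l else 0 := by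
    intro s hs
    have hs : p < s := by simpa using hs
    -- the exponents of these coefficients do not depend on `i`
    let g : ℕ → ℕ → M₀ := fun k l' => if s = Fin.last (n + 1) → l' = 0 then
      F (slot s (md (M s) a k) x) (T - leafExp p ((D : ℂ) - k - l') - leafExp s l') l else 0
    have hg : ∀ k l', D < k + l' → g k l' = 0 := by
      intro k l' h
      simp only [g]
      split_ifs with h1
      · exact H2 s hs k l' h h1
      · rfl
    have h1 : ∀ i ∈ Finset.range (A + 1), (A.choose i : ℂ) •
        (∑ᶠ k : ℕ, ((Ring.choose ((i : ℤ) - q) k : ℤ) : ℂ) • ∑ᶠ l' : ℕ,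
        (if s = Fin.last (n + 1) → l' = 0 then (-1 : ℂ) ^ ((i : ℤ) - q - k) *
          ((-1 : ℂ) ^ l' * ((Ring.choose ((i : ℤ) - q - k) l' : ℤ) : ℂ)) else 0) •
        F (slot s (md (M s) a k) x) (T - leafExp p ((c : ℂ) + A - i) -
          (leafExp p ((((i : ℤ) - q : ℤ) : ℂ) - k - l') + leafExp s l')) l) =
        ∑ k ∈ Finset.range (D + 1), ∑ l' ∈ Finset.range (D + 1),
          ((A.choose i : ℂ) * (((Ring.choose ((i : ℤ) - q) k : ℤ) : ℂ) *
          ((-1 : ℂ) ^ ((i : ℤ) - q - k) * ((-1 : ℂ) ^ l' *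
            ((Ring.choose ((i : ℤ) - q - k) l' : ℤ) : ℂ))))) • g k l' := by
      intro i _
      have h2 : ∀ k l' : ℕ, (if s = Fin.last (n + 1) → l' = 0 then (-1 : ℂ) ^ ((i : ℤ) - q - k) *
          ((-1 : ℂ) ^ l' * ((Ring.choose ((i : ℤ) - q - k) l' : ℤ) : ℂ)) else 0) •
          F (slot s (md (M s) a k) x) (T - leafExp p ((c : ℂ) + A - i) -
            (leafExp p ((((i : ℤ) - q : ℤ) : ℂ) - k - l') + leafExp s l')) l =
          ((-1 : ℂ) ^ ((i : ℤ) - q - k) *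
            ((-1 : ℂ) ^ l' * ((Ring.choose ((i : ℤ) - q - k) l' : ℤ) : ℂ))) • g k l' := by
        intro k l'
        simp only [g]
        split_ifs with h3
        · have e : leafExp p ((D : ℂ) - k - l') = leafExp p ((c : ℂ) + A - i) +
              leafExp p ((((i : ℤ) - q : ℤ) : ℂ) - k - l') := by
            rw [← leafExp_add]; congr 1; push_cast; rw [hqc]; ring
          rw [e]
          congr 3
          abel_nf
        · simp
      have h4 : ∀ k : ℕ, ∑ᶠ l' : ℕ, ((-1 : ℂ) ^ ((i : ℤ) - q - k) *
            ((-1 : ℂ) ^ l' * ((Ring.choose ((i : ℤ) - q - k) l' : ℤ) : ℂ))) • g k l' =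
          ∑ l' ∈ Finset.range (D + 1), ((-1 : ℂ) ^ ((i : ℤ) - q - k) *
            ((-1 : ℂ) ^ l' * ((Ring.choose ((i : ℤ) - q - k) l' : ℤ) : ℂ))) • g k l' := by
        intro k
        refine finsum_eq_sum_of_support_subset _ fun l' hl' => ?_
        by_contra hc
        apply hl'
        change _ • g k l' = 0
        rw [hg k l' (by simp at hc; omega), smul_zero]
      rw [finsum_congr fun k => by rw [finsum_congr (h2 k), h4 k],
        finsum_eq_sum_of_support_subset (s := Finset.range (D + 1))]
      · rw [Finset.smul_sum]
        refine Finset.sum_congr rfl fun k _ => ?_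
        rw [smul_smul, Finset.smul_sum]
        refine Finset.sum_congr rfl fun l' _ => ?_
        rw [smul_smul, mul_assoc]
      · intro k hk
        by_contra hc
        apply hk
        change _ • _ = _
        rw [Finset.sum_eq_zero, smul_zero]
        intro l' _
        rw [hg k l' (by simp at hc; omega), smul_zero]
    rw [Finset.sum_congr rfl h1, Finset.sum_comm, ← ite_zero_smul, zeroTerm, Finset.smul_sum]
    refine Finset.sum_congr rfl fun k hk => ?_
    have hk : k ≤ D := by have := Finset.mem_range.mp hk; omega
    rw [Finset.sum_comm, Finset.sum_eq_single (D - k)]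
    · rw [← Finset.sum_smul, kernel_coeff A k (D - k) q (by omega)]
      by_cases hAD : A = D
      · have : q = c := by omega
        rw [if_pos (by omega), if_pos hAD, this, hAD, zpow_natCast, mul_smul]
        congr 1
        simp only [g]
        have e1 : (s = Fin.last (n + 1) → D - k = 0) ↔ (s = Fin.last (n + 1) → k = D) :=
          ⟨fun h h2 => by have := h h2; omega, fun h h2 => by have := h h2; omega⟩
        simp only [e1]
        split_ifs
        · congr 3
          push_cast [hk]
          rw [sub_self, leafExp_zero, sub_zero]
        · simp
      · rw [if_neg (by omega), if_neg hAD, zero_smul, zero_smul]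
    · intro l' hl' hne
      rw [← Finset.sum_smul]
      rcases lt_trichotomy (k + l') D with h | h | h
      · rw [kernel_coeff A k l' q (by omega), if_neg (by omega), zero_smul]
      · exact absurd (by omega) hne
      · rw [hg k l' h, smul_zero]
    · intro h
      exact absurd (Finset.mem_range.mpr (by omega)) h
  rw [Finset.sum_congr rfl fun i _ => by rw [hF.borcherds_lt a _ hp, smul_sub, smul_add,
    Finset.smul_sum, Finset.smul_sum], Finset.sum_sub_distrib, Finset.sum_add_distrib,
    Finset.sum_congr rfl e1, Finset.sum_comm (t := Finset.univ.filter (· < p)),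
    Finset.sum_congr rfl fun s hs => Finset.sum_congr rfl (e2 s hs),
    Finset.sum_comm (t := Finset.univ.filter (p < ·)), Finset.sum_congr rfl e3]
  simp only [Finset.sum_ite_eq', Finset.mem_range, Nat.lt_succ_self, if_true]
  split_ifs <;> simp [Finset.smul_sum, sub_eq_add_neg, add_assoc, add_comm, add_left_comm]

end pio

/-! ### Exponents of the intermediate states -/

/-- The exponents of `ζ` in `x^T` when the `l`-th vector is rescaled by `x_l^{w_l}`: the weights of the
intermediate states. -/
def interExp {n : ℕ} (T : Fin (n + 1) → ℂ) (w : Fin (n + 2) → ℂ) (i : Fin n) : ℂ :=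
  zetaExp T i + ∑ l : Fin (n + 2), if i.castSucc.castSucc < l then w l else 0

theorem sum_update_add {n : ℕ} (w : Fin (n + 2) → ℂ) (s : Fin (n + 2)) (c : ℂ) :
    ∑ l, Function.update w s (w s + c) l = ∑ l, w l + c := by
  rw [← Finset.add_sum_erase _ _ (Finset.mem_univ s), ← Finset.add_sum_erase _ w (Finset.mem_univ s),
    Function.update_self, Finset.sum_congr rfl (g := w) fun i hi =>
      Function.update_of_ne (Finset.ne_of_mem_erase hi) _ _]
  ring

theorem interExp_update {n : ℕ} (T : Fin (n + 1) → ℂ) (w : Fin (n + 2) → ℂ) (s : Fin (n + 2)) (c : ℂ)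
    (i : Fin n) : interExp T (Function.update w s (w s + c)) i =
      interExp T w i + if i.castSucc.castSucc < s then c else 0 := by
  rw [interExp, interExp, add_assoc (zetaExp T i)]
  congr 1
  have := sum_update_add (fun l => if i.castSucc.castSucc < l then w l else 0) s
    (if i.castSucc.castSucc < s then c else 0)
  rw [← this]
  refine Finset.sum_congr rfl fun l _ => ?_
  by_cases e : l = s
  · subst e
    rw [Function.update_self, Function.update_self]
    split_ifs <;> simp
  · rw [Function.update_of_ne e, Function.update_of_ne e]

theorem interExp_sub {n : ℕ} (T T' : Fin (n + 1) → ℂ) (w : Fin (n + 2) → ℂ) (i : Fin n) :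
    interExp (T - T') w i = interExp T w i - zetaExp T' i := by
  rw [interExp, interExp, zetaExp_sub, Pi.sub_apply]; ring

section pio

variable {V : Type*} [AddCommGroup V] [Module ℂ V] [VertexOperatorAlgebra V] {n : ℕ}
  {M₀ : Type*} [AddCommGroup M₀] [Module ℂ M₀] [VOAModule V M₀]
  {M : Fin (n + 2) → Type*} [∀ i, AddCommGroup (M i)] [∀ i, Module ℂ (M i)]
  [∀ i, VOAModule V (M i)] {F : (⨂[ℂ] i, M i) →ₗ[ℂ] LogSeries (n + 1) M₀}

/-- The residue identity on homogeneous vectors. The terms with `a` acting on `M₀` that are not leading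
vanish for reasons of weight; the others are assumed to vanish. Here `e` is the amount by which the
weights of the intermediate states of such a term are smaller than those of the leading terms. At the
last point there is no such drop, but there only the modes `a(k)` with `k > D`, which lower the weight of
`m_r`, have to vanish. -/
theorem IsPIO.lead_homog (hF : IsPIO V M₀ M F) {Δ' : ℂ} (hΔ' : IsGradedFrom V M₀ Δ')
    (hM₀ : IsVModule V M₀) {w : Fin (n + 2) → ℂ} {m : ∀ i, M i} (hm : Homog V w m)
    {T : Fin (n + 1) → ℂ} (hT : ∑ i, w i + ∑ i, T i = Δ') (l : Fin (n + 1) →₀ ℕ)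
    {D : ℕ} {a : V} (A c : ℕ) (hDA : D ≤ A) {p : Fin (n + 2)} (hp : p < Fin.last (n + 1))
    (Hv : ∀ (s : Fin (n + 2)) (k : ℕ) (T' : Fin (n + 1) → ℂ) (e : Fin n → ℕ),
      ∑ i, w i + ∑ i, T' i + ((D : ℂ) - k) = Δ' →
      (∀ i : Fin n, interExp T' w i + (if i.castSucc.castSucc < s then (D : ℂ) - k else 0) + e i =
        interExp T w i) →
      (s ≠ Fin.last (n + 1) ∧ e ≠ 0) ∨ (s = Fin.last (n + 1) ∧ D < k) →
      F (slot s (md (M s) a k) (PiTensorProduct.tprod ℂ m)) T' l = 0) :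
    ∑ i ∈ Finset.range (A + 1), (A.choose i : ℂ) •
      F (slot p (md (M p) a ((i : ℤ) - (c + A - D))) (PiTensorProduct.tprod ℂ m))
        (T - leafExp p ((c : ℂ) + A - i)) l =
    (if c = 0 then md M₀ a D (F (PiTensorProduct.tprod ℂ m) T l) -
      ∑ s ∈ Finset.univ.filter (· < p), zeroTerm F a D s (PiTensorProduct.tprod ℂ m) T l else 0) -
    (if A = D then (-1 : ℂ) ^ c • ∑ s ∈ Finset.univ.filter (p < ·),
      zeroTerm F a D s (PiTensorProduct.tprod ℂ m) T l else 0) := by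
  have hsum : ∀ (s : Fin (n + 2)) (c : ℂ) (T : Fin (n + 1) → ℂ), s ≠ Fin.last (n + 1) ∨ c = 0 →
      ∑ i, (T - leafExp s c) i = ∑ i, T i - c := by
    intro s c T h
    simp only [Pi.sub_apply, Finset.sum_sub_distrib]
    rcases h with h | h
    · rw [sum_leafExp h]
    · subst h; simp [leafExp_zero]
  have hexp : ∀ (s : Fin (n + 2)) (c : ℂ) (T : Fin (n + 1) → ℂ) (i : Fin n),
      s ≠ Fin.last (n + 1) ∨ c = 0 →
      interExp (T - leafExp s c) w i = interExp T w i - if i.castSucc.castSucc < s then c else 0 := by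
    intro s c T i h
    rw [interExp_sub]
    rcases h with h | h
    · rw [zetaExp_leafExp h]
    · subst h; simp [leafExp_zero, zetaExp]
  refine hF.lead a D A c hDA hp _ T l (fun γ hγ => ?_) (fun s hs k γ hγ => ?_)
    fun s hs k i hki hi => ?_
  · refine hF.eq_zero_of_lt hΔ' hM₀ hm (j := -γ) (by omega) ?_ l
    rw [hsum p _ _ (Or.inl hp.ne)]
    push_cast
    linear_combination hT
  -- for `s < p` the weights of the states between `s` and `p` are smaller by `γ`
  · have hsl := (lt_trans hs hp).ne
    refine Hv s k _ (fun i => if i.castSucc.castSucc < p then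
      (if i.castSucc.castSucc < s then 0 else γ) else 0) ?_ (fun i => ?_) (Or.inl ⟨hsl, ?_⟩)
    · rw [hsum s _ _ (Or.inl hsl), hsum p _ _ (Or.inl hp.ne)]
      linear_combination hT
    · rw [hexp s _ _ _ (Or.inl hsl), hexp p _ _ _ (Or.inl hp.ne)]
      by_cases h1 : i.castSucc.castSucc < s
      · simp only [h1, lt_trans h1 hs, if_true]; push_cast; ring
      · by_cases h2 : i.castSucc.castSucc < p <;> simp [h1, h2]
    · intro h
      have hs' : (s : ℕ) < p := hs
      have hp' : (p : ℕ) < n + 1 := hp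
      obtain ⟨i, hi⟩ : ∃ i : Fin n, i.castSucc.castSucc = s := ⟨⟨s, by omega⟩, Fin.ext rfl⟩
      have := congrFun h i
      simp only [hi, hs, lt_irrefl, if_true, if_false, Pi.zero_apply] at this
      omega
  -- for `s > p` the weights of the states between `p` and `s` are smaller by `k + i - D`
  · have hi' : s ≠ Fin.last (n + 1) ∨ (i : ℂ) = 0 := by
      by_cases h : s = Fin.last (n + 1)
      · right; rw [hi h]; simp
      · exact Or.inl h
    refine Hv s k _ (fun j => if j.castSucc.castSucc < s then
      (if j.castSucc.castSucc < p then 0 else k + i - D) else 0) ?_ (fun j => ?_) ?_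
    · rw [hsum s _ _ hi', hsum p _ _ (Or.inl hp.ne)]
      linear_combination hT
    · rw [hexp s _ _ _ hi', hexp p _ _ _ (Or.inl hp.ne)]
      by_cases h1 : j.castSucc.castSucc < p
      · simp only [h1, lt_trans h1 hs, if_true]; push_cast; ring
      · by_cases h2 : j.castSucc.castSucc < s
        · simp only [h1, h2, if_true, if_false]
          rw [Nat.cast_sub hki.le]; push_cast; ring
        · simp [h1, h2]
    · by_cases h : s = Fin.last (n + 1)
      · right
        exact ⟨h, by have := hi h; omega⟩
      · refine Or.inl ⟨h, fun h0 => ?_⟩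
        have hs' : (p : ℕ) < s := hs
        have hs2 : (s : ℕ) ≠ n + 1 := fun h2 => h (Fin.ext h2)
        have := s.2
        obtain ⟨j, hj⟩ : ∃ j : Fin n, j.castSucc.castSucc = p := ⟨⟨p, by omega⟩, Fin.ext rfl⟩
        have := congrFun h0 j
        simp only [hj, hs, lt_irrefl, if_true, if_false, Pi.zero_apply] at this
        omega

/-- The image of a homogeneous tensor under a mode acting on one factor. -/
theorem Homog.md {w : Fin (n + 2) → ℂ} {m : ∀ i, M i} (hm : Homog V w m) {d : ℕ} {a : V}
    (ha : a ∈ grade V d) (s : Fin (n + 2)) (k : ℤ) :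
    Homog V (Function.update w s (w s + (d - k - 1)))
      (Function.update m s (VOA.md (M s) a k (m s))) :=
  hm.update s (md_mem ha k (hm s))

/-- On a finite-dimensional space of vectors `x`, the exponents of the `F(x)` lie in common translates of
the exponents of `ℂ[[ζ]]`. -/
theorem exists_support_of_fg (hF : IsPIO V M₀ M F) {Δ' : ℂ} (hΔ' : IsGradedFrom V M₀ Δ')
    (hM₀ : IsVModule V M₀) {X : Submodule ℂ (⨂[ℂ] i, M i)} (hX : X.FG) (h : ℂ) :
    ∃ S : Finset (Fin (n + 1) → ℂ), ∀ x ∈ X, ∀ t k, genProj V M₀ h (F x t k) ≠ 0 →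
      ∃ s ∈ S, ∃ ν : Fin n → ℕ, t = s + zetaShift (fun e => (ν e : ℂ)) := by
  classical
  obtain ⟨G, rfl⟩ := hX
  choose S D hSD using hF.support hΔ' hM₀ h
  refine ⟨G.biUnion S, fun x hx t k => ?_⟩
  contrapose!
  intro hc
  induction hx using Submodule.span_induction with
  | mem x hx =>
    by_contra h0
    obtain ⟨⟨s, hs, ν, hν⟩, -⟩ := hSD x t k h0
    exact hc s (Finset.mem_biUnion.mpr ⟨x, hx, hs⟩) ν hν
  | zero => rw [map_zero]; exact map_zero _
  | add x y _ _ hx hy =>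
    rw [map_add]
    change genProj V M₀ h (F x t k + F y t k) = 0
    rw [map_add, hx, hy, add_zero]
  | smul c x _ hx =>
    rw [map_smul]
    change genProj V M₀ h (c • F x t k) = 0
    rw [map_smul, hx, smul_zero]

/-- The weights of the intermediate states are bounded below. By `C₁`-cofiniteness every vector is a
combination of vectors of bounded weight and of vectors `a(-1)m`; the residue identity for
`z^{d-1} x_p (z - x_p)^{-1} a(z)` expresses the latter by vectors of smaller total weight without
lowering the weights of the intermediate states. -/
theorem IsPIO.exists_bound (hF : IsPIO V M₀ M F) {Δ' : ℂ} (hΔ' : IsGradedFrom V M₀ Δ')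
    (hM₀ : IsVModule V M₀) {Δ : Fin (n + 2) → ℂ} (hΔ : ∀ i, IsGradedFrom V (M i) (Δ i))
    (hM : ∀ i, IsVModule V (M i)) (hC : ∀ i, IsCOneCofinite V (M i)) :
    ∃ B : Finset (Fin n → ℂ), ∀ (k : Fin (n + 2) → ℕ) (m : ∀ i, M i),
      Homog V (fun i => Δ i + k i) m → ∀ T l, ∑ i, (Δ i + k i) + ∑ i, T i = Δ' →
      F (PiTensorProduct.tprod ℂ m) T l ≠ 0 →
      ∃ b ∈ B, ∃ e : Fin n → ℕ, ∀ i, interExp T (fun i => Δ i + k i) i = b i + e i := by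
  classical
  choose K hK using fun i => (hΔ i).exists_cOne (hC i)
  let U : ∀ i, Submodule ℂ (M i) := fun i => ⨆ k ∈ Finset.range (K i + 1), wt V (M i) (Δ i + k)
  have hU : ∀ i, FiniteDimensional ℂ (U i) := by
    intro i
    have : ∀ k : ℕ, FiniteDimensional ℂ (wt V (M i) (Δ i + k)) := fun k => (hM i).finite _
    have := Submodule.finiteDimensional_finset_sup (Finset.range (K i + 1))
      (fun k : ℕ => wt V (M i) (Δ i + k))
    rwa [Finset.sup_eq_iSup] at this
  -- `S` and `Ks` account for the vectors of bounded weight, on which `F` has bounded exponents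
  obtain ⟨S, hS⟩ := exists_support_of_fg hF hΔ' hM₀
    (X := LinearMap.range (PiTensorProduct.map fun i => (U i).subtype))
    (by rw [LinearMap.range_eq_map]; exact Module.Finite.fg_top.map _) Δ'
  let Ks := Fintype.piFinset fun i => Finset.range (K i + 1)
  refine ⟨(S ×ˢ Ks).image fun x => interExp x.1 fun i => Δ i + x.2 i, ?_⟩
  suffices H : ∀ (N : ℕ) (k : Fin (n + 2) → ℕ), ∑ i, k i = N → ∀ (m : ∀ i, M i),
      Homog V (fun i => Δ i + k i) m → ∀ T l, ∑ i, (Δ i + k i) + ∑ i, T i = Δ' →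
      (∀ b ∈ (S ×ˢ Ks).image (fun x => interExp x.1 fun i => Δ i + (x.2 i : ℂ)), ∀ e : Fin n → ℕ,
        ¬ ∀ i, interExp T (fun i => Δ i + k i) i = b i + e i) →
      F (PiTensorProduct.tprod ℂ m) T l = 0 by
    intro k m hm T l hT h0
    by_contra hc
    push Not at hc
    exact h0 (H _ k rfl m hm T l hT fun b hb e h => by
      obtain ⟨i, hi⟩ := hc b hb e
      exact hi (h i))
  intro N
  induction N using Nat.strong_induction_on with
  | _ N ih =>
  intro k hkN m hm T l hT hB
  by_cases hk : ∀ i, k i ≤ K i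
  · -- vectors of bounded weight
    by_contra h0
    have hx : PiTensorProduct.tprod ℂ m ∈
        LinearMap.range (PiTensorProduct.map fun i => (U i).subtype) := by
      have hmU : ∀ i, m i ∈ U i := fun i =>
        (le_iSup₂_of_le (f := fun k (_ : k ∈ Finset.range (K i + 1)) => wt V (M i) (Δ i + (k : ℂ)))
          (k i) (Finset.mem_range.mpr (Nat.lt_succ_of_le (hk i))) le_rfl) (hm i)
      exact ⟨PiTensorProduct.tprod ℂ fun i => ⟨m i, hmU i⟩, by
        rw [PiTensorProduct.map_tprod]; rfl⟩
    obtain ⟨s, hs, ν, hν⟩ := hS _ hx T l (by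
      intro h1
      have := hF.mem_wt hΔ' hM₀ hm T l
      rw [hT] at this
      have h2 := hΔ'.genProj_of_mem this
      rw [h1] at h2
      exact h0 h2.symm)
    refine hB _ (Finset.mem_image.mpr ⟨(s, k), Finset.mem_product.mpr ⟨hs, ?_⟩, rfl⟩) ν fun i => ?_
    · exact Fintype.mem_piFinset.mpr fun i => Finset.mem_range.mpr (Nat.lt_succ_of_le (hk i))
    · rw [hν]
      simp only [interExp, zetaExp_add, zetaExp_zetaShift, Pi.add_apply]
      ring
  push Not at hk
  obtain ⟨p, hp⟩ := hk
  -- reduction to `m_p = a(-1) m'`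
  have hmem := hK p (k p) hp (hm p)
  suffices hker : cOneWt V (M p) (Δ p) (k p) ≤ LinearMap.ker
      (LinearMap.proj l ∘ₗ LinearMap.proj T ∘ₗ F ∘ₗ
        (PiTensorProduct.tprod ℂ).toLinearMap m p) by
    have := hker hmem
    simpa using this
  refine Submodule.span_le.mpr ?_
  rintro _ ⟨d, hd, a, ha, j, hjd, m', hm', rfl⟩
  change F (PiTensorProduct.tprod ℂ (Function.update m p (md (M p) a (-1) m'))) T l = 0
  obtain ⟨D, rfl⟩ : ∃ D, d = D + 1 := ⟨d - 1, by omega⟩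
  set k1 : Fin (n + 2) → ℕ := Function.update k p j with hk1
  set m1 : ∀ i, M i := Function.update m p m' with hm1
  have hw1 : (fun i => Δ i + (k1 i : ℂ)) = Function.update (fun i => Δ i + (k i : ℂ)) p
      (Δ p + k p + (-((D : ℂ) + 1))) := by
    funext i
    by_cases e : i = p
    · subst e
      simp only [hk1, Function.update_self, ← hjd]; push_cast; ring
    · simp [hk1, e]
  have hm1h : Homog V (fun i => Δ i + (k1 i : ℂ)) m1 := by
    have := hm.update p hm'
    rw [hw1]
    convert this using 2
    rw [← hjd]; push_cast; ring
  have hsum1 : ∑ i, (Δ i + (k1 i : ℂ)) = ∑ i, (Δ i + (k i : ℂ)) - (D + 1) := by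
    have := sum_update_add (fun i => Δ i + (k i : ℂ)) p (-((D : ℂ) + 1))
    rw [← hw1] at this
    rw [this]; ring
  have hsumN : ∑ i, k1 i + (D + 1) = N := by
    rw [← hkN, ← Finset.add_sum_erase _ k1 (Finset.mem_univ p),
      ← Finset.add_sum_erase _ k (Finset.mem_univ p)]
    have h2 : ∑ i ∈ Finset.univ.erase p, k1 i = ∑ i ∈ Finset.univ.erase p, k i :=
      Finset.sum_congr rfl fun i hi => Function.update_of_ne (Finset.ne_of_mem_erase hi) _ _
    rw [h2, hk1, Function.update_self]
    omega
  have hexp1 : ∀ T' (i : Fin n), interExp T' (fun i => Δ i + (k i : ℂ)) i =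
      interExp T' (fun i => Δ i + (k1 i : ℂ)) i +
        if i.castSucc.castSucc < p then (D : ℂ) + 1 else 0 := by
    intro T' i
    rw [hw1, interExp_update _ (fun i => Δ i + (k i : ℂ))]
    split_ifs <;> ring
  have hslot : PiTensorProduct.tprod ℂ (Function.update m p (md (M p) a (-1) m')) =
      slot p (md (M p) a (-1)) (PiTensorProduct.tprod ℂ m1) := by
    rw [slot_tprod, hm1, Function.update_self, Function.update_idem]
  -- the induction hypothesis for the vectors `a(κ)_s m1`
  have claim : ∀ (s : Fin (n + 2)) (κ : ℤ) (T' : Fin (n + 1) → ℂ) (e : Fin n → ℕ), 0 ≤ κ →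
      ∑ i, (Δ i + (k1 i : ℂ)) + ∑ i, T' i + ((D : ℂ) - κ) = Δ' →
      (∀ i : Fin n, interExp T' (fun i => Δ i + (k1 i : ℂ)) i +
        (if i.castSucc.castSucc < s then (D : ℂ) - κ else 0) + e i =
        interExp T (fun i => Δ i + (k i : ℂ)) i) →
      F (slot s (md (M s) a κ) (PiTensorProduct.tprod ℂ m1)) T' l = 0 := by
    intro s κ T' e hκ hT' he
    rw [slot_tprod]
    have hw := hm1h.md ha s κ
    rcases lt_or_ge ((k1 s : ℤ) + D - κ) 0 with hneg | hpos
    · have : md (M s) a κ (m1 s) = 0 := by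
        refine (hΔ s).eq_zero_of_lt hneg ?_ (md_mem ha κ (hm1h s))
        push_cast; ring
      rw [tprod_eq_zero (p := s) (by simpa using this), map_zero]
      rfl
    · have hw2 : (fun i => Δ i + ((Function.update k1 s ((k1 s : ℤ) + D - κ).toNat i : ℕ) : ℂ)) =
          Function.update (fun i => Δ i + (k1 i : ℂ)) s (Δ s + k1 s + ((D : ℂ) - κ)) := by
        funext i
        by_cases e : i = s
        · subst e
          have : (((((k1 i : ℤ) + D - κ).toNat : ℕ) : ℤ) : ℂ) = (((k1 i : ℤ) + D - κ : ℤ) : ℂ) := by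
            rw [Int.toNat_of_nonneg hpos]
          simp only [Function.update_self]
          push_cast at this
          rw [this]; ring
        · simp [e]
      refine ih (∑ i, Function.update k1 s ((k1 s : ℤ) + D - κ).toNat i) ?_ _ rfl _ ?_ T' l ?_ ?_
      · rw [← Finset.add_sum_erase _ _ (Finset.mem_univ s)]
        have h2 : ∑ i ∈ Finset.univ.erase s, Function.update k1 s ((k1 s : ℤ) + D - κ).toNat i =
            ∑ i ∈ Finset.univ.erase s, k1 i :=
          Finset.sum_congr rfl fun i hi => Function.update_of_ne (Finset.ne_of_mem_erase hi) _ _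
        have h3 := Finset.add_sum_erase _ k1 (Finset.mem_univ s)
        rw [h2, Function.update_self]
        omega
      · rw [hw2]
        convert hw using 2
        push_cast; ring
      · rw [hw2, sum_update_add (fun i => Δ i + (k1 i : ℂ))]
        linear_combination hT'
      · intro b hb e' h
        refine hB b hb (fun i => e' i + e i) fun i => ?_
        have h1 := h i
        rw [hw2, interExp_update _ (fun i => Δ i + (k1 i : ℂ))] at h1
        rw [← he i, h1]
        push_cast; ring
  rw [hslot]
  by_cases hpl : p = Fin.last (n + 1)
  -- at the last point the Borcherds identity for `a(-1)` suffices: the term with `a` acting on `M₀`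
  -- vanishes for reasons of weight, and the others by induction
  · subst hpl
    rw [hF.borcherds_last, hF.eq_zero_of_lt hΔ' hM₀ hm1h (j := -((D : ℤ) + 1)) (by omega)
      (by push_cast; rw [hsum1]; linear_combination hT), map_zero, zero_sub, neg_eq_zero]
    refine Finset.sum_eq_zero fun s hs => finsum_eq_zero_of_forall_eq_zero fun κ => ?_
    have hs := Finset.ne_of_mem_erase hs
    rw [claim s κ _ (fun i => if i.castSucc.castSucc < s then 0 else D + 1) (by omega), smul_zero]
    · rw [hsum1]
      simp only [Pi.sub_apply, Finset.sum_sub_distrib]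
      rw [sum_leafExp hs]
      push_cast
      linear_combination hT
    · intro i
      rw [interExp_sub, zetaExp_leafExp hs, hexp1]
      have : i.castSucc.castSucc < Fin.last (n + 1) := Fin.castSucc_lt_last _
      rw [if_pos this]
      split_ifs <;> · push_cast; ring
  -- at the other points the term with `a(-1)` is the one with `i = 0` of the residue identity for
  -- `A = D`, `c = 1`; all the others vanish by induction
  · have hpl' : p < Fin.last (n + 1) := lt_of_le_of_ne (Fin.le_last p) hpl
    have hT0 : ∑ i, (T + leafExp p ((D : ℂ) + 1)) i = ∑ i, T i + (D + 1) := by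
      simp only [Pi.add_apply, Finset.sum_add_distrib]
      rw [sum_leafExp hpl]
    have hexp0 : ∀ i, interExp (T + leafExp p ((D : ℂ) + 1)) (fun i => Δ i + (k1 i : ℂ)) i =
        interExp T (fun i => Δ i + (k i : ℂ)) i := by
      intro i
      rw [hexp1, interExp, interExp, zetaExp_add, Pi.add_apply, zetaExp_leafExp hpl]
      ring
    have hlead := hF.lead_homog hΔ' hM₀ hm1h (T := T + leafExp p ((D : ℂ) + 1))
      (by rw [hT0, hsum1]; linear_combination hT) l (D := D) (a := a) D 1 le_rfl hpl'
      (fun s κ T' e h1 h2 _ => claim s κ T' e (by omega) h1 fun i => by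
        rw [← hexp0]; exact h2 i)
    have hz : ∀ s, p < s → zeroTerm F a D s (PiTensorProduct.tprod ℂ m1)
        (T + leafExp p ((D : ℂ) + 1)) l = 0 := by
      intro s _
      refine Finset.sum_eq_zero fun κ hκ => ?_
      split_ifs with h
      · have hs : s ≠ Fin.last (n + 1) ∨ (D : ℂ) - κ = 0 := by
          by_cases e : s = Fin.last (n + 1)
          · right; rw [h e, sub_self]
          · exact Or.inl e
        rw [claim s κ _ 0 (by omega), smul_zero]
        · simp only [Pi.sub_apply, Finset.sum_sub_distrib]
          rw [hT0, hsum1]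
          rcases hs with hs | hs
          · rw [sum_leafExp hs]; push_cast; linear_combination hT
          · rw [hs, leafExp_zero]; simp only [Pi.zero_apply, Finset.sum_const_zero]
            push_cast
            linear_combination hT + hs
        · intro i
          rw [interExp_sub, hexp0]
          rcases hs with hs | hs
          · rw [zetaExp_leafExp hs]
            split_ifs <;> simp
          · rw [hs, leafExp_zero]
            simp [zetaExp, hs]
      · rfl
    rw [if_neg one_ne_zero, if_pos rfl, Finset.sum_eq_zero (s := Finset.univ.filter (p < ·))
      (fun s hs => hz s (by simpa using hs)), smul_zero, sub_zero, Finset.sum_range_succ',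
      Finset.sum_eq_zero, zero_add, Nat.choose_zero_right, Nat.cast_one, one_smul] at hlead
    · convert hlead using 3
      · push_cast; congr 1; ring_nf
      · push_cast
        have : (1 : ℂ) + D - 0 = D + 1 := by ring
        rw [this, add_sub_cancel_right]
    · intro i hi
      have hi : i < D := Finset.mem_range.mp hi
      rw [claim p _ _ 0 (by push_cast; omega), smul_zero]
      · simp only [Pi.sub_apply, Finset.sum_sub_distrib]
        rw [hT0, hsum1, sum_leafExp hpl]
        push_cast; linear_combination hT
      · intro j
        rw [interExp_sub, hexp0, zetaExp_leafExp hpl]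
        split_ifs
        · simp only [Pi.zero_apply, Nat.cast_zero]; push_cast; ring
        · simp

end pio

/-! ### The substitution `x_p = z_p - z_r` -/

section toZ

variable {n : ℕ} {W : Type*} [AddCommGroup W] [Module ℂ W]

/-- For every exponent only finitely many powers of logarithms occur, so that the substitution
`x_p = z_p - z_r` involves only finite sums. -/
def FinLog {N : ℕ} (G : LogSeries N W) : Prop := ∀ T, {k | G T k ≠ 0}.Finite

/-- The coefficient of `∏ᵢ z_i^{s_i-j_i} (log z_i)^{l_i} z_r^{j_i}` in the expansion of
`∏ᵢ x_i^{s_i} (log x_i)^{k_i}`, where `x_i = z_i - z_r`. -/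
def toZCoeff (s : Fin (n + 1) → ℂ) (j : Fin (n + 1) → ℕ) (l : Fin (n + 2) →₀ ℕ)
    (k : Fin (n + 1) →₀ ℕ) : ℂ :=
  ∏ i, ((k i).choose (l i.castSucc) : ℂ) *
    (if l i.castSucc ≤ k i then shiftCoeff (s i) (k i - l i.castSucc) (j i) else 0)

open Classical in
theorem toZ_def (G : LogSeries (n + 1) W) (t : Fin (n + 2) → ℂ)
    (l : Fin (n + 2) →₀ ℕ) : toZ G t l = ∑ᶠ j : Fin (n + 1) → ℕ,
    if l (Fin.last (n + 1)) = 0 ∧ t (Fin.last (n + 1)) = ∑ i, (j i : ℂ) then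
      ∑ᶠ k : Fin (n + 1) →₀ ℕ, toZCoeff (fun i => t i.castSucc + j i) j l k •
        G (fun i => t i.castSucc + j i) k else 0 := rfl

theorem finite_sum_eq (c : ℂ) : {j : Fin (n + 1) → ℕ | c = ∑ i, (j i : ℂ)}.Finite := by
  by_cases h : ∃ j0 : Fin (n + 1) → ℕ, c = ∑ i, (j0 i : ℂ)
  · obtain ⟨j0, rfl⟩ := h
    refine (Set.finite_Icc 0 (fun _ => ∑ i, j0 i)).subset fun j hj => ⟨fun _ => Nat.zero_le _,
      fun i => ?_⟩
    have : ∑ i, j0 i = ∑ i, j i := by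
      have : ∑ i, (j0 i : ℂ) = ∑ i, (j i : ℂ) := hj
      exact_mod_cast this
    rw [this]
    exact Finset.single_le_sum (f := j) (fun _ _ => Nat.zero_le _) (Finset.mem_univ i)
  · refine Set.finite_empty.subset fun j hj => h ⟨j, hj⟩

open Classical in
theorem toZ_finite (G : LogSeries (n + 1) W) (t : Fin (n + 2) → ℂ) (l : Fin (n + 2) →₀ ℕ) :
     (Function.support fun j : Fin (n + 1) → ℕ =>
    if l (Fin.last (n + 1)) = 0 ∧ t (Fin.last (n + 1)) = ∑ i, (j i : ℂ) then
      ∑ᶠ k : Fin (n + 1) →₀ ℕ, toZCoeff (fun i => t i.castSucc + j i) j l k •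
        G (fun i => t i.castSucc + j i) k else 0).Finite := by
  refine (finite_sum_eq (t (Fin.last (n + 1)))).subset fun j hj => ?_
  by_contra h
  exact hj (if_neg fun h2 => h h2.2)

theorem toZ_finite' {G : LogSeries (n + 1) W} (hG : FinLog G) (T) (c : (Fin (n + 1) →₀ ℕ) → ℂ) :
    (Function.support fun k => c k • G T k).Finite :=
  (hG T).subset fun k hk h => hk (by simp [h])

theorem toZ_add {G G' : LogSeries (n + 1) W} (hG : FinLog G) (hG' : FinLog G') (t l) :
    toZ (G + G') t l = toZ G t l + toZ G' t l := by
  classical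
  rw [toZ_def, toZ_def, toZ_def, ← finsum_add_distrib (toZ_finite G t l) (toZ_finite G' t l)]
  refine finsum_congr fun j => ?_
  split_ifs
  · rw [← finsum_add_distrib (toZ_finite' hG _ _) (toZ_finite' hG' _ _)]
    refine finsum_congr fun k => ?_
    rw [← smul_add]; rfl
  · rw [add_zero]

theorem map_toZ {W' : Type*} [AddCommGroup W'] [Module ℂ W'] (f : W →ₗ[ℂ] W')
    {G : LogSeries (n + 1) W} (hG : FinLog G) (t l) :
    f (toZ G t l) = toZ (fun T k => f (G T k)) t l := by
  classical
  rw [toZ_def, toZ_def]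
  have := f.toAddMonoidHom.map_finsum (toZ_finite G t l)
  refine this.trans (finsum_congr fun j => ?_)
  split_ifs
  · have := f.toAddMonoidHom.map_finsum (toZ_finite' hG (fun i => t i.castSucc + j i)
      (toZCoeff (fun i => t i.castSucc + j i) j l))
    refine this.trans (finsum_congr fun k => ?_)
    exact map_smul f _ _
  · exact map_zero f

theorem toZ_smul (c : ℂ) {G : LogSeries (n + 1) W} (hG : FinLog G) (t l) :
    toZ (c • G) t l = c • toZ G t l :=
  (map_toZ (LinearMap.lsmul ℂ W c) hG t l).symm

theorem toZ_zero (t l) : toZ (0 : LogSeries (n + 1) W) t l = 0 := by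
  classical
  rw [toZ_def]
  refine finsum_eq_zero_of_forall_eq_zero fun j => ?_
  split_ifs
  · exact finsum_eq_zero_of_forall_eq_zero fun k => smul_zero _
  · rfl

omit [Module ℂ W] in
theorem FinLog.zero {N : ℕ} : FinLog (0 : LogSeries N W) := fun T => by
  refine Set.finite_empty.subset fun k hk => hk rfl

omit [Module ℂ W] in
theorem FinLog.add {N : ℕ} {G G' : LogSeries N W} (hG : FinLog G) (hG' : FinLog G') :
    FinLog (G + G') := fun T => ((hG T).union (hG' T)).subset fun k hk => by
  by_contra hc
  simp only [Set.mem_union, Set.mem_ofPred_eq, not_or, not_not] at hc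
  exact hk (by simp [hc.1, hc.2])

omit [Module ℂ W] in
theorem FinLog.sum {N : ℕ} {ι : Type*} (s : Finset ι) {G : ι → LogSeries N W}
    (hG : ∀ i ∈ s, FinLog (G i)) : FinLog (∑ i ∈ s, G i) := by
  classical
  induction s using Finset.induction_on with
  | empty => exact FinLog.zero
  | insert a s ha ih =>
    rw [Finset.sum_insert ha]
    exact (hG a (Finset.mem_insert_self a s)).add (ih fun i hi => hG i (Finset.mem_insert_of_mem hi))

theorem toZ_sum {ι : Type*} (s : Finset ι) {G : ι → LogSeries (n + 1) W}
    (hG : ∀ i ∈ s, FinLog (G i)) (t l) : toZ (∑ i ∈ s, G i) t l = ∑ i ∈ s, toZ (G i) t l := by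
  classical
  induction s using Finset.induction_on with
  | empty => exact toZ_zero t l
  | insert a s ha ih =>
    rw [Finset.sum_insert ha, Finset.sum_insert ha, toZ_add (hG a (Finset.mem_insert_self a s))
      (FinLog.sum s fun i hi => hG i (Finset.mem_insert_of_mem hi)),
      ih fun i hi => hG i (Finset.mem_insert_of_mem hi)]

/-- Only the coefficients of the same total degree enter. -/
theorem toZ_congr {G G' : LogSeries (n + 1) W} {t : Fin (n + 2) → ℂ}
    (h : ∀ T, ∑ i, T i = ∑ i, t i → G T = G' T) (l) : toZ G t l = toZ G' t l := by
  classical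
  rw [toZ_def, toZ_def]
  refine finsum_congr fun j => ?_
  split_ifs with hj
  · rw [h]
    rw [Fin.sum_univ_castSucc t, hj.2, Finset.sum_add_distrib]
  · rfl

theorem toZ_mem (S : Submodule ℂ W) {G : LogSeries (n + 1) W} {t : Fin (n + 2) → ℂ}
    (h : ∀ T, ∑ i, T i = ∑ i, t i → ∀ k, G T k ∈ S) (l) : toZ G t l ∈ S := by
  classical
  rw [toZ_def]
  refine finsum_induction (· ∈ S) S.zero_mem (fun _ _ => S.add_mem) fun j => ?_
  split_ifs with hj
  · refine finsum_induction (· ∈ S) S.zero_mem (fun _ _ => S.add_mem) fun k => S.smul_mem _ (h _ ?_ k)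
    rw [Fin.sum_univ_castSucc t, hj.2, Finset.sum_add_distrib]
  · exact S.zero_mem

theorem exists_of_toZ_ne_zero {G : LogSeries (n + 1) W} {t l} (h : toZ G t l ≠ 0) :
    ∃ (j : Fin (n + 1) → ℕ) (k : Fin (n + 1) →₀ ℕ), l (Fin.last (n + 1)) = 0 ∧
      t (Fin.last (n + 1)) = ∑ i, (j i : ℂ) ∧ (∀ i, l i.castSucc ≤ k i) ∧
      G (fun i => t i.castSucc + j i) k ≠ 0 := by
  classical
  rw [toZ_def] at h
  obtain ⟨j, hj⟩ := not_forall.mp fun h0 => h (finsum_eq_zero_of_forall_eq_zero h0)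
  split_ifs at hj with h1
  · obtain ⟨k, hk⟩ := not_forall.mp fun h0 => hj (finsum_eq_zero_of_forall_eq_zero h0)
    refine ⟨j, k, h1.1, h1.2, fun i => ?_, fun h0 => hk (by rw [h0, smul_zero])⟩
    by_contra hc
    apply hk
    rw [toZCoeff, Finset.prod_eq_zero (Finset.mem_univ i), zero_smul]
    rw [if_neg hc, mul_zero]
  · exact absurd rfl hj

theorem shiftCoeff_zero (s : ℂ) (q : ℕ) : shiftCoeff s q 0 = if q = 0 then 1 else 0 := by
  rw [shiftCoeff, PowerSeries.coeff_zero_eq_constantCoeff_apply, map_mul, map_pow,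
    ← PowerSeries.coeff_zero_eq_constantCoeff_apply, ← PowerSeries.coeff_zero_eq_constantCoeff_apply,
    PowerSeries.coeff_mk, PowerSeries.coeff_mk]
  by_cases h : q = 0 <;> simp [h]

/-- The terms of degree `0` in `z_r` are those of the original series. -/
theorem toZ_last_zero (G : LogSeries (n + 1) W) {t : Fin (n + 2) → ℂ} (ht : t (Fin.last (n + 1)) = 0)
    {l : Fin (n + 2) →₀ ℕ} (hl : l (Fin.last (n + 1)) = 0) :
    toZ G t l = G (fun i => t i.castSucc) (Finsupp.equivFunOnFinite.symm fun i => l i.castSucc) := by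
  classical
  rw [toZ_def, finsum_eq_single _ 0]
  · rw [if_pos ⟨hl, by simp [ht]⟩, finsum_eq_single _ (Finsupp.equivFunOnFinite.symm
      fun i => l i.castSucc)]
    · rw [toZCoeff, Finset.prod_eq_one, one_smul]
      · simp
      · intro i _
        simp [shiftCoeff_zero]
    · intro k hk
      obtain ⟨i, hi⟩ : ∃ i, k i ≠ l i.castSucc := by
        by_contra hc
        push Not at hc
        exact hk (Finsupp.ext fun i => by simp [hc i])
      rw [toZCoeff, Finset.prod_eq_zero (Finset.mem_univ i), zero_smul]
      rw [Pi.zero_apply, shiftCoeff_zero]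
      split_ifs with h1 h2
      · omega
      · rw [mul_zero]
      · rw [mul_zero]
  · intro j hj
    refine if_neg fun h => hj ?_
    have h2 : ∑ i, (j i : ℂ) = 0 := by rw [← h.2, ht]
    have h3 : ∑ i, j i = 0 := by exact_mod_cast h2
    funext i
    exact Finset.sum_eq_zero_iff.mp h3 i (Finset.mem_univ i)

/-- The derivative with respect to `log x_i`, for constant `x`. -/
def logDeriv {N : ℕ} (i : Fin N) (G : LogSeries N W) : LogSeries N W := fun T k =>
  ((k i : ℂ) + 1) • G T (k + Finsupp.single i 1)

theorem FinLog.logDeriv {N : ℕ} {G : LogSeries N W} (hG : FinLog G) (i : Fin N) :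
    FinLog (logDeriv i G) := fun T =>
  ((hG T).preimage (f := fun k => k + Finsupp.single i 1)
    ((add_left_injective (Finsupp.single i 1)).injOn)).subset fun k hk h0 => hk (by
      change _ • G T (k + Finsupp.single i 1) = 0
      rw [h0, smul_zero])

theorem toZ_logDeriv_last (G : LogSeries (n + 1) W) (t : Fin (n + 2) → ℂ)
    (l : Fin (n + 2) →₀ ℕ) :
    logDeriv (Fin.last (n + 1)) (toZ G) t l = 0 := by
  rw [logDeriv]
  by_contra h
  obtain ⟨-, -, h1, -⟩ := exists_of_toZ_ne_zero (right_ne_zero_of_smul h)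
  simp at h1

/-- The substitution commutes with the derivatives with respect to the logarithms. -/
theorem toZ_logDeriv (i : Fin (n + 1)) (G : LogSeries (n + 1) W) (t : Fin (n + 2) → ℂ)
    (l : Fin (n + 2) →₀ ℕ) :
    logDeriv i.castSucc (toZ G) t l = toZ (logDeriv i G) t l := by
  classical
  rw [logDeriv, toZ_def, toZ_def, smul_finsum]
  refine finsum_congr fun j => ?_
  have hl : (l + Finsupp.single i.castSucc 1 : Fin (n + 2) →₀ ℕ) (Fin.last (n + 1)) = l (Fin.last (n + 1)) := by
    simp [(Fin.castSucc_lt_last i).ne]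
  rw [hl]
  split_ifs with hj
  · rw [smul_finsum]
    set T : Fin (n + 1) → ℂ := fun i => t i.castSucc + j i
    have h1 : ∀ k, toZCoeff T j l k • logDeriv i G T k = (fun k' =>
        ((l i.castSucc : ℂ) + 1) • toZCoeff T j (l + Finsupp.single i.castSucc 1) k' • G T k')
          (k + Finsupp.single i 1) := by
      intro k
      simp only [logDeriv, smul_smul]
      congr 1
      simp only [toZCoeff]
      rw [← Finset.mul_prod_erase _ _ (Finset.mem_univ i),
        ← Finset.mul_prod_erase _ _ (Finset.mem_univ i)]
      have h2 : ∀ i' ∈ Finset.univ.erase i,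
          (((k + Finsupp.single i 1 : Fin (n + 1) →₀ ℕ) i').choose
            ((l + Finsupp.single i.castSucc 1 : Fin (n + 2) →₀ ℕ) i'.castSucc) : ℂ) *
            (if (l + Finsupp.single i.castSucc 1 : Fin (n + 2) →₀ ℕ) i'.castSucc ≤
                (k + Finsupp.single i 1 : Fin (n + 1) →₀ ℕ) i' then
              shiftCoeff (T i') ((k + Finsupp.single i 1 : Fin (n + 1) →₀ ℕ) i' -
                (l + Finsupp.single i.castSucc 1 : Fin (n + 2) →₀ ℕ) i'.castSucc) (j i') else 0) =
          ((k i').choose (l i'.castSucc) : ℂ) *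
            (if l i'.castSucc ≤ k i' then shiftCoeff (T i') (k i' - l i'.castSucc) (j i') else 0) := by
        intro i' hi'
        have := Finset.ne_of_mem_erase hi'
        simp [this.symm]
      rw [Finset.prod_congr rfl h2]
      have h3 : (k + Finsupp.single i 1 : Fin (n + 1) →₀ ℕ) i = k i + 1 := by simp
      have h4 : (l + Finsupp.single i.castSucc 1 : Fin (n + 2) →₀ ℕ) i.castSucc = l i.castSucc + 1 := by simp
      rw [h3, h4, Nat.add_sub_add_right]
      simp only [Nat.add_le_add_iff_right]
      have h5 : ((k i : ℂ) + 1) * ((k i).choose (l i.castSucc) : ℂ) =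
          ((k i + 1).choose (l i.castSucc + 1) : ℂ) * ((l i.castSucc : ℂ) + 1) := by
        exact_mod_cast Nat.add_one_mul_choose_eq (k i) (l i.castSucc)
      linear_combination (if l i.castSucc ≤ k i then shiftCoeff (T i) (k i - l i.castSucc) (j i)
        else 0) * (∏ x ∈ Finset.univ.erase i, ((k x).choose (l x.castSucc) : ℂ) *
          (if l x.castSucc ≤ k x then shiftCoeff (T x) (k x - l x.castSucc) (j x) else 0)) * h5
    -- the terms that the index shift misses have no `log x_i` and do not contribute
    rw [finsum_congr h1, ← finsum_mem_range (f := fun k' =>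
        ((l i.castSucc : ℂ) + 1) • toZCoeff T j (l + Finsupp.single i.castSucc 1) k' • G T k')
        (add_left_injective (Finsupp.single i 1))]
    refine finsum_congr fun k => ?_
    rw [finsum_eq_if]
    split_ifs with hk
    · rfl
    · have hk0 : k i = 0 := by
        by_contra h0
        refine hk ⟨k - Finsupp.single i 1, tsub_add_cancel_of_le ?_⟩
        exact Finsupp.single_le_iff.mpr (Nat.one_le_iff_ne_zero.mpr h0)
      rw [toZCoeff, Finset.prod_eq_zero (Finset.mem_univ i), zero_smul, smul_zero]
      rw [if_neg, mul_zero]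
      simp [hk0]
  · rw [smul_zero]

end toZ

/-! ### Sums over antidiagonals -/

section antidiagonal

variable {σ : Type*} [DecidableEq σ] {W : Type*} [AddCommGroup W] [Module ℂ W]

theorem antidiagonal_sum_fst (f : (σ →₀ ℕ) → (σ →₀ ℕ) → W) (i : σ) (l : σ →₀ ℕ) :
    ∑ x ∈ Finset.HasAntidiagonal.antidiagonal (l + Finsupp.single i 1 : σ →₀ ℕ), (x.1 i : ℂ) • f x.1 x.2 =
      ∑ x ∈ Finset.HasAntidiagonal.antidiagonal l,
        ((x.1 i : ℂ) + 1) • f (x.1 + Finsupp.single i 1) x.2 := by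
  symm
  refine Finset.sum_of_injOn (fun x => (x.1 + Finsupp.single i 1, x.2)) ?_ ?_ ?_ ?_
  · intro x _ y _ h
    simp only [Prod.mk.injEq] at h
    exact Prod.ext (add_right_cancel h.1) h.2
  · intro x hx
    simp only [Finset.mem_coe, Finset.HasAntidiagonal.mem_antidiagonal] at hx ⊢
    rw [← hx]; abel
  · intro x hx hx2
    have h0 : x.1 i = 0 := by
      by_contra h0
      refine hx2 ⟨(x.1 - Finsupp.single i 1, x.2), ?_, ?_⟩
      · simp only [Finset.mem_coe, Finset.HasAntidiagonal.mem_antidiagonal] at hx ⊢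
        have : x.1 - Finsupp.single i 1 + Finsupp.single i 1 = x.1 := tsub_add_cancel_of_le
          (Finsupp.single_le_iff.mpr (Nat.one_le_iff_ne_zero.mpr h0))
        rw [← this] at hx
        refine add_right_cancel (b := Finsupp.single i 1) ?_
        rw [← hx]; exact add_right_comm _ _ _
      · exact Prod.ext (tsub_add_cancel_of_le
          (Finsupp.single_le_iff.mpr (Nat.one_le_iff_ne_zero.mpr h0))) rfl
    rw [h0, Nat.cast_zero, zero_smul]
  · intro x _
    simp

theorem antidiagonal_sum_snd (f : (σ →₀ ℕ) → (σ →₀ ℕ) → W) (i : σ) (l : σ →₀ ℕ) :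
    ∑ x ∈ Finset.HasAntidiagonal.antidiagonal (l + Finsupp.single i 1 : σ →₀ ℕ), (x.2 i : ℂ) • f x.1 x.2 =
      ∑ x ∈ Finset.HasAntidiagonal.antidiagonal l,
        ((x.2 i : ℂ) + 1) • f x.1 (x.2 + Finsupp.single i 1) := by
  have h := antidiagonal_sum_fst (fun a b => f b a) i l
  refine (Finsupp.sum_antidiagonal_swap _ fun a b => (b i : ℂ) • f a b).trans (h.trans ?_)
  exact Finsupp.sum_antidiagonal_swap _ fun a b => ((a i : ℂ) + 1) • f b (a + Finsupp.single i 1)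

/-- The product rule for products of series in the logarithms. -/
theorem antidiagonal_deriv (f : (σ →₀ ℕ) → (σ →₀ ℕ) → W) (i : σ) (l : σ →₀ ℕ) :
    ((l i : ℂ) + 1) • ∑ x ∈ Finset.HasAntidiagonal.antidiagonal (l + Finsupp.single i 1 : σ →₀ ℕ), f x.1 x.2 =
      ∑ x ∈ Finset.HasAntidiagonal.antidiagonal l,
        (((x.1 i : ℂ) + 1) • f (x.1 + Finsupp.single i 1) x.2 +
          ((x.2 i : ℂ) + 1) • f x.1 (x.2 + Finsupp.single i 1)) := by
  rw [Finset.sum_add_distrib, ← antidiagonal_sum_fst, ← antidiagonal_sum_snd,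
    ← Finset.sum_add_distrib, Finset.smul_sum]
  refine Finset.sum_congr rfl fun x hx => ?_
  rw [← add_smul]
  congr 1
  have := DFunLike.congr_fun (Finset.HasAntidiagonal.mem_antidiagonal.mp hx) i
  simp only [Finsupp.add_apply, Finsupp.single_eq_same] at this
  exact_mod_cast this.symm

end antidiagonal

/-! ### The modified series on homogeneous vectors -/

section powL0

variable {V : Type*} [AddCommGroup V] [Module ℂ V] [VertexOperatorAlgebra V]
  {M : Type*} [AddCommGroup M] [Module ℂ M] [VOAModule V M]

theorem powL0_apply (h : ℂ) (k : ℕ) (m : M) :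
    powL0 V M h k m = ((k.factorial : ℂ)⁻¹) • (nil V M h ^ k) (genProj V M h m) := rfl

theorem powL0_mem (h : ℂ) (k : ℕ) (m : M) : powL0 V M h k m ∈ wt V M h :=
  Submodule.smul_mem _ _ (nil_pow_mem (genProj V M h m).2 k)

theorem IsGradedFrom.powL0_of_mem {Δ : ℂ} (hM : IsGradedFrom V M Δ) {h : ℂ} {m : M}
    (hm : m ∈ wt V M h) (k : ℕ) :
    powL0 V M h k m = ((k.factorial : ℂ)⁻¹) • (nil V M h ^ k) m := by
  rw [powL0_apply, hM.genProj_of_mem hm]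

theorem IsGradedFrom.powL0_of_mem_ne {Δ : ℂ} (hM : IsGradedFrom V M Δ) {h h' : ℂ} {m : M}
    (hm : m ∈ wt V M h') (hne : h' ≠ h) (k : ℕ) : powL0 V M h k m = 0 := by
  rw [powL0_apply, hM.genProj_of_mem_ne hm hne, ZeroMemClass.coe_zero, map_zero, smul_zero]

end powL0

section unwrap

variable {V : Type*} [AddCommGroup V] [Module ℂ V] [VertexOperatorAlgebra V] {n : ℕ}
  {M₀ : Type*} [AddCommGroup M₀] [Module ℂ M₀] [VOAModule V M₀]
  {M : Fin (n + 2) → Type*} [∀ i, AddCommGroup (M i)] [∀ i, Module ℂ (M i)]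
  [∀ i, VOAModule V (M i)] {F : (⨂[ℂ] i, M i) →ₗ[ℂ] LogSeries (n + 1) M₀}

/-- The coefficient of `∏ᵢ z_i^{w_i} (log z_i)^{k_i}` in `z_1^{L(0)}m_1 ⊗ ⋯ ⊗ z_r^{L(0)}m_r`, for
`m_i` of weight `w_i`. -/
def npow (V : Type*) [AddCommGroup V] [Module ℂ V] [VertexOperatorAlgebra V] {n : ℕ}
    {M : Fin (n + 2) → Type*} [∀ i, AddCommGroup (M i)] [∀ i, Module ℂ (M i)]
    [∀ i, VOAModule V (M i)] (w : Fin (n + 2) → ℂ) (m : ∀ i, M i) (k : Fin (n + 2) →₀ ℕ) (i) : M i :=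
  (((k i).factorial : ℂ)⁻¹) • (nil V (M i) (w i) ^ k i) (m i)

theorem Homog.npow {w : Fin (n + 2) → ℂ} {m : ∀ i, M i} (hm : Homog V w m)
    (k : Fin (n + 2) →₀ ℕ) : Homog V w (npow V w m k) := fun i =>
  Submodule.smul_mem _ _ (nil_pow_mem (hm i) _)

theorem npow_zero (w : Fin (n + 2) → ℂ) (m : ∀ i, M i) : npow V w m 0 = m := by
  funext i
  simp [npow]

theorem IsPIO.finLog (hF : IsPIO V M₀ M F) {Δ' : ℂ} (hΔ' : IsGradedFrom V M₀ Δ')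
    (hM₀ : IsVModule V M₀) {Δ : Fin (n + 2) → ℂ} (hΔ : ∀ i, IsGradedFrom V (M i) (Δ i))
    (x : ⨂[ℂ] i, M i) : FinLog (F x) :=
  fun T => hF.finite_support hΔ' hM₀ hΔ x T

theorem IsPIO.toZ_mem_wt (hF : IsPIO V M₀ M F) {Δ' : ℂ} (hΔ' : IsGradedFrom V M₀ Δ')
    (hM₀ : IsVModule V M₀) {w : Fin (n + 2) → ℂ} {m : ∀ i, M i} (hm : Homog V w m)
    (t : Fin (n + 2) → ℂ) (l : Fin (n + 2) →₀ ℕ) :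
    toZ (F (PiTensorProduct.tprod ℂ m)) t l ∈ wt V M₀ (∑ i, w i + ∑ i, t i) :=
  toZ_mem _ (fun T hT k => hT ▸ hF.mem_wt hΔ' hM₀ hm T k) l

theorem sum_sub_single {N : ℕ} (t : Fin N → ℂ) (p : Fin N) (c : ℂ) :
    ∑ i, (t - Pi.single p c : Fin N → ℂ) i = ∑ i, t i - c := by
  simp [Finset.sum_sub_distrib]

theorem IsPIO.toZ_shift_mem_wt (hF : IsPIO V M₀ M F) {Δ' : ℂ} (hΔ' : IsGradedFrom V M₀ Δ')
    (hM₀ : IsVModule V M₀) {w : Fin (n + 2) → ℂ} {m : ∀ i, M i} (hm : Homog V w m)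
    (t : Fin (n + 2) → ℂ) (l : Fin (n + 2) →₀ ℕ) (k : ℕ) :
    toZ (F (PiTensorProduct.tprod ℂ m)) (t - Pi.single (Fin.last (n + 1)) (k : ℂ)) l ∈
      wt V M₀ (∑ i, w i + ∑ i, t i - k) := by
  have h := hF.toZ_mem_wt hΔ' hM₀ hm (t - Pi.single (Fin.last (n + 1)) (k : ℂ)) l
  rwa [sum_sub_single, ← add_sub_assoc] at h

/-- On vectors of weight `Δ'`, the factor `exp(L(-1)z_r)` drops out. -/
theorem IsPIO.tildeF_tprod (hF : IsPIO V M₀ M F) {Δ' : ℂ} (hΔ' : IsGradedFrom V M₀ Δ')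
    (hM₀ : IsVModule V M₀) {w : Fin (n + 2) → ℂ} {m : ∀ i, M i} (hm : Homog V w m)
    {t : Fin (n + 2) → ℂ} (ht : ∑ i, w i + ∑ i, t i = Δ') (l : Fin (n + 2) →₀ ℕ) :
    tildeF V (F (PiTensorProduct.tprod ℂ m)) t l = toZ (F (PiTensorProduct.tprod ℂ m)) t l := by
  rw [tildeF, finsum_eq_single _ 0]
  · simp
  · intro k hk
    have h := hF.toZ_shift_mem_wt hΔ' hM₀ hm t l k
    have h0 := hΔ'.eq_zero_of_lt (j := -(k : ℤ)) (by omega) (by rw [ht]; push_cast; ring) h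
    rw [h0, map_zero, smul_zero]

theorem IsPIO.tildeF_mem_wt (hF : IsPIO V M₀ M F) {Δ' : ℂ} (hΔ' : IsGradedFrom V M₀ Δ')
    (hM₀ : IsVModule V M₀) {w : Fin (n + 2) → ℂ} {m : ∀ i, M i} (hm : Homog V w m)
    (t : Fin (n + 2) → ℂ) (l : Fin (n + 2) →₀ ℕ) :
    tildeF V (F (PiTensorProduct.tprod ℂ m)) t l ∈ wt V M₀ (∑ i, w i + ∑ i, t i) := by
  rw [tildeF]
  refine finsum_induction (· ∈ wt V M₀ (∑ i, w i + ∑ i, t i)) (Submodule.zero_mem _)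
    (fun _ _ => Submodule.add_mem _) fun k => Submodule.smul_mem _ _ ?_
  have h := vir_neg_one_pow_mem (hF.toZ_shift_mem_wt hΔ' hM₀ hm t l k) k
  rwa [sub_add_cancel] at h

theorem tildeF_zero (t : Fin (n + 2) → ℂ) (l : Fin (n + 2) →₀ ℕ) :
    tildeF V (0 : LogSeries (n + 1) M₀) t l = 0 := by
  rw [tildeF]
  refine finsum_eq_zero_of_forall_eq_zero fun k => ?_
  rw [toZ_zero, map_zero, smul_zero]

theorem map_powL0_tprod {Δ : Fin (n + 2) → ℂ} (hΔ : ∀ i, IsGradedFrom V (M i) (Δ i))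
    {w : Fin (n + 2) → ℂ} {m : ∀ i, M i} (hm : Homog V w m) (k : Fin (n + 2) →₀ ℕ) :
    PiTensorProduct.map (fun i => powL0 V (M i) (w i) (k i)) (PiTensorProduct.tprod ℂ m) =
      PiTensorProduct.tprod ℂ (npow V w m k) := by
  rw [PiTensorProduct.map_tprod]
  congr 1
  funext i
  exact (hΔ i).powL0_of_mem (hm i) _

theorem map_powL0_tprod_ne {Δ : Fin (n + 2) → ℂ} (hΔ : ∀ i, IsGradedFrom V (M i) (Δ i))
    {w h : Fin (n + 2) → ℂ} (hne : h ≠ w) {m : ∀ i, M i} (hm : Homog V w m)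
    (k : Fin (n + 2) →₀ ℕ) :
    PiTensorProduct.map (fun i => powL0 V (M i) (h i) (k i)) (PiTensorProduct.tprod ℂ m) = 0 := by
  obtain ⟨i, hi⟩ := Function.ne_iff.mp hne
  rw [PiTensorProduct.map_tprod]
  exact tprod_eq_zero ((hΔ i).powL0_of_mem_ne (hm i) hi.symm _)

theorem tildeFL0_tprod {Δ : Fin (n + 2) → ℂ} (hΔ : ∀ i, IsGradedFrom V (M i) (Δ i))
    {w : Fin (n + 2) → ℂ} {m : ∀ i, M i} (hm : Homog V w m)
    (t : Fin (n + 2) → ℂ) (l : Fin (n + 2) →₀ ℕ) :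
    tildeFL0 V F (PiTensorProduct.tprod ℂ m) t l =
      ∑ k ∈ Finset.HasAntidiagonal.antidiagonal l,
        tildeF V (F (PiTensorProduct.tprod ℂ (npow V w m k.1))) (t - w) k.2 := by
  rw [tildeFL0, finsum_eq_single _ w]
  · refine Finset.sum_congr rfl fun k _ => ?_
    rw [map_powL0_tprod hΔ hm]
  · intro h hne
    refine Finset.sum_eq_zero fun k _ => ?_
    rw [map_powL0_tprod_ne hΔ hne hm, map_zero, tildeF_zero]

/-- The coefficients of `F̃(z_1^{L(0)}m_1 ⊗ ⋯ ⊗ z_r^{L(0)}m_r)` of weight `Δ'`. -/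
def twistZ (V : Type*) [AddCommGroup V] [Module ℂ V] [VertexOperatorAlgebra V] {n : ℕ}
    {M₀ : Type*} [AddCommGroup M₀] [Module ℂ M₀]
    {M : Fin (n + 2) → Type*} [∀ i, AddCommGroup (M i)] [∀ i, Module ℂ (M i)]
    [∀ i, VOAModule V (M i)] (F : (⨂[ℂ] i, M i) →ₗ[ℂ] LogSeries (n + 1) M₀)
    (w : Fin (n + 2) → ℂ) (m : ∀ i, M i) : LogSeries (n + 2) M₀ := fun t l =>
  ∑ k ∈ Finset.HasAntidiagonal.antidiagonal l,
    toZ (F (PiTensorProduct.tprod ℂ (npow V w m k.1))) (t - w) k.2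

theorem sum_add_single_sub (t w : Fin (n + 2) → ℂ) (c : ℂ) :
    ∑ i, w i + ∑ i, (t + Pi.single 0 c - w : Fin (n + 2) → ℂ) i = ∑ i, t i + c := by
  simp [Finset.sum_sub_distrib, Finset.sum_add_distrib]

theorem IsPIO.twistZ_mem_wt (hF : IsPIO V M₀ M F) {Δ' : ℂ} (hΔ' : IsGradedFrom V M₀ Δ')
    (hM₀ : IsVModule V M₀) {w : Fin (n + 2) → ℂ} {m : ∀ i, M i} (hm : Homog V w m)
    {t : Fin (n + 2) → ℂ} (ht : ∑ i, t i = 0) (l : Fin (n + 2) →₀ ℕ) :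
    twistZ V F w m (t + Pi.single 0 Δ') l ∈ wt V M₀ Δ' := by
  refine Submodule.sum_mem _ fun k _ => ?_
  have := hF.toZ_mem_wt hΔ' hM₀ (hm.npow k.1) (t + Pi.single 0 Δ' - w) k.2
  rwa [sum_add_single_sub, ht, zero_add] at this

theorem IsPIO.barFz_tprod (hF : IsPIO V M₀ M F) {Δ' : ℂ} (hΔ' : IsGradedFrom V M₀ Δ')
    (hM₀ : IsVModule V M₀) {Δ : Fin (n + 2) → ℂ} (hΔ : ∀ i, IsGradedFrom V (M i) (Δ i))
    {w : Fin (n + 2) → ℂ} {m : ∀ i, M i} (hm : Homog V w m)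
    {t : Fin (n + 2) → ℂ} (ht : ∑ i, t i = 0) (l : Fin (n + 2) →₀ ℕ) :
    barFz V Δ' F (PiTensorProduct.tprod ℂ m) t l =
      ∑ k ∈ Finset.range (l 0 + 1), ((-1 : ℂ) ^ k * ((k.factorial : ℂ)⁻¹)) •
        (nil V M₀ Δ' ^ k) (twistZ V F w m (t + Pi.single 0 Δ') (l - Finsupp.single 0 k)) := by
  rw [barFz]
  refine Finset.sum_congr rfl fun k _ => ?_
  have e : tildeFL0 V F (PiTensorProduct.tprod ℂ m) (t + Pi.single 0 Δ') (l - Finsupp.single 0 k) =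
      twistZ V F w m (t + Pi.single 0 Δ') (l - Finsupp.single 0 k) := by
    rw [tildeFL0_tprod hΔ hm]
    refine Finset.sum_congr rfl fun k _ => ?_
    refine hF.tildeF_tprod hΔ' hM₀ (hm.npow k.1) ?_ _
    rw [sum_add_single_sub, ht, zero_add]
  rw [e, hΔ'.powL0_of_mem (hF.twistZ_mem_wt hΔ' hM₀ hm ht _), smul_smul]

theorem IsPIO.barFz_tprod_of_ne (hF : IsPIO V M₀ M F) {Δ' : ℂ} (hΔ' : IsGradedFrom V M₀ Δ')
    (hM₀ : IsVModule V M₀) {Δ : Fin (n + 2) → ℂ} (hΔ : ∀ i, IsGradedFrom V (M i) (Δ i))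
    {w : Fin (n + 2) → ℂ} {m : ∀ i, M i} (hm : Homog V w m)
    {t : Fin (n + 2) → ℂ} (ht : ∑ i, t i ≠ 0) (l : Fin (n + 2) →₀ ℕ) :
    barFz V Δ' F (PiTensorProduct.tprod ℂ m) t l = 0 := by
  rw [barFz]
  refine Finset.sum_eq_zero fun k _ => ?_
  rw [hΔ'.powL0_of_mem_ne (h' := ∑ i, t i + Δ') ?_ (fun h => ht (by simpa using h)), smul_zero]
  rw [tildeFL0_tprod hΔ hm]
  refine Submodule.sum_mem _ fun k _ => ?_
  have := hF.tildeF_mem_wt hΔ' hM₀ (hm.npow k.1) (t + Pi.single 0 Δ' - w) k.2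
  rwa [sum_add_single_sub] at this

/-! ### Linearity of the modified series -/

theorem IsPIO.finite_tilde (hF : IsPIO V M₀ M F) {Δ' : ℂ} (hΔ' : IsGradedFrom V M₀ Δ')
    (hM₀ : IsVModule V M₀) {Δ : Fin (n + 2) → ℂ} (hΔ : ∀ i, IsGradedFrom V (M i) (Δ i))
    (x : ⨂[ℂ] i, M i) (t : Fin (n + 2) → ℂ) (l : Fin (n + 2) →₀ ℕ) :
    {k : ℕ | toZ (F x) (t - Pi.single (Fin.last (n + 1)) (k : ℂ)) l ≠ 0}.Finite := by
  have hl := hF.finLog hΔ' hM₀ hΔ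
  let W : Submodule ℂ (⨂[ℂ] i, M i) :=
    { carrier := {x | {k : ℕ | toZ (F x) (t - Pi.single (Fin.last (n + 1)) (k : ℂ)) l ≠ 0}.Finite}
      add_mem' := fun {x y} hx hy => (hx.union hy).subset fun k hk => by
        by_contra hc
        simp only [Set.mem_union, Set.mem_ofPred_eq, not_or, not_not] at hc
        exact hk (by rw [map_add, toZ_add (hl x) (hl y), hc.1, hc.2, add_zero])
      zero_mem' := by
        refine Set.finite_empty.subset fun k hk => hk ?_
        rw [map_zero, toZ_zero]
      smul_mem' := fun c x hx => Set.Finite.subset hx fun k hk h0 => hk (by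
        rw [map_smul, toZ_smul c (hl x), h0, smul_zero]) }
  refine tensor_induction hΔ W (fun k m hm => ?_) x
  have key : ∀ j : ℕ, toZ (F (PiTensorProduct.tprod ℂ m))
      (t - Pi.single (Fin.last (n + 1)) (j : ℂ)) l ≠ 0 →
      ∃ i : ℕ, ∑ i, (Δ i + k i) + ∑ i, t i = Δ' + ((i + j : ℕ) : ℂ) := by
    intro j hj
    by_contra hc
    push Not at hc
    refine hj (hΔ'.eq_zero_of_ne (fun i hi => hc i ?_) (hF.toZ_shift_mem_wt hΔ' hM₀ hm t l j))
    rw [sub_eq_iff_eq_add] at hi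
    rw [hi]; push_cast; ring
  by_cases h0 : ∃ j : ℕ, toZ (F (PiTensorProduct.tprod ℂ m))
      (t - Pi.single (Fin.last (n + 1)) (j : ℂ)) l ≠ 0
  · obtain ⟨j0, hj0⟩ := h0
    obtain ⟨i0, hi0⟩ := key j0 hj0
    refine (Set.finite_Iic (i0 + j0)).subset fun j hj => ?_
    obtain ⟨i, hi⟩ := key j hj
    rw [hi0] at hi
    have : i0 + j0 = i + j := by exact_mod_cast add_left_cancel hi
    simp only [Set.mem_Iic]
    omega
  · push Not at h0
    exact Set.finite_empty.subset fun j hj => hj (h0 j)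

theorem IsPIO.tildeF_add (hF : IsPIO V M₀ M F) {Δ' : ℂ} (hΔ' : IsGradedFrom V M₀ Δ')
    (hM₀ : IsVModule V M₀) {Δ : Fin (n + 2) → ℂ} (hΔ : ∀ i, IsGradedFrom V (M i) (Δ i))
    (x y : ⨂[ℂ] i, M i) (t : Fin (n + 2) → ℂ) (l : Fin (n + 2) →₀ ℕ) :
    tildeF V (F (x + y)) t l = tildeF V (F x) t l + tildeF V (F y) t l := by
  have hl := hF.finLog hΔ' hM₀ hΔ
  have hf : ∀ x, (Function.support fun k : ℕ => ((k.factorial : ℂ)⁻¹) • (vir V M₀ (-1) ^ k)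
      (toZ (F x) (t - Pi.single (Fin.last (n + 1)) (k : ℂ)) l)).Finite := fun x =>
    (hF.finite_tilde hΔ' hM₀ hΔ x t l).subset fun k hk h0 => hk (by
      change _ • (vir V M₀ (-1) ^ k) _ = 0
      rw [h0, map_zero, smul_zero])
  rw [tildeF, tildeF, tildeF, ← finsum_add_distrib (hf x) (hf y)]
  refine finsum_congr fun k => ?_
  rw [map_add F, toZ_add (hl x) (hl y), map_add, smul_add]

theorem IsPIO.tildeF_smul (hF : IsPIO V M₀ M F) {Δ' : ℂ} (hΔ' : IsGradedFrom V M₀ Δ')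
    (hM₀ : IsVModule V M₀) {Δ : Fin (n + 2) → ℂ} (hΔ : ∀ i, IsGradedFrom V (M i) (Δ i))
    (c : ℂ) (x : ⨂[ℂ] i, M i) (t : Fin (n + 2) → ℂ) (l : Fin (n + 2) →₀ ℕ) :
    tildeF V (F (c • x)) t l = c • tildeF V (F x) t l := by
  rw [tildeF, tildeF, smul_finsum]
  refine finsum_congr fun k => ?_
  rw [map_smul F, toZ_smul c (hF.finLog hΔ' hM₀ hΔ x), map_smul, smul_comm]

theorem finite_weights {Δ : Fin (n + 2) → ℂ} (hΔ : ∀ i, IsGradedFrom V (M i) (Δ i))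
    (x : ⨂[ℂ] i, M i) : {h : Fin (n + 2) → ℂ | ∃ k : Fin (n + 2) →₀ ℕ,
      PiTensorProduct.map (fun i => powL0 V (M i) (h i) (k i)) x ≠ 0}.Finite := by
  let W : Submodule ℂ (⨂[ℂ] i, M i) :=
    { carrier := {x | {h : Fin (n + 2) → ℂ | ∃ k : Fin (n + 2) →₀ ℕ,
        PiTensorProduct.map (fun i => powL0 V (M i) (h i) (k i)) x ≠ 0}.Finite}
      add_mem' := fun {x y} hx hy => (hx.union hy).subset fun h ⟨k, hk⟩ => by
        by_contra hc
        simp only [Set.mem_union, Set.mem_ofPred_eq, not_or, not_exists, not_not] at hc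
        exact hk (by rw [map_add, hc.1 k, hc.2 k, add_zero])
      zero_mem' := Set.finite_empty.subset fun h ⟨k, hk⟩ => hk (map_zero _)
      smul_mem' := fun c x hx => Set.Finite.subset hx fun h ⟨k, hk⟩ => ⟨k, fun h0 => hk (by
        rw [map_smul, h0, smul_zero])⟩ }
  refine tensor_induction hΔ W (fun k m hm => ?_) x
  refine (Set.finite_singleton (fun i => Δ i + k i : Fin (n + 2) → ℂ)).subset fun h ⟨e, he⟩ => ?_
  by_contra hne
  exact he (map_powL0_tprod_ne hΔ hne hm e)

theorem IsPIO.tildeFL0_add (hF : IsPIO V M₀ M F) {Δ' : ℂ} (hΔ' : IsGradedFrom V M₀ Δ')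
    (hM₀ : IsVModule V M₀) {Δ : Fin (n + 2) → ℂ} (hΔ : ∀ i, IsGradedFrom V (M i) (Δ i))
    (x y : ⨂[ℂ] i, M i) (t : Fin (n + 2) → ℂ) (l : Fin (n + 2) →₀ ℕ) :
    tildeFL0 V F (x + y) t l = tildeFL0 V F x t l + tildeFL0 V F y t l := by
  have hf : ∀ x, (Function.support fun h : Fin (n + 2) → ℂ =>
      ∑ k ∈ Finset.HasAntidiagonal.antidiagonal l,
      tildeF V (F (PiTensorProduct.map (fun i => powL0 V (M i) (h i) (k.1 i)) x))
        (t - h) k.2).Finite := fun x =>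
    (finite_weights hΔ x).subset fun h hh => by
      by_contra hc
      simp only [Set.mem_ofPred_eq, not_exists, not_not] at hc
      refine hh (Finset.sum_eq_zero fun k _ => ?_)
      rw [hc k.1, map_zero, tildeF_zero]
  rw [tildeFL0, tildeFL0, tildeFL0, ← finsum_add_distrib (hf x) (hf y)]
  refine finsum_congr fun h => ?_
  rw [← Finset.sum_add_distrib]
  refine Finset.sum_congr rfl fun k _ => ?_
  rw [map_add (PiTensorProduct.map _), hF.tildeF_add hΔ' hM₀ hΔ]

theorem IsPIO.tildeFL0_smul (hF : IsPIO V M₀ M F) {Δ' : ℂ} (hΔ' : IsGradedFrom V M₀ Δ')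
    (hM₀ : IsVModule V M₀) {Δ : Fin (n + 2) → ℂ} (hΔ : ∀ i, IsGradedFrom V (M i) (Δ i))
    (c : ℂ) (x : ⨂[ℂ] i, M i) (t : Fin (n + 2) → ℂ) (l : Fin (n + 2) →₀ ℕ) :
    tildeFL0 V F (c • x) t l = c • tildeFL0 V F x t l := by
  rw [tildeFL0, tildeFL0, smul_finsum]
  refine finsum_congr fun h => ?_
  rw [Finset.smul_sum]
  refine Finset.sum_congr rfl fun k _ => ?_
  rw [map_smul (PiTensorProduct.map _), hF.tildeF_smul hΔ' hM₀ hΔ]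

theorem IsPIO.barFz_add (hF : IsPIO V M₀ M F) {Δ' : ℂ} (hΔ' : IsGradedFrom V M₀ Δ')
    (hM₀ : IsVModule V M₀) {Δ : Fin (n + 2) → ℂ} (hΔ : ∀ i, IsGradedFrom V (M i) (Δ i))
    (x y : ⨂[ℂ] i, M i) : barFz V Δ' F (x + y) = barFz V Δ' F x + barFz V Δ' F y := by
  funext t l
  rw [Pi.add_apply, Pi.add_apply, barFz, barFz, barFz, ← Finset.sum_add_distrib]
  refine Finset.sum_congr rfl fun k _ => ?_
  rw [hF.tildeFL0_add hΔ' hM₀ hΔ, map_add, smul_add]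

theorem IsPIO.barFz_smul (hF : IsPIO V M₀ M F) {Δ' : ℂ} (hΔ' : IsGradedFrom V M₀ Δ')
    (hM₀ : IsVModule V M₀) {Δ : Fin (n + 2) → ℂ} (hΔ : ∀ i, IsGradedFrom V (M i) (Δ i))
    (c : ℂ) (x : ⨂[ℂ] i, M i) : barFz V Δ' F (c • x) = c • barFz V Δ' F x := by
  funext t l
  rw [Pi.smul_apply, Pi.smul_apply, barFz, barFz, Finset.smul_sum]
  refine Finset.sum_congr rfl fun k _ => ?_
  rw [hF.tildeFL0_smul hΔ' hM₀ hΔ, map_smul, smul_comm]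

/-- A property of series that is closed under linear combinations holds for `F̄(x)` if it holds for
homogeneous `x`. -/
theorem IsPIO.barFz_induction (hF : IsPIO V M₀ M F) {Δ' : ℂ} (hΔ' : IsGradedFrom V M₀ Δ')
    (hM₀ : IsVModule V M₀) {Δ : Fin (n + 2) → ℂ} (hΔ : ∀ i, IsGradedFrom V (M i) (Δ i))
    (P : Submodule ℂ (LogSeries (n + 2) M₀)) (hP : ∀ (k : Fin (n + 2) → ℕ) (m : ∀ i, M i),
      Homog V (fun i => Δ i + k i) m → barFz V Δ' F (PiTensorProduct.tprod ℂ m) ∈ P)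
    (x : ⨂[ℂ] i, M i) : barFz V Δ' F x ∈ P := by
  have hz : barFz V Δ' F 0 = 0 := by
    have := hF.barFz_smul hΔ' hM₀ hΔ 0 0
    rwa [zero_smul, zero_smul] at this
  let W : Submodule ℂ (⨂[ℂ] i, M i) :=
    { carrier := {x | barFz V Δ' F x ∈ P}
      add_mem' := fun {x y} hx hy => by
        change barFz V Δ' F (x + y) ∈ P
        rw [hF.barFz_add hΔ' hM₀ hΔ]; exact P.add_mem hx hy
      zero_mem' := by
        change barFz V Δ' F 0 ∈ P
        rw [hz]; exact P.zero_mem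
      smul_mem' := fun c x hx => by
        change barFz V Δ' F (c • x) ∈ P
        rw [hF.barFz_smul hΔ' hM₀ hΔ]; exact P.smul_mem c hx }
  exact tensor_induction hΔ W hP x

theorem IsPIO.barFz_of_ne (hF : IsPIO V M₀ M F) {Δ' : ℂ} (hΔ' : IsGradedFrom V M₀ Δ')
    (hM₀ : IsVModule V M₀) {Δ : Fin (n + 2) → ℂ} (hΔ : ∀ i, IsGradedFrom V (M i) (Δ i))
    (x : ⨂[ℂ] i, M i) {t : Fin (n + 2) → ℂ} (ht : ∑ i, t i ≠ 0) : barFz V Δ' F x t = 0 :=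
  hF.barFz_induction hΔ' hM₀ hΔ (LinearMap.ker (LinearMap.proj t))
    (fun _ _ hm => funext fun l => hF.barFz_tprod_of_ne hΔ' hM₀ hΔ hm ht l) x

theorem barFz_mem (Δ' : ℂ) (x : ⨂[ℂ] i, M i) (t : Fin (n + 2) → ℂ) (l : Fin (n + 2) →₀ ℕ) :
    barFz V Δ' F x t l ∈ wt V M₀ Δ' :=
  Submodule.sum_mem _ fun _ _ => Submodule.smul_mem _ _ (powL0_mem _ _ _)

theorem barF_mem (Δ' : ℂ) (x : ⨂[ℂ] i, M i) (ν : Fin (n + 1) → ℂ) (q : Fin (n + 1) →₀ ℕ) :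
    barF V Δ' F x ν q ∈ wt V M₀ Δ' := by
  rw [barF]
  refine finsum_induction (· ∈ wt V M₀ Δ') (Submodule.zero_mem _)
    (fun _ _ => Submodule.add_mem _) fun l => ?_
  split_ifs
  · exact Submodule.smul_mem _ _ (barFz_mem _ _ _ _)
  · exact Submodule.zero_mem _

end unwrap

/-! ### Bounded powers of logarithms -/

/-- The series with bounded powers of logarithms. -/
def logBdd (N : ℕ) (W : Type*) [AddCommGroup W] [Module ℂ W] : Submodule ℂ (LogSeries N W) where
  carrier := {G | ∃ D : ℕ, ∀ t l, G t l ≠ 0 → ∀ i, l i ≤ D}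
  add_mem' := by
    rintro G G' ⟨D, hD⟩ ⟨D', hD'⟩
    refine ⟨max D D', fun t l h i => ?_⟩
    by_cases h0 : G t l = 0
    · refine (hD' t l (fun h1 => h ?_) i).trans (le_max_right _ _)
      rw [Pi.add_apply, Pi.add_apply, h0, h1, add_zero]
    · exact (hD t l h0 i).trans (le_max_left _ _)
  zero_mem' := ⟨0, fun _ _ h => absurd rfl h⟩
  smul_mem' := by
    rintro c G ⟨D, hD⟩
    refine ⟨D, fun t l h => hD t l fun h0 => h ?_⟩
    rw [Pi.smul_apply, Pi.smul_apply, h0, smul_zero]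

theorem finLog_of_logBdd {N : ℕ} {W : Type*} [AddCommGroup W] [Module ℂ W] {G : LogSeries N W}
    (h : G ∈ logBdd N W) : FinLog G := fun t => by
  obtain ⟨D, hD⟩ := h
  exact (finite_bounded D).subset fun l hl => hD t l hl

section bounds

variable {V : Type*} [AddCommGroup V] [Module ℂ V] [VertexOperatorAlgebra V] {n : ℕ}
  {M₀ : Type*} [AddCommGroup M₀] [Module ℂ M₀] [VOAModule V M₀]
  {M : Fin (n + 2) → Type*} [∀ i, AddCommGroup (M i)] [∀ i, Module ℂ (M i)]
  [∀ i, VOAModule V (M i)] {F : (⨂[ℂ] i, M i) →ₗ[ℂ] LogSeries (n + 1) M₀}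

omit [VOAModule V M₀] in
theorem exists_of_twistZ_ne_zero {w : Fin (n + 2) → ℂ} {m : ∀ i, M i} {t : Fin (n + 2) → ℂ}
    {l : Fin (n + 2) →₀ ℕ} (h : twistZ V F w m t l ≠ 0) :
    ∃ (k l' : Fin (n + 2) →₀ ℕ) (j : Fin (n + 1) → ℕ) (κ : Fin (n + 1) →₀ ℕ), k + l' = l ∧
      l' (Fin.last (n + 1)) = 0 ∧ (∀ i, l' i.castSucc ≤ κ i) ∧
      (t - w) (Fin.last (n + 1)) = ∑ i, (j i : ℂ) ∧
      F (PiTensorProduct.tprod ℂ (npow V w m k)) (fun i => (t - w) i.castSucc + j i) κ ≠ 0 := by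
  obtain ⟨⟨k, l'⟩, hk, h2⟩ := Finset.exists_ne_zero_of_sum_ne_zero h
  obtain ⟨j, κ, h3, h4, h5, h6⟩ := exists_of_toZ_ne_zero h2
  exact ⟨k, l', j, κ, Finset.HasAntidiagonal.mem_antidiagonal.mp hk, h3, h5, h4, h6⟩

theorem IsPIO.exists_of_barFz_ne_zero (hF : IsPIO V M₀ M F) {Δ' : ℂ} (hΔ' : IsGradedFrom V M₀ Δ')
    (hM₀ : IsVModule V M₀) {Δ : Fin (n + 2) → ℂ} (hΔ : ∀ i, IsGradedFrom V (M i) (Δ i))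
    {w : Fin (n + 2) → ℂ} {m : ∀ i, M i} (hm : Homog V w m)
    {t : Fin (n + 2) → ℂ} {l : Fin (n + 2) →₀ ℕ}
    (h : barFz V Δ' F (PiTensorProduct.tprod ℂ m) t l ≠ 0) :
    ∑ i, t i = 0 ∧ ∃ k ≤ l 0, (nil V M₀ Δ' ^ k)
      (twistZ V F w m (t + Pi.single 0 Δ') (l - Finsupp.single 0 k)) ≠ 0 := by
  have ht : ∑ i, t i = 0 := by
    by_contra ht
    exact h (hF.barFz_tprod_of_ne hΔ' hM₀ hΔ hm ht l)
  rw [hF.barFz_tprod hΔ' hM₀ hΔ hm ht] at h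
  obtain ⟨k, hk, h2⟩ := Finset.exists_ne_zero_of_sum_ne_zero h
  exact ⟨ht, k, by have := Finset.mem_range.mp hk; omega, right_ne_zero_of_smul h2⟩

/-- The total degree of the terms of `F` that contribute to the part of weight `Δ'`. -/
theorem sum_shift_total {t w : Fin (n + 2) → ℂ} {Δ' : ℂ} (ht : ∑ i, t i = 0)
    {j : Fin (n + 1) → ℕ} (hj : (t + Pi.single 0 Δ' - w : Fin (n + 2) → ℂ) (Fin.last (n + 1)) = ∑ i, (j i : ℂ)) :
    ∑ i, w i + ∑ i : Fin (n + 1), ((t + Pi.single 0 Δ' - w : Fin (n + 2) → ℂ) i.castSucc + j i) =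
      Δ' := by
  have h := sum_add_single_sub t w Δ'
  generalize (t + Pi.single 0 Δ' - w : Fin (n + 2) → ℂ) = τ at h hj ⊢
  rw [ht, zero_add, Fin.sum_univ_castSucc τ, hj] at h
  rw [Finset.sum_add_distrib, h]

/-- The logarithms in `F̄` come from the nilpotent parts of `L(0)` on `M₀` and on the factors `M_i` and
from `F` itself; each source is bounded. -/
theorem IsPIO.barFz_mem_logBdd (hF : IsPIO V M₀ M F) {Δ' : ℂ} (hΔ' : IsGradedFrom V M₀ Δ')
    (hM₀ : IsVModule V M₀) {Δ : Fin (n + 2) → ℂ} (hΔ : ∀ i, IsGradedFrom V (M i) (Δ i))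
    (x : ⨂[ℂ] i, M i) : barFz V Δ' F x ∈ logBdd (n + 2) M₀ := by
  refine hF.barFz_induction hΔ' hM₀ hΔ _ (fun e m hm => ?_) x
  set w : Fin (n + 2) → ℂ := fun i => Δ i + e i
  choose r hr using fun i => mem_wt_iff.mp (hm i)
  choose S D hD using fun k => hF.support hΔ' hM₀ Δ' (PiTensorProduct.tprod ℂ (npow V w m k))
  obtain ⟨N, hN⟩ := hM₀.nilpotent
  set R := ∑ i, r i
  set D' := (finite_bounded (N := n + 2) R).toFinset.sup D
  refine ⟨N + R + D', fun t l h i => ?_⟩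
  obtain ⟨ht, j, hj, h2⟩ := hF.exists_of_barFz_ne_zero hΔ' hM₀ hΔ hm h
  have hjN : j < N := by
    by_contra hc
    refine h2 ?_
    have e : nil V M₀ Δ' ^ j = nil V M₀ Δ' ^ (j - N) * nil V M₀ Δ' ^ N := by
      rw [← pow_add, Nat.sub_add_cancel (not_lt.mp hc)]
    rw [e, Module.End.mul_apply]
    have := hN Δ' _ (hF.twistZ_mem_wt hΔ' hM₀ hm ht (l - Finsupp.single 0 j))
    exact (congrArg (nil V M₀ Δ' ^ (j - N)) this).trans (map_zero _)
  obtain ⟨k, l', j', κ, h3, h4, h5, h6, h7⟩ := exists_of_twistZ_ne_zero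
    (fun h0 => h2 (by rw [h0, map_zero]))
  have hk : ∀ i, k i ≤ R := by
    intro i
    by_contra hc
    refine h7 ?_
    rw [tprod_eq_zero (p := i), map_zero]; · rfl
    rw [npow]
    have : r i ≤ k i := (Finset.single_le_sum (f := r) (fun _ _ => Nat.zero_le _)
      (Finset.mem_univ i)).trans (not_le.mp hc).le
    rw [← Nat.sub_add_cancel this, pow_add, Module.End.mul_apply]
    have h0 : (nil V (M i) (w i) ^ r i) (m i) = 0 := hr i
    rw [h0, map_zero, smul_zero]
  have hκ : ∀ i, κ i ≤ D' := by
    intro i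
    refine ((hD k
      (fun i => (t + Pi.single 0 Δ' - w : Fin (n + 2) → ℂ) i.castSucc + j' i) κ ?_).2 i).trans (Finset.le_sup (f := D) (by simpa using hk))
    intro h0
    refine h7 ?_
    have h8 := hF.mem_wt hΔ' hM₀ (hm.npow k)
      (fun i => (t + Pi.single 0 Δ' - w : Fin (n + 2) → ℂ) i.castSucc + j' i) κ
    rw [sum_shift_total ht h6] at h8
    rw [← hΔ'.genProj_of_mem h8, h0]
    rfl
  have hl' : l' i ≤ D' := by
    refine Fin.lastCases ?_ (fun i => ?_) i
    · rw [h4]; exact Nat.zero_le _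
    · exact (h5 i).trans (hκ i)
  have h8 := DFunLike.congr_fun h3 i
  have h9 : (Finsupp.single 0 j : Fin (n + 2) →₀ ℕ) i ≤ j := by
    rw [Finsupp.single_apply]; split_ifs <;> omega
  have h10 := hk i
  rw [Finsupp.add_apply, Finsupp.tsub_apply] at h8
  omega

/-! ### Scale invariance -/

/-- The derivative of `z_i^{L(0)} m_i` with respect to `log z_i`. -/
theorem npow_add_single (w : Fin (n + 2) → ℂ) (m : ∀ i, M i) (k : Fin (n + 2) →₀ ℕ)
    (i : Fin (n + 2)) :
    ((k i : ℂ) + 1) • PiTensorProduct.tprod ℂ (npow V w m (k + Finsupp.single i 1)) =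
      PiTensorProduct.tprod ℂ
        (Function.update (npow V w m k) i (nil V (M i) (w i) (npow V w m k i))) := by
  have : npow V w m (k + Finsupp.single i 1) = Function.update (npow V w m k) i
      ((((k i : ℂ) + 1)⁻¹) • nil V (M i) (w i) (npow V w m k i)) := by
    funext i'
    by_cases e : i' = i
    · subst e
      rw [Function.update_self, npow, npow, Finsupp.add_apply, Finsupp.single_eq_same, map_smul,
        smul_smul, Nat.factorial_succ, Nat.cast_mul, mul_inv, pow_succ', Module.End.mul_apply]
      push_cast; rfl
    · rw [Function.update_of_ne e, npow, npow]
      simp [e]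
  rw [this, MultilinearMap.map_update_smul, smul_smul, mul_inv_cancel₀, one_smul]
  exact_mod_cast Nat.succ_ne_zero (k i)

/-- The Euler equation: under a simultaneous rescaling of the `z_i`, the nilpotent part of `L(0)` on `M₀`
describes the behaviour of the logarithms. -/
theorem IsPIO.twistZ_scale (hF : IsPIO V M₀ M F) {Δ' : ℂ} (hΔ' : IsGradedFrom V M₀ Δ')
    (hM₀ : IsVModule V M₀) {Δ : Fin (n + 2) → ℂ} (hΔ : ∀ i, IsGradedFrom V (M i) (Δ i))
    {w : Fin (n + 2) → ℂ} (m : ∀ i, M i) {t : Fin (n + 2) → ℂ} (ht : ∑ i, t i = 0)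
    (l : Fin (n + 2) →₀ ℕ) :
    ∑ i, ((l i : ℂ) + 1) • twistZ V F w m (t + Pi.single 0 Δ') (l + Finsupp.single i 1) =
      nil V M₀ Δ' (twistZ V F w m (t + Pi.single 0 Δ') l) := by
  have hl := hF.finLog hΔ' hM₀ hΔ
  set τ : Fin (n + 2) → ℂ := t + Pi.single 0 Δ' - w
  simp only [twistZ, map_sum]
  rw [Finset.sum_congr rfl fun i _ => antidiagonal_deriv
    (fun k l => toZ (F (PiTensorProduct.tprod ℂ (npow V w m k))) τ l) i l, Finset.sum_comm]
  refine Finset.sum_congr rfl fun ⟨k, l'⟩ _ => ?_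
  set y := npow V w m k
  have h1 : ∀ i, ((k i : ℂ) + 1) • toZ (F (PiTensorProduct.tprod ℂ
      (npow V w m (k + Finsupp.single i 1)))) τ l' =
      toZ (F (PiTensorProduct.tprod ℂ (Function.update y i (nil V (M i) (w i) (y i))))) τ l' := by
    intro i
    rw [← toZ_smul _ (hl _), ← map_smul, npow_add_single]
  have h2 : ∑ i, ((l' i : ℂ) + 1) • toZ (F (PiTensorProduct.tprod ℂ y)) τ
      (l' + Finsupp.single i 1) =
      toZ (∑ i, logDeriv i (F (PiTensorProduct.tprod ℂ y))) τ l' := by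
    rw [Fin.sum_univ_castSucc, toZ_sum _ fun i _ => (hl _).logDeriv i]
    have := toZ_logDeriv_last (F (PiTensorProduct.tprod ℂ y)) τ l'
    rw [logDeriv] at this
    rw [this, add_zero]
    exact Finset.sum_congr rfl fun i _ => toZ_logDeriv i _ τ l'
  rw [Finset.sum_add_distrib, Finset.sum_congr rfl fun i _ => h1 i, h2,
    ← toZ_sum _ fun i _ => hl _, ← toZ_add (FinLog.sum _ fun i _ => hl _)
      (FinLog.sum _ fun i _ => (hl _).logDeriv i), map_toZ _ (hl _)]
  refine toZ_congr (fun T hT => ?_) l'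
  funext κ
  have h3 := hF.euler_tprod w y T κ
  have h4 := sum_add_single_sub t w Δ'
  rw [ht, zero_add] at h4
  rw [hT, h4] at h3
  rw [nil_apply, h3]
  simp only [Pi.add_apply, Finset.sum_apply, logDeriv]
  abel

/-- `F̄` as a sum over an antidiagonal. -/
theorem IsPIO.barFz_antidiagonal (hF : IsPIO V M₀ M F) {Δ' : ℂ} (hΔ' : IsGradedFrom V M₀ Δ')
    (hM₀ : IsVModule V M₀) {Δ : Fin (n + 2) → ℂ} (hΔ : ∀ i, IsGradedFrom V (M i) (Δ i))
    {w : Fin (n + 2) → ℂ} {m : ∀ i, M i} (hm : Homog V w m)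
    {t : Fin (n + 2) → ℂ} (ht : ∑ i, t i = 0) (l : Fin (n + 2) →₀ ℕ) :
    barFz V Δ' F (PiTensorProduct.tprod ℂ m) t l =
      ∑ x ∈ Finset.HasAntidiagonal.antidiagonal l,
        if x.1 = Finsupp.single 0 (x.1 0) then
          ((-1 : ℂ) ^ (x.1 0) * (((x.1 0).factorial : ℂ)⁻¹)) •
            (nil V M₀ Δ' ^ (x.1 0)) (twistZ V F w m (t + Pi.single 0 Δ') x.2) else 0 := by
  rw [hF.barFz_tprod hΔ' hM₀ hΔ hm ht]
  refine Finset.sum_of_injOn (fun k => (Finsupp.single 0 k, l - Finsupp.single 0 k)) ?_ ?_ ?_ ?_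
  · intro x _ y _ h
    simp only [Prod.mk.injEq] at h
    exact Finsupp.single_injective 0 h.1
  · intro k hk
    have : k ≤ l 0 := by have := Finset.mem_range.mp hk; omega
    exact Finset.HasAntidiagonal.mem_antidiagonal.mpr
      (add_tsub_cancel_of_le (Finsupp.single_le_iff.mpr this))
  · intro x hx hx2
    refine if_neg fun h => hx2 ⟨x.1 0, ?_, ?_⟩
    · have := DFunLike.congr_fun (Finset.HasAntidiagonal.mem_antidiagonal.mp hx) 0
      rw [Finsupp.add_apply] at this
      exact Finset.mem_coe.mpr (Finset.mem_range.mpr (by omega))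
    · refine Prod.ext h.symm ?_
      change l - Finsupp.single 0 (x.1 0) = x.2
      rw [← h, ← Finset.HasAntidiagonal.mem_antidiagonal.mp hx, add_tsub_cancel_left]
  · intro k _
    simp

/-- `F̄` is invariant under a simultaneous rescaling of the `z_i`: the factor `z_1^{-L(0)}` compensates
the nilpotent part of `L(0)` in the Euler equation. -/
theorem IsPIO.barFz_scale (hF : IsPIO V M₀ M F) {Δ' : ℂ} (hΔ' : IsGradedFrom V M₀ Δ')
    (hM₀ : IsVModule V M₀) {Δ : Fin (n + 2) → ℂ} (hΔ : ∀ i, IsGradedFrom V (M i) (Δ i))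
    (x : ⨂[ℂ] i, M i) (t : Fin (n + 2) → ℂ) (l : Fin (n + 2) →₀ ℕ) :
    ∑ i, ((l i : ℂ) + 1) • barFz V Δ' F x t (l + Finsupp.single i 1) = 0 := by
  by_cases ht : ∑ i, t i = 0
  swap
  · simp [hF.barFz_of_ne hΔ' hM₀ hΔ x ht]
  let L : LogSeries (n + 2) M₀ →ₗ[ℂ] M₀ := ∑ i, ((l i : ℂ) + 1) •
    (LinearMap.proj (l + Finsupp.single i 1) : ((Fin (n + 2) →₀ ℕ) → M₀) →ₗ[ℂ] M₀) ∘ₗ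
      (LinearMap.proj t : LogSeries (n + 2) M₀ →ₗ[ℂ] _)
  have hL : ∀ G, L G = ∑ i, ((l i : ℂ) + 1) • G t (l + Finsupp.single i 1) := fun G => by
    simp [L]
  rw [← hL]
  refine hF.barFz_induction hΔ' hM₀ hΔ (LinearMap.ker L) (fun e m hm => ?_) x
  rw [LinearMap.mem_ker, hL]
  set w : Fin (n + 2) → ℂ := fun i => Δ i + e i
  set u := twistZ V F w m (t + Pi.single 0 Δ')
  have hu : ∀ l, ∑ i, ((l i : ℂ) + 1) • u (l + Finsupp.single i 1) = nil V M₀ Δ' (u l) :=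
    fun l => hF.twistZ_scale hΔ' hM₀ hΔ m ht l
  -- the coefficients of `exp(-N log z_1)`, where `N` is the nilpotent part of `L(0)`
  set v : (Fin (n + 2) →₀ ℕ) → M₀ → M₀ := fun k y => if k = Finsupp.single 0 (k 0) then
    ((-1 : ℂ) ^ (k 0) * (((k 0).factorial : ℂ)⁻¹)) • (nil V M₀ Δ' ^ (k 0)) y else 0 with hv
  have hb : ∀ l, barFz V Δ' F (PiTensorProduct.tprod ℂ m) t l =
      ∑ x ∈ Finset.HasAntidiagonal.antidiagonal l, v x.1 (u x.2) := fun l =>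
    hF.barFz_antidiagonal hΔ' hM₀ hΔ hm ht l
  have hvadd : ∀ k, ∃ f : M₀ →ₗ[ℂ] M₀, ∀ y, v k y = f y := fun k => by
    by_cases h : k = Finsupp.single 0 (k 0)
    · exact ⟨((-1 : ℂ) ^ (k 0) * (((k 0).factorial : ℂ)⁻¹)) • (nil V M₀ Δ' ^ (k 0)), fun y =>
        if_pos h⟩
    · exact ⟨0, fun y => if_neg h⟩
  have hv0 : ∀ k y, ((k 0 : ℂ) + 1) • v (k + Finsupp.single 0 1) y = -v k (nil V M₀ Δ' y) := by
    intro k y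
    have e0 : (k + Finsupp.single 0 1 : Fin (n + 2) →₀ ℕ) 0 = k 0 + 1 := by simp
    have e1 : (k + Finsupp.single 0 1 = Finsupp.single 0 ((k + Finsupp.single 0 1 :
        Fin (n + 2) →₀ ℕ) 0)) ↔ k = Finsupp.single 0 (k 0) := by
      rw [e0, Finsupp.single_add]
      exact add_left_inj _
    simp only [hv, e1]
    split_ifs
    · rw [e0, smul_smul, ← neg_smul, pow_succ (nil V M₀ Δ'), Module.End.mul_apply]
      congr 1
      rw [Nat.factorial_succ, Nat.cast_mul, mul_inv, pow_succ]
      have : ((k 0 + 1 : ℕ) : ℂ) ≠ 0 := Nat.cast_ne_zero.mpr (Nat.succ_ne_zero _)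
      push_cast at this ⊢
      field_simp
    · simp
  have hvi : ∀ (i : Fin (n + 2)), i ≠ 0 → ∀ k y, v (k + Finsupp.single i 1) y = 0 := by
    intro i hi k y
    refine if_neg fun h => ?_
    have := DFunLike.congr_fun h i
    simp [hi.symm] at this
  simp only [hb]
  rw [Finset.sum_congr rfl fun i _ => antidiagonal_deriv (fun k l => v k (u l)) i l,
    Finset.sum_comm]
  refine Finset.sum_eq_zero fun ⟨k, l'⟩ _ => ?_
  rw [Finset.sum_add_distrib, Finset.sum_eq_single 0 (fun i _ hi => by rw [hvi i hi, smul_zero])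
    (by simp), hv0]
  obtain ⟨f, hf⟩ := hvadd k
  simp only [hf]
  rw [← hu, map_sum, ← sub_eq_neg_add, sub_eq_zero]
  refine Finset.sum_congr rfl fun i _ => ?_
  rw [map_smul]

end bounds

/-! ### Logarithms of quotients -/

section polynomials

variable {N : ℕ}

/-- The derivative of `s ↦ P(x + s(1, …, 1))`. -/
theorem aeval_translate_derivative {σ : Type*} [Fintype σ] (x : σ → ℂ) (P : MvPolynomial σ ℂ) :
    Polynomial.derivative (MvPolynomial.aeval (fun i => Polynomial.C (x i) + Polynomial.X) P) =
      MvPolynomial.aeval (fun i => Polynomial.C (x i) + Polynomial.X)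
        (∑ i, MvPolynomial.pderiv i P) := by
  classical
  induction P using MvPolynomial.induction_on with
  | C a => simp
  | add p q hp hq => simp only [map_add, Finset.sum_add_distrib, hp, hq]
  | mul_X p j hp =>
    simp only [Derivation.leibniz, MvPolynomial.pderiv_X, smul_eq_mul, Finset.sum_add_distrib,
      map_add, map_mul, MvPolynomial.aeval_X, Polynomial.derivative_mul, hp]
    rw [← Finset.mul_sum, ← Finset.mul_sum]
    simp [Pi.single_apply, mul_comm, add_comm]

/-- A polynomial that is invariant under simultaneous translation is a polynomial in the
differences. -/
theorem aeval_sub_of_pderiv {P : MvPolynomial (Fin (N + 1)) ℂ}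
    (h : ∑ i, MvPolynomial.pderiv i P = 0) :
    MvPolynomial.aeval (fun i => MvPolynomial.X i - MvPolynomial.X 0 :
      Fin (N + 1) → MvPolynomial (Fin (N + 1)) ℂ) P = P := by
  -- `P` is constant along the lines in the direction `(1, …, 1)`; one takes `s = 0` and `s = -x_0`
  refine MvPolynomial.funext fun x => ?_
  have h1 := aeval_translate_derivative x P
  rw [h, map_zero] at h1
  have h2 := Polynomial.eq_C_of_derivative_eq_zero h1
  set c := Polynomial.coeff (MvPolynomial.aeval (fun i => Polynomial.C (x i) + Polynomial.X) P) 0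
  have h3 : ∀ s : ℂ, MvPolynomial.eval (fun i => x i + s) P = c := by
    intro s
    have h4 := congrArg (Polynomial.eval s) h2
    rw [Polynomial.eval_C, ← Polynomial.coe_aeval_eq_eval, ← AlgHom.comp_apply,
      MvPolynomial.comp_aeval] at h4
    rw [← h4, ← MvPolynomial.aeval_eq_eval]
    simp
  have h5 := h3 0
  simp only [add_zero] at h5
  have h6 := h3 (-x 0)
  rw [← MvPolynomial.aeval_eq_eval] at h6
  rw [h5, ← h6, ← MvPolynomial.aeval_eq_eval]
  change MvPolynomial.aeval x (MvPolynomial.aeval _ P) = MvPolynomial.aeval _ P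
  rw [← AlgHom.comp_apply, MvPolynomial.comp_aeval]
  simp [sub_eq_add_neg]

/-- The polynomial `log z_{i+1} = log ζ_1 + ⋯ + log ζ_i` in the `log ζ_j`, for `z_1 = 1`. -/
def logZ (N : ℕ) (i : Fin (N + 2)) : MvPolynomial (Fin (N + 1)) ℂ :=
  Fin.cases 0 (fun i => ∑ j : Fin (N + 1), if j ≤ i then MvPolynomial.X j else 0) i

/-- The polynomial `log ζ_i = log z_{i+1} - log z_i` in the `log z_j`. -/
def logZeta (N : ℕ) (i : Fin (N + 1)) : MvPolynomial (Fin (N + 2)) ℂ :=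
  MvPolynomial.X i.succ - MvPolynomial.X i.castSucc

theorem sum_telescope {A : Type*} [AddCommGroup A] (f : Fin (N + 2) → A) (i : Fin (N + 1)) :
    ∑ j : Fin (N + 1), (if j ≤ i then f j.succ - f j.castSucc else 0) = f i.succ - f 0 := by
  induction i using Fin.induction with
  | zero =>
    rw [Finset.sum_eq_single 0]
    · simp
    · intro j _ hj
      rw [if_neg]
      simpa [Fin.le_zero_iff] using hj
    · simp
  | succ i ih =>
    have h : ∀ j : Fin (N + 1), (if j ≤ i.succ then f j.succ - f j.castSucc else 0) =
        (if j ≤ i.castSucc then f j.succ - f j.castSucc else 0) +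
          if j = i.succ then f j.succ - f j.castSucc else 0 := by
      intro j
      by_cases h1 : j = i.succ
      · subst h1
        rw [if_pos le_rfl, if_pos rfl, if_neg, zero_add]
        exact not_le.mpr Fin.castSucc_lt_succ
      · have : j ≤ i.succ ↔ j ≤ i.castSucc := by
          have h2 : (j : ℕ) ≠ i + 1 := fun h => h1 (Fin.ext (by simpa using h))
          simp only [Fin.le_def, Fin.val_succ, Fin.val_castSucc]
          omega
        simp [this, h1]
    rw [Finset.sum_congr rfl fun j _ => h j, Finset.sum_add_distrib, ih,
      Finset.sum_ite_eq' Finset.univ, if_pos (Finset.mem_univ _), ← Fin.succ_castSucc]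
    abel

theorem aeval_logZeta_logZ (i : Fin (N + 2)) :
    MvPolynomial.aeval (logZeta N) (logZ N i) = MvPolynomial.X i - MvPolynomial.X 0 := by
  refine Fin.cases ?_ (fun i => ?_) i
  · simp [logZ]
  · rw [logZ, Fin.cases_succ, map_sum, ← sum_telescope MvPolynomial.X i]
    refine Finset.sum_congr rfl fun j _ => ?_
    split_ifs
    · simp [logZeta]
    · simp

theorem aeval_logZeta_aeval_logZ {P : MvPolynomial (Fin (N + 2)) ℂ}
    (h : ∑ i, MvPolynomial.pderiv i P = 0) :
    MvPolynomial.aeval (logZeta N) (MvPolynomial.aeval (logZ N) P) = P := by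
  rw [← AlgHom.comp_apply, MvPolynomial.comp_aeval]
  simp only [aeval_logZeta_logZ]
  exact aeval_sub_of_pderiv h

/-- The coefficient of `∏ᵢ (log ζ_i)^{q_i}` in `∏ᵢ (log z_i)^{l_i}`, for `z_1 = 1`. -/
def logCoeff (q : Fin (N + 1) →₀ ℕ) (l : Fin (N + 2) →₀ ℕ) : ℂ :=
  MvPolynomial.coeff q (∏ i, logZ N i ^ l i)

theorem logCoeff_eq (q : Fin (N + 1) →₀ ℕ) (l : Fin (N + 2) →₀ ℕ) : logCoeff q l =
    if l 0 = 0 then MvPolynomial.coeff q (∏ i : Fin (N + 1),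
      (∑ j : Fin (N + 1), if j ≤ i then MvPolynomial.X j else 0 :
        MvPolynomial (Fin (N + 1)) ℂ) ^ l i.succ) else 0 := by
  rw [logCoeff, Fin.prod_univ_succ]
  split_ifs with h
  · rw [h, pow_zero, one_mul]
    rfl
  · have : logZ N 0 = 0 := rfl
    rw [this, zero_pow h, zero_mul, MvPolynomial.coeff_zero]

theorem logCoeff_eq_zero {q : Fin (N + 1) →₀ ℕ} {l : Fin (N + 2) →₀ ℕ}
    (h : ∑ i, q i ≠ ∑ i, l i) : logCoeff q l = 0 := by
  have h1 : ∀ i, (logZ N i).IsHomogeneous 1 := fun i => by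
    refine Fin.cases (MvPolynomial.isHomogeneous_zero _ _ _) (fun i => ?_) i
    refine MvPolynomial.IsHomogeneous.sum _ _ _ fun j _ => ?_
    split_ifs
    · exact MvPolynomial.isHomogeneous_X _ _
    · exact MvPolynomial.isHomogeneous_zero _ _ _
  have h2 := MvPolynomial.IsHomogeneous.prod Finset.univ (fun i => logZ N i ^ l i)
    (fun i => 1 * l i) fun i _ => (h1 i).pow (l i)
  refine h2.coeff_eq_zero ?_
  rw [Finsupp.degree_eq_sum]
  simpa using h

theorem finite_sum_nat (d : ℕ) : {l : Fin N →₀ ℕ | ∑ i, l i = d}.Finite :=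
  (finite_bounded d).subset fun l hl i => (Finset.single_le_sum (f := l)
    (fun _ _ => Nat.zero_le _) (Finset.mem_univ i)).trans (le_of_eq hl)

/-- The coefficient of `∏ᵢ (log ζ_i)^{q_i}` after the substitution `log z_i = log ζ_1 + ⋯ + log ζ_{i-1}` in
a family of coefficients. The substitution preserves the degree, so the sum is finite. -/
def logSubst {W : Type*} [AddCommGroup W] [Module ℂ W] (q : Fin (N + 1) →₀ ℕ) :
    ((Fin (N + 2) →₀ ℕ) → W) →ₗ[ℂ] W :=
  ∑ l ∈ (finite_sum_nat (N := N + 2) (∑ i, q i)).toFinset, logCoeff q l • LinearMap.proj l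

variable {W : Type*} [AddCommGroup W] [Module ℂ W]

theorem logSubst_apply (q : Fin (N + 1) →₀ ℕ) (g : (Fin (N + 2) →₀ ℕ) → W) :
    logSubst q g = ∑ l ∈ (finite_sum_nat (N := N + 2) (∑ i, q i)).toFinset, logCoeff q l • g l := by
  simp [logSubst]

theorem logSubst_eq_finsum (q : Fin (N + 1) →₀ ℕ) (g : (Fin (N + 2) →₀ ℕ) → W) :
    logSubst q g = ∑ᶠ l, logCoeff q l • g l := by
  rw [logSubst_apply, finsum_eq_sum_of_support_subset]
  intro l hl
  by_contra hc
  refine hl ?_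
  have h0 : logCoeff q l = 0 := logCoeff_eq_zero fun h => hc (by simp [h])
  change logCoeff q l • g l = 0
  rw [h0, zero_smul]

theorem exists_of_logSubst_ne_zero {q : Fin (N + 1) →₀ ℕ} {g : (Fin (N + 2) →₀ ℕ) → W}
    (h : logSubst q g ≠ 0) : ∃ l : Fin (N + 2) →₀ ℕ, ∑ i, l i = ∑ i, q i ∧ g l ≠ 0 := by
  rw [logSubst_apply] at h
  obtain ⟨l, hl, h2⟩ := Finset.exists_ne_zero_of_sum_ne_zero h
  exact ⟨l, by simpa using hl, right_ne_zero_of_smul h2⟩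

open Classical in
/-- The polynomial with the coefficients `g`. -/
def toPoly {g : (Fin N →₀ ℕ) → ℂ} (hg : {l | g l ≠ 0}.Finite) : MvPolynomial (Fin N) ℂ :=
  ∑ l ∈ hg.toFinset, MvPolynomial.monomial l (g l)

theorem coeff_toPoly {g : (Fin N →₀ ℕ) → ℂ} (hg : {l | g l ≠ 0}.Finite) (l : Fin N →₀ ℕ) :
    MvPolynomial.coeff l (toPoly hg) = g l := by
  classical
  rw [toPoly, MvPolynomial.coeff_sum]
  simp only [MvPolynomial.coeff_monomial]
  rw [Finset.sum_ite_eq']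
  split_ifs with h
  · rfl
  · symm; simpa using h

theorem coeff_aeval {K : ℕ} (v : Fin N → MvPolynomial (Fin K) ℂ) (P : MvPolynomial (Fin N) ℂ)
    (q : Fin K →₀ ℕ) : MvPolynomial.coeff q (MvPolynomial.aeval v P) =
      ∑ᶠ l : Fin N →₀ ℕ, MvPolynomial.coeff l P * MvPolynomial.coeff q (∏ i, v i ^ l i) := by
  rw [MvPolynomial.aeval_def, MvPolynomial.eval₂_eq', MvPolynomial.coeff_sum,
    finsum_eq_sum_of_support_subset (s := P.support)]
  · refine Finset.sum_congr rfl fun l _ => ?_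
    rw [MvPolynomial.algebraMap_eq, MvPolynomial.coeff_C_mul]
  · intro l hl
    by_contra hc
    refine hl ?_
    change _ * _ = _
    rw [MvPolynomial.notMem_support_iff.mp hc, zero_mul]

theorem pderiv_toPoly {g : (Fin N →₀ ℕ) → ℂ} (hg : {l | g l ≠ 0}.Finite)
    (h : ∀ l, ∑ i, ((l i : ℂ) + 1) * g (l + Finsupp.single i 1) = 0) :
    ∑ i, MvPolynomial.pderiv i (toPoly hg) = 0 := by
  ext l
  rw [MvPolynomial.coeff_sum, MvPolynomial.coeff_zero, ← h l]
  refine Finset.sum_congr rfl fun i _ => ?_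
  rw [MvPolynomial.coeff_pderiv, coeff_toPoly, mul_comm]

/-- A family of coefficients that is invariant under rescaling all variables is recovered from its
expression in the `log ζ_i`. -/
theorem finsum_logSubst {g : (Fin (N + 2) →₀ ℕ) → W} (hg : {l | g l ≠ 0}.Finite)
    (h : ∀ l, ∑ i, ((l i : ℂ) + 1) • g (l + Finsupp.single i 1) = 0) (l : Fin (N + 2) →₀ ℕ) :
    ∑ᶠ q : Fin (N + 1) →₀ ℕ,
      MvPolynomial.coeff l (∏ i, logZeta N i ^ q i) • logSubst q g = g l := by
  have hq : {q : Fin (N + 1) →₀ ℕ | logSubst q g ≠ 0}.Finite := by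
    refine (hg.biUnion (t := fun l => {q : Fin (N + 1) →₀ ℕ | ∑ i, q i = ∑ i, l i})
      fun l _ => finite_sum_nat _).subset fun q hq => ?_
    obtain ⟨l, h1, h2⟩ := exists_of_logSubst_ne_zero hq
    exact Set.mem_biUnion h2 h1.symm
  -- functionals on `W` reduce the claim to polynomials with coefficients in `ℂ`
  rw [← sub_eq_zero, ← Module.forall_dual_apply_eq_zero_iff ℂ]
  intro f
  rw [map_sub, sub_eq_zero]
  have hfin : (Function.support fun q : Fin (N + 1) →₀ ℕ =>
      MvPolynomial.coeff l (∏ i, logZeta N i ^ q i) • logSubst q g).Finite :=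
    hq.subset fun q hq h0 => hq (by
      change _ • _ = _
      rw [h0, smul_zero])
  have hf : {l | f (g l) ≠ 0}.Finite := hg.subset fun l hl h0 => hl (by rw [h0, map_zero])
  have hP : ∑ i, MvPolynomial.pderiv i (toPoly hf) = 0 := pderiv_toPoly hf fun l => by
    have := congrArg f (h l)
    simpa using this
  have hsub : ∀ q, f (logSubst q g) =
      MvPolynomial.coeff q (MvPolynomial.aeval (logZ N) (toPoly hf)) := by
    intro q
    rw [coeff_aeval, logSubst_apply, map_sum, finsum_eq_sum_of_support_subset (s :=
      (finite_sum_nat (N := N + 2) (∑ i, q i)).toFinset)]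
    · refine Finset.sum_congr rfl fun l _ => ?_
      rw [coeff_toPoly, map_smul, smul_eq_mul, mul_comm]
      rfl
    · intro l hl
      by_contra hc
      refine hl ?_
      have h0 : logCoeff q l = 0 := logCoeff_eq_zero fun h => hc (by simp [h])
      change _ * logCoeff q l = 0
      rw [h0, mul_zero]
  refine (f.toAddMonoidHom.map_finsum hfin).trans ?_
  have h3 := congrArg (MvPolynomial.coeff l) (aeval_logZeta_aeval_logZ hP)
  rw [coeff_toPoly, coeff_aeval] at h3
  rw [← h3]
  refine finsum_congr fun q => ?_
  rw [← hsub, mul_comm]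
  exact map_smul f _ _

end polynomials

/-- The exponents of total degree `0` of `z` are those of the monomials in the `ζ_i`. -/
theorem zetaShift_neg_sum {N : ℕ} {t : Fin (N + 2) → ℂ} (ht : ∑ i, t i = 0) :
    zetaShift (fun i => -∑ j : Fin (N + 1), if j ≤ i then t j.castSucc else 0) = t := by
  set ν : Fin (N + 1) → ℂ := fun i => -∑ j : Fin (N + 1), if j ≤ i then t j.castSucc else 0
  have hν : ∀ i, ν i = -∑ l : Fin (N + 2), if l ≤ i.castSucc then t l else 0 := by
    intro i
    rw [Fin.sum_univ_castSucc, if_neg (not_le.mpr (Fin.castSucc_lt_last i)), add_zero]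
    rfl
  have ha : ∀ j : Fin (N + 2), ∑ i : Fin (N + 1), ν i * (if j = i.succ then 1 else 0) =
      -∑ l, if l < j then t l else 0 := by
    intro j
    refine Fin.cases ?_ (fun j => ?_) j
    · rw [Finset.sum_eq_zero, Finset.sum_eq_zero, neg_zero]
      · intro l _; rw [if_neg (by simp)]
      · intro i _; rw [if_neg (Fin.succ_ne_zero i).symm, mul_zero]
    · simp only [Fin.succ_inj, mul_ite, mul_one, mul_zero]
      rw [Finset.sum_ite_eq, if_pos (Finset.mem_univ _), hν]
      congr 1
      refine Finset.sum_congr rfl fun l _ => ?_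
      simp only [Fin.le_castSucc_iff]
  have hb : ∀ j : Fin (N + 2), ∑ i : Fin (N + 1), ν i * (if j = i.castSucc then 1 else 0) =
      -∑ l, if l ≤ j then t l else 0 := by
    intro j
    refine Fin.lastCases ?_ (fun j => ?_) j
    · rw [Finset.sum_eq_zero]
      · simp [Fin.le_last, ht]
      · intro i _; rw [if_neg (Fin.castSucc_lt_last i).ne', mul_zero]
    · simp only [Fin.castSucc_inj, mul_ite, mul_one, mul_zero]
      rw [Finset.sum_ite_eq, if_pos (Finset.mem_univ _), hν]
  funext j
  simp only [zetaShift, mul_sub, Finset.sum_sub_distrib]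
  rw [ha, hb, neg_sub_neg, ← Finset.sum_sub_distrib, Finset.sum_eq_single j]
  · simp
  · intro l _ hl
    rcases lt_or_gt_of_ne hl with h | h
    · rw [if_pos h.le, if_pos h, sub_self]
    · rw [if_neg (not_le.mpr h), if_neg (not_lt.mpr h.le), sub_self]
  · simp

section barF

variable {V : Type*} [AddCommGroup V] [Module ℂ V] [VertexOperatorAlgebra V] {n : ℕ}
  {M₀ : Type*} [AddCommGroup M₀] [Module ℂ M₀] [VOAModule V M₀]
  {M : Fin (n + 2) → Type*} [∀ i, AddCommGroup (M i)] [∀ i, Module ℂ (M i)]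
  [∀ i, VOAModule V (M i)] {F : (⨂[ℂ] i, M i) →ₗ[ℂ] LogSeries (n + 1) M₀}

theorem barF_eq_logSubst (Δ' : ℂ) (x : ⨂[ℂ] i, M i) (ν : Fin (n + 1) → ℂ) (q : Fin (n + 1) →₀ ℕ) :
    barF V Δ' F x ν q = logSubst q (barFz V Δ' F x (zetaShift ν)) := by
  rw [logSubst_eq_finsum, barF]
  refine finsum_congr fun l => ?_
  rw [logCoeff_eq]
  split_ifs
  · rfl
  · rw [zero_smul]

/-- `F̄` is a series in the `ζ_i` and their logarithms. -/
theorem IsPIO.barFz_eq_zetaToZ (hF : IsPIO V M₀ M F) {Δ' : ℂ} (hΔ' : IsGradedFrom V M₀ Δ')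
    (hM₀ : IsVModule V M₀) {Δ : Fin (n + 2) → ℂ} (hΔ : ∀ i, IsGradedFrom V (M i) (Δ i))
    (x : ⨂[ℂ] i, M i) : barFz V Δ' F x = zetaToZ (barF V Δ' F x) := by
  funext t l
  rw [zetaToZ]
  split_ifs with ht
  · simp only [barF_eq_logSubst]
    rw [zetaShift_neg_sum ht]
    exact (finsum_logSubst (finLog_of_logBdd (hF.barFz_mem_logBdd hΔ' hM₀ hΔ x) t)
      (fun l => hF.barFz_scale hΔ' hM₀ hΔ x t l) l).symm
  · rw [hF.barFz_of_ne hΔ' hM₀ hΔ x ht]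
    rfl

/-- `F̄` as a linear map. -/
def IsPIO.barLin (hF : IsPIO V M₀ M F) {Δ' : ℂ} (hΔ' : IsGradedFrom V M₀ Δ')
    (hM₀ : IsVModule V M₀) {Δ : Fin (n + 2) → ℂ} (hΔ : ∀ i, IsGradedFrom V (M i) (Δ i)) :
    (⨂[ℂ] i, M i) →ₗ[ℂ] LogSeries (n + 1) M₀ where
  toFun := barF V Δ' F
  map_add' x y := by
    funext ν q
    simp only [Pi.add_apply, barF_eq_logSubst]
    rw [hF.barFz_add hΔ' hM₀ hΔ, ← map_add]
    rfl
  map_smul' c x := by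
    funext ν q
    simp only [Pi.smul_apply, barF_eq_logSubst, RingHom.id_apply]
    rw [hF.barFz_smul hΔ' hM₀ hΔ, ← map_smul]
    rfl

theorem IsPIO.barF_logBdd (hF : IsPIO V M₀ M F) {Δ' : ℂ} (hΔ' : IsGradedFrom V M₀ Δ')
    (hM₀ : IsVModule V M₀) {Δ : Fin (n + 2) → ℂ} (hΔ : ∀ i, IsGradedFrom V (M i) (Δ i))
    (x : ⨂[ℂ] i, M i) : barF V Δ' F x ∈ logBdd (n + 1) M₀ := by
  obtain ⟨D, hD⟩ := hF.barFz_mem_logBdd hΔ' hM₀ hΔ x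
  refine ⟨(n + 2) * D, fun ν q h i => ?_⟩
  rw [barF_eq_logSubst] at h
  obtain ⟨l, h1, h2⟩ := exists_of_logSubst_ne_zero h
  have h3 : ∑ i, l i ≤ (n + 2) * D := by
    refine (Finset.sum_le_card_nsmul _ _ D fun i _ => hD _ l h2 i).trans ?_
    simp
  exact (Finset.single_le_sum (f := q) (fun _ _ => Nat.zero_le _) (Finset.mem_univ i)).trans
    (h1 ▸ h3)

end barF

/-! ### The exponents of the modified series -/

theorem modInt_eq_iff {x y : ℂ} : (x : ModInt) = (y : ModInt) ↔ ∃ z : ℤ, x = y + z := by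
  rw [eq_comm, QuotientAddGroup.eq, AddSubgroup.mem_zmultiples_iff]
  refine exists_congr fun z => ?_
  rw [zsmul_eq_mul, mul_one, eq_comm, ← sub_eq_neg_add, sub_eq_iff_eq_add']

theorem modInt_add_nat (x : ℂ) (z : ℕ) : ((x + z : ℂ) : ModInt) = (x : ModInt) :=
  modInt_eq_iff.mpr ⟨z, by simp⟩

theorem zetaExp_castSucc {n : ℕ} (t : Fin (n + 2) → ℂ) (i : Fin n) :
    zetaExp t i.castSucc = zetaExp (fun i => t i.castSucc) i + t (Fin.last (n + 1)) := by
  rw [zetaExp, Fin.sum_univ_castSucc, if_pos (Fin.castSucc_lt_last _), zetaExp]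
  rfl

theorem zetaShift_last {n : ℕ} (ν : Fin (n + 1) → ℂ) :
    zetaShift ν (Fin.last (n + 1)) = ν (Fin.last n) := by
  have h := congrFun (zetaExp_zetaShift ν) (Fin.last n)
  rw [zetaExp, Fin.sum_univ_castSucc, if_pos (Fin.castSucc_lt_last _), Finset.sum_eq_zero,
    zero_add] at h
  · exact h
  · intro l _
    refine if_neg (not_lt.mpr ?_)
    exact Fin.castSucc_le_castSucc_iff.mpr (Fin.le_last l)

/-- The exponent of `z` in the terms of `F̃` of weight `Δ'` on vectors of weights `w` that contribute
to `ζ^ν` in `F̄`. -/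
def tauExp {n : ℕ} (Δ' : ℂ) (ν : Fin (n + 1) → ℂ) (w : Fin (n + 2) → ℂ) : Fin (n + 2) → ℂ :=
  zetaShift ν + Pi.single 0 Δ' - w

theorem tauExp_last {n : ℕ} (Δ' : ℂ) (ν : Fin (n + 1) → ℂ) (w : Fin (n + 2) → ℂ) :
    tauExp Δ' ν w (Fin.last (n + 1)) = ν (Fin.last n) - w (Fin.last (n + 1)) := by
  simp [tauExp, zetaShift_last]

theorem interExp_tauExp {n : ℕ} (Δ' : ℂ) (ν : Fin (n + 1) → ℂ) (w : Fin (n + 2) → ℂ) (i : Fin n) :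
    interExp (fun i => tauExp Δ' ν w i.castSucc) w i =
      ν i.castSucc - tauExp Δ' ν w (Fin.last (n + 1)) := by
  have h := zetaExp_castSucc (tauExp Δ' ν w) i
  have h1 : zetaExp (Pi.single 0 Δ' : Fin (n + 2) → ℂ) i.castSucc = 0 := by
    refine Finset.sum_eq_zero fun l _ => ?_
    split_ifs with h
    · exact Pi.single_eq_of_ne (Fin.pos_iff_ne_zero.mp (lt_of_le_of_lt (Fin.zero_le _) h)) _
    · rfl
  have h2 : zetaExp (tauExp Δ' ν w) i.castSucc = ν i.castSucc - zetaExp w i.castSucc := by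
    rw [tauExp, zetaExp_sub, zetaExp_add, zetaExp_zetaShift, Pi.sub_apply, Pi.add_apply, h1, add_zero]
  rw [interExp, eq_sub_iff_add_eq, add_right_comm, ← h, h2]
  exact sub_add_cancel _ _

/-- Shifting the `x`-exponents by `j` changes the intermediate weights by an integer between `0` and
the total shift. -/
theorem interExp_add_nat {n : ℕ} (T : Fin (n + 1) → ℂ) (w : Fin (n + 2) → ℂ) (j : Fin (n + 1) → ℕ)
    (i : Fin n) : ∃ d : ℕ, interExp (fun i => T i + j i) w i + d = interExp T w i + ∑ i, (j i : ℂ) := by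
  refine ⟨∑ l : Fin (n + 1), if i.castSucc < l then 0 else j l, ?_⟩
  have h : interExp (fun i => T i + j i) w i =
      interExp T w i + zetaExp (fun i => (j i : ℂ)) i := by
    have := congrFun (zetaExp_add T (fun i => (j i : ℂ))) i
    rw [interExp, interExp, add_right_comm (zetaExp T i)]
    exact congrArg (· + _) this
  rw [h, add_assoc]
  congr 1
  rw [zetaExp]
  push_cast
  rw [← Finset.sum_add_distrib]
  refine Finset.sum_congr rfl fun l _ => ?_
  split_ifs <;> simp

theorem interExp_modInt {n : ℕ} (T : Fin (n + 1) → ℂ) (w w' : Fin (n + 2) → ℂ) (i : Fin n)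
    (h : ∀ l, (w l : ModInt) = (w' l : ModInt)) :
    (interExp T w i : ModInt) = (interExp T w' i : ModInt) := by
  choose z hz using fun l => modInt_eq_iff.mp (h l)
  refine modInt_eq_iff.mpr ⟨∑ l : Fin (n + 2), if i.castSucc.castSucc < l then z l else 0, ?_⟩
  rw [interExp, interExp, add_assoc (zetaExp T i)]
  congr 1
  push_cast
  rw [← Finset.sum_add_distrib]
  refine Finset.sum_congr rfl fun l _ => ?_
  split_ifs
  · exact hz l
  · simp

theorem neg_sum_zetaShift {n : ℕ} (ν : Fin (n + 1) → ℂ) :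
    (fun i => -∑ j : Fin (n + 1), if j ≤ i then zetaShift ν j.castSucc else 0) = ν := by
  have h := zetaShift_neg_sum (sum_zetaShift ν)
  rw [← zetaExp_zetaShift (fun i => -∑ j : Fin (n + 1), if j ≤ i then zetaShift ν j.castSucc else 0),
    h, zetaExp_zetaShift]

/-- If `x^T` has a coefficient of weight `Δ'` on vectors of weights `w`, its leading term
`∏ᵢ z_i^{T_i}` contributes to the monomial in `ζ` whose exponents are the weights of the intermediate
states and the weight of `m_r`. -/
theorem tauExp_snoc {n : ℕ} {Δ' : ℂ} {T : Fin (n + 1) → ℂ} {w : Fin (n + 2) → ℂ}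
    (hT : ∑ i, w i + ∑ i, T i = Δ') :
    tauExp Δ' (Fin.snoc (α := fun _ => ℂ) (interExp T w) (w (Fin.last (n + 1)))) w =
      Fin.snoc (α := fun _ => ℂ) T 0 := by
  set τ : Fin (n + 2) → ℂ := Fin.snoc (α := fun _ => ℂ) T 0 with hτ0
  have ht : ∑ i, (w - Pi.single 0 Δ' + τ : Fin (n + 2) → ℂ) i = 0 := by
    have h1 : ∑ i, τ i = ∑ i, T i := by
      rw [Fin.sum_univ_castSucc]; simp [τ]
    simp only [Pi.add_apply, Pi.sub_apply, Finset.sum_add_distrib, Finset.sum_sub_distrib, h1]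
    rw [← hT]; simp
  obtain ⟨ν', hν'⟩ : ∃ ν', zetaShift ν' = w - Pi.single 0 Δ' + τ := ⟨_, zetaShift_neg_sum ht⟩
  have hτ : tauExp Δ' ν' w = τ := by
    rw [tauExp, hν']; abel
  rw [← hτ]
  congr 1
  have h1 : τ (Fin.last (n + 1)) = 0 := by simp [τ]
  have h2 := tauExp_last Δ' ν' w
  rw [hτ, h1] at h2
  funext i
  refine Fin.lastCases ?_ (fun i => ?_) i
  · rw [eq_comm, sub_eq_zero] at h2
    rw [h2, Fin.snoc_last]
  · have h3 := interExp_tauExp Δ' ν' w i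
    rw [hτ, h1, sub_zero] at h3
    rw [← h3, Fin.snoc_castSucc]
    simp [τ]

section exponents

variable {V : Type*} [AddCommGroup V] [Module ℂ V] [VertexOperatorAlgebra V] {n : ℕ}
  {M₀ : Type*} [AddCommGroup M₀] [Module ℂ M₀] [VOAModule V M₀]
  {M : Fin (n + 2) → Type*} [∀ i, AddCommGroup (M i)] [∀ i, Module ℂ (M i)]
  [∀ i, VOAModule V (M i)] {F : (⨂[ℂ] i, M i) →ₗ[ℂ] LogSeries (n + 1) M₀}

/-- A non-zero coefficient of `F̄` comes from a non-zero coefficient of weight `Δ'` of `F`, whose exponents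
of `ζ` are smaller or equal, as the expansion of `x_p = z_p - z_r` in powers of `z_r/z_p` only raises them. -/
theorem IsPIO.exists_of_barF_ne_zero (hF : IsPIO V M₀ M F) {Δ' : ℂ} (hΔ' : IsGradedFrom V M₀ Δ')
    (hM₀ : IsVModule V M₀) {Δ : Fin (n + 2) → ℂ} (hΔ : ∀ i, IsGradedFrom V (M i) (Δ i))
    {w : Fin (n + 2) → ℂ} {m : ∀ i, M i} (hm : Homog V w m)
    {ν : Fin (n + 1) → ℂ} {q : Fin (n + 1) →₀ ℕ}
    (h : barF V Δ' F (PiTensorProduct.tprod ℂ m) ν q ≠ 0) :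
    ∃ (k : Fin (n + 2) →₀ ℕ) (T : Fin (n + 1) → ℂ) (κ : Fin (n + 1) →₀ ℕ) (J : ℕ) (d : Fin n → ℕ),
      ∑ i, w i + ∑ i, T i = Δ' ∧ ν (Fin.last n) = w (Fin.last (n + 1)) + J ∧
      (∀ i, ν i.castSucc = interExp T w i + d i) ∧
      F (PiTensorProduct.tprod ℂ (npow V w m k)) T κ ≠ 0 := by
  rw [barF_eq_logSubst] at h
  obtain ⟨l, -, h2⟩ := exists_of_logSubst_ne_zero h
  obtain ⟨ht, e, -, h3⟩ := hF.exists_of_barFz_ne_zero hΔ' hM₀ hΔ hm h2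
  obtain ⟨k, l', j, κ, -, -, -, h4, h5⟩ := exists_of_twistZ_ne_zero
    (fun h0 => h3 (by rw [h0, map_zero]))
  have h6 := sum_shift_total ht h4
  change tauExp Δ' ν w (Fin.last (n + 1)) = _ at h4
  choose d hd using interExp_add_nat (fun i => tauExp Δ' ν w i.castSucc) w j
  refine ⟨k, _, κ, ∑ i, j i, d, h6, ?_, fun i => ?_, h5⟩
  · rw [tauExp_last, sub_eq_iff_eq_add'] at h4
    rw [h4]; push_cast; rfl
  · refine Eq.trans ?_ (hd i).symm
    rw [interExp_tauExp, h4, sub_add_cancel]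

theorem exists_lower_bound (S : Finset ℂ) (lam : ModInt) :
    ∃ c : ℂ, (c : ModInt) = lam ∧ ∀ b ∈ S, (b : ModInt) = lam → ∃ k : ℕ, b = c + k := by
  classical
  induction S using Finset.induction_on with
  | empty =>
    obtain ⟨c, rfl⟩ := QuotientAddGroup.mk_surjective lam
    exact ⟨c, rfl, by simp⟩
  | insert b S _ ih =>
    obtain ⟨c, rfl, hc⟩ := ih
    by_cases hb : (b : ModInt) = (c : ModInt)
    · obtain ⟨z, hz⟩ := modInt_eq_iff.mp hb
      refine ⟨c - (z.natAbs : ℕ), ?_, fun b' hb' hl => ?_⟩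
      · refine modInt_eq_iff.mpr ⟨-(z.natAbs : ℤ), ?_⟩
        rw [sub_eq_add_neg, Int.cast_neg, Int.cast_natCast]
      · rcases Finset.mem_insert.mp hb' with rfl | hb'
        · refine ⟨(z + z.natAbs).toNat, ?_⟩
          have h1 : (((z + z.natAbs).toNat : ℤ) : ℂ) = ((z + z.natAbs : ℤ) : ℂ) := by
            congr 1
            exact Int.toNat_of_nonneg (by omega)
          rw [Int.cast_natCast] at h1
          rw [h1, hz, Int.cast_add, Int.cast_natCast]; ring
        · obtain ⟨k, hk⟩ := hc b' hb' hl
          exact ⟨k + z.natAbs, by rw [hk]; push_cast; ring⟩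
    · refine ⟨c, rfl, fun b' hb' hl => ?_⟩
      rcases Finset.mem_insert.mp hb' with rfl | hb'
      · exact absurd hl hb
      · exact hc b' hb' hl

theorem pLam_ne_zero {N : ℕ} {W : Type*} [AddCommGroup W] {lam : Fin N → ModInt}
    {G : LogSeries (N + 1) W} {ν : Fin (N + 1) → ℂ} {q : Fin (N + 1) →₀ ℕ} :
    pLam lam G ν q ≠ 0 ↔ (∀ i : Fin N, (ν i.castSucc : ModInt) = lam i) ∧ G ν q ≠ 0 := by
  rw [pLam]
  split_ifs with h
  · exact ⟨fun h2 => ⟨h, h2⟩, fun h2 => h2.2⟩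
  · exact ⟨fun h2 => absurd rfl h2, fun h2 => absurd h2.1 h⟩

/-- The poles of `F̄` are bounded below: the exponents of `F` are, by `IsPIO.exists_bound`, and those of
`F̄` are not smaller. -/
theorem IsPIO.exists_pole_bound (hF : IsPIO V M₀ M F) {Δ' : ℂ} (hΔ' : IsGradedFrom V M₀ Δ')
    (hM₀ : IsVModule V M₀) {Δ : Fin (n + 2) → ℂ} (hΔ : ∀ i, IsGradedFrom V (M i) (Δ i))
    (hM : ∀ i, IsVModule V (M i)) (hC : ∀ i, IsCOneCofinite V (M i)) (lam : Fin n → ModInt) :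
    ∃ c : Fin n → ℂ, (∀ i, (c i : ModInt) = lam i) ∧ ∀ x ν q,
      pLam lam (barF V Δ' F x) ν q ≠ 0 → ∃ k : Fin (n + 1) → ℕ,
        (∀ i : Fin n, ν i.castSucc = c i + k i.castSucc) ∧
          ν (Fin.last n) = Δ (Fin.last (n + 1)) + k (Fin.last n) := by
  classical
  obtain ⟨B, hB⟩ := hF.exists_bound hΔ' hM₀ hΔ hM hC
  choose c hc hc2 using fun i => exists_lower_bound (B.image fun b => b i) (lam i)
  refine ⟨c, hc, fun x ν q h => ?_⟩
  obtain ⟨hν, h⟩ := pLam_ne_zero.mp h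
  by_contra hno
  refine h ?_
  let L : (⨂[ℂ] i, M i) →ₗ[ℂ] M₀ := LinearMap.proj q ∘ₗ LinearMap.proj ν ∘ₗ hF.barLin hΔ' hM₀ hΔ
  refine tensor_induction hΔ (LinearMap.ker L) (fun e m hm => ?_) x
  by_contra hne
  obtain ⟨k, T, κ, J, d, h1, h2, h3, h4⟩ := hF.exists_of_barF_ne_zero hΔ' hM₀ hΔ hm hne
  obtain ⟨b, hb, f, hf⟩ := hB e _ (hm.npow k) T κ h1 h4
  have hbl : ∀ i, (b i : ModInt) = lam i := by
    intro i
    rw [← hν i, h3, hf, modInt_add_nat, modInt_add_nat]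
  choose g hg using fun i => hc2 i (b i) (Finset.mem_image_of_mem _ hb) (hbl i)
  refine hno ⟨Fin.snoc (α := fun _ => ℕ) (fun i => g i + f i + d i) (e (Fin.last (n + 1)) + J), ?_, ?_⟩
  · intro i
    rw [Fin.snoc_castSucc, h3, hf, hg]
    push_cast; ring
  · rw [Fin.snoc_last, h2]
    push_cast; ring

/-! ### From `F` to the modified series -/

/-- The factor `z_1^{-L(0)}` is invertible. -/
theorem IsPIO.twistZ_eq_zero (hF : IsPIO V M₀ M F) {Δ' : ℂ} (hΔ' : IsGradedFrom V M₀ Δ')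
    (hM₀ : IsVModule V M₀) {Δ : Fin (n + 2) → ℂ} (hΔ : ∀ i, IsGradedFrom V (M i) (Δ i))
    {w : Fin (n + 2) → ℂ} {m : ∀ i, M i} (hm : Homog V w m)
    {t : Fin (n + 2) → ℂ} (ht : ∑ i, t i = 0)
    (h : ∀ l, barFz V Δ' F (PiTensorProduct.tprod ℂ m) t l = 0) (l : Fin (n + 2) →₀ ℕ) :
    twistZ V F w m (t + Pi.single 0 Δ') l = 0 := by
  induction hN : l 0 using Nat.strong_induction_on generalizing l with
  | _ N ih =>
    have h1 := h l
    rw [hF.barFz_tprod hΔ' hM₀ hΔ hm ht, Finset.sum_eq_single 0] at h1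
    · simpa using h1
    · intro k hk hk0
      have h2 := Finset.mem_range.mp hk
      rw [ih ((l - Finsupp.single 0 k : Fin (n + 2) →₀ ℕ) 0) ?_ _ rfl, map_zero, smul_zero]
      rw [Finsupp.tsub_apply, Finsupp.single_eq_same]
      omega
    · intro h0; exact absurd (Finset.mem_range.mpr (Nat.succ_pos _)) h0

omit [VOAModule V M₀] in
/-- The factors `z_i^{L(0)}` are invertible; the proof is by induction on the sum of the nilpotency
orders of the `m_i`. -/
theorem toZ_eq_zero_of_twistZ {w : Fin (n + 2) → ℂ} (t : Fin (n + 2) → ℂ)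
    (h : ∀ m, Homog V w m → ∀ l, twistZ V F w m t l = 0) {m : ∀ i, M i} (hm : Homog V w m)
    (l : Fin (n + 2) →₀ ℕ) : toZ (F (PiTensorProduct.tprod ℂ m)) (t - w) l = 0 := by
  suffices H : ∀ (N : ℕ) (e : Fin (n + 2) → ℕ) (m : ∀ i, M i), Homog V w m → ∑ i, e i = N →
      (∀ i, (nil V (M i) (w i) ^ e i) (m i) = 0) → ∀ l,
      toZ (F (PiTensorProduct.tprod ℂ m)) (t - w) l = 0 by
    choose e he using fun i => mem_wt_iff.mp (hm i)
    exact H _ e m hm rfl he l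
  intro N
  induction N using Nat.strong_induction_on with
  | _ N ih =>
    intro e m hm hN he l
    by_cases h0 : ∃ i, e i = 0
    · obtain ⟨i, hi⟩ := h0
      have := he i
      rw [hi, pow_zero, Module.End.one_apply] at this
      rw [tprod_eq_zero this, map_zero, toZ_zero]
    · push Not at h0
      have h1 := h m hm l
      rw [twistZ, Finset.sum_eq_single (0, l)] at h1
      · rwa [npow_zero] at h1
      · rintro ⟨k, l'⟩ hk hne
        have hk0 : k ≠ 0 := by
          rintro rfl
          refine hne (Prod.ext rfl ?_)
          simpa using Finset.HasAntidiagonal.mem_antidiagonal.mp hk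
        obtain ⟨i, hi⟩ := Finsupp.ne_iff.mp hk0
        refine ih (∑ i, (e i - k i)) ?_ (fun i => e i - k i) _ (hm.npow k) rfl (fun i => ?_) l'
        · rw [← hN]
          refine Finset.sum_lt_sum (fun _ _ => Nat.sub_le _ _) ⟨i, Finset.mem_univ i, ?_⟩
          have := h0 i
          have hi' : k i ≠ 0 := hi
          omega
        · rw [npow, map_smul, ← Module.End.mul_apply, ← pow_add]
          have : e i - k i + k i = (e i - k i + k i - e i) + e i := by omega
          rw [this, pow_add, Module.End.mul_apply, he, map_zero, smul_zero]
      · intro h2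
        exact absurd (Finset.HasAntidiagonal.mem_antidiagonal.mpr (zero_add l)) h2

theorem IsPIO.barFz_eq_zero (hF : IsPIO V M₀ M F) {Δ' : ℂ} (hΔ' : IsGradedFrom V M₀ Δ')
    (hM₀ : IsVModule V M₀) {Δ : Fin (n + 2) → ℂ} (hΔ : ∀ i, IsGradedFrom V (M i) (Δ i))
    {x : ⨂[ℂ] i, M i} {ν : Fin (n + 1) → ℂ} (h : ∀ q, barF V Δ' F x ν q = 0)
    (l : Fin (n + 2) →₀ ℕ) : barFz V Δ' F x (zetaShift ν) l = 0 := by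
  rw [hF.barFz_eq_zetaToZ hΔ' hM₀ hΔ, zetaToZ, if_pos (sum_zetaShift ν)]
  refine finsum_eq_zero_of_forall_eq_zero fun q => ?_
  rw [neg_sum_zetaShift, h, smul_zero]

theorem exists_snoc_zero (κ : Fin (n + 1) →₀ ℕ) : ∃ l : Fin (n + 2) →₀ ℕ,
    l (Fin.last (n + 1)) = 0 ∧
      (Finsupp.equivFunOnFinite.symm fun i : Fin (n + 1) => l i.castSucc) = κ :=
  ⟨Finsupp.equivFunOnFinite.symm (Fin.snoc (α := fun _ => ℕ) (fun i => κ i) 0),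
    Fin.snoc_last (α := fun _ => ℕ) _ _,
    Finsupp.ext fun i => Fin.snoc_castSucc (α := fun _ => ℕ) _ _ i⟩

/-- If the coefficient of `ζ^ν` in `F̄` vanishes and `z_r` does not occur in the corresponding terms of
`F̃`, the latter are terms of `F`, and they vanish. -/
theorem IsPIO.eq_zero_of_barF (hF : IsPIO V M₀ M F) {Δ' : ℂ} (hΔ' : IsGradedFrom V M₀ Δ')
    (hM₀ : IsVModule V M₀) {Δ : Fin (n + 2) → ℂ} (hΔ : ∀ i, IsGradedFrom V (M i) (Δ i))
    {w : Fin (n + 2) → ℂ} {m : ∀ i, M i} (hm : Homog V w m) {ν : Fin (n + 1) → ℂ}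
    (hν : tauExp Δ' ν w (Fin.last (n + 1)) = 0) (h : ∀ x q, barF V Δ' F x ν q = 0)
    (κ : Fin (n + 1) →₀ ℕ) :
    F (PiTensorProduct.tprod ℂ m) (fun i => tauExp Δ' ν w i.castSucc) κ = 0 := by
  obtain ⟨l, hl, hlκ⟩ := exists_snoc_zero κ
  have h1 : ∀ m, Homog V w m → ∀ l, twistZ V F w m (zetaShift ν + Pi.single 0 Δ') l = 0 :=
    fun m hm l => hF.twistZ_eq_zero hΔ' hM₀ hΔ hm (sum_zetaShift ν)
      (fun l => hF.barFz_eq_zero hΔ' hM₀ hΔ (h _) l) l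
  have h3 := toZ_eq_zero_of_twistZ _ h1 hm l
  have h4 := toZ_last_zero (F (PiTensorProduct.tprod ℂ m)) hν hl
  rw [hlκ] at h4
  exact h4.symm.trans h3

/-- A non-zero coefficient of `F` of weight `Δ'` gives a non-zero coefficient of `F̄`. -/
theorem IsPIO.exists_barF_ne_zero (hF : IsPIO V M₀ M F) {Δ' : ℂ} (hΔ' : IsGradedFrom V M₀ Δ')
    (hM₀ : IsVModule V M₀) {Δ : Fin (n + 2) → ℂ} (hΔ : ∀ i, IsGradedFrom V (M i) (Δ i))
    {w : Fin (n + 2) → ℂ} {m : ∀ i, M i} (hm : Homog V w m) {T : Fin (n + 1) → ℂ}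
    (hT : ∑ i, w i + ∑ i, T i = Δ') {κ : Fin (n + 1) →₀ ℕ}
    (h : F (PiTensorProduct.tprod ℂ m) T κ ≠ 0) :
    ∃ x q, barF V Δ' F x
      (Fin.snoc (α := fun _ => ℂ) (interExp T w) (w (Fin.last (n + 1)))) q ≠ 0 := by
  by_contra hc
  push Not at hc
  have h1 := tauExp_snoc hT
  have h2 := hF.eq_zero_of_barF hΔ' hM₀ hΔ hm (by rw [h1]; exact Fin.snoc_last _ _) hc κ
  rw [h1] at h2
  simp only [Fin.snoc_castSucc] at h2
  exact h h2

/-! ### Non-vanishing -/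

/-- As `M₀^∨` is generated by its lowest weight space, `F` is determined by its part of weight
`Δ'`. -/
theorem IsPIO.exists_ne_zero (hF : IsPIO V M₀ M F) {Δ' : ℂ} (hΔ' : IsGradedFrom V M₀ Δ')
    (hM₀ : IsVModule V M₀) {Δ : Fin (n + 2) → ℂ} (hΔ : ∀ i, IsGradedFrom V (M i) (Δ i))
    (hgen₀ : IsDualGeneratedBy V M₀ Δ') (hne : F ≠ 0) :
    ∃ (k : Fin (n + 2) → ℕ) (m : ∀ i, M i) (T : Fin (n + 1) → ℂ) (κ : Fin (n + 1) →₀ ℕ),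
      Homog V (fun i => Δ i + k i) m ∧ ∑ i, (Δ i + k i) + ∑ i, T i = Δ' ∧
        F (PiTensorProduct.tprod ℂ m) T κ ≠ 0 := by
  by_contra hc
  push Not at hc
  refine hne (LinearMap.ext fun x => funext fun T => funext fun κ =>
    hΔ'.eq_zero_of_resDual hM₀ fun u hu => ?_)
  -- by the Borcherds identity, the functionals that vanish on all coefficients are stable under the
  -- modes of the contragredient module
  let W : Submodule ℂ (Module.Dual ℂ M₀) :=
    { carrier := {u | ∀ x T κ, u (F x T κ) = 0}
      add_mem' := fun {u v} hu hv x T κ => by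
        rw [LinearMap.add_apply, hu, hv, add_zero]
      zero_mem' := fun x T κ => rfl
      smul_mem' := fun c u hu x T κ => by rw [LinearMap.smul_apply, hu, smul_zero] }
  refine hgen₀ W (fun u hu x T κ => ?_) (fun d a ha j u hu x T κ => ?_) hu x T κ
  · have : u ∘ₗ LinearMap.proj κ ∘ₗ LinearMap.proj T ∘ₗ F = 0 := by
      refine tensor_hom_ext hΔ fun k m hm => ?_
      change u (F _ T κ) = 0
      by_cases e : ∑ i, (Δ i + k i) + ∑ i, T i = Δ'
      · rw [hc k m T κ hm e, map_zero]
      · exact apply_eq_zero_of_mem_wtDual hu (hF.mem_wt hΔ' hM₀ hm T κ) e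
    exact LinearMap.congr_fun this x
  · rw [dualMode, LinearMap.sum_apply]
    refine Finset.sum_eq_zero fun k _ => ?_
    rw [LinearMap.smul_apply, LinearMap.comp_apply]
    have h1 := hF.borcherds_last ((vir V V 1 ^ k) a) (2 * d - 2 - k - j) x T κ
    rw [eq_sub_iff_add_eq] at h1
    rw [← h1, map_add, hu, zero_add]
    have h2 : ∑ s ∈ Finset.univ.erase (Fin.last (n + 1)), ∑ᶠ k' : ℕ,
        ((Ring.choose (2 * d - 2 - k - j : ℤ) k' : ℤ) : ℂ) •
        F (slot s (md (M s) ((vir V V 1 ^ k) a) k') x)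
          (T - leafExp s (((2 * d - 2 - k - j : ℤ) : ℂ) - k')) κ ∈ LinearMap.ker u := by
      refine Submodule.sum_mem _ fun s _ => ?_
      refine finsum_induction (· ∈ LinearMap.ker u) (Submodule.zero_mem _)
        (fun _ _ => Submodule.add_mem _) fun k' => Submodule.smul_mem _ _ (hu _ _ _)
    rw [LinearMap.mem_ker.mp h2, smul_zero]

/-- As `M_r` is generated by its lowest weight space, `F` does not vanish on it. The classes modulo `ℤ` of
the exponents of `ζ` can be kept, since the modes of `V` change exponents by integers. -/
theorem IsPIO.exists_lowest_ne_zero (hF : IsPIO V M₀ M F) {Δ' : ℂ} (hΔ' : IsGradedFrom V M₀ Δ')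
    (hM₀ : IsVModule V M₀) {Δ : Fin (n + 2) → ℂ} (hΔ : ∀ i, IsGradedFrom V (M i) (Δ i))
    (hgen : IsGeneratedBy V (M (Fin.last (n + 1))) (Δ (Fin.last (n + 1))))
    {w : Fin (n + 2) → ℂ} {m : ∀ i, M i} (hm : Homog V w m) {T : Fin (n + 1) → ℂ}
    (hT : ∑ i, w i + ∑ i, T i = Δ') {κ : Fin (n + 1) →₀ ℕ}
    (h : F (PiTensorProduct.tprod ℂ m) T κ ≠ 0) :
    ∃ (k : Fin (n + 2) → ℕ) (m' : ∀ i, M i) (T' : Fin (n + 1) → ℂ) (κ' : Fin (n + 1) →₀ ℕ),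
      k (Fin.last (n + 1)) = 0 ∧ Homog V (fun i => Δ i + k i) m' ∧
      ∑ i, (Δ i + k i) + ∑ i, T' i = Δ' ∧
      (∀ i, (interExp T' Δ i : ModInt) = (interExp T Δ i : ModInt)) ∧
      F (PiTensorProduct.tprod ℂ m') T' κ' ≠ 0 := by
  by_contra hc
  push Not at hc
  -- the vectors `m_r` on which the components of `F` of weight `Δ'` vanish; operators that raise the
  -- weight preserve them, as the functionals of lowest weight kill the term with `a` acting on `M₀`
  let W : Submodule ℂ (M (Fin.last (n + 1))) :=
    { carrier := {y | ∀ m : ∀ i, M i, ∀ u ∈ wtDual V M₀ Δ', ∀ (T' : Fin (n + 1) → ℂ) κ',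
        (∀ i, (interExp T' Δ i : ModInt) = (interExp T Δ i : ModInt)) →
        u (F (PiTensorProduct.tprod ℂ (Function.update m (Fin.last (n + 1)) y)) T' κ') = 0}
      add_mem' := fun {y y'} hy hy' m u hu T' κ' hT' => by
        rw [MultilinearMap.map_update_add, map_add, Pi.add_apply, Pi.add_apply, map_add,
          hy m u hu T' κ' hT', hy' m u hu T' κ' hT', add_zero]
      zero_mem' := fun m u hu T' κ' hT' => by
        rw [MultilinearMap.map_update_zero, map_zero]
        exact map_zero u
      smul_mem' := fun c y hy m u hu T' κ' hT' => by
        rw [MultilinearMap.map_update_smul, map_smul, Pi.smul_apply, Pi.smul_apply, map_smul,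
          hy m u hu T' κ' hT', smul_zero] }
  have hW : W = ⊤ := by
    refine (hΔ _).eq_top_of_raising hgen W ?_ ?_
    · intro y hy m u hu T' κ' hT'
      let p := (wt V (M (Fin.last (n + 1))) (Δ (Fin.last (n + 1)))).subtype ∘ₗ
        genProj V (M (Fin.last (n + 1))) (Δ (Fin.last (n + 1)))
      have hp : u ∘ₗ LinearMap.proj κ' ∘ₗ LinearMap.proj T' ∘ₗ F ∘ₗ slot (Fin.last (n + 1)) p = 0 := by
        refine tensor_hom_ext hΔ fun k m hm => ?_
        change u (F (slot _ p _) T' κ') = 0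
        rw [slot_tprod]
        by_cases hk : k (Fin.last (n + 1)) = 0
        · have h1 : p (m (Fin.last (n + 1))) = m (Fin.last (n + 1)) :=
            (hΔ _).genProj_of_mem (by simpa [hk] using hm (Fin.last (n + 1)))
          rw [h1, Function.update_eq_self]
          by_cases e : ∑ i, (Δ i + k i) + ∑ i, T' i = Δ'
          · rw [hc k m T' κ' hk hm e hT', map_zero]
          · exact apply_eq_zero_of_mem_wtDual hu (hF.mem_wt hΔ' hM₀ hm T' κ') e
        · have h1 : p (m (Fin.last (n + 1))) = 0 := by
            have := (hΔ _).genProj_of_mem_ne (h := Δ (Fin.last (n + 1))) (hm (Fin.last (n + 1)))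
              (by simpa using hk)
            exact congrArg Subtype.val this
          rw [h1, MultilinearMap.map_update_zero, map_zero]
          exact map_zero u
      have h2 := LinearMap.congr_fun hp (PiTensorProduct.tprod ℂ
        (Function.update m (Fin.last (n + 1)) y))
      change u (F (slot _ p _) T' κ') = 0 at h2
      rw [slot_tprod] at h2
      have h3 : p y = y := (hΔ _).genProj_of_mem hy
      simpa [h3] using h2
    · intro d a ha j hj y hy m u hu T' κ' hT'
      have h1 := hF.borcherds_last a j (PiTensorProduct.tprod ℂ
        (Function.update m (Fin.last (n + 1)) y)) T' κ'
      rw [slot_tprod, Function.update_self, Function.update_idem] at h1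
      rw [h1, map_sub, hΔ'.wtDual_md hu ha hj, zero_sub, neg_eq_zero]
      refine LinearMap.mem_ker.mp (Submodule.sum_mem _ fun s hs => ?_)
      refine finsum_induction (· ∈ LinearMap.ker u) (Submodule.zero_mem _)
        (fun _ _ => Submodule.add_mem _) fun k' => Submodule.smul_mem _ _ ?_
      have hs' := Finset.ne_of_mem_erase hs
      rw [slot_tprod, Function.update_of_ne hs', Function.update_comm hs'.symm]
      refine hy _ u hu _ κ' fun i => ?_
      rw [← hT' i, interExp_sub, zetaExp_leafExp hs']
      refine modInt_eq_iff.mpr ⟨-(if i.castSucc.castSucc < s then j - k' else 0), ?_⟩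
      split_ifs <;> push_cast <;> ring
  have h1 : ∀ u ∈ wtDual V M₀ Δ', u (F (PiTensorProduct.tprod ℂ m) T κ) = 0 := by
    intro u hu
    have h2 : m (Fin.last (n + 1)) ∈ W := by rw [hW]; trivial
    have h3 := h2 m u hu T κ fun _ => rfl
    rwa [Function.update_eq_self] at h3
  have h2 := hF.mem_wt hΔ' hM₀ hm T κ
  rw [hT] at h2
  obtain ⟨S, hS, hS2⟩ := hΔ'.exists_functionals hM₀ Δ'
  obtain ⟨u, hu, hu2⟩ := hS2 (F (PiTensorProduct.tprod ℂ m) T κ) (fun h0 => h (by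
    rw [← hΔ'.genProj_of_mem h2, h0]; rfl))
  exact hu2 (h1 u (hS u hu))

theorem mem_expSet_iff {Δ' : ℂ} {Δ : Fin (n + 2) → ℂ}
    {lam : Fin n → ModInt} {k : Fin n → ℂ} :
    k ∈ expSet V Δ' (Δ (Fin.last (n + 1))) F lam ↔ (∀ i, (k i : ModInt) = lam i) ∧
      ∃ x q, barF V Δ' F x (Fin.snoc (α := fun _ => ℂ) k (Δ (Fin.last (n + 1)))) q ≠ 0 := by
  simp only [expSet, Set.mem_ofPred_eq, pLam_ne_zero, Fin.snoc_castSucc]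
  constructor
  · rintro ⟨x, q, h1, h2⟩; exact ⟨h1, x, q, h2⟩
  · rintro ⟨h1, x, q, h2⟩; exact ⟨x, q, h1, h2⟩

/-- If `p_λ F̄` does not vanish, neither does its part of degree `Δ_r` in `ζ_{r-1}`, since `M_r` is
generated by its lowest weight space; and it has minimal exponents, as its exponents are bounded
below. -/
theorem IsPIO.leadSet_nonempty (hF : IsPIO V M₀ M F) {Δ' : ℂ} (hΔ' : IsGradedFrom V M₀ Δ')
    (hM₀ : IsVModule V M₀) {Δ : Fin (n + 2) → ℂ} (hΔ : ∀ i, IsGradedFrom V (M i) (Δ i))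
    (hM : ∀ i, IsVModule V (M i)) (hC : ∀ i, IsCOneCofinite V (M i))
    (hgen : IsGeneratedBy V (M (Fin.last (n + 1))) (Δ (Fin.last (n + 1)))) {lam : Fin n → ModInt}
    (hne : ∃ x, pLam lam (barF V Δ' F x) ≠ 0) :
    (leadSet V Δ' (Δ (Fin.last (n + 1))) F lam).Nonempty := by
  have hS : (expSet V Δ' (Δ (Fin.last (n + 1))) F lam).Nonempty := by
    obtain ⟨x, hx⟩ := hne
    obtain ⟨ν, hx⟩ := Function.ne_iff.mp hx
    obtain ⟨q, hx⟩ := Function.ne_iff.mp hx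
    obtain ⟨hν, hx⟩ := pLam_ne_zero.mp hx
    obtain ⟨e, m, hm, hb⟩ : ∃ (e : Fin (n + 2) → ℕ) (m : ∀ i, M i), Homog V (fun i => Δ i + e i) m ∧
        barF V Δ' F (PiTensorProduct.tprod ℂ m) ν q ≠ 0 := by
      by_contra hc
      push Not at hc
      let L : (⨂[ℂ] i, M i) →ₗ[ℂ] M₀ := LinearMap.proj q ∘ₗ LinearMap.proj ν ∘ₗ hF.barLin hΔ' hM₀ hΔ
      exact hx (tensor_induction hΔ (LinearMap.ker L) (fun e m hm => hc e m hm) x)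
    obtain ⟨k, T, κ, J, d, h1, -, h3, h4⟩ := hF.exists_of_barF_ne_zero hΔ' hM₀ hΔ hm hb
    obtain ⟨k', m', T', κ', g1, g2, g3, g4, g5⟩ := hF.exists_lowest_ne_zero hΔ' hM₀ hΔ hgen
      (hm.npow k) h1 h4
    have hmod : ∀ (k : Fin (n + 2) → ℕ) T i, (interExp T (fun i => Δ i + k i) i : ModInt) =
        (interExp T Δ i : ModInt) := fun k T i => interExp_modInt T _ _ i fun l => modInt_add_nat _ _
    obtain ⟨x', q', hx'⟩ := hF.exists_barF_ne_zero hΔ' hM₀ hΔ g2 g3 g5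
    rw [g1, Nat.cast_zero, add_zero] at hx'
    refine ⟨_, mem_expSet_iff.mpr ⟨fun i => ?_, x', q', hx'⟩⟩
    rw [hmod, g4, ← hmod e, ← hν i, h3, modInt_add_nat]
  obtain ⟨c, -, hc⟩ := hF.exists_pole_bound hΔ' hM₀ hΔ hM hC lam
  have hk : ∀ k ∈ expSet V Δ' (Δ (Fin.last (n + 1))) F lam, ∃ e : Fin n → ℕ, ∀ i, k i = c i + e i := by
    rintro k ⟨x, q, h⟩
    obtain ⟨e, he, -⟩ := hc x _ q h
    exact ⟨fun i => e i.castSucc, fun i => by simpa using he i⟩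
  -- an exponent with the smallest possible `∑ᵢ eᵢ`
  obtain ⟨N, ⟨h, hh, e, he, hN⟩, hmin⟩ := Nat.lt_wfRel.wf.has_min
    {N : ℕ | ∃ k ∈ expSet V Δ' (Δ (Fin.last (n + 1))) F lam, ∃ e : Fin n → ℕ,
      (∀ i, k i = c i + e i) ∧ ∑ i, e i = N}
    (by obtain ⟨k, hk'⟩ := hS; obtain ⟨e, he⟩ := hk k hk'; exact ⟨_, k, hk', e, he, rfl⟩)
  refine ⟨h, hh, fun k hk' hle => ?_⟩
  obtain ⟨f, hf⟩ := hk k hk'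
  have hfe : ∀ i, f i ≤ e i := by
    intro i
    obtain ⟨j, hj⟩ := hle i
    rw [he, hf, add_sub_add_left_eq_sub, sub_eq_iff_eq_add] at hj
    have : e i = j + f i := by exact_mod_cast hj
    omega
  have h1 : ¬ ∑ i, f i < N := hmin _ ⟨k, hk', f, hf, rfl⟩
  funext i
  rw [he, hf]
  have : f i = e i := by
    by_contra hne
    exact h1 (hN ▸ Finset.sum_lt_sum (fun i _ => hfe i) ⟨i, Finset.mem_univ i, lt_of_le_of_ne (hfe i) hne⟩)
  rw [this]

end exponents

/-! ### The leading coefficient -/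

section leadTwist

variable {n : ℕ} {W : Type*} [AddCommGroup W] [Module ℂ W]

/-- The powers of the logarithms that appear when the vectors `m_i` are replaced by `z_i^{L(0)}m_i`, for
families of coefficients without `z_r`. -/
def logTwist : ((Fin (n + 2) →₀ ℕ) → (Fin (n + 1) →₀ ℕ) → W) →ₗ[ℂ] (Fin (n + 2) →₀ ℕ) → W where
  toFun G l := ∑ x ∈ Finset.HasAntidiagonal.antidiagonal l, if x.2 (Fin.last (n + 1)) = 0 then
    G x.1 (Finsupp.equivFunOnFinite.symm fun i => x.2 i.castSucc) else 0
  map_add' G G' := by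
    funext l
    rw [Pi.add_apply, ← Finset.sum_add_distrib]
    refine Finset.sum_congr rfl fun x _ => ?_
    split_ifs
    · rfl
    · rw [add_zero]
  map_smul' c G := by
    funext l
    rw [Pi.smul_apply, Finset.smul_sum]
    refine Finset.sum_congr rfl fun x _ => ?_
    split_ifs
    · rfl
    · rw [smul_zero]

theorem logTwist_apply (G : (Fin (n + 2) →₀ ℕ) → (Fin (n + 1) →₀ ℕ) → W) (l : Fin (n + 2) →₀ ℕ) :
    logTwist G l = ∑ x ∈ Finset.HasAntidiagonal.antidiagonal l,
      if x.2 (Fin.last (n + 1)) = 0 then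
        G x.1 (Finsupp.equivFunOnFinite.symm fun i => x.2 i.castSucc) else 0 := rfl

/-- The coefficient of `(log ζ)^q` of the leading coefficient of `F̄`, in terms of the leading coefficients
of `F` on the vectors `npow V w m k`. Relations between coefficients of `F` that hold for all
`npow V w m k` carry over to `F̄` by linearity. -/
def leadTwist (q : Fin (n + 1) →₀ ℕ) :
    ((Fin (n + 2) →₀ ℕ) → (Fin (n + 1) →₀ ℕ) → W) →ₗ[ℂ] W :=
  logSubst q ∘ₗ logTwist

theorem map_leadTwist {W' : Type*} [AddCommGroup W'] [Module ℂ W'] (f : W →ₗ[ℂ] W')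
    (q : Fin (n + 1) →₀ ℕ) (G : (Fin (n + 2) →₀ ℕ) → (Fin (n + 1) →₀ ℕ) → W) :
    f (leadTwist q G) = leadTwist q fun k κ => f (G k κ) := by
  simp only [leadTwist, LinearMap.comp_apply, logSubst_apply, map_sum, map_smul, logTwist_apply]
  refine Finset.sum_congr rfl fun l _ => ?_
  congr 1
  refine Finset.sum_congr rfl fun x _ => ?_
  split_ifs
  · rfl
  · exact map_zero f

end leadTwist

section lead

variable {V : Type*} [AddCommGroup V] [Module ℂ V] [VertexOperatorAlgebra V] {n : ℕ}
  {M₀ : Type*} [AddCommGroup M₀] [Module ℂ M₀] [VOAModule V M₀]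
  {M : Fin (n + 2) → Type*} [∀ i, AddCommGroup (M i)] [∀ i, Module ℂ (M i)]
  [∀ i, VOAModule V (M i)] {F : (⨂[ℂ] i, M i) →ₗ[ℂ] LogSeries (n + 1) M₀}

/-- As `F̄` is expressed in the `log ζ_i` by setting `z_1 = 1`, the factor `z_1^{-L(0)}` drops out. -/
theorem IsPIO.barF_eq_twistZ (hF : IsPIO V M₀ M F) {Δ' : ℂ} (hΔ' : IsGradedFrom V M₀ Δ')
    (hM₀ : IsVModule V M₀) {Δ : Fin (n + 2) → ℂ} (hΔ : ∀ i, IsGradedFrom V (M i) (Δ i))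
    {w : Fin (n + 2) → ℂ} {m : ∀ i, M i} (hm : Homog V w m) (ν : Fin (n + 1) → ℂ)
    (q : Fin (n + 1) →₀ ℕ) : barF V Δ' F (PiTensorProduct.tprod ℂ m) ν q =
      logSubst q (twistZ V F w m (zetaShift ν + Pi.single 0 Δ')) := by
  rw [barF_eq_logSubst, logSubst_apply, logSubst_apply]
  refine Finset.sum_congr rfl fun l _ => ?_
  by_cases h : l 0 = 0
  · rw [hF.barFz_tprod hΔ' hM₀ hΔ hm (sum_zetaShift ν), h]
    simp
  · rw [logCoeff_eq, if_neg h, zero_smul, zero_smul]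

/-- The exponents of `x` in the terms of `F` that give the coefficient of `ζ^ν` in `F̄` when `m_r` has
weight `ν_{r-1}`. -/
def leadExp (Δ' : ℂ) (ν : Fin (n + 1) → ℂ) (w : Fin (n + 2) → ℂ) (i : Fin (n + 1)) : ℂ :=
  tauExp Δ' ν w i.castSucc

/-- When `m_r` has the lowest possible weight, no power of `z_r` comes from `x_p = z_p - z_r`. -/
theorem toZ_leadExp {W : Type*} [AddCommGroup W] [Module ℂ W] (G : LogSeries (n + 1) W) {Δ' : ℂ}
    {ν : Fin (n + 1) → ℂ} {w : Fin (n + 2) → ℂ} (hw : w (Fin.last (n + 1)) = ν (Fin.last n))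
    (l : Fin (n + 2) →₀ ℕ) : toZ G (zetaShift ν + Pi.single 0 Δ' - w) l =
      if l (Fin.last (n + 1)) = 0 then
        G (leadExp Δ' ν w) (Finsupp.equivFunOnFinite.symm fun i => l i.castSucc) else 0 := by
  split_ifs with h
  · refine toZ_last_zero G ?_ h
    change tauExp Δ' ν w _ = 0
    rw [tauExp_last, hw, sub_self]
  · by_contra hc
    obtain ⟨-, -, h1, -⟩ := exists_of_toZ_ne_zero hc
    exact h h1

omit [VOAModule V M₀] in
theorem twistZ_eq_logTwist {w : Fin (n + 2) → ℂ} (m : ∀ i, M i) {Δ' : ℂ} {ν : Fin (n + 1) → ℂ}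
    (hw : w (Fin.last (n + 1)) = ν (Fin.last n)) :
    twistZ V F w m (zetaShift ν + Pi.single 0 Δ') = logTwist fun k κ =>
      F (PiTensorProduct.tprod ℂ (npow V w m k)) (leadExp Δ' ν w) κ := by
  funext l
  rw [twistZ, logTwist_apply]
  exact Finset.sum_congr rfl fun x _ => toZ_leadExp _ hw _

theorem IsPIO.barF_lead (hF : IsPIO V M₀ M F) {Δ' : ℂ} (hΔ' : IsGradedFrom V M₀ Δ')
    (hM₀ : IsVModule V M₀) {Δ : Fin (n + 2) → ℂ} (hΔ : ∀ i, IsGradedFrom V (M i) (Δ i))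
    {w : Fin (n + 2) → ℂ} {m : ∀ i, M i} (hm : Homog V w m) {ν : Fin (n + 1) → ℂ}
    (hw : w (Fin.last (n + 1)) = ν (Fin.last n)) (q : Fin (n + 1) →₀ ℕ) :
    barF V Δ' F (PiTensorProduct.tprod ℂ m) ν q = leadTwist q fun k κ =>
      F (PiTensorProduct.tprod ℂ (npow V w m k)) (leadExp Δ' ν w) κ := by
  rw [hF.barF_eq_twistZ hΔ' hM₀ hΔ hm, twistZ_eq_logTwist m hw]
  rfl

/-- Modes commute with the nilpotent parts of `L(0)`, hence with the factors `z_i^{L(0)}` up to powers of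
`z_i`. -/
theorem npow_update_md (w : Fin (n + 2) → ℂ) (m : ∀ i, M i) {d : ℕ} {a : V} (ha : a ∈ grade V d)
    (p : Fin (n + 2)) (j : ℤ) (k : Fin (n + 2) →₀ ℕ) :
    npow V (Function.update w p (w p + (d - j - 1))) (Function.update m p (md (M p) a j (m p))) k =
      Function.update (npow V w m k) p (md (M p) a j (npow V w m k p)) := by
  funext i
  by_cases e : i = p
  · subst e
    simp only [npow, Function.update_self]
    rw [nil_pow_md ha, map_smul]
  · simp only [npow, Function.update_of_ne e]

theorem leadExp_update (Δ' : ℂ) (ν : Fin (n + 1) → ℂ) (w : Fin (n + 2) → ℂ) (p : Fin (n + 2))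
    (c : ℂ) : leadExp Δ' ν (Function.update w p (w p + c)) = leadExp Δ' ν w - leafExp p c := by
  funext i
  simp only [leadExp, tauExp, Pi.sub_apply, leafExp]
  by_cases e : i.castSucc = p
  · subst e
    rw [Function.update_self, if_pos rfl]; ring
  · rw [Function.update_of_ne e, if_neg e, sub_zero]

theorem leadExp_sum {Δ' : ℂ} {ν : Fin (n + 1) → ℂ} {w : Fin (n + 2) → ℂ}
    (hw : w (Fin.last (n + 1)) = ν (Fin.last n)) : ∑ i, w i + ∑ i, leadExp Δ' ν w i = Δ' := by
  have h := sum_add_single_sub (zetaShift ν) w Δ'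
  rw [sum_zetaShift, zero_add] at h
  change ∑ i, w i + ∑ i, tauExp Δ' ν w i = Δ' at h
  rw [Fin.sum_univ_castSucc (tauExp Δ' ν w), tauExp_last, hw, sub_self, add_zero] at h
  exact h

theorem interExp_leadExp {Δ' : ℂ} {ν : Fin (n + 1) → ℂ} {w : Fin (n + 2) → ℂ}
    (hw : w (Fin.last (n + 1)) = ν (Fin.last n)) (i : Fin n) :
    interExp (leadExp Δ' ν w) w i = ν i.castSucc := by
  have := interExp_tauExp Δ' ν w i
  rwa [tauExp_last, hw, sub_self, sub_zero] at this

theorem update_last_eq {w : Fin (n + 2) → ℂ} {p : Fin (n + 2)} {d : ℕ} {j : ℤ}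
    (hp : p = Fin.last (n + 1) → j = (d : ℤ) - 1) :
    Function.update w p (w p + ((d : ℂ) - j - 1)) (Fin.last (n + 1)) = w (Fin.last (n + 1)) := by
  by_cases e : p = Fin.last (n + 1)
  · subst e
    rw [hp rfl, Function.update_self]; push_cast; ring
  · rw [Function.update_of_ne (Ne.symm e)]

theorem IsPIO.barF_lead_slot (hF : IsPIO V M₀ M F) {Δ' : ℂ} (hΔ' : IsGradedFrom V M₀ Δ')
    (hM₀ : IsVModule V M₀) {Δ : Fin (n + 2) → ℂ} (hΔ : ∀ i, IsGradedFrom V (M i) (Δ i))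
    {w : Fin (n + 2) → ℂ} {m : ∀ i, M i} (hm : Homog V w m) {ν : Fin (n + 1) → ℂ}
    (hw : w (Fin.last (n + 1)) = ν (Fin.last n)) {d : ℕ} {a : V} (ha : a ∈ grade V d)
    {p : Fin (n + 2)} {j : ℤ} (hp : p = Fin.last (n + 1) → j = (d : ℤ) - 1)
    (q : Fin (n + 1) →₀ ℕ) :
    barF V Δ' F (slot p (md (M p) a j) (PiTensorProduct.tprod ℂ m)) ν q = leadTwist q fun k κ =>
      F (slot p (md (M p) a j) (PiTensorProduct.tprod ℂ (npow V w m k)))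
        (leadExp Δ' ν w - leafExp p (d - j - 1)) κ := by
  rw [slot_tprod, hF.barF_lead hΔ' hM₀ hΔ (hm.md ha p j) (by rw [update_last_eq hp, hw])]
  simp only [npow_update_md w m ha, leadExp_update, slot_tprod]

/-- The exponent of `ζ_{r-1}` is at least the weight of `m_r`. -/
theorem IsPIO.barF_eq_zero_of_lt (hF : IsPIO V M₀ M F) {Δ' : ℂ} (hΔ' : IsGradedFrom V M₀ Δ')
    (hM₀ : IsVModule V M₀) {Δ : Fin (n + 2) → ℂ} (hΔ : ∀ i, IsGradedFrom V (M i) (Δ i))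
    {w : Fin (n + 2) → ℂ} {m : ∀ i, M i} (hm : Homog V w m) {ν : Fin (n + 1) → ℂ} {e : ℕ}
    (he : e ≠ 0) (hw : w (Fin.last (n + 1)) = ν (Fin.last n) + e) (q : Fin (n + 1) →₀ ℕ) :
    barF V Δ' F (PiTensorProduct.tprod ℂ m) ν q = 0 := by
  by_contra hc
  obtain ⟨k, T, κ, J, d, -, h2, -⟩ := hF.exists_of_barF_ne_zero hΔ' hM₀ hΔ hm hc
  rw [hw, add_assoc, left_eq_add] at h2
  have : e + J = 0 := by exact_mod_cast h2
  omega

theorem IsPIO.barF_slot_eq_zero_of_lt (hF : IsPIO V M₀ M F) {Δ' : ℂ} (hΔ' : IsGradedFrom V M₀ Δ')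
    (hM₀ : IsVModule V M₀) {Δ : Fin (n + 2) → ℂ} (hΔ : ∀ i, IsGradedFrom V (M i) (Δ i))
    {w : Fin (n + 2) → ℂ} {m : ∀ i, M i} (hm : Homog V w m) {ν : Fin (n + 1) → ℂ} {e : ℕ}
    (he : e ≠ 0) (hw : w (Fin.last (n + 1)) = ν (Fin.last n) + e) {d : ℕ} {a : V}
    (ha : a ∈ grade V d) {p : Fin (n + 2)} {j : ℤ} (hp : p = Fin.last (n + 1) → j = (d : ℤ) - 1)
    (q : Fin (n + 1) →₀ ℕ) :
    barF V Δ' F (slot p (md (M p) a j) (PiTensorProduct.tprod ℂ m)) ν q = 0 := by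
  rw [slot_tprod]
  exact hF.barF_eq_zero_of_lt hΔ' hM₀ hΔ (hm.md ha p j) he (by rw [update_last_eq hp, hw]) q

/-! ### The relations between the leading coefficients -/

/-- The operator on the `s`-th factor in the leading part of `a(D)F`, for `a` of weight `D+1`. -/
def zeroSlot {V : Type*} [AddCommGroup V] [Module ℂ V] [VertexOperatorAlgebra V] {n : ℕ}
    (M : Fin (n + 2) → Type*) [∀ i, AddCommGroup (M i)] [∀ i, Module ℂ (M i)]
    [∀ i, VOAModule V (M i)] (a : V) (D : ℕ) (s : Fin (n + 2)) : Module.End ℂ (⨂[ℂ] i, M i) :=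
  ∑ k ∈ Finset.range (D + 1), if s = Fin.last (n + 1) → k = D then
    (D.choose k : ℂ) • slot s (md (M s) a k) else 0

theorem slot_add (p : Fin (n + 2)) (f g : Module.End ℂ (M p)) : slot p (f + g) = slot p f + slot p g := by
  refine PiTensorProduct.ext (MultilinearMap.ext fun m => ?_)
  simp only [LinearMap.compMultilinearMap_apply, LinearMap.add_apply, slot_tprod,
    MultilinearMap.map_update_add]

theorem slot_smul (p : Fin (n + 2)) (c : ℂ) (f : Module.End ℂ (M p)) : slot p (c • f) = c • slot p f := by
  refine PiTensorProduct.ext (MultilinearMap.ext fun m => ?_)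
  simp only [LinearMap.compMultilinearMap_apply, LinearMap.smul_apply, slot_tprod,
    MultilinearMap.map_update_smul]

theorem slot_sum (p : Fin (n + 2)) {ι : Type*} (s : Finset ι) (f : ι → Module.End ℂ (M p)) :
    slot p (∑ i ∈ s, f i) = ∑ i ∈ s, slot p (f i) := by
  classical
  induction s using Finset.induction_on with
  | empty =>
    rw [Finset.sum_empty, Finset.sum_empty]
    have := slot_smul p 0 (0 : Module.End ℂ (M p))
    rwa [zero_smul, zero_smul] at this
  | insert i s hi ih => rw [Finset.sum_insert hi, Finset.sum_insert hi, slot_add, ih]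

variable {Δ' : ℂ} {Δ : Fin (n + 2) → ℂ}

theorem IsPIO.barF_zeroSlot (hF : IsPIO V M₀ M F) (hΔ' : IsGradedFrom V M₀ Δ')
    (hM₀ : IsVModule V M₀) (hΔ : ∀ i, IsGradedFrom V (M i) (Δ i))
    {w : Fin (n + 2) → ℂ} {m : ∀ i, M i} (hm : Homog V w m) {ν : Fin (n + 1) → ℂ}
    (hw : w (Fin.last (n + 1)) = ν (Fin.last n)) {D : ℕ} {a : V} (ha : a ∈ grade V (D + 1))
    (s : Fin (n + 2)) (q : Fin (n + 1) →₀ ℕ) :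
    barF V Δ' F (zeroSlot M a D s (PiTensorProduct.tprod ℂ m)) ν q = leadTwist q fun k κ =>
      zeroTerm F a D s (PiTensorProduct.tprod ℂ (npow V w m k)) (leadExp Δ' ν w) κ := by
  let L : (⨂[ℂ] i, M i) →ₗ[ℂ] M₀ := LinearMap.proj q ∘ₗ LinearMap.proj ν ∘ₗ hF.barLin hΔ' hM₀ hΔ
  change L _ = _
  have h1 : (fun k κ => zeroTerm F a D s (PiTensorProduct.tprod ℂ (npow V w m k))
      (leadExp Δ' ν w) κ) = ∑ k' ∈ Finset.range (D + 1), fun k κ =>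
        if s = Fin.last (n + 1) → k' = D then (D.choose k' : ℂ) •
          F (slot s (md (M s) a k') (PiTensorProduct.tprod ℂ (npow V w m k)))
            (leadExp Δ' ν w - leafExp s ((D : ℂ) - k')) κ else 0 := by
    funext k κ
    simp only [zeroTerm, Finset.sum_apply]
  rw [h1, map_sum, zeroSlot, LinearMap.sum_apply, map_sum]
  refine Finset.sum_congr rfl fun k' _ => ?_
  split_ifs with hk
  · have h2 := hF.barF_lead_slot hΔ' hM₀ hΔ hm hw ha (p := s) (j := k')
      (fun hs => by rw [hk hs]; push_cast; ring) q
    change L _ = _ at h2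
    rw [LinearMap.smul_apply, map_smul, h2, ← map_smul]
    congr 1
    funext k κ
    have e : ((D + 1 : ℕ) : ℂ) - ((k' : ℤ) : ℂ) - 1 = (D : ℂ) - k' := by push_cast; ring
    rw [e]
    rfl
  · rw [LinearMap.zero_apply, map_zero]
    exact (map_zero _).symm

theorem IsPIO.barF_zeroSlot_eq_zero (hF : IsPIO V M₀ M F) (hΔ' : IsGradedFrom V M₀ Δ')
    (hM₀ : IsVModule V M₀) (hΔ : ∀ i, IsGradedFrom V (M i) (Δ i))
    {w : Fin (n + 2) → ℂ} {m : ∀ i, M i} (hm : Homog V w m) {ν : Fin (n + 1) → ℂ} {e : ℕ}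
    (he : e ≠ 0) (hw : w (Fin.last (n + 1)) = ν (Fin.last n) + e)
    {D : ℕ} {a : V} (ha : a ∈ grade V (D + 1))
    (s : Fin (n + 2)) (q : Fin (n + 1) →₀ ℕ) :
    barF V Δ' F (zeroSlot M a D s (PiTensorProduct.tprod ℂ m)) ν q = 0 := by
  let L : (⨂[ℂ] i, M i) →ₗ[ℂ] M₀ := LinearMap.proj q ∘ₗ LinearMap.proj ν ∘ₗ hF.barLin hΔ' hM₀ hΔ
  change L _ = _
  rw [zeroSlot, LinearMap.sum_apply, map_sum]
  refine Finset.sum_eq_zero fun k _ => ?_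
  split_ifs with hk
  · have h2 := hF.barF_slot_eq_zero_of_lt hΔ' hM₀ hΔ hm he hw ha (p := s) (j := k)
      (fun hs => by rw [hk hs]; push_cast; ring) q
    change L _ = _ at h2
    rw [LinearMap.smul_apply, map_smul, h2, smul_zero]
  · rw [LinearMap.zero_apply, map_zero]

theorem int_cast_aux (c A D i : ℕ) :
    ((D + 1 : ℕ) : ℂ) - (((i : ℤ) - (c + A - D) : ℤ) : ℂ) - 1 = (c : ℂ) + A - i := by
  push_cast; ring

/-- At a minimal exponent, the terms with smaller intermediate weights vanish, and so do the modes that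
lower the weight of `m_r`. This is the hypothesis of `IsPIO.lead_homog`. -/
theorem IsPIO.lead_vanishing (hF : IsPIO V M₀ M F) (hΔ' : IsGradedFrom V M₀ Δ')
    (hM₀ : IsVModule V M₀) (hΔ : ∀ i, IsGradedFrom V (M i) (Δ i)) {lam : Fin n → ModInt}
    {h : Fin n → ℂ} (hh : h ∈ leadSet V Δ' (Δ (Fin.last (n + 1))) F lam)
    {w : Fin (n + 2) → ℂ} {m : ∀ i, M i} (hm : Homog V w m)
    (hw : w (Fin.last (n + 1)) = Δ (Fin.last (n + 1))) {D : ℕ} {a : V} (ha : a ∈ grade V (D + 1))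
    (l : Fin (n + 1) →₀ ℕ) (s : Fin (n + 2)) (k : ℕ) (T : Fin (n + 1) → ℂ) (e : Fin n → ℕ)
    (hT : ∑ i, w i + ∑ i, T i + ((D : ℂ) - k) = Δ')
    (he : ∀ i : Fin n, interExp T w i + (if i.castSucc.castSucc < s then (D : ℂ) - k else 0) + e i =
      h i)
    (hs : (s ≠ Fin.last (n + 1) ∧ e ≠ 0) ∨ (s = Fin.last (n + 1) ∧ D < k)) :
    F (slot s (md (M s) a k) (PiTensorProduct.tprod ℂ m)) T l = 0 := by
  have e1 : ((D + 1 : ℕ) : ℂ) - ((k : ℤ) : ℂ) - 1 = (D : ℂ) - k := by push_cast; ring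
  have hm' := hm.md ha s k
  rw [e1] at hm'
  rw [slot_tprod]
  rcases hs with ⟨hs, he0⟩ | ⟨rfl, hk⟩
  · by_contra hc
    obtain ⟨x, q, hx⟩ := hF.exists_barF_ne_zero hΔ' hM₀ hΔ hm'
      (by rw [sum_update_add, add_right_comm, hT]) hc
    rw [Function.update_of_ne (Ne.symm hs), hw] at hx
    have h1 : ∀ i, h i - interExp T (Function.update w s (w s + ((D : ℂ) - k))) i = e i := by
      intro i
      rw [interExp_update, ← he i]; ring
    have h2 := hh.2 (interExp T (Function.update w s (w s + ((D : ℂ) - k))))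
      (mem_expSet_iff.mpr ⟨fun i => ?_, x, q, hx⟩) fun i => ⟨e i, h1 i⟩
    · refine he0 (funext fun i => ?_)
      have := h1 i
      rw [h2, sub_self] at this
      exact_mod_cast this.symm
    · rw [← (mem_expSet_iff.mp hh.1).1 i, ← sub_add_cancel (h i)
        (interExp T (Function.update w s (w s + ((D : ℂ) - k))) i), h1, add_comm (e i : ℂ), modInt_add_nat]
  · have h0 := hm' (Fin.last (n + 1))
    rw [Function.update_self, Function.update_self, hw] at h0
    rw [tprod_eq_zero (p := Fin.last (n + 1)), map_zero]
    · rfl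
    · rw [Function.update_self]
      exact (hΔ _).eq_zero_of_lt (j := (D : ℤ) - k) (by omega) (by push_cast; ring) h0

/-- The relations between the leading coefficients at a minimal exponent. The operator at `p` is the
right product with `a` for `(A, c) = (D, 1)`, the left product for `(D + 1, 0)`, the
operator that defines `O(M_p)` for `(D + 1, 1)`, and the contribution of `p` to `o(a)` for `(D, 0)`. -/
theorem IsPIO.lead_relation (hF : IsPIO V M₀ M F) (hΔ' : IsGradedFrom V M₀ Δ')
    (hM₀ : IsVModule V M₀) (hΔ : ∀ i, IsGradedFrom V (M i) (Δ i)) {lam : Fin n → ModInt}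
    {h : Fin n → ℂ} (hh : h ∈ leadSet V Δ' (Δ (Fin.last (n + 1))) F lam)
    {D : ℕ} {a : V} (ha : a ∈ grade V (D + 1)) (A c : ℕ) (hDA : D ≤ A) {p : Fin (n + 2)}
    (hp : p < Fin.last (n + 1)) (x : ⨂[ℂ] i, M i) (q : Fin (n + 1) →₀ ℕ)
    {L : (⨂[ℂ] i, M i) →ₗ[ℂ] M₀}
    (hL : ∀ x, L x = barF V Δ' F x (Fin.snoc (α := fun _ => ℂ) h (Δ (Fin.last (n + 1)))) q) :
    L (slot p (zop (M p) A (c + A - D) a) x) =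
      (if c = 0 then md M₀ a D (L x) - ∑ s ∈ Finset.univ.filter (· < p), L (zeroSlot M a D s x)
        else 0) -
      (if A = D then (-1 : ℂ) ^ c • ∑ s ∈ Finset.univ.filter (p < ·), L (zeroSlot M a D s x)
        else 0) := by
  set ν : Fin (n + 1) → ℂ := Fin.snoc (α := fun _ => ℂ) h (Δ (Fin.last (n + 1))) with hν
  have hνl : ν (Fin.last n) = Δ (Fin.last (n + 1)) := Fin.snoc_last (α := fun _ => ℂ) _ _
  have hνi : ∀ i : Fin n, ν i.castSucc = h i := fun i => Fin.snoc_castSucc (α := fun _ => ℂ) _ _ i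
  let R : (⨂[ℂ] i, M i) →ₗ[ℂ] M₀ :=
    (if c = 0 then md M₀ a D ∘ₗ L - ∑ s ∈ Finset.univ.filter (· < p), L ∘ₗ zeroSlot M a D s
      else 0) -
    (if A = D then (-1 : ℂ) ^ c • ∑ s ∈ Finset.univ.filter (p < ·), L ∘ₗ zeroSlot M a D s else 0)
  have hR : ∀ x, R x = (if c = 0 then md M₀ a D (L x) -
        ∑ s ∈ Finset.univ.filter (· < p), L (zeroSlot M a D s x) else 0) -
      (if A = D then (-1 : ℂ) ^ c • ∑ s ∈ Finset.univ.filter (p < ·), L (zeroSlot M a D s x)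
        else 0) := by
    intro x
    simp only [R]
    split_ifs <;> simp
  have hS : ∀ x, L (slot p (zop (M p) A (c + A - D) a) x) =
      ∑ i ∈ Finset.range (A + 1), (A.choose i : ℂ) •
        L (slot p (md (M p) a ((i : ℤ) - (c + A - D))) x) := by
    intro x
    rw [zop, slot_sum, LinearMap.sum_apply, map_sum]
    refine Finset.sum_congr rfl fun i _ => ?_
    rw [slot_smul, LinearMap.smul_apply, map_smul]
  rw [← hR]
  refine LinearMap.congr_fun (f := L ∘ₗ slot p (zop (M p) A (c + A - D) a)) (g := R)
    (tensor_hom_ext hΔ fun e m hm => ?_) x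
  rw [LinearMap.comp_apply, hS, hR]
  set w : Fin (n + 2) → ℂ := fun i => Δ i + e i with hwdef
  -- if `m_r` is not of lowest weight, all terms vanish
  by_cases he : e (Fin.last (n + 1)) = 0
  · have hw : w (Fin.last (n + 1)) = Δ (Fin.last (n + 1)) := by simp [hwdef, he]
    have hwν : w (Fin.last (n + 1)) = ν (Fin.last n) := by rw [hw, hνl]
    have key : ∀ (k : Fin (n + 2) →₀ ℕ) (κ : Fin (n + 1) →₀ ℕ), _ := fun k κ =>
      hF.lead_homog hΔ' hM₀ (hm.npow k) (leadExp_sum hwν) κ A c hDA hp (a := a)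
        fun s k' T' e' hT' he' hs' => hF.lead_vanishing hΔ' hM₀ hΔ hh (hm.npow k) hw ha κ s k' T' e'
          hT' (fun i => by rw [he' i, interExp_leadExp hwν, hνi]) hs'
    have h1 : ∀ i ∈ Finset.range (A + 1), (A.choose i : ℂ) •
        L (slot p (md (M p) a ((i : ℤ) - (c + A - D))) (PiTensorProduct.tprod ℂ m)) =
        leadTwist q (fun k κ => (A.choose i : ℂ) • F (slot p (md (M p) a ((i : ℤ) - (c + A - D)))
          (PiTensorProduct.tprod ℂ (npow V w m k))) (leadExp Δ' ν w -
            leafExp p ((c : ℂ) + A - i)) κ) := by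
      intro i _
      rw [hL, hF.barF_lead_slot hΔ' hM₀ hΔ hm hwν ha (fun h => absurd h hp.ne), int_cast_aux]
      exact (map_smul (leadTwist q) _ _).symm
    have h2 : ∀ s, L (zeroSlot M a D s (PiTensorProduct.tprod ℂ m)) = leadTwist q fun k κ =>
        zeroTerm F a D s (PiTensorProduct.tprod ℂ (npow V w m k)) (leadExp Δ' ν w) κ := fun s => by
      rw [hL, hF.barF_zeroSlot hΔ' hM₀ hΔ hm hwν ha]
    have h3 : md M₀ a D (L (PiTensorProduct.tprod ℂ m)) = leadTwist q fun k κ =>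
        md M₀ a D (F (PiTensorProduct.tprod ℂ (npow V w m k)) (leadExp Δ' ν w) κ) := by
      rw [hL, hF.barF_lead hΔ' hM₀ hΔ hm hwν, map_leadTwist]
    rw [Finset.sum_congr rfl h1, ← map_sum, h3]
    simp only [h2]
    rw [← map_sum, ← map_sum, ← map_smul, ← map_sub, ← map_zero (leadTwist (W := M₀) q),
      ← apply_ite (leadTwist q), ← apply_ite (leadTwist q), ← map_sub]
    congr 1
    funext k κ
    refine Eq.trans ?_ ((key k κ).trans ?_)
    · simp only [Finset.sum_apply]
    · split_ifs <;> simp [Finset.sum_apply]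
  · have hw : w (Fin.last (n + 1)) = ν (Fin.last n) + (e (Fin.last (n + 1)) : ℕ) := by
      rw [hνl]
    have h1 : ∀ i ∈ Finset.range (A + 1), (A.choose i : ℂ) •
        L (slot p (md (M p) a ((i : ℤ) - (c + A - D))) (PiTensorProduct.tprod ℂ m)) = 0 := by
      intro i _
      rw [hL, hF.barF_slot_eq_zero_of_lt hΔ' hM₀ hΔ hm he hw ha (fun h => absurd h hp.ne),
        smul_zero]
    have h2 : ∀ s, L (zeroSlot M a D s (PiTensorProduct.tprod ℂ m)) = 0 := fun s => by
      rw [hL, hF.barF_zeroSlot_eq_zero hΔ' hM₀ hΔ hm he hw ha]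
    have h3 : L (PiTensorProduct.tprod ℂ m) = 0 := by
      rw [hL, hF.barF_eq_zero_of_lt hΔ' hM₀ hΔ hm he hw]
    rw [Finset.sum_eq_zero h1, h3]
    simp [h2]

end lead

/-! ### Derivatives with respect to `log ζ` -/

section chain

variable {N : ℕ}

theorem pderiv_aeval {σ τ : Type*} [Fintype σ] (v : σ → MvPolynomial τ ℂ) (j : τ)
    (P : MvPolynomial σ ℂ) : MvPolynomial.pderiv j (MvPolynomial.aeval v P) =
      ∑ s, MvPolynomial.aeval v (MvPolynomial.pderiv s P) * MvPolynomial.pderiv j (v s) := by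
  classical
  induction P using MvPolynomial.induction_on with
  | C a => simp
  | add p q hp hq => simp only [map_add, Finset.sum_add_distrib, hp, hq, add_mul]
  | mul_X p i hp =>
    simp only [Derivation.leibniz, MvPolynomial.pderiv_X, smul_eq_mul, Finset.sum_add_distrib,
      map_add, map_mul, MvPolynomial.aeval_X, hp, add_mul, Finset.mul_sum, mul_assoc]
    congr 1
    simp [Pi.single_apply]

theorem pderiv_logZ (i : Fin (N + 1)) (s : Fin (N + 2)) :
    MvPolynomial.pderiv i (logZ N s) = if i.castSucc < s then 1 else 0 := by
  classical
  refine Fin.cases ?_ (fun s => ?_) s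
  · simp [logZ]
  · rw [logZ, Fin.cases_succ, map_sum, Finset.sum_eq_single i]
    · by_cases h : i ≤ s
      · rw [if_pos h, if_pos (Fin.castSucc_lt_succ_iff.mpr h)]; simp
      · rw [if_neg h, if_neg (fun h' => h (Fin.castSucc_lt_succ_iff.mp h')), map_zero]
    · intro j _ hj
      split_ifs
      · rw [MvPolynomial.pderiv_X_of_ne hj]
      · exact map_zero _
    · simp

theorem aeval_logZ_monomial (l : Fin (N + 2) →₀ ℕ) (c : ℂ) :
    MvPolynomial.aeval (logZ N) (MvPolynomial.monomial l c) =
      MvPolynomial.C c * ∏ i, logZ N i ^ l i := by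
  rw [MvPolynomial.aeval_monomial, MvPolynomial.algebraMap_eq, Finsupp.prod_fintype]
  simp

theorem logCoeff_deriv (i : Fin (N + 1)) (q : Fin (N + 1) →₀ ℕ) (l : Fin (N + 2) →₀ ℕ) :
    ((q i : ℂ) + 1) * logCoeff (q + Finsupp.single i 1) l =
      ∑ s, if i.castSucc < s then (l s : ℂ) * logCoeff q (l - Finsupp.single s 1) else 0 := by
  classical
  have h := congrArg (MvPolynomial.coeff q)
    (pderiv_aeval (logZ N) i (MvPolynomial.monomial l (1 : ℂ)))
  rw [MvPolynomial.coeff_pderiv, aeval_logZ_monomial, MvPolynomial.C_1, one_mul, mul_comm,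
    MvPolynomial.coeff_sum] at h
  refine h.trans (Finset.sum_congr rfl fun s _ => ?_)
  rw [pderiv_logZ]
  split_ifs
  · rw [mul_one, MvPolynomial.pderiv_monomial, aeval_logZ_monomial, MvPolynomial.coeff_C_mul, one_mul]
    rfl
  · rw [mul_zero, MvPolynomial.coeff_zero]

variable {W : Type*} [AddCommGroup W] [Module ℂ W]

/-- The chain rule: `∂/∂(log ζ_i)` is the sum of the derivatives with respect to the `log z_s` to the right
of the `i`-th node. -/
theorem logSubst_deriv (i : Fin (N + 1)) (q : Fin (N + 1) →₀ ℕ) (u : (Fin (N + 2) →₀ ℕ) → W) :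
    ∑ s ∈ Finset.univ.filter (i.castSucc < ·),
      logSubst q (fun l => ((l s : ℂ) + 1) • u (l + Finsupp.single s 1)) =
    ((q i : ℂ) + 1) • logSubst (q + Finsupp.single i 1) u := by
  rw [logSubst_apply, Finset.smul_sum]
  have h1 : ∀ l, ((q i : ℂ) + 1) • logCoeff (q + Finsupp.single i 1) l • u l =
      ∑ s ∈ Finset.univ.filter (i.castSucc < ·),
        ((l s : ℂ) * logCoeff q (l - Finsupp.single s 1)) • u l := by
    intro l
    rw [smul_smul, logCoeff_deriv, ← Finset.sum_filter, Finset.sum_smul]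
  rw [Finset.sum_congr rfl fun l _ => h1 l, Finset.sum_comm]
  refine Finset.sum_congr rfl fun s _ => ?_
  have hq : ∑ j, (q + Finsupp.single i 1 : Fin (N + 1) →₀ ℕ) j = ∑ j, q j + 1 := by
    simp [Finset.sum_add_distrib, Finsupp.single_apply]
  have hl : ∀ l : Fin (N + 2) →₀ ℕ,
      ∑ j, (l + Finsupp.single s 1 : Fin (N + 2) →₀ ℕ) j = ∑ j, l j + 1 := by
    intro l
    simp [Finset.sum_add_distrib, Finsupp.single_apply]
  rw [logSubst_apply]
  refine Finset.sum_of_injOn (fun l => l + Finsupp.single s 1) (add_left_injective _).injOn ?_ ?_ ?_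
  · intro l h
    have h' : ∑ j, l j = ∑ j, q j := by simpa using h
    have : ∑ j, (l + Finsupp.single s 1 : Fin (N + 2) →₀ ℕ) j =
        ∑ j, (q + Finsupp.single i 1 : Fin (N + 1) →₀ ℕ) j := by rw [hl, hq, h']
    simpa using this
  · intro l h h2
    have h0 : l s = 0 := by
      by_contra h0
      have e : l - Finsupp.single s 1 + Finsupp.single s 1 = l := tsub_add_cancel_of_le
        (Finsupp.single_le_iff.mpr (Nat.one_le_iff_ne_zero.mpr h0))
      refine h2 ⟨l - Finsupp.single s 1, ?_, e⟩
      have h3 : ∑ j, l j = ∑ j, (q + Finsupp.single i 1 : Fin (N + 1) →₀ ℕ) j := by simpa using h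
      have h4 := hl (l - Finsupp.single s 1)
      rw [e, h3, hq] at h4
      have h5 : ∑ j, (l - Finsupp.single s 1 : Fin (N + 2) →₀ ℕ) j = ∑ j, q j :=
        (Nat.add_right_cancel h4).symm
      exact Finset.mem_coe.mpr ((Set.Finite.mem_toFinset _).mpr h5)
    rw [h0, Nat.cast_zero, zero_mul, zero_smul]
  · intro l _
    simp only [Finsupp.add_apply, Finsupp.single_eq_same, add_tsub_cancel_right, smul_smul]
    rw [mul_comm]
    push_cast; rfl

/-- The product rule for the logarithms in `z_i^{L(0)}m_i` and in `F`. -/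
theorem logTwist_deriv {n : ℕ} (G : (Fin (n + 2) →₀ ℕ) → (Fin (n + 1) →₀ ℕ) → W) (i : Fin (n + 1))
    (l : Fin (n + 2) →₀ ℕ) :
    ((l i.castSucc : ℂ) + 1) • logTwist G (l + Finsupp.single i.castSucc 1) =
      logTwist (fun k κ => ((k i.castSucc : ℂ) + 1) • G (k + Finsupp.single i.castSucc 1) κ +
        ((κ i : ℂ) + 1) • G k (κ + Finsupp.single i 1)) l := by
  rw [logTwist_apply, logTwist_apply, antidiagonal_deriv (fun x y : Fin (n + 2) →₀ ℕ =>
    if y (Fin.last (n + 1)) = 0 then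
      G x (Finsupp.equivFunOnFinite.symm fun i => y i.castSucc) else 0)]
  refine Finset.sum_congr rfl fun x _ => ?_
  have h1 : (x.2 + Finsupp.single i.castSucc 1 : Fin (n + 2) →₀ ℕ) (Fin.last (n + 1)) =
      x.2 (Fin.last (n + 1)) := by
    simp [(Fin.castSucc_lt_last i).ne]
  rw [h1]
  split_ifs
  · congr 3
    ext j
    simp [Finsupp.single_apply]
  · rw [smul_zero, smul_zero, add_zero]

theorem logTwist_deriv_last {n : ℕ} (G : (Fin (n + 2) →₀ ℕ) → (Fin (n + 1) →₀ ℕ) → W)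
    (l : Fin (n + 2) →₀ ℕ) :
    ((l (Fin.last (n + 1)) : ℂ) + 1) • logTwist G (l + Finsupp.single (Fin.last (n + 1)) 1) =
      logTwist (fun k κ => ((k (Fin.last (n + 1)) : ℂ) + 1) •
        G (k + Finsupp.single (Fin.last (n + 1)) 1) κ) l := by
  rw [logTwist_apply, logTwist_apply, antidiagonal_deriv (fun x y : Fin (n + 2) →₀ ℕ =>
    if y (Fin.last (n + 1)) = 0 then
      G x (Finsupp.equivFunOnFinite.symm fun i => y i.castSucc) else 0)]
  refine Finset.sum_congr rfl fun x _ => ?_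
  have h1 : (x.2 + Finsupp.single (Fin.last (n + 1)) 1 : Fin (n + 2) →₀ ℕ) (Fin.last (n + 1)) ≠ 0 := by
    simp
  rw [if_neg h1, smul_zero, add_zero]
  split_ifs
  · rfl
  · exact smul_zero _

end chain

section omega

variable {V : Type*} [AddCommGroup V] [Module ℂ V] [VertexOperatorAlgebra V] {n : ℕ}
  {M₀ : Type*} [AddCommGroup M₀] [Module ℂ M₀] [VOAModule V M₀]
  {M : Fin (n + 2) → Type*} [∀ i, AddCommGroup (M i)] [∀ i, Module ℂ (M i)]
  [∀ i, VOAModule V (M i)] {F : (⨂[ℂ] i, M i) →ₗ[ℂ] LogSeries (n + 1) M₀}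
  {Δ' : ℂ} {Δ : Fin (n + 2) → ℂ}

omit [VOAModule V M₀] in
/-- `L(0)` acts on `z_s^{L(0)}m_s` as the Euler operator in `z_s`. -/
theorem map_slot_vir_zero (w : Fin (n + 2) → ℂ) (m : ∀ i, M i) (k : Fin (n + 2) →₀ ℕ)
    (s : Fin (n + 2)) (T : Fin (n + 1) → ℂ) (κ : Fin (n + 1) →₀ ℕ) :
    F (slot s (vir V (M s) 0) (PiTensorProduct.tprod ℂ (npow V w m k))) T κ =
      ((k s : ℂ) + 1) • F (PiTensorProduct.tprod ℂ (npow V w m (k + Finsupp.single s 1))) T κ +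
        w s • F (PiTensorProduct.tprod ℂ (npow V w m k)) T κ := by
  rw [slot_vir_tprod w, ← npow_add_single, map_add, map_smul, map_smul]
  rfl

/-- The leading part of the action of `ω` on the `s`-th factor is `L(-1) + L(0)`, or `L(0)` for the last
factor. Both are derivatives by `IsPIO.translation`, and together they act as the Euler operator in `z_s`. -/
theorem IsPIO.leadTwist_conf (hF : IsPIO V M₀ M F) {w : Fin (n + 2) → ℂ} (m : ∀ i, M i)
    {ν : Fin (n + 1) → ℂ} (hw : w (Fin.last (n + 1)) = ν (Fin.last n)) (s : Fin (n + 2))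
    (q : Fin (n + 1) →₀ ℕ) :
    (leadTwist q fun k κ => zeroTerm F (VertexOperatorAlgebra.conf : V) 1 s
      (PiTensorProduct.tprod ℂ (npow V w m k)) (leadExp Δ' ν w) κ) =
    (w s + tauExp Δ' ν w s) • (leadTwist q fun k κ =>
      F (PiTensorProduct.tprod ℂ (npow V w m k)) (leadExp Δ' ν w) κ) +
    logSubst q (fun l => ((l s : ℂ) + 1) • logTwist (fun k κ =>
      F (PiTensorProduct.tprod ℂ (npow V w m k)) (leadExp Δ' ν w) κ)
        (l + Finsupp.single s 1)) := by
  set T := leadExp Δ' ν w with hT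
  refine Fin.lastCases ?_ (fun j => ?_) s
  · have h1 : tauExp Δ' ν w (Fin.last (n + 1)) = 0 := by rw [tauExp_last, hw, sub_self]
    rw [h1, add_zero]
    simp only [logTwist_deriv_last]
    change _ = _ + leadTwist q _
    rw [← map_smul, ← map_add]
    congr 1
    funext k κ
    have h2 := map_slot_vir_zero (V := V) (F := F) w m k (Fin.last (n + 1)) T κ
    rw [vir_zero] at h2
    simp only [zeroTerm, Pi.add_apply, Pi.smul_apply]
    rw [Finset.sum_eq_single 1]
    · rw [if_pos (fun _ => rfl), add_comm (w _ • _), ← h2]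
      simp [leafExp_zero]
    · intro b _ hb
      rw [if_neg (by simpa using hb)]
    · simp
  · simp only [logTwist_deriv]
    change _ = _ + leadTwist q _
    rw [← map_smul, ← map_add]
    congr 1
    funext k κ
    have h2 := map_slot_vir_zero (V := V) (F := F) w m k j.castSucc T κ
    have h3 := congrFun (congrFun (hF.translation j (PiTensorProduct.tprod ℂ (npow V w m k)))
      (T - leafExp j.castSucc 1)) κ
    rw [vir_zero] at h2
    rw [vir_neg_one, derivX, leafExp_castSucc, sub_add_cancel] at h3
    have h4 : j.castSucc ≠ Fin.last (n + 1) := (Fin.castSucc_lt_last j).ne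
    have h5 : tauExp Δ' ν w j.castSucc = T j := rfl
    simp only [zeroTerm, Pi.add_apply, Pi.smul_apply]
    rw [Finset.sum_range_succ, Finset.sum_range_one, if_pos (fun h => absurd h h4),
      if_pos (fun h => absurd h h4)]
    simp only [Nat.choose_zero_right, Nat.choose_self, Nat.cast_one, one_smul, Nat.cast_zero,
      sub_zero, sub_self, leafExp_zero, leafExp_castSucc]
    rw [h3, h2, h5]
    simp only [Pi.sub_apply, Pi.single_eq_same, sub_add_cancel, add_smul]
    abel

theorem sum_weights_tauExp (ν : Fin (n + 1) → ℂ) (w : Fin (n + 2) → ℂ) (i : Fin (n + 1)) :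
    ∑ s ∈ Finset.univ.filter (i.castSucc < ·), (w s + tauExp Δ' ν w s) = ν i := by
  have h1 : zetaExp (Pi.single 0 Δ' : Fin (n + 2) → ℂ) i = 0 := by
    refine Finset.sum_eq_zero fun l _ => ?_
    split_ifs with h
    · exact Pi.single_eq_of_ne (Fin.pos_iff_ne_zero.mp (lt_of_le_of_lt (Fin.zero_le _) h)) _
    · rfl
  have h2 := congrFun (zetaExp_add (zetaShift ν) (Pi.single 0 Δ')) i
  rw [Pi.add_apply, zetaExp_zetaShift, h1, add_zero, zetaExp] at h2
  rw [← h2, Finset.sum_filter]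
  refine Finset.sum_congr rfl fun s _ => ?_
  rw [tauExp]
  congr 1
  exact add_sub_cancel _ _

/-- `ω` acts on the vectors to the right of a node as the Euler operator of the corresponding `ζ_i`,
that is as `ν_i + ∂/∂(log ζ_i)`. -/
theorem IsPIO.omega_relation (hF : IsPIO V M₀ M F) (hΔ' : IsGradedFrom V M₀ Δ')
    (hM₀ : IsVModule V M₀) (hΔ : ∀ i, IsGradedFrom V (M i) (Δ i)) {ν : Fin (n + 1) → ℂ}
    (hν : ν (Fin.last n) = Δ (Fin.last (n + 1))) (i : Fin (n + 1)) (x : ⨂[ℂ] i, M i)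
    (q : Fin (n + 1) →₀ ℕ) :
    ∑ s ∈ Finset.univ.filter (i.castSucc < ·),
      barF V Δ' F (zeroSlot M (VertexOperatorAlgebra.conf : V) 1 s x) ν q =
    ν i • barF V Δ' F x ν q + ((q i : ℂ) + 1) • barF V Δ' F x ν (q + Finsupp.single i 1) := by
  let L : (⨂[ℂ] i, M i) →ₗ[ℂ] M₀ := LinearMap.proj q ∘ₗ LinearMap.proj ν ∘ₗ hF.barLin hΔ' hM₀ hΔ
  let L' : (⨂[ℂ] i, M i) →ₗ[ℂ] M₀ :=
    LinearMap.proj (q + Finsupp.single i 1) ∘ₗ LinearMap.proj ν ∘ₗ hF.barLin hΔ' hM₀ hΔ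
  have hc : (VertexOperatorAlgebra.conf : V) ∈ grade V (1 + 1) := conf_mem
  suffices H : ∑ s ∈ Finset.univ.filter (i.castSucc < ·),
      L ∘ₗ zeroSlot M (VertexOperatorAlgebra.conf : V) 1 s = ν i • L + ((q i : ℂ) + 1) • L' by
    have := LinearMap.congr_fun H x
    rw [LinearMap.sum_apply] at this
    exact this
  refine tensor_hom_ext hΔ fun e m hm => ?_
  rw [LinearMap.sum_apply]
  change ∑ s ∈ _, barF V Δ' F (zeroSlot M (VertexOperatorAlgebra.conf : V) 1 s
    (PiTensorProduct.tprod ℂ m)) ν q = ν i • barF V Δ' F _ ν q +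
      ((q i : ℂ) + 1) • barF V Δ' F _ ν (q + Finsupp.single i 1)
  by_cases he : e (Fin.last (n + 1)) = 0
  · have hw : (fun i => Δ i + (e i : ℂ)) (Fin.last (n + 1)) = ν (Fin.last n) := by simp [he, hν]
    rw [Finset.sum_congr rfl fun s _ => (hF.barF_zeroSlot hΔ' hM₀ hΔ hm hw hc s q).trans
      (hF.leadTwist_conf m hw s q), Finset.sum_add_distrib, ← Finset.sum_smul, sum_weights_tauExp,
      logSubst_deriv, hF.barF_lead hΔ' hM₀ hΔ hm hw, hF.barF_lead hΔ' hM₀ hΔ hm hw]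
    rfl
  · have hw : (fun i => Δ i + (e i : ℂ)) (Fin.last (n + 1)) =
        ν (Fin.last n) + (e (Fin.last (n + 1)) : ℕ) := by simp [hν]
    rw [hF.barF_eq_zero_of_lt hΔ' hM₀ hΔ hm he hw, hF.barF_eq_zero_of_lt hΔ' hM₀ hΔ hm he hw,
      smul_zero, smul_zero, add_zero]
    exact Finset.sum_eq_zero fun s _ => hF.barF_zeroSlot_eq_zero hΔ' hM₀ hΔ hm he hw hc s q

end omega

/-! ### The iterated tensor products over the Zhu algebra -/

section tail

universe v

variable {V : Type*} [AddCommGroup V] [Module ℂ V] [VertexOperatorAlgebra V] {n : ℕ}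
  {M : Fin (n + 2) → Type v} [∀ i, AddCommGroup (M i)] [∀ i, Module ℂ (M i)]
  [∀ i, VOAModule V (M i)]

/-- The `A(V)`-module `A(M_i) ⊗_{A(V)} T`. -/
def zhuStep (i : Fin (n + 1)) (T : ZhuTail.{_, _, v} V (∀ i, M i)) :
    ZhuTail.{_, _, v} V (∀ i, M i) where
  carrier := (ZhuMod V (M i.castSucc) ⊗[ℂ] T.carrier) ⧸ balance (M i.castSucc) T.act
  act d a := (balance (M i.castSucc) T.act).mapQ (balance (M i.castSucc) T.act)
    ((zhuAct (M i.castSucc) d a).rTensor T.carrier) (balance_le (M i.castSucc) T.act d a)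
  tens m := (balance (M i.castSucc) T.act).mkQ
    ((zhuO V (M i.castSucc)).mkQ (m i.castSucc) ⊗ₜ[ℂ] T.tens m)

theorem zhuTail_castSucc (Δ : ℂ) (i : Fin (n + 1)) :
    zhuTail V M Δ i.castSucc = zhuStep i (zhuTail V M Δ i.succ) :=
  Fin.reverseInduction_castSucc ..

theorem zhuTail_last (Δ : ℂ) :
    zhuTail V M Δ (Fin.last (n + 1)) =
      { carrier := ↥(wt V (M (Fin.last (n + 1))) Δ)
        act := zeroMode (M (Fin.last (n + 1))) Δ
        tens := fun m => genProj V (M (Fin.last (n + 1))) Δ (m (Fin.last (n + 1))) } :=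
  Fin.reverseInduction_last ..

/-- The element `m ⊗ t` of `A(M_i) ⊗_{A(V)} T`. -/
def zhuMk (i : Fin (n + 1)) (T : ZhuTail.{_, _, v} V (∀ i, M i)) :
    M i.castSucc →ₗ[ℂ] T.carrier →ₗ[ℂ] (zhuStep i T).carrier :=
  (TensorProduct.mk ℂ (ZhuMod V (M i.castSucc)) T.carrier).compr₂
    (balance (M i.castSucc) T.act).mkQ ∘ₗ (zhuO V (M i.castSucc)).mkQ

theorem zhuStep_tens (i : Fin (n + 1)) (T : ZhuTail.{_, _, v} V (∀ i, M i)) (m : ∀ i, M i) :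
    (zhuStep i T).tens m = zhuMk i T (m i.castSucc) (T.tens m) := rfl

theorem zhuStep_act (i : Fin (n + 1)) (T : ZhuTail.{_, _, v} V (∀ i, M i)) {d : ℕ}
    (a : ↥(grade V d)) (x : M i.castSucc) (t : T.carrier) :
    (zhuStep i T).act d a (zhuMk i T x t) = zhuMk i T (zhuLeft (M i.castSucc) d (a : V) x) t := rfl

theorem zhuMk_zhuRight (i : Fin (n + 1)) (T : ZhuTail.{_, _, v} V (∀ i, M i)) {d : ℕ}
    (a : ↥(grade V d)) (x : M i.castSucc) (t : T.carrier) :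
    zhuMk i T (zhuRight (M i.castSucc) d (a : V) x) t = zhuMk i T x (T.act d a t) := by
  rw [← sub_eq_zero]
  exact (Submodule.Quotient.mk_eq_zero (balance (M i.castSucc) T.act)).mpr
    (Submodule.subset_span ⟨d, a, x, t, rfl⟩)

theorem zhuStep_hom_ext {i : Fin (n + 1)} {T : ZhuTail.{_, _, v} V (∀ i, M i)} {X : Type*}
    [AddCommGroup X] [Module ℂ X] {f g : (zhuStep i T).carrier →ₗ[ℂ] X}
    (h : ∀ x t, f (zhuMk i T x t) = g (zhuMk i T x t)) : f = g := by
  refine Submodule.linearMap_qext _ (TensorProduct.ext' fun x t => ?_)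
  obtain ⟨x, rfl⟩ := Submodule.mkQ_surjective _ x
  exact h x t

/-- A bilinear map that vanishes on `O(M_i)` and is balanced over `A(V)` factors through
`A(M_i) ⊗_{A(V)} T`. -/
theorem zhuStep_exists_lift (i : Fin (n + 1)) (T : ZhuTail.{_, _, v} V (∀ i, M i)) {X : Type*}
    [AddCommGroup X] [Module ℂ X] (β : M i.castSucc →ₗ[ℂ] T.carrier →ₗ[ℂ] X)
    (hO : ∀ d, ∀ a ∈ grade V d, ∀ x, β (zop (M i.castSucc) d 2 a x) = 0)
    (hβ : ∀ (d : ℕ) (a : ↥(grade V d)) x t,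
      β (zhuRight (M i.castSucc) d (a : V) x) t = β x (T.act d a t)) :
    ∃ B : (zhuStep i T).carrier →ₗ[ℂ] X, ∀ x t, B (zhuMk i T x t) = β x t := by
  have h1 : zhuO V (M i.castSucc) ≤ LinearMap.ker β := by
    refine Submodule.span_le.mpr ?_
    rintro x ⟨d, a, ha, y, rfl⟩
    exact hO d a ha y
  have h2 : balance (M i.castSucc) T.act ≤
      LinearMap.ker (TensorProduct.lift ((zhuO V (M i.castSucc)).liftQ β h1)) := by
    refine Submodule.span_le.mpr ?_
    rintro x ⟨d, a, y, t, rfl⟩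
    refine LinearMap.mem_ker.mpr ?_
    rw [map_sub, TensorProduct.lift.tmul, TensorProduct.lift.tmul, Submodule.mkQ_apply,
      Submodule.mkQ_apply, Submodule.liftQ_apply, Submodule.liftQ_apply, hβ, sub_self]
  exact ⟨(balance (M i.castSucc) T.act).liftQ _ h2, fun x t => rfl⟩

/-- `m_p ⊗ ⋯ ⊗ m_r` depends only on `m_p, …, m_r`. -/
theorem zhuTail_tens_congr (Δ : ℂ) (p : Fin (n + 2)) {m m' : ∀ i, M i}
    (h : ∀ s, p ≤ s → m s = m' s) : (zhuTail V M Δ p).tens m = (zhuTail V M Δ p).tens m' := by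
  induction p using Fin.reverseInduction with
  | last => rw [zhuTail_last]; simp only [h _ le_rfl]
  | cast i ih =>
    rw [zhuTail_castSucc, zhuStep_tens, zhuStep_tens, h _ le_rfl,
      ih fun s hs => h s (Fin.castSucc_lt_succ.le.trans hs)]

/-- The module `T_p` is spanned by the elements `m_p ⊗ ⋯ ⊗ m_r`. -/
theorem zhuTail_hom_ext {Δr : ℂ} (hr : IsGradedFrom V (M (Fin.last (n + 1))) Δr)
    {p : Fin (n + 2)} {X : Type*} [AddCommGroup X] [Module ℂ X]
    {f g : (zhuTail V M Δr p).carrier →ₗ[ℂ] X}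
    (h : ∀ m, f ((zhuTail V M Δr p).tens m) = g ((zhuTail V M Δr p).tens m)) : f = g := by
  induction p using Fin.reverseInduction generalizing X with
  | last =>
    revert f g
    rw [zhuTail_last]
    intro f g h
    refine LinearMap.ext fun t => ?_
    have := h (Function.update (fun _ => 0) (Fin.last (n + 1)) (t : M (Fin.last (n + 1))))
    simp only [Function.update_self] at this
    have e : genProj V (M (Fin.last (n + 1))) Δr (t : M (Fin.last (n + 1))) = t :=
      Subtype.ext (by
        have e := hr.genProj_of_mem t.2
        exact e)
    rwa [e] at this
  | cast i ih =>
    revert f g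
    rw [zhuTail_castSucc]
    intro f g h
    refine zhuStep_hom_ext fun x t => ?_
    refine LinearMap.congr_fun (f := f ∘ₗ zhuMk i _ x) (g := g ∘ₗ zhuMk i _ x) (ih fun m => ?_) t
    have h1 := h (Function.update m i.castSucc x)
    have h2 : (zhuTail V M Δr i.succ).tens (Function.update m i.castSucc x) =
        (zhuTail V M Δr i.succ).tens m := zhuTail_tens_congr Δr _ fun s hs =>
      Function.update_of_ne (lt_of_lt_of_le Fin.castSucc_lt_succ hs).ne' _ _
    rwa [zhuStep_tens, Function.update_self, h2] at h1

/-- The operator on `M_p` that induces the action of `a ∈ V_d` on `A(M_p)` or, for the last module, on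
its lowest weight space. -/
def leftOp {V : Type*} [AddCommGroup V] [Module ℂ V] [VertexOperatorAlgebra V] {n : ℕ}
    (M : Fin (n + 2) → Type*) [∀ i, AddCommGroup (M i)] [∀ i, Module ℂ (M i)]
    [∀ i, VOAModule V (M i)] (Δr : ℂ) (p : Fin (n + 2)) (d : ℕ) (a : V) : Module.End ℂ (M p) :=
  if p = Fin.last (n + 1) then
    md (M p) a ((d : ℤ) - 1) ∘ₗ (wt V (M p) Δr).subtype ∘ₗ genProj V (M p) Δr
  else zhuLeft (M p) d a

/-- The action of `A(V)` on `T_p` is an operator on the factor `M_p`. -/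
theorem zhuTail_act_tens {Δr : ℂ} (hr : IsGradedFrom V (M (Fin.last (n + 1))) Δr)
    (p : Fin (n + 2)) {d : ℕ} (a : ↥(grade V d)) (m : ∀ i, M i) :
    (zhuTail V M Δr p).act d a ((zhuTail V M Δr p).tens m) =
      (zhuTail V M Δr p).tens (Function.update m p (leftOp M Δr p d (a : V) (m p))) := by
  refine Fin.lastCases ?_ (fun i => ?_) p
  · rw [zhuTail_last, leftOp, if_pos rfl]
    simp only [Function.update_self]
    refine Subtype.ext ?_
    have e := hr.genProj_of_mem (md_mem_wt Δr a.2 _ (genProj V (M (Fin.last (n + 1))) Δr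
      (m (Fin.last (n + 1)))).2)
    exact e.symm
  · rw [zhuTail_castSucc, zhuStep_tens, zhuStep_tens, zhuStep_act, Function.update_self, leftOp,
      if_neg (Fin.castSucc_lt_last i).ne]
    congr 1
    exact zhuTail_tens_congr Δr _ fun s hs =>
      (Function.update_of_ne (lt_of_lt_of_le Fin.castSucc_lt_succ hs).ne' _ _).symm

/-- A map on `M_1 ⊗ ⋯ ⊗ M_r` that is balanced over `A(V)`: it vanishes on the `O(M_i)`, depends only on the
component of `m_r` of lowest weight, and the right action of `a` at `i` equals the left action at
`i + 1`. -/
structure IsZhuBalanced {V : Type*} [AddCommGroup V] [Module ℂ V] [VertexOperatorAlgebra V] {n : ℕ}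
    {M : Fin (n + 2) → Type*} [∀ i, AddCommGroup (M i)] [∀ i, Module ℂ (M i)]
    [∀ i, VOAModule V (M i)] {X : Type*} [AddCommGroup X] [Module ℂ X] (Δr : ℂ)
    (φ : (⨂[ℂ] i, M i) →ₗ[ℂ] X) : Prop where
  zhuO : ∀ (i : Fin (n + 1)) (d : ℕ), ∀ a ∈ grade V d, ∀ x,
    φ (slot i.castSucc (zop (M i.castSucc) d 2 a) x) = 0
  last : ∀ x, φ (slot (Fin.last (n + 1)) ((wt V (M (Fin.last (n + 1))) Δr).subtype ∘ₗ
    genProj V (M (Fin.last (n + 1))) Δr) x) = φ x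
  balanced : ∀ (i : Fin (n + 1)) (d : ℕ), ∀ a ∈ grade V d, ∀ m : ∀ i, M i,
    φ (PiTensorProduct.tprod ℂ
      (Function.update m i.castSucc (zhuRight (M i.castSucc) d a (m i.castSucc)))) =
    φ (slot i.succ (leftOp M Δr i.succ d a) (PiTensorProduct.tprod ℂ m))

/-- The universal property of `T_p`, with the vectors `m_1, …, m_{p-1}` fixed. -/
theorem IsZhuBalanced.exists_lift {Δr : ℂ} (hr : IsGradedFrom V (M (Fin.last (n + 1))) Δr)
    {X : Type*} [AddCommGroup X] [Module ℂ X] {φ : (⨂[ℂ] i, M i) →ₗ[ℂ] X}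
    (hφ : IsZhuBalanced (V := V) Δr φ) (p : Fin (n + 2)) (m : ∀ i, M i) :
    ∃ B : (zhuTail V M Δr p).carrier →ₗ[ℂ] X, ∀ m' : ∀ i, M i, (∀ s, s < p → m' s = m s) →
      B ((zhuTail V M Δr p).tens m') = φ (PiTensorProduct.tprod ℂ m') := by
  induction p using Fin.reverseInduction generalizing m with
  | last =>
    rw [zhuTail_last]
    refine ⟨φ ∘ₗ (PiTensorProduct.tprod ℂ).toLinearMap m (Fin.last (n + 1)) ∘ₗ
      (wt V (M (Fin.last (n + 1))) Δr).subtype, fun m' hm' => ?_⟩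
    rw [← hφ.last (PiTensorProduct.tprod ℂ m'), slot_tprod]
    simp only [LinearMap.comp_apply, MultilinearMap.toLinearMap_apply]
    congr 2
    funext s
    rcases eq_or_ne s (Fin.last (n + 1)) with rfl | hs
    · simp
    · rw [Function.update_of_ne hs, Function.update_of_ne hs, hm' s (Fin.lt_last_iff_ne_last.mpr hs)]
  | cast i ih =>
    -- the factors up to `i` of the tuples may be prescribed
    have key : ∀ m' : ∀ i, M i, (zhuTail V M Δr i.succ).tens
        (fun s => if s ≤ i.castSucc then m s else m' s) = (zhuTail V M Δr i.succ).tens m' := fun m' =>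
      zhuTail_tens_congr Δr _ fun s hs =>
        if_neg (not_le.mpr (lt_of_lt_of_le Fin.castSucc_lt_succ hs))
    -- the maps for fixed `m_1, …, m_i`
    have ih' : ∀ x : M i.castSucc, ∃ B : (zhuTail V M Δr i.succ).carrier →ₗ[ℂ] X, ∀ m' : ∀ i, M i,
        (∀ s, s < i.castSucc → m' s = m s) →
        B ((zhuTail V M Δr i.succ).tens m') =
          φ (PiTensorProduct.tprod ℂ (Function.update m' i.castSucc x)) := by
      intro x
      obtain ⟨B, hB⟩ := ih (Function.update m i.castSucc x)
      refine ⟨B, fun m' hm' => ?_⟩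
      rw [← hB]
      · congr 1
        exact zhuTail_tens_congr Δr _ fun s hs =>
          (Function.update_of_ne (lt_of_lt_of_le Fin.castSucc_lt_succ hs).ne' _ _).symm
      · intro s hs
        rcases (Fin.le_castSucc_iff.mpr hs).lt_or_eq with h | rfl
        · rw [Function.update_of_ne h.ne, Function.update_of_ne h.ne, hm' s h]
        · rw [Function.update_self, Function.update_self]
    choose B hB using ih'
    -- these maps are unique, so they depend linearly on `x`
    have hB' : ∀ (f g : (zhuTail V M Δr i.succ).carrier →ₗ[ℂ] X), (∀ m' : ∀ i, M i,
        (∀ s, s < i.castSucc → m' s = m s) → f ((zhuTail V M Δr i.succ).tens m') =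
          g ((zhuTail V M Δr i.succ).tens m')) → f = g := by
      intro f g h
      refine zhuTail_hom_ext hr fun m' => ?_
      rw [← key m']
      exact h _ fun s hs => if_pos hs.le
    let β : M i.castSucc →ₗ[ℂ] (zhuTail V M Δr i.succ).carrier →ₗ[ℂ] X :=
      { toFun := B
        map_add' := fun x y => hB' _ _ fun m' hm' => by
          rw [LinearMap.add_apply, hB _ _ hm', hB _ _ hm', hB _ _ hm', MultilinearMap.map_update_add,
            map_add]
        map_smul' := fun c x => hB' _ _ fun m' hm' => by
          rw [RingHom.id_apply, LinearMap.smul_apply, hB _ _ hm', hB _ _ hm',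
            MultilinearMap.map_update_smul, map_smul] }
    rw [zhuTail_castSucc]
    obtain ⟨C, hC⟩ := zhuStep_exists_lift i (zhuTail V M Δr i.succ) β
      (fun d a ha x => hB' _ _ fun m' hm' => by
        refine (hB _ _ hm').trans ?_
        have := hφ.zhuO i d a ha (PiTensorProduct.tprod ℂ (Function.update m' i.castSucc x))
        rwa [slot_tprod, Function.update_self, Function.update_idem] at this)
      (fun d a x t => by
        refine LinearMap.congr_fun (f := B (zhuRight (M i.castSucc) d (a : V) x))
          (g := B x ∘ₗ (zhuTail V M Δr i.succ).act d a) (hB' _ _ fun m' hm' => ?_) t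
        have h1 := hφ.balanced i d a a.2 (Function.update m' i.castSucc x)
        have h2 : i.succ ≠ i.castSucc := Fin.castSucc_lt_succ.ne'
        rw [slot_tprod, Function.update_self, Function.update_idem, Function.update_of_ne h2,
          Function.update_comm h2.symm] at h1
        rw [hB _ _ hm', h1, LinearMap.comp_apply, zhuTail_act_tens hr, hB]
        intro s hs
        rw [Function.update_of_ne (hs.trans Fin.castSucc_lt_succ).ne, hm' s hs])
    refine ⟨C, fun m' hm' => ?_⟩
    rw [zhuStep_tens, hC]
    refine (hB _ _ hm').trans ?_
    rw [Function.update_eq_self]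

/-- For `C₁`-cofinite modules, the modules `T_p` are finite-dimensional: modulo vectors of smaller
weight, `a(-1)m` is the right product `m * a`. -/
theorem zhuTail_finite {Δ : Fin (n + 2) → ℂ} (hM : ∀ i, IsVModule V (M i))
    (hΔ : ∀ i, IsGradedFrom V (M i) (Δ i)) (hC : ∀ i, IsCOneCofinite V (M i)) (p : Fin (n + 2)) :
    FiniteDimensional ℂ (zhuTail V M (Δ (Fin.last (n + 1))) p).carrier := by
  induction p using Fin.reverseInduction with
  | last => rw [zhuTail_last]; exact (hM _).finite _
  | cast i ih =>
    rw [zhuTail_castSucc]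
    generalize zhuTail V M (Δ (Fin.last (n + 1))) i.succ = T at ih
    obtain ⟨K, hK⟩ := (hΔ i.castSucc).exists_cOne (hC i.castSucc)
    have hfin : ∀ k : ℕ, FiniteDimensional ℂ (wt V (M i.castSucc) (Δ i.castSucc + k)) :=
      fun k => (hM _).finite _
    let U : Submodule ℂ (M i.castSucc) :=
      ⨆ k ∈ Finset.range (K + 1), wt V (M i.castSucc) (Δ i.castSucc + k)
    have hU : FiniteDimensional ℂ U := by
      have := Submodule.finiteDimensional_finset_sup (Finset.range (K + 1))
        fun k => wt V (M i.castSucc) (Δ i.castSucc + (k : ℂ))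
      rwa [Finset.sup_eq_iSup] at this
    let g : U ⊗[ℂ] T.carrier →ₗ[ℂ] (zhuStep i T).carrier :=
      TensorProduct.lift (zhuMk i T ∘ₗ U.subtype)
    have hg : ∀ x ∈ U, ∀ t, zhuMk i T x t ∈ LinearMap.range g := fun x hx t =>
      ⟨⟨x, hx⟩ ⊗ₜ[ℂ] t, rfl⟩
    have hwt : ∀ k : ℕ, ∀ x ∈ wt V (M i.castSucc) (Δ i.castSucc + k), ∀ t,
        zhuMk i T x t ∈ LinearMap.range g := by
      intro k
      induction k using Nat.strong_induction_on with
      | _ k ihk =>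
        intro x hx t
        rcases le_or_gt k K with hk | hk
        · exact hg x (Submodule.mem_iSup_of_mem k (Submodule.mem_iSup_of_mem
            (Finset.mem_range.mpr (Nat.lt_succ_of_le hk)) hx)) t
        · have h1 : cOneWt V (M i.castSucc) (Δ i.castSucc) k ≤
              (LinearMap.range g).comap ((zhuMk i T).flip t) := by
            refine Submodule.span_le.mpr ?_
            rintro x ⟨d, hd, a, ha, j, hj, y, hy, rfl⟩
            change zhuMk i T (md (M i.castSucc) a (-1) y) t ∈ LinearMap.range g
            obtain ⟨D, rfl⟩ := Nat.exists_eq_add_of_le' hd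
            -- the right product is `∑ (D choose k) a(k-1) y`, and `a(k)` with `k ≥ 0` raises the weight less
            have h2 : md (M i.castSucc) a (-1) y = zhuRight (M i.castSucc) (D + 1) a y -
                ∑ k ∈ Finset.range D, (D.choose (k + 1) : ℂ) • md (M i.castSucc) a k y := by
              rw [zhuRight_succ, zop_apply, Finset.sum_range_succ']
              have e : ∀ k : ℕ, ((k + 1 : ℕ) : ℤ) - 1 = k := fun k => by push_cast; ring
              simp only [e]
              rw [add_sub_cancel_left]
              simp
            rw [h2, map_sub, LinearMap.sub_apply]
            refine Submodule.sub_mem _ ?_ ?_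
            · rw [zhuMk_zhuRight i T ⟨a, ha⟩]
              exact ihk j (by omega) y hy _
            · rw [map_sum, LinearMap.sum_apply]
              refine Submodule.sum_mem _ fun l hl => ?_
              rw [map_smul, LinearMap.smul_apply]
              have hl' := Finset.mem_range.mp hl
              refine Submodule.smul_mem _ _ (ihk (j + D - l) (by omega) _ (md_mem' ha l hy ?_) t)
              rw [Nat.cast_sub (by omega)]
              push_cast
              ring
          exact h1 (hK k hk hx)
    have hall : ∀ x t, zhuMk i T x t ∈ LinearMap.range g := by
      intro x t
      have hx : x ∈ (⊤ : Submodule ℂ (M i.castSucc)) := trivial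
      rw [← (hΔ i.castSucc : _ = _)] at hx
      have : (⨆ k : ℕ, wt V (M i.castSucc) (Δ i.castSucc + k)) ≤
          (LinearMap.range g).comap ((zhuMk i T).flip t) := iSup_le fun k y hy => hwt k y hy t
      exact this hx
    have htop : LinearMap.range g = ⊤ := by
      have : (LinearMap.range g).mkQ = 0 := zhuStep_hom_ext fun x t => by
        rw [LinearMap.zero_apply]
        exact (Submodule.Quotient.mk_eq_zero _).mpr (hall x t)
      rw [← Submodule.ker_mkQ (LinearMap.range g), this, LinearMap.ker_zero]
    exact Module.Finite.of_surjective g (LinearMap.range_eq_top.mp htop)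

end tail

/-! ### The leading coefficient as a balanced map -/

section vacuum

variable {V : Type*} [AddCommGroup V] [Module ℂ V] [VertexOperatorAlgebra V]
  {M : Type*} [AddCommGroup M] [Module ℂ M] [VOAModule V M]

theorem exists_smul_vac {a : V} (ha : a ∈ grade V 0) :
    ∃ r : ℂ, a = r • VertexOperatorAlgebra.vac := by
  rw [grade_zero, Submodule.mem_span_singleton] at ha
  obtain ⟨r, hr⟩ := ha
  exact ⟨r, hr.symm⟩

theorem md_smul_vac (r : ℂ) (j : ℤ) :
    md M (r • (VertexOperatorAlgebra.vac : V)) j = if j = -1 then r • LinearMap.id else 0 := by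
  rw [md_smul, md, VOAModule.vacuum]
  split_ifs
  · rfl
  · exact smul_zero _

theorem zhuRight_smul_vac (r : ℂ) (m : M) :
    zhuRight M 0 (r • (VertexOperatorAlgebra.vac : V)) m = r • m := by
  rw [zhuRight, finsum_eq_single _ 0]
  · rw [md_smul_vac, if_pos (by norm_num)]
    simp
  · intro k hk
    rw [md_smul_vac, if_neg (by omega), LinearMap.zero_apply, smul_zero]

theorem zop_zero_smul_vac (r : ℂ) (q : ℤ) :
    zop M 0 q (r • (VertexOperatorAlgebra.vac : V)) = if q = 1 then r • LinearMap.id else 0 := by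
  simp [zop, md_smul_vac]

end vacuum

section relations

variable {V : Type*} [AddCommGroup V] [Module ℂ V] [VertexOperatorAlgebra V] {n : ℕ}
  {M₀ : Type*} [AddCommGroup M₀] [Module ℂ M₀] [VOAModule V M₀]
  {M : Fin (n + 2) → Type*} [∀ i, AddCommGroup (M i)] [∀ i, Module ℂ (M i)]
  [∀ i, VOAModule V (M i)] {F : (⨂[ℂ] i, M i) →ₗ[ℂ] LogSeries (n + 1) M₀}
  {Δ' : ℂ} {Δ : Fin (n + 2) → ℂ}

theorem slot_comp (p : Fin (n + 2)) (f g : Module.End ℂ (M p)) (x : ⨂[ℂ] i, M i) :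
    slot p f (slot p g x) = slot p (f ∘ₗ g) x := by
  refine LinearMap.congr_fun (f := slot p f ∘ₗ slot p g) (g := slot p (f ∘ₗ g))
    (PiTensorProduct.ext (MultilinearMap.ext fun m => ?_)) x
  simp only [LinearMap.compMultilinearMap_apply, LinearMap.comp_apply, slot_tprod,
    Function.update_self, Function.update_idem]

theorem slot_id (p : Fin (n + 2)) (x : ⨂[ℂ] i, M i) : slot p (LinearMap.id : M p →ₗ[ℂ] M p) x = x := by
  refine LinearMap.congr_fun (f := slot p LinearMap.id) (g := LinearMap.id)
    (PiTensorProduct.ext (MultilinearMap.ext fun m => ?_)) x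
  simp only [LinearMap.compMultilinearMap_apply, slot_tprod, LinearMap.id_apply,
    Function.update_eq_self]

theorem zeroSlot_last (a : V) (D : ℕ) :
    zeroSlot M a D (Fin.last (n + 1)) = slot (Fin.last (n + 1)) (md (M (Fin.last (n + 1))) a D) := by
  rw [zeroSlot, Finset.sum_eq_single D]
  · simp
  · intro b _ hb
    rw [if_neg (by simpa using hb)]
  · simp

theorem zeroSlot_of_ne (a : V) (D : ℕ) {p : Fin (n + 2)} (hp : p ≠ Fin.last (n + 1)) :
    zeroSlot M a D p = slot p (zop (M p) D 0 a) := by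
  rw [zeroSlot, zop, slot_sum]
  refine Finset.sum_congr rfl fun k _ => ?_
  rw [if_pos fun h => absurd h hp, slot_smul, sub_zero]

/-- The coefficient of `ζ^ν` in `F̄`, as a polynomial in the logarithms. -/
def IsPIO.leadMap (hF : IsPIO V M₀ M F) (hΔ' : IsGradedFrom V M₀ Δ') (hM₀ : IsVModule V M₀)
    (hΔ : ∀ i, IsGradedFrom V (M i) (Δ i)) (ν : Fin (n + 1) → ℂ) :
    (⨂[ℂ] i, M i) →ₗ[ℂ] ((Fin (n + 1) →₀ ℕ) →₀ ↥(wt V M₀ Δ')) where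
  toFun x := Finsupp.ofSupportFinite (fun q => ⟨barF V Δ' F x ν q, barF_mem Δ' x ν q⟩)
    ((finLog_of_logBdd (hF.barF_logBdd hΔ' hM₀ hΔ x) ν).subset fun _ hq h =>
      hq (Subtype.ext h))
  map_add' x y := Finsupp.ext fun q => Subtype.ext
    (congrFun (congrFun ((hF.barLin hΔ' hM₀ hΔ).map_add x y) ν) q)
  map_smul' c x := Finsupp.ext fun q => Subtype.ext
    (congrFun (congrFun ((hF.barLin hΔ' hM₀ hΔ).map_smul c x) ν) q)

theorem IsPIO.leadMap_apply (hF : IsPIO V M₀ M F) (hΔ' : IsGradedFrom V M₀ Δ')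
    (hM₀ : IsVModule V M₀) (hΔ : ∀ i, IsGradedFrom V (M i) (Δ i)) (ν : Fin (n + 1) → ℂ)
    (x : ⨂[ℂ] i, M i) (q : Fin (n + 1) →₀ ℕ) :
    (hF.leadMap hΔ' hM₀ hΔ ν x q : M₀) = barF V Δ' F x ν q := rfl

/-- Only the lowest weight space of the last module contributes to the leading coefficient. -/
theorem IsPIO.lead_last (hF : IsPIO V M₀ M F) (hΔ' : IsGradedFrom V M₀ Δ')
    (hM₀ : IsVModule V M₀) (hΔ : ∀ i, IsGradedFrom V (M i) (Δ i)) {ν : Fin (n + 1) → ℂ}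
    (hν : ν (Fin.last n) = Δ (Fin.last (n + 1))) (q : Fin (n + 1) →₀ ℕ) (x : ⨂[ℂ] i, M i) :
    barF V Δ' F (slot (Fin.last (n + 1)) ((wt V (M (Fin.last (n + 1)))
      (Δ (Fin.last (n + 1)))).subtype ∘ₗ genProj V (M (Fin.last (n + 1))) (Δ (Fin.last (n + 1)))) x)
      ν q = barF V Δ' F x ν q := by
  let L : (⨂[ℂ] i, M i) →ₗ[ℂ] M₀ := LinearMap.proj q ∘ₗ LinearMap.proj ν ∘ₗ hF.barLin hΔ' hM₀ hΔ
  refine LinearMap.congr_fun (f := L ∘ₗ slot (Fin.last (n + 1)) ((wt V (M (Fin.last (n + 1)))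
      (Δ (Fin.last (n + 1)))).subtype ∘ₗ genProj V (M (Fin.last (n + 1))) (Δ (Fin.last (n + 1)))))
    (g := L) (tensor_hom_ext hΔ fun e m hm => ?_) x
  rw [LinearMap.comp_apply, slot_tprod]
  change L (PiTensorProduct.tprod ℂ (Function.update m (Fin.last (n + 1)) ((genProj V
    (M (Fin.last (n + 1))) (Δ (Fin.last (n + 1))) (m (Fin.last (n + 1))) : ↥(wt V _ _)) :
      M (Fin.last (n + 1))))) = _
  have hm' := hm (Fin.last (n + 1))
  by_cases he : e (Fin.last (n + 1)) = 0
  · simp only [he, Nat.cast_zero, add_zero] at hm'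
    rw [(hΔ _).genProj_of_mem hm', Function.update_eq_self]
  · rw [(hΔ _).genProj_of_mem_ne hm' (by simpa using he), Submodule.coe_zero,
      MultilinearMap.map_update_zero, map_zero]
    exact (hF.barF_eq_zero_of_lt hΔ' hM₀ hΔ hm he (by rw [hν]) q).symm

section lead

variable {lam : Fin n → ModInt} {h : Fin n → ℂ} {L : (⨂[ℂ] i, M i) →ₗ[ℂ] M₀}
  {q : Fin (n + 1) →₀ ℕ} {D : ℕ} {a : V}

/-- The right product with `a` acts as the sum of the actions on the vectors further to the right. -/
theorem IsPIO.lead_zhuRight (hF : IsPIO V M₀ M F) (hΔ' : IsGradedFrom V M₀ Δ')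
    (hM₀ : IsVModule V M₀) (hΔ : ∀ i, IsGradedFrom V (M i) (Δ i))
    (hh : h ∈ leadSet V Δ' (Δ (Fin.last (n + 1))) F lam)
    (hL : ∀ x, L x = barF V Δ' F x (Fin.snoc (α := fun _ => ℂ) h (Δ (Fin.last (n + 1)))) q)
    (ha : a ∈ grade V (D + 1)) {p : Fin (n + 2)} (hp : p < Fin.last (n + 1)) (x : ⨂[ℂ] i, M i) :
    L (slot p (zop (M p) D 1 a) x) =
      ∑ s ∈ Finset.univ.filter (p < ·), L (zeroSlot M a D s x) := by
  have := hF.lead_relation hΔ' hM₀ hΔ hh ha D 1 le_rfl hp x q hL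
  rw [Nat.cast_one, add_sub_cancel_right, if_neg one_ne_zero, if_pos rfl] at this
  rw [this, pow_one, neg_smul, one_smul, zero_sub, neg_neg]

/-- The left product with `a` acts as `o(a)` minus the actions on the vectors further to the left. -/
theorem IsPIO.lead_zhuLeft (hF : IsPIO V M₀ M F) (hΔ' : IsGradedFrom V M₀ Δ')
    (hM₀ : IsVModule V M₀) (hΔ : ∀ i, IsGradedFrom V (M i) (Δ i))
    (hh : h ∈ leadSet V Δ' (Δ (Fin.last (n + 1))) F lam)
    (hL : ∀ x, L x = barF V Δ' F x (Fin.snoc (α := fun _ => ℂ) h (Δ (Fin.last (n + 1)))) q)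
    (ha : a ∈ grade V (D + 1)) {p : Fin (n + 2)} (hp : p < Fin.last (n + 1)) (x : ⨂[ℂ] i, M i) :
    L (slot p (zhuLeft (M p) (D + 1) a) x) =
      md M₀ a D (L x) - ∑ s ∈ Finset.univ.filter (· < p), L (zeroSlot M a D s x) := by
  have := hF.lead_relation hΔ' hM₀ hΔ hh ha (D + 1) 0 (Nat.le_succ D) hp x q hL
  have e : ((0 : ℕ) : ℤ) + (D + 1 : ℕ) - D = 1 := by push_cast; ring
  rw [e, if_pos rfl, if_neg (Nat.succ_ne_self D), sub_zero] at this
  exact this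

theorem IsPIO.lead_zhuO (hF : IsPIO V M₀ M F) (hΔ' : IsGradedFrom V M₀ Δ')
    (hM₀ : IsVModule V M₀) (hΔ : ∀ i, IsGradedFrom V (M i) (Δ i))
    (hh : h ∈ leadSet V Δ' (Δ (Fin.last (n + 1))) F lam)
    (hL : ∀ x, L x = barF V Δ' F x (Fin.snoc (α := fun _ => ℂ) h (Δ (Fin.last (n + 1)))) q)
    (ha : a ∈ grade V (D + 1)) {p : Fin (n + 2)} (hp : p < Fin.last (n + 1)) (x : ⨂[ℂ] i, M i) :
    L (slot p (zop (M p) (D + 1) 2 a) x) = 0 := by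
  have := hF.lead_relation hΔ' hM₀ hΔ hh ha (D + 1) 1 (Nat.le_succ D) hp x q hL
  have e : ((1 : ℕ) : ℤ) + (D + 1 : ℕ) - D = 2 := by push_cast; ring
  rw [e, if_neg one_ne_zero, if_neg (Nat.succ_ne_self D), sub_zero] at this
  exact this

/-- The operator `o(a)` on `(M₀)_{Δ'}` is the sum of the actions on all factors. -/
theorem IsPIO.lead_total (hF : IsPIO V M₀ M F) (hΔ' : IsGradedFrom V M₀ Δ')
    (hM₀ : IsVModule V M₀) (hΔ : ∀ i, IsGradedFrom V (M i) (Δ i))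
    (hh : h ∈ leadSet V Δ' (Δ (Fin.last (n + 1))) F lam)
    (hL : ∀ x, L x = barF V Δ' F x (Fin.snoc (α := fun _ => ℂ) h (Δ (Fin.last (n + 1)))) q)
    (ha : a ∈ grade V (D + 1)) (x : ⨂[ℂ] i, M i) :
    ∑ s, L (zeroSlot M a D s x) = md M₀ a D (L x) := by
  have h0 : (0 : Fin (n + 2)) < Fin.last (n + 1) := Fin.last_pos
  have := hF.lead_relation hΔ' hM₀ hΔ hh ha D 0 le_rfl h0 x q hL
  rw [Nat.cast_zero, zero_add, sub_self, if_pos rfl, if_pos rfl, ← zeroSlot_of_ne a D h0.ne,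
    pow_zero, one_smul, Finset.filter_false_of_mem (fun s _ => not_lt.mpr (Fin.zero_le s)),
    Finset.sum_empty, sub_zero, eq_sub_iff_add_eq] at this
  rw [← this, ← Finset.add_sum_erase _ _ (Finset.mem_univ (0 : Fin (n + 2)))]
  congr 1
  refine Finset.sum_congr (Finset.ext fun s => ?_) fun _ _ => rfl
  simp [Fin.pos_iff_ne_zero]

theorem md_comp_genProj {W : Type*} [AddCommGroup W] [Module ℂ W] [VOAModule V W] {Δr : ℂ}
    (hr : IsGradedFrom V W Δr) (ha : a ∈ grade V (D + 1)) :
    md W a (((D + 1 : ℕ) : ℤ) - 1) ∘ₗ (wt V W Δr).subtype ∘ₗ genProj V W Δr =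
      ((wt V W Δr).subtype ∘ₗ genProj V W Δr) ∘ₗ md W a D := by
  have e : ((D + 1 : ℕ) : ℤ) - 1 = D := by push_cast; ring
  rw [e]
  refine hr.hom_ext fun k m hm => ?_
  have hm' : md W a D m ∈ wt V W (Δr + k) := md_mem' ha D hm (by push_cast; ring)
  simp only [LinearMap.comp_apply, Submodule.subtype_apply]
  by_cases hk : k = 0
  · subst hk
    rw [Nat.cast_zero, add_zero] at hm hm'
    rw [hr.genProj_of_mem hm, hr.genProj_of_mem hm']
  · have hne : Δr + (k : ℂ) ≠ Δr := by simpa using hk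
    rw [hr.genProj_of_mem_ne hm hne, hr.genProj_of_mem_ne hm' hne, Submodule.coe_zero, map_zero]

/-- The left action on the factor `i+1` is the sum of the actions on the factors to the right of the
`i`-th one. -/
theorem IsPIO.lead_leftOp (hF : IsPIO V M₀ M F) (hΔ' : IsGradedFrom V M₀ Δ')
    (hM₀ : IsVModule V M₀) (hΔ : ∀ i, IsGradedFrom V (M i) (Δ i))
    (hh : h ∈ leadSet V Δ' (Δ (Fin.last (n + 1))) F lam)
    (hL : ∀ x, L x = barF V Δ' F x (Fin.snoc (α := fun _ => ℂ) h (Δ (Fin.last (n + 1)))) q)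
    (ha : a ∈ grade V (D + 1)) (i : Fin (n + 1)) (x : ⨂[ℂ] i, M i) :
    L (slot i.succ (leftOp M (Δ (Fin.last (n + 1))) i.succ (D + 1) a) x) =
      ∑ s ∈ Finset.univ.filter (i.castSucc < ·), L (zeroSlot M a D s x) := by
  refine Fin.lastCases ?_ (fun j => ?_) i
  · have hlast : (Finset.univ.filter ((Fin.last n).castSucc < ·)) = {Fin.last (n + 1)} := by
      ext s
      simp only [Finset.mem_filter, Finset.mem_univ, true_and, Finset.mem_singleton, Fin.ext_iff,
        Fin.lt_def, Fin.val_castSucc, Fin.val_last]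
      omega
    rw [hlast, Finset.sum_singleton, zeroSlot_last, Fin.succ_last, leftOp, if_pos rfl,
      md_comp_genProj (hΔ _) ha, ← slot_comp, hL, hL,
      hF.lead_last hΔ' hM₀ hΔ (Fin.snoc_last (α := fun _ => ℂ) _ _)]
  · have hj : j.castSucc.succ < Fin.last (n + 1) := by
      rw [Fin.succ_castSucc]; exact Fin.castSucc_lt_last _
    rw [leftOp, if_neg hj.ne, hF.lead_zhuLeft hΔ' hM₀ hΔ hh hL ha hj,
      ← hF.lead_total hΔ' hM₀ hΔ hh hL ha, sub_eq_iff_eq_add,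
      ← Finset.sum_filter_not_add_sum_filter Finset.univ (· < j.castSucc.succ)]
    congr 1
    refine Finset.sum_congr (Finset.ext fun s => ?_) fun _ _ => rfl
    simp only [Finset.mem_filter, Finset.mem_univ, true_and, Fin.lt_def, Fin.val_castSucc,
      Fin.val_succ]
    omega

end lead

end relations

/-! ### Maps that intertwine an operator with a shift of a nilpotent operator -/

section linear

variable {T X : Type*} [AddCommGroup T] [Module ℂ T] [AddCommGroup X] [Module ℂ X]

/-- If `B` intertwines `f` with `c + g` for a locally nilpotent `g`, then `B` vanishes on the
generalized eigenspaces of `f` for all `μ ≠ c`. -/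
theorem apply_eq_zero_of_mem_maxGenEigenspace {f : Module.End ℂ T} {g : Module.End ℂ X} {c : ℂ}
    {B : T →ₗ[ℂ] X} (hB : ∀ t, B (f t) = c • B t + g (B t)) (hg : ∀ x, ∃ k, (g ^ k) x = 0) {μ : ℂ}
    (hμ : μ ≠ c) {t : T} (ht : t ∈ Module.End.maxGenEigenspace f μ) : B t = 0 := by
  obtain ⟨k, hk⟩ := Module.End.mem_maxGenEigenspace _ _ _ |>.mp ht
  have h1 : ∀ (k : ℕ) (t : T), B (((f - μ • 1) ^ k) t) = ((g - (μ - c) • 1) ^ k) (B t) := by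
    intro k
    induction k with
    | zero => intro t; rfl
    | succ k ih =>
      intro t
      rw [pow_succ, pow_succ, Module.End.mul_apply, Module.End.mul_apply, ih]
      congr 1
      simp only [LinearMap.sub_apply, LinearMap.smul_apply, Module.End.one_apply, map_sub, map_smul,
        hB, sub_smul]
      abel
  have h2 : B t ∈ Module.End.maxGenEigenspace g (μ - c) :=
    (Module.End.mem_maxGenEigenspace _ _ _).mpr ⟨k, by rw [← h1, hk, map_zero]⟩
  have h3 : B t ∈ Module.End.maxGenEigenspace g 0 := by
    obtain ⟨l, hl⟩ := hg (B t)
    exact (Module.End.mem_maxGenEigenspace _ _ _).mpr ⟨l, by rwa [zero_smul, sub_zero]⟩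
  have h4 := Module.End.disjoint_genEigenspace g (sub_ne_zero.mpr hμ) ⊤ ⊤
  exact Submodule.disjoint_def.mp h4 _ h2 h3

/-- Otherwise `B` would vanish on all generalized eigenspaces of `f`. -/
theorem hasEigenvalue_of_intertwines [FiniteDimensional ℂ T] {f : Module.End ℂ T}
    {g : Module.End ℂ X} {c : ℂ} {B : T →ₗ[ℂ] X} (hB : ∀ t, B (f t) = c • B t + g (B t))
    (hg : ∀ x, ∃ k, (g ^ k) x = 0) (hB0 : B ≠ 0) : f.HasEigenvalue c := by
  by_contra hc
  refine hB0 (LinearMap.ker_eq_top.mp (eq_top_iff.mpr ?_))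
  rw [← Module.End.iSup_maxGenEigenspace_eq_top f]
  refine iSup_le fun μ t ht => ?_
  rcases eq_or_ne μ c with rfl | hμ
  · have h1 : Module.End.maxGenEigenspace f μ = ⊥ := by
      by_contra h2
      exact hc (Module.End.HasUnifEigenvalue.lt zero_lt_one h2)
    rw [h1, Submodule.mem_bot] at ht
    rw [ht]
    exact Submodule.zero_mem _
  · exact apply_eq_zero_of_mem_maxGenEigenspace hB hg hμ ht

/-- `B` lives on the generalized eigenspace of `f` for `c`, on which a semisimple `f` acts as `c`. -/
theorem comp_eq_zero_of_isSemisimple [FiniteDimensional ℂ T] {f : Module.End ℂ T}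
    (hf : f.IsSemisimple) {g : Module.End ℂ X} {c : ℂ} {B : T →ₗ[ℂ] X}
    (hB : ∀ t, B (f t) = c • B t + g (B t)) (hg : ∀ x, ∃ k, (g ^ k) x = 0) (t : T) : g (B t) = 0 := by
  have h : (⊤ : Submodule ℂ T) ≤ LinearMap.ker (g ∘ₗ B) := by
    rw [← Module.End.iSup_maxGenEigenspace_eq_top f]
    refine iSup_le fun μ t ht => ?_
    change g (B t) = 0
    rcases eq_or_ne μ c with rfl | hμ
    · rw [hf.isFinitelySemisimple.maxGenEigenspace_eq_eigenspace, Module.End.mem_eigenspace_iff] at ht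
      have := hB t
      rw [ht, map_smul] at this
      exact left_eq_add.mp this
    · rw [apply_eq_zero_of_mem_maxGenEigenspace hB hg hμ ht, map_zero]
  exact h (Submodule.mem_top (x := t))

end linear

section logD

variable {N : ℕ} {W : Type*} [AddCommGroup W] [Module ℂ W]

/-- The derivative with respect to the `i`-th variable on polynomials with coefficients in `W`. -/
def polyDeriv (i : Fin N) : Module.End ℂ ((Fin N →₀ ℕ) →₀ W) where
  toFun f := Finsupp.ofSupportFinite (fun q => ((q i : ℂ) + 1) • f (q + Finsupp.single i 1))
    ((f.hasFiniteSupport.preimage (add_left_injective (Finsupp.single i 1)).injOn).subset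
      fun q hq h => hq (by simp only [h, smul_zero]))
  map_add' f g := Finsupp.ext fun q => smul_add _ _ _
  map_smul' c f := Finsupp.ext fun q => smul_comm _ _ _

theorem polyDeriv_apply (i : Fin N) (f : (Fin N →₀ ℕ) →₀ W) (q : Fin N →₀ ℕ) :
    polyDeriv i f q = ((q i : ℂ) + 1) • f (q + Finsupp.single i 1) := rfl

theorem exists_polyDeriv_pow (i : Fin N) (f : (Fin N →₀ ℕ) →₀ W) : ∃ k, (polyDeriv i ^ k) f = 0 := by
  have h1 : ∀ (k : ℕ) (q : Fin N →₀ ℕ), ∃ c : ℂ,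
      (polyDeriv i ^ k) f q = c • f (q + Finsupp.single i k) := by
    intro k
    induction k with
    | zero => exact fun q => ⟨1, by simp⟩
    | succ k ih =>
      intro q
      obtain ⟨c, hc⟩ := ih (q + Finsupp.single i 1)
      refine ⟨((q i : ℂ) + 1) * c, ?_⟩
      rw [pow_succ', Module.End.mul_apply, polyDeriv_apply, hc, smul_smul, add_assoc,
        ← Finsupp.single_add, add_comm 1 k]
  refine ⟨f.support.sup (fun q => q i) + 1, Finsupp.ext fun q => ?_⟩
  obtain ⟨c, hc⟩ := h1 (f.support.sup (fun q => q i) + 1) q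
  rw [hc]
  by_contra h
  have h2 : q + Finsupp.single i (f.support.sup (fun q => q i) + 1) ∈ f.support :=
    Finsupp.mem_support_iff.mpr fun h3 => h (by rw [h3, smul_zero]; rfl)
  have h3 := Finset.le_sup (f := fun q : Fin N →₀ ℕ => q i) h2
  simp only [Finsupp.add_apply, Finsupp.single_eq_same] at h3
  omega

theorem eq_single_of_polyDeriv {f : (Fin N →₀ ℕ) →₀ W} (h : ∀ i, polyDeriv i f = 0) :
    f = Finsupp.single 0 (f 0) := by
  refine Finsupp.ext fun q => ?_
  rcases eq_or_ne q 0 with rfl | hq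
  · rw [Finsupp.single_eq_same]
  · rw [Finsupp.single_eq_of_ne hq]
    obtain ⟨i, hi⟩ := Finsupp.ne_iff.mp hq
    have h1 := DFunLike.congr_fun (h i) (q - Finsupp.single i 1)
    rw [polyDeriv_apply, tsub_add_cancel_of_le (Finsupp.single_le_iff.mpr
      (Nat.one_le_iff_ne_zero.mpr hi))] at h1
    exact (smul_eq_zero.mp h1).resolve_left (Nat.cast_add_one_ne_zero _)

end logD

/-! ### The map on the tensor products over the Zhu algebra -/

section lift

universe v

variable {V : Type*} [AddCommGroup V] [Module ℂ V] [VertexOperatorAlgebra V] {n : ℕ}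
  {M₀ : Type*} [AddCommGroup M₀] [Module ℂ M₀] [VOAModule V M₀]
  {M : Fin (n + 2) → Type v} [∀ i, AddCommGroup (M i)] [∀ i, Module ℂ (M i)]
  [∀ i, VOAModule V (M i)] {F : (⨂[ℂ] i, M i) →ₗ[ℂ] LogSeries (n + 1) M₀}
  {Δ' : ℂ} {Δ : Fin (n + 2) → ℂ} {lam : Fin n → ModInt} {h : Fin n → ℂ}

theorem leftOp_smul_vac (Δr : ℂ) (p : Fin (n + 2)) (r : ℂ) :
    leftOp M Δr p 0 (r • (VertexOperatorAlgebra.vac : V)) = r • (if p = Fin.last (n + 1) then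
      (wt V (M p) Δr).subtype ∘ₗ genProj V (M p) Δr else LinearMap.id) := by
  rw [leftOp]
  split_ifs
  · rw [md_smul_vac, if_pos (by norm_num)]
    rfl
  · rw [zhuLeft, zop_zero_smul_vac, if_pos rfl]

/-- The leading coefficient is balanced over the Zhu algebra. For `a` of positive weight these are the
relations at a minimal exponent; for `a` of weight `0`, which is a multiple of the vacuum, they are
trivial. -/
theorem IsPIO.isZhuBalanced_leadMap (hF : IsPIO V M₀ M F) (hΔ' : IsGradedFrom V M₀ Δ')
    (hM₀ : IsVModule V M₀) (hΔ : ∀ i, IsGradedFrom V (M i) (Δ i))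
    (hh : h ∈ leadSet V Δ' (Δ (Fin.last (n + 1))) F lam) :
    IsZhuBalanced (V := V) (Δ (Fin.last (n + 1))) (hF.leadMap hΔ' hM₀ hΔ
      (Fin.snoc (α := fun _ => ℂ) h (Δ (Fin.last (n + 1))))) := by
  set φ := hF.leadMap hΔ' hM₀ hΔ (Fin.snoc (α := fun _ => ℂ) h (Δ (Fin.last (n + 1)))) with hφ
  have hL : ∀ q x, ((wt V M₀ Δ').subtype ∘ₗ Finsupp.lapply q ∘ₗ φ) x =
    barF V Δ' F x (Fin.snoc (α := fun _ => ℂ) h (Δ (Fin.last (n + 1)))) q := fun _ _ => rfl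
  have hlast : ∀ x, φ (slot (Fin.last (n + 1)) ((wt V (M (Fin.last (n + 1)))
      (Δ (Fin.last (n + 1)))).subtype ∘ₗ genProj V (M (Fin.last (n + 1)))
        (Δ (Fin.last (n + 1)))) x) = φ x := fun x => Finsupp.ext fun q => Subtype.ext
    (hF.lead_last hΔ' hM₀ hΔ (Fin.snoc_last (α := fun _ => ℂ) _ _) q x)
  refine ⟨fun i d a ha x => ?_, hlast, fun i d a ha m => ?_⟩
  · rcases d with _ | D
    · obtain ⟨r, rfl⟩ := exists_smul_vac ha
      rw [zop_zero_smul_vac, if_neg (by norm_num), ← zero_smul ℂ (0 : Module.End ℂ (M i.castSucc)),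
        slot_smul, zero_smul, LinearMap.zero_apply, map_zero]
    · exact Finsupp.ext fun q => Subtype.ext
        (hF.lead_zhuO hΔ' hM₀ hΔ hh (hL q) ha (Fin.castSucc_lt_last i) x)
  · rcases d with _ | D
    · obtain ⟨r, rfl⟩ := exists_smul_vac ha
      rw [zhuRight_smul_vac, MultilinearMap.map_update_smul, Function.update_eq_self,
        leftOp_smul_vac, slot_smul, LinearMap.smul_apply, map_smul, map_smul]
      congr 1
      split_ifs with hi
      · have key : ∀ p : Fin (n + 2), p = Fin.last (n + 1) → ∀ x, φ (slot p
            ((wt V (M p) (Δ (Fin.last (n + 1)))).subtype ∘ₗ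
              genProj V (M p) (Δ (Fin.last (n + 1)))) x) = φ x := by
          rintro p rfl
          exact hlast
        exact (key _ hi _).symm
      · rw [slot_id]
    · rw [zhuRight_succ, ← slot_tprod i.castSucc]
      refine Finsupp.ext fun q => Subtype.ext ?_
      exact (hF.lead_zhuRight hΔ' hM₀ hΔ hh (hL q) ha (Fin.castSucc_lt_last i) _).trans
        (hF.lead_leftOp hΔ' hM₀ hΔ hh (hL q) ha i _).symm

/-- There is nothing to the left of the first factor, so the left action on it is `o(a)`. -/
theorem IsPIO.leadMap_leftOp_zero (hF : IsPIO V M₀ M F) (hΔ' : IsGradedFrom V M₀ Δ')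
    (hM₀ : IsVModule V M₀) (hΔ : ∀ i, IsGradedFrom V (M i) (Δ i))
    (hh : h ∈ leadSet V Δ' (Δ (Fin.last (n + 1))) F lam) {d : ℕ} (a : ↥(grade V d))
    (x : ⨂[ℂ] i, M i) :
    hF.leadMap hΔ' hM₀ hΔ (Fin.snoc (α := fun _ => ℂ) h (Δ (Fin.last (n + 1))))
        (slot 0 (leftOp M (Δ (Fin.last (n + 1))) 0 d (a : V)) x) =
      Finsupp.mapRange.linearMap (zeroMode M₀ Δ' d a) (hF.leadMap hΔ' hM₀ hΔ
        (Fin.snoc (α := fun _ => ℂ) h (Δ (Fin.last (n + 1)))) x) := by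
  set φ := hF.leadMap hΔ' hM₀ hΔ (Fin.snoc (α := fun _ => ℂ) h (Δ (Fin.last (n + 1)))) with hφ
  have hL : ∀ q x, ((wt V M₀ Δ').subtype ∘ₗ Finsupp.lapply q ∘ₗ φ) x =
    barF V Δ' F x (Fin.snoc (α := fun _ => ℂ) h (Δ (Fin.last (n + 1)))) q := fun _ _ => rfl
  have h0 : (0 : Fin (n + 2)) < Fin.last (n + 1) := Fin.last_pos
  obtain ⟨a, ha⟩ := a
  refine Finsupp.ext fun q => Subtype.ext ?_
  rw [Finsupp.mapRange.linearMap_apply, Finsupp.mapRange_apply]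
  change _ = md M₀ a ((d : ℤ) - 1) (φ x q : M₀)
  rcases d with _ | D
  · obtain ⟨r, rfl⟩ := exists_smul_vac ha
    rw [leftOp_smul_vac, if_neg h0.ne, slot_smul, LinearMap.smul_apply, slot_id, map_smul,
      md_smul_vac, if_pos (by norm_num)]
    rfl
  · have h1 := hF.lead_zhuLeft hΔ' hM₀ hΔ hh (hL q) ha h0 x
    rw [Finset.filter_false_of_mem (fun s _ => not_lt.mpr (Fin.zero_le s)), Finset.sum_empty,
      sub_zero] at h1
    have e : ((D + 1 : ℕ) : ℤ) - 1 = D := by push_cast; ring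
    rw [leftOp, if_neg h0.ne, e]
    exact h1

/-- The class of `ω` acts on `T_{i+1}` as `h_i + ∂/∂(log ζ_i)`. -/
theorem IsPIO.leadMap_omega (hF : IsPIO V M₀ M F) (hΔ' : IsGradedFrom V M₀ Δ')
    (hM₀ : IsVModule V M₀) (hΔ : ∀ i, IsGradedFrom V (M i) (Δ i))
    (hh : h ∈ leadSet V Δ' (Δ (Fin.last (n + 1))) F lam) (i : Fin (n + 1)) (x : ⨂[ℂ] i, M i) :
    hF.leadMap hΔ' hM₀ hΔ (Fin.snoc (α := fun _ => ℂ) h (Δ (Fin.last (n + 1)))) (slot i.succ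
      (leftOp M (Δ (Fin.last (n + 1))) i.succ 2 (VertexOperatorAlgebra.conf : V)) x) =
    (Fin.snoc (α := fun _ => ℂ) h (Δ (Fin.last (n + 1))) i : ℂ) •
      hF.leadMap hΔ' hM₀ hΔ (Fin.snoc (α := fun _ => ℂ) h (Δ (Fin.last (n + 1)))) x +
    polyDeriv i (hF.leadMap hΔ' hM₀ hΔ
      (Fin.snoc (α := fun _ => ℂ) h (Δ (Fin.last (n + 1)))) x) := by
  set φ := hF.leadMap hΔ' hM₀ hΔ (Fin.snoc (α := fun _ => ℂ) h (Δ (Fin.last (n + 1)))) with hφ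
  have hL : ∀ q x, ((wt V M₀ Δ').subtype ∘ₗ Finsupp.lapply q ∘ₗ φ) x =
    barF V Δ' F x (Fin.snoc (α := fun _ => ℂ) h (Δ (Fin.last (n + 1)))) q := fun _ _ => rfl
  refine Finsupp.ext fun q => Subtype.ext ?_
  refine (hF.lead_leftOp hΔ' hM₀ hΔ hh (hL q) (D := 1) conf_mem i x).trans ?_
  simp only [hL]
  exact hF.omega_relation hΔ' hM₀ hΔ (Fin.snoc_last (α := fun _ => ℂ) _ _) i x q

/-- The map induced by the leading coefficient on `T_{i+1}`, for fixed `m_1, …, m_i`, intertwines `ω` with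
`h_i + ∂/∂(log ζ_i)`. -/
theorem IsPIO.exists_omega_lift (hF : IsPIO V M₀ M F) (hΔ' : IsGradedFrom V M₀ Δ')
    (hM₀ : IsVModule V M₀) (hΔ : ∀ i, IsGradedFrom V (M i) (Δ i))
    (hh : h ∈ leadSet V Δ' (Δ (Fin.last (n + 1))) F lam) (i : Fin (n + 1)) (m : ∀ i, M i) :
    ∃ B : (zhuTail V M (Δ (Fin.last (n + 1))) i.succ).carrier →ₗ[ℂ]
        ((Fin (n + 1) →₀ ℕ) →₀ ↥(wt V M₀ Δ')),
      B ((zhuTail V M (Δ (Fin.last (n + 1))) i.succ).tens m) = hF.leadMap hΔ' hM₀ hΔ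
        (Fin.snoc (α := fun _ => ℂ) h (Δ (Fin.last (n + 1)))) (PiTensorProduct.tprod ℂ m) ∧
      ∀ t, B ((zhuTail V M (Δ (Fin.last (n + 1))) i.succ).omega t) =
        (Fin.snoc (α := fun _ => ℂ) h (Δ (Fin.last (n + 1))) i : ℂ) • B t + polyDeriv i (B t) := by
  obtain ⟨B, hB⟩ := (hF.isZhuBalanced_leadMap hΔ' hM₀ hΔ hh).exists_lift (hΔ _) i.succ m
  refine ⟨B, hB m fun _ _ => rfl, fun t => ?_⟩
  refine LinearMap.congr_fun (f := B ∘ₗ (zhuTail V M (Δ (Fin.last (n + 1))) i.succ).omega)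
    (g := (Fin.snoc (α := fun _ => ℂ) h (Δ (Fin.last (n + 1))) i : ℂ) • B + polyDeriv i ∘ₗ B)
    (zhuTail_hom_ext (hΔ _) fun m' => ?_) t
  have key : (zhuTail V M (Δ (Fin.last (n + 1))) i.succ).tens
      (fun s => if s < i.succ then m s else m' s) =
      (zhuTail V M (Δ (Fin.last (n + 1))) i.succ).tens m' :=
    zhuTail_tens_congr _ _ fun s hs => if_neg (not_lt.mpr hs)
  rw [← key]
  generalize hm'' : (fun s => if s < i.succ then m s else m' s) = m''
  have hm : ∀ s, s < i.succ → m'' s = m s := fun s hs => by rw [← hm'']; exact if_pos hs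
  simp only [LinearMap.comp_apply, LinearMap.add_apply, LinearMap.smul_apply]
  rw [ZhuTail.omega, zhuTail_act_tens (hΔ _), hB _ hm, hB, ← hF.leadMap_omega hΔ' hM₀ hΔ hh,
    slot_tprod]
  intro s hs
  rw [Function.update_of_ne hs.ne, hm s hs]

theorem IsPIO.exists_leadMap_ne_zero (hF : IsPIO V M₀ M F) (hΔ' : IsGradedFrom V M₀ Δ')
    (hM₀ : IsVModule V M₀) (hΔ : ∀ i, IsGradedFrom V (M i) (Δ i))
    (hh : h ∈ leadSet V Δ' (Δ (Fin.last (n + 1))) F lam) :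
    ∃ m : ∀ i, M i, hF.leadMap hΔ' hM₀ hΔ (Fin.snoc (α := fun _ => ℂ) h (Δ (Fin.last (n + 1))))
      (PiTensorProduct.tprod ℂ m) ≠ 0 := by
  by_contra! hc
  obtain ⟨-, x, q, hx⟩ := mem_expSet_iff.mp hh.1
  have h1 : hF.leadMap hΔ' hM₀ hΔ (Fin.snoc (α := fun _ => ℂ) h (Δ (Fin.last (n + 1)))) = 0 :=
    PiTensorProduct.ext (MultilinearMap.ext hc)
  refine hx ?_
  rw [← hF.leadMap_apply hΔ' hM₀ hΔ, h1]
  rfl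

/-- The exponents `h_i` are eigenvalues of `ω`. -/
theorem IsPIO.hasEigenvalue_omega (hF : IsPIO V M₀ M F) (hΔ' : IsGradedFrom V M₀ Δ')
    (hM₀ : IsVModule V M₀) (hΔ : ∀ i, IsGradedFrom V (M i) (Δ i)) (hM : ∀ i, IsVModule V (M i))
    (hC : ∀ i, IsCOneCofinite V (M i))
    (hh : h ∈ leadSet V Δ' (Δ (Fin.last (n + 1))) F lam) (i : Fin n) :
    (zhuTail V M (Δ (Fin.last (n + 1))) i.succ.castSucc).omega.HasEigenvalue (h i) := by
  obtain ⟨m, hm⟩ := hF.exists_leadMap_ne_zero hΔ' hM₀ hΔ hh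
  obtain ⟨B, hB, hω⟩ := hF.exists_omega_lift hΔ' hM₀ hΔ hh i.castSucc m
  have hfin := zhuTail_finite hM hΔ hC i.succ.castSucc
  rw [Fin.snoc_castSucc (α := fun _ => ℂ)] at hω
  exact hasEigenvalue_of_intertwines hω (exists_polyDeriv_pow _) fun h0 => hm (by
    rw [← hB, h0, LinearMap.zero_apply])

/-- If `ω` acts semisimply, the leading coefficient contains no logarithm. -/
theorem IsPIO.leadMap_eq_single (hF : IsPIO V M₀ M F) (hΔ' : IsGradedFrom V M₀ Δ')
    (hM₀ : IsVModule V M₀) (hΔ : ∀ i, IsGradedFrom V (M i) (Δ i)) (hM : ∀ i, IsVModule V (M i))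
    (hC : ∀ i, IsCOneCofinite V (M i))
    (hh : h ∈ leadSet V Δ' (Δ (Fin.last (n + 1))) F lam)
    (hss : ∀ p, (zhuTail V M (Δ (Fin.last (n + 1))) p).omega.IsSemisimple) (m : ∀ i, M i) :
    hF.leadMap hΔ' hM₀ hΔ (Fin.snoc (α := fun _ => ℂ) h (Δ (Fin.last (n + 1))))
      (PiTensorProduct.tprod ℂ m) = Finsupp.single 0 (hF.leadMap hΔ' hM₀ hΔ
        (Fin.snoc (α := fun _ => ℂ) h (Δ (Fin.last (n + 1)))) (PiTensorProduct.tprod ℂ m) 0) := by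
  refine eq_single_of_polyDeriv fun i => ?_
  obtain ⟨B, hB, hω⟩ := hF.exists_omega_lift hΔ' hM₀ hΔ hh i m
  have hfin := zhuTail_finite hM hΔ hC i.succ
  rw [← hB]
  exact comp_eq_zero_of_isSemisimple (hss i.succ) hω (exists_polyDeriv_pow i) _

end lift

end

end VOA

theorem mainTheorem8 {V : Type*} [AddCommGroup V] [Module ℂ V]
    [VertexOperatorAlgebra V] {n : ℕ}
    {M₀ : Type*} [AddCommGroup M₀] [Module ℂ M₀] [VOAModule V M₀]
    {M : Fin (n + 2) → Type*} [∀ i, AddCommGroup (M i)] [∀ i, Module ℂ (M i)]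
    [∀ i, VOAModule V (M i)]
    (Δ' : ℂ) (Δ : Fin (n + 2) → ℂ)
    (hM₀ : VOA.IsVModule V M₀) (hM : ∀ i, VOA.IsVModule V (M i))
    (hΔ' : VOA.IsGradedFrom V M₀ Δ') (hΔ : ∀ i, VOA.IsGradedFrom V (M i) (Δ i))
    (hC : ∀ i, VOA.IsCOneCofinite V (M i))
    (hgen₀ : VOA.IsDualGeneratedBy V M₀ Δ')
    (hgen : VOA.IsGeneratedBy V (M (Fin.last (n + 1))) (Δ (Fin.last (n + 1)))) :
    (∀ F : (PiTensorProduct ℂ M) →ₗ[ℂ] VOA.LogSeries (n + 1) M₀, VOA.IsPIO V M₀ M F →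
      -- `F̄` is a series in `ζ` with coefficients in `(M₀)_{Δ'}`
      (∀ m, VOA.barFz V Δ' F m = VOA.zetaToZ (VOA.barF V Δ' F m)) ∧
      (∀ m ν q, VOA.barF V Δ' F m ν q ∈ VOA.wt V M₀ Δ') ∧
      -- the poles are bounded below, uniformly in `m`
      (∀ lam : Fin n → VOA.ModInt, ∃ μ : Fin n → ℂ, (∀ i, (μ i : VOA.ModInt) = -lam i) ∧
        ∀ m, ∃ D : ℕ, ∀ ν q, VOA.pLam lam (VOA.barF V Δ' F m) ν q ≠ 0 →
          (∃ k : Fin (n + 1) → ℕ, (∀ i : Fin n, ν i.castSucc = -μ i + k i.castSucc) ∧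
            ν (Fin.last n) = Δ (Fin.last (n + 1)) + k (Fin.last n)) ∧ ∀ i, q i ≤ D) ∧
      (F ≠ 0 → ∃ lam : Fin n → VOA.ModInt, ∃ m, VOA.pLam lam (VOA.barF V Δ' F m) ≠ 0) ∧
      (∀ lam : Fin n → VOA.ModInt, (∃ m, VOA.pLam lam (VOA.barF V Δ' F m) ≠ 0) →
        (VOA.leadSet V Δ' (Δ (Fin.last (n + 1))) F lam).Nonempty) ∧
      -- the leading coefficient induces a map of left `A(V)`-modules
      ∀ lam : Fin n → VOA.ModInt, ∀ h ∈ VOA.leadSet V Δ' (Δ (Fin.last (n + 1))) F lam,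
        (∃ A : (VOA.zhuTail V M (Δ (Fin.last (n + 1))) 0).carrier →ₗ[ℂ]
            ((Fin (n + 1) →₀ ℕ) →₀ ↥(VOA.wt V M₀ Δ')),
          (∀ (m : ∀ i, M i) (l : Fin (n + 1) →₀ ℕ),
            (A ((VOA.zhuTail V M (Δ (Fin.last (n + 1))) 0).tens m) l : M₀) =
              VOA.barF V Δ' F (PiTensorProduct.tprod ℂ m)
                (Fin.snoc (α := fun _ => ℂ) h (Δ (Fin.last (n + 1)))) l) ∧
          (∀ B : (VOA.zhuTail V M (Δ (Fin.last (n + 1))) 0).carrier →ₗ[ℂ]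
              ((Fin (n + 1) →₀ ℕ) →₀ ↥(VOA.wt V M₀ Δ')),
            (∀ m : ∀ i, M i, B ((VOA.zhuTail V M (Δ (Fin.last (n + 1))) 0).tens m) =
              A ((VOA.zhuTail V M (Δ (Fin.last (n + 1))) 0).tens m)) → B = A) ∧
          A ≠ 0 ∧
          (∀ (d : ℕ) (a : ↥(VOA.grade V d)) x,
            A ((VOA.zhuTail V M (Δ (Fin.last (n + 1))) 0).act d a x) =
              Finsupp.mapRange.linearMap (VOA.zeroMode M₀ Δ' d a) (A x)) ∧
          -- no logarithms if `ω` acts semisimply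
          ((∀ p, (VOA.zhuTail V M (Δ (Fin.last (n + 1))) p).omega.IsSemisimple) →
            ∃ A' : (VOA.zhuTail V M (Δ (Fin.last (n + 1))) 0).carrier →ₗ[ℂ] ↥(VOA.wt V M₀ Δ'),
              (∀ x, A x = Finsupp.single 0 (A' x)) ∧
              ∀ (d : ℕ) (a : ↥(VOA.grade V d)) x,
                A' ((VOA.zhuTail V M (Δ (Fin.last (n + 1))) 0).act d a x) =
                  VOA.zeroMode M₀ Δ' d a (A' x))) ∧
        -- the exponents are eigenvalues of `ω`
        ∀ i : Fin n, (h i : VOA.ModInt) = lam i ∧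
          (VOA.zhuTail V M (Δ (Fin.last (n + 1))) i.succ.castSucc).omega.HasEigenvalue (h i)) ∧
    -- finitely many possibilities for `(λ, h)`
    {p : (Fin n → VOA.ModInt) × (Fin n → ℂ) |
      ∃ F : (PiTensorProduct ℂ M) →ₗ[ℂ] VOA.LogSeries (n + 1) M₀, VOA.IsPIO V M₀ M F ∧
        p.2 ∈ VOA.leadSet V Δ' (Δ (Fin.last (n + 1))) F p.1}.Finite := by
  classical
  have hadd : ∀ F : (PiTensorProduct ℂ M) →ₗ[ℂ] VOA.LogSeries (n + 1) M₀, VOA.IsPIO V M₀ M F →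
      ∀ lam : Fin n → VOA.ModInt, ∀ h ∈ VOA.leadSet V Δ' (Δ (Fin.last (n + 1))) F lam,
      ∀ i : Fin n, (h i : VOA.ModInt) = lam i ∧
        (VOA.zhuTail V M (Δ (Fin.last (n + 1))) i.succ.castSucc).omega.HasEigenvalue (h i) :=
    fun F hF lam h hh i => ⟨(VOA.mem_expSet_iff.mp hh.1).1 i,
      hF.hasEigenvalue_omega hΔ' hM₀ hΔ hM hC hh i⟩
  refine ⟨fun F hF => ⟨fun m => hF.barFz_eq_zetaToZ hΔ' hM₀ hΔ m,
    fun m ν q => VOA.barF_mem Δ' m ν q, fun lam => ?_, fun hne => ?_, fun lam hne =>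
      hF.leadSet_nonempty hΔ' hM₀ hΔ hM hC hgen hne, fun lam h hh => ⟨?_, hadd F hF lam h hh⟩⟩, ?_⟩
  · obtain ⟨c, hc, hb⟩ := hF.exists_pole_bound hΔ' hM₀ hΔ hM hC lam
    refine ⟨fun i => -c i, fun i => ?_, fun m => ?_⟩
    · rw [← hc i]; rfl
    · obtain ⟨D, hD⟩ := hF.barF_logBdd hΔ' hM₀ hΔ m
      refine ⟨D, fun ν q hq => ⟨?_, hD ν q fun h0 => (VOA.pLam_ne_zero.mp hq).2 h0⟩⟩
      obtain ⟨k, hk, hk'⟩ := hb m ν q hq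
      exact ⟨k, fun i => by rw [neg_neg]; exact hk i, hk'⟩
  · obtain ⟨k, m, T, κ, hm, hT, hF0⟩ := hF.exists_ne_zero hΔ' hM₀ hΔ hgen₀ hne
    obtain ⟨x, q, hx⟩ := hF.exists_barF_ne_zero hΔ' hM₀ hΔ hm hT hF0
    generalize (Fin.snoc (VOA.interExp T fun i => Δ i + (k i : ℂ)) (Δ (Fin.last (n + 1)) +
      (k (Fin.last (n + 1)) : ℂ)) : Fin (n + 1) → ℂ) = ν at hx
    exact ⟨fun i => (ν i.castSucc : VOA.ModInt), x, fun h0 =>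
      VOA.pLam_ne_zero.mpr ⟨fun _ => rfl, hx⟩ (congrFun (congrFun h0 ν) q)⟩
  · set φ := hF.leadMap hΔ' hM₀ hΔ (Fin.snoc (α := fun _ => ℂ) h (Δ (Fin.last (n + 1)))) with hφ
    -- for the whole tensor product no factor is fixed
    obtain ⟨A, hA⟩ := (hF.isZhuBalanced_leadMap hΔ' hM₀ hΔ hh).exists_lift (hΔ _) 0 fun _ => 0
    replace hA : ∀ m : ∀ i, M i,
        A ((VOA.zhuTail V M (Δ (Fin.last (n + 1))) 0).tens m) = φ (PiTensorProduct.tprod ℂ m) :=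
      fun m => hA m fun s hs => absurd hs (Fin.not_lt_zero s)
    have hact : ∀ (d : ℕ) (a : ↥(VOA.grade V d)) x,
        A ((VOA.zhuTail V M (Δ (Fin.last (n + 1))) 0).act d a x) =
          Finsupp.mapRange.linearMap (VOA.zeroMode M₀ Δ' d a) (A x) := fun d a x => by
      refine LinearMap.congr_fun (f := A ∘ₗ (VOA.zhuTail V M (Δ (Fin.last (n + 1))) 0).act d a)
        (g := Finsupp.mapRange.linearMap (VOA.zeroMode M₀ Δ' d a) ∘ₗ A)
        (VOA.zhuTail_hom_ext (hΔ _) fun m => ?_) x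
      rw [LinearMap.comp_apply, LinearMap.comp_apply, VOA.zhuTail_act_tens (hΔ _), hA, hA,
        ← hF.leadMap_leftOp_zero hΔ' hM₀ hΔ hh, VOA.slot_tprod]
    refine ⟨A, fun m l => ?_, fun B hB => VOA.zhuTail_hom_ext (hΔ _) hB, fun h0 => ?_, hact,
      fun hss => ?_⟩
    · rw [hA]
      rfl
    · obtain ⟨m, hm⟩ := hF.exists_leadMap_ne_zero hΔ' hM₀ hΔ hh
      exact hm (by rw [← hφ, ← hA, h0, LinearMap.zero_apply])
    · have hs : ∀ x, A x = Finsupp.single 0 (A x 0) := fun x =>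
        LinearMap.congr_fun (f := A) (g := Finsupp.lsingle 0 ∘ₗ Finsupp.lapply 0 ∘ₗ A)
          (VOA.zhuTail_hom_ext (hΔ _) fun m => by
            simp only [LinearMap.comp_apply, Finsupp.lsingle_apply, Finsupp.lapply_apply, hA]
            exact hF.leadMap_eq_single hΔ' hM₀ hΔ hM hC hh hss m) x
      refine ⟨Finsupp.lapply 0 ∘ₗ A, hs, fun d a x => ?_⟩
      rw [LinearMap.comp_apply, hact]
      rfl
  -- `λ` is determined by `h`, and the `h_i` are eigenvalues on finite-dimensional spaces
  · have hfin : {g : Fin n → ℂ | ∀ i, g i ∈ {c : ℂ | (VOA.zhuTail V M (Δ (Fin.last (n + 1)))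
        i.succ.castSucc).omega.HasEigenvalue c}}.Finite := Set.Finite.pi' fun i => by
      have := VOA.zhuTail_finite hM hΔ hC i.succ.castSucc
      exact Module.End.finite_hasEigenvalue _
    refine (hfin.image fun g => ((fun i => (g i : VOA.ModInt)), g)).subset ?_
    rintro ⟨lam, h⟩ ⟨F, hF, hh⟩
    exact ⟨h, fun i => (hadd F hF lam h hh i).2, Prod.ext (funext fun i => (hadd F hF lam h hh i).1) rfl⟩
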